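/- Let $S$ be the set of integers $n\ge 1$ that are sums of two integer squares. For $n\in S$ put $\Lambda_n:=\{\lambda\in\mathbb Z^2:\lambda_1^2+\lambda_2^2=n\}$, $\mathcal N_n:=|\Lambda_n|$, $\mu_n:=\frac1{\mathcal N_n}\sum_{\lambda\in\Lambda_n}\delta_{\lambda/\sqrt n}$ (a probability measure on the unit circle $\mathbb S^1\subset\mathbb C$) and $\widehat{\mu_n}(4):=\int_{\mathbb S^1}\theta^{-4}\,d\mu_n(\theta)$. Let $\{a_\lambda\}_{\lambda\in\mathbb Z^2\setminus\{0\}}$ be standard complex Gaussian random variables on a probability space $(\Omega,\mathcal F,\mathbb P)$ (real and imaginary parts independent, centered, of variance $1/2$), independent except for the relations $\overline{a_\lambda}=a_{-\lambda}$. For $n\in S$ let $$T_n(x):=\frac1{\sqrt{\mathcal N_n}}\sum_{\lambda\in\Lambda_n}a_\lambda e^{2\pi i\langle\lambda,x\rangle},\qquad x\in\mathbb T:=\mathbb R^2/\mathbb Z^2,$$ and let $\mathcal L_n:=\mathrm{length}(T_n^{-1}(0))$ (one-dimensional Hausdorff measure). Let $\mathbf A$ be the closure in $L^2(\mathbb P)$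 of the real linear span of the variables $z a_\lambda+\overline z a_{-\lambda}$, $z\in\mathbb C$, $\lambda\ne0$, and let the fourth Wiener chaos $C_4$ be the closure in $L^2(\mathbb P)$ of the real linear span of the products $H_{p_1}(\xi_1)\cdots H_{p_k}(\xi_k)$ with $k\ge1$, $p_1+\dots+p_k=4$ and $(\xi_1,\dots,\xi_k)$ a standard Gaussian vector extracted from $\mathbf A$, where $H_p$ are the Hermite polynomials ($H_0=1$, $H_p(t)=tH_{p-1}(t)-H_{p-1}'(t)$). Let $\mathcal L_n[4]$ be the orthogonal projection of $\mathcal L_n$ onto $C_4$ and $\widetilde{\mathcal L}_n[4]:=\mathcal L_n[4]/\sqrt{\mathrm{Var}(\mathcal L_n[4])}$. For $\eta\in[0,1]$ let $$\mathcal M_\eta:=\frac1{2\sqrt{1+\eta^2}}\left(2-(1+\eta)X_1^2-(1-\eta)X_2^2\right),$$ with $X_1,X_2$ i.i.d. standard Gaussian. There is an absolute constant $C>0$ such that the following holds. Let $h:\mathbb R\to\mathbb R$ be $1$-Lipschitz, let $\eta\in[0,1]$, and let $\{n_j\}\subset S$ be a sequence such that $\mathcal N_{n_j}\to+\infty$ and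 $|\widehat{\mu_{n_j}}(4)|\to\eta$ as $j\to\infty$. Then, for every $j$, $\mathcal L_{n_j}\in L^2(\mathbb P)$ and $\mathrm{Var}(\mathcal L_{n_j}[4])>0$ (so that $\widetilde{\mathcal L}_{n_j}[4]$ is well defined), and $$\left|\mathbb E\left[h(\widetilde{\mathcal L}_{n_j}[4])\right]-\mathbb E\left[h(\mathcal M_\eta)\right]\right|\le C\,\max\left(\mathcal N_{n_j}^{-1/4},\ \left||\widehat{\mu_{n_j}}(4)|-\eta\right|^{1/2}\right).$$ -/

import Mathlib

open MeasureTheory ProbabilityTheory Filter Topology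
open scoped ENNReal NNReal

noncomputable section

namespace ArithmeticWave

/-- The positive integers that are sums of two integer squares. -/
def sumTwoSquares : Set ℕ := {n | 0 < n ∧ ∃ a b : ℤ, (n : ℤ) = a ^ 2 + b ^ 2}

/-- `Λ_n`: the lattice points on the circle of radius `√n` (see `mem_freq`). -/
def freq (n : ℕ) : Finset (ℤ × ℤ) :=
  (Finset.Icc (-(n : ℤ)) n ×ˢ Finset.Icc (-(n : ℤ)) n).filter
    (fun l => l.1 ^ 2 + l.2 ^ 2 = (n : ℤ))

theorem mem_freq (n : ℕ) (l : ℤ × ℤ) : l ∈ freq n ↔ l.1 ^ 2 + l.2 ^ 2 = (n : ℤ) := by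
  simp only [freq, Finset.mem_filter, Finset.mem_product, Finset.mem_Icc, and_iff_right_iff_imp]
  intro h
  have key : ∀ x : ℤ, x ^ 2 ≤ (n : ℤ) → -(n : ℤ) ≤ x ∧ x ≤ n := fun x hx =>
    ⟨by nlinarith [Int.le_self_sq (-x), neg_sq x], by nlinarith [Int.le_self_sq x]⟩
  exact ⟨key _ (by nlinarith [sq_nonneg l.2]), key _ (by nlinarith [sq_nonneg l.1])⟩

/-- `𝒩_n = |Λ_n|`. -/
def freqCard (n : ℕ) : ℕ := (freq n).card

/-- `μ_n`, the uniform probability measure on the points `λ / √n`, `λ ∈ Λ_n`, of the unit circle,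
the plane being identified with `ℂ`. -/
def angularMeasure (n : ℕ) : Measure ℂ :=
  (freqCard n : ℝ≥0∞)⁻¹ •
    ∑ l ∈ freq n, Measure.dirac (((l.1 : ℂ) + (l.2 : ℂ) * Complex.I) / ((√(n : ℝ) : ℝ) : ℂ))

/-- The fourth Fourier coefficient `∫ θ⁻⁴ dμ(θ)` of a measure carried by the unit circle. -/
def fourthFourier (μ : Measure ℂ) : ℂ := ∫ z, z ^ (-4 : ℤ) ∂μ

variable {Ω : Type*} [MeasurableSpace Ω]

/-- `(a_λ)` is a family of standard complex Gaussian variables (independent real and imaginary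
parts of law `N(0, 1/2)`), mutually independent except for the relations `conj a_λ = a_{-λ}`.
Nothing is asked of `a_0`, which is never used. -/
structure IsWaveCoefficients (a : ℤ × ℤ → Ω → ℂ) (P : Measure Ω) : Prop where
  measurable : ∀ l, Measurable (a l)
  conj_eq : ∀ l, l ≠ 0 → ∀ᵐ ω ∂P, a (-l) ω = (starRingEnd ℂ) (a l ω)
  law_re : ∀ l, l ≠ 0 → HasLaw (fun ω => (a l ω).re) (gaussianReal 0 (1 / 2)) P
  law_im : ∀ l, l ≠ 0 → HasLaw (fun ω => (a l ω).im) (gaussianReal 0 (1 / 2)) P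
  indep_re_im : ∀ l, l ≠ 0 → IndepFun (fun ω => (a l ω).re) (fun ω => (a l ω).im) P
  indep : ∀ s : Set (ℤ × ℤ), (∀ l ∈ s, -l ∉ s) → iIndepFun (fun l : s => a l) P

/-- `e_λ(x) = exp(2πi⟨λ, x⟩)`. -/
def torusExp (l : ℤ × ℤ) (x : EuclideanSpace ℝ (Fin 2)) : ℂ :=
  Complex.exp (2 * (Real.pi : ℂ) * Complex.I * (((l.1 : ℝ) * x 0 + (l.2 : ℝ) * x 1 : ℝ) : ℂ))

/-- The arithmetic random wave `T_n`, as a `ℤ²`-periodic function on the plane. The sum is almost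
surely real, because `a_{-λ} = conj a_λ`. -/
def wave (a : ℤ × ℤ → Ω → ℂ) (n : ℕ) (ω : Ω) (x : EuclideanSpace ℝ (Fin 2)) : ℝ :=
  (((√(freqCard n : ℝ) : ℝ) : ℂ)⁻¹ * ∑ l ∈ freq n, a l ω * torusExp l x).re

/-- The total nodal length: the one-dimensional Hausdorff measure (for the Euclidean distance) of
the zero set of `T_n` in the flat torus, computed in the fundamental domain `[0, 1)²`. -/
def nodalLength (a : ℤ × ℤ → Ω → ℂ) (n : ℕ) (ω : Ω) : ℝ :=
  (μH[1] {x : EuclideanSpace ℝ (Fin 2) | (∀ i, x i ∈ Set.Ico (0 : ℝ) 1) ∧ wave a n ω x = 0}).toReal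

/-- The Gaussian Hilbert space `A`: the `L²`-closure of the real span of the variables
`z a_λ + conj z a_{-λ}`. -/
def gaussianSpace (a : ℤ × ℤ → Ω → ℂ) (P : Measure Ω) : Submodule ℝ (Lp ℝ 2 P) :=
  (Submodule.span ℝ {ξ : Lp ℝ 2 P | ∃ l : ℤ × ℤ, l ≠ 0 ∧ ∃ z : ℂ,
    ∀ᵐ ω ∂P, ((ξ ω : ℝ) : ℂ) = z * a l ω + (starRingEnd ℂ) z * a (-l) ω}).topologicalClosure

/-- The `q`-th Wiener chaos associated with `A`: the `L²`-closure of the real span of the products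
`H_{p_1}(ξ_1) ⋯ H_{p_k}(ξ_k)` with `p_1 + ⋯ + p_k = q` and `(ξ_1, …, ξ_k)` a standard Gaussian
vector extracted from `A`; `H_p` is the (probabilists') Hermite polynomial. -/
def wienerChaos (a : ℤ × ℤ → Ω → ℂ) (P : Measure Ω) (q : ℕ) : Submodule ℝ (Lp ℝ 2 P) :=
  (Submodule.span ℝ {F : Lp ℝ 2 P | ∃ (k : ℕ) (p : Fin k → ℕ) (ξ : Fin k → Lp ℝ 2 P),
    1 ≤ k ∧ ∑ i, p i = q ∧ (∀ i, ξ i ∈ gaussianSpace a P) ∧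
    HasLaw (fun ω i => ξ i ω) (Measure.pi fun _ : Fin k => gaussianReal 0 1) P ∧
    ∀ᵐ ω ∂P, F ω = ∏ i, Polynomial.aeval (ξ i ω) (Polynomial.hermite (p i))}).topologicalClosure

instance (a : ℤ × ℤ → Ω → ℂ) (P : Measure Ω) (q : ℕ) :
    (wienerChaos a P q).HasOrthogonalProjection := by
  unfold wienerChaos; infer_instance

open Classical in
/-- The `q`-th chaotic component `F[q]` of a square integrable variable `F`: its orthogonal
projection onto the `q`-th Wiener chaos (and `0` if `F` is not square integrable). -/
def chaosComponent (a : ℤ × ℤ → Ω → ℂ) (P : Measure Ω) (q : ℕ) (F : Ω → ℝ) : Lp ℝ 2 P :=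
  if hF : MemLp F 2 P then (wienerChaos a P q).starProjection (hF.toLp F) else 0

/-- `ℒ_n[4]`. -/
def fourthComponent (a : ℤ × ℤ → Ω → ℂ) (P : Measure Ω) (n : ℕ) : Lp ℝ 2 P :=
  chaosComponent a P 4 (nodalLength a n)

/-- `ℒ_n[4] / √Var(ℒ_n[4])`. -/
def normalizedFourth (a : ℤ × ℤ → Ω → ℂ) (P : Measure Ω) (n : ℕ) (ω : Ω) : ℝ :=
  fourthComponent a P n ω / √(variance (fun ω => fourthComponent a P n ω) P)

/-- The law of `ℳ_η = (2 - (1 + η) X₁² - (1 - η) X₂²) / (2 √(1 + η²))`, with `X₁`, `X₂` independent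
standard Gaussian variables. -/
def limitLaw (η : ℝ) : Measure ℝ :=
  ((gaussianReal 0 1).prod (gaussianReal 0 1)).map
    (fun x : ℝ × ℝ =>
      1 / (2 * √(1 + η ^ 2)) * (2 - (1 + η) * x.1 ^ 2 - (1 - η) * x.2 ^ 2))

end ArithmeticWave

end

set_option linter.unusedSectionVars false

namespace ArithmeticWave

/-! ### One-dimensional Gaussian calculus -/

/-! The fourth chaotic component is computed exactly, and a quantitative central limit theorem is
then applied to a random vector in the plane. Below, N is the number of lattice points, φ_λ the
angle of λ, and ρ = `anisotropy n` the real fourth Fourier coefficient.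

Identification of the component. By polarization every product of Hermite polynomials of total
degree four is a combination of fourth Wick powers of single elements ζ of the Gaussian space. A
variable orthogonal to all these powers is therefore orthogonal to the fourth chaos
(`inner_eq_zero_of_forall_wick4`). So the projection of the nodal length is determined by its
correlations with Wick powers, and it suffices to exhibit an element of the chaos with the same
correlations.

The correlations follow a Kac-Rice argument. Almost surely the wave has no singular zero, so its
nodal length is the limit of the integrals of |∇T| over the bands |T| ≤ ε, divided by 2ε
(`tendsto_bandMeasure_unitSquare`). Horizontal and vertical slices of T are trigonometric
polynomials of degree at most n, hence have boundedly many monotone pieces, and the band integrals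
are at most 2(2n+1) whatever ε and the coefficients are (`bandMeasure_trigSum_le`); this gives both
square integrability and dominated convergence. At a fixed point, T and its normalised derivatives
are independent standard Gaussians, so a three-dimensional Gaussian integral yields a quartic
polynomial in the covariances of ζ with this triple. Integration over the torus keeps only
quadruples of lattice points with zero sum, and on a circle these cancel in pairs
(`eq_neg_of_zero_sum`). With c_λ = E[ζ a_λ] the outcome is a multiple of `quarticForm`, that is
Σ|c_λ|⁴ - ΣΣ cos 2(φ_λ - φ_μ) |c_λ|²|c_μ|². The component is the multiple of the Hermite polynomial
with this symbol (`fourthComponent_ae`). The Hermite polynomial has variance 4N²(1+ρ²) - 8N, which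
is positive because N ≥ 4.

Central limit theorem. The kernel cos 2(φ - ψ) has rank two. Hence the Hermite polynomial equals N(2
- R) plus a centred sum of fourth powers of moduli that is O(√N) in L¹ (`chaosVar_eq_radius`,
`integral_abs_quarticDefect_le`). Here R is the squared length of the planar vector N^(-1/2) Σ (ξ_λ²
- 1) e^{2iφ_λ}, with independent standard Gaussian ξ_λ. The two coordinates of this vector are
uncorrelated with variances 1 ± ρ, so R is compared with (1+ρ)X₁² + (1-ρ)X₂². The comparison runs
along the path cos θ (ξ² - 1) + sin θ √2 ξ', which preserves covariances; Gaussian integration by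
parts bounds the derivative of E F(R) along it by O((A + B)/√N), where A and B bound F' and F''
(`integral_interp_pair_le`). Smoothing h at scale N^(-1/4) makes B of order N^(1/4), and all errors
become O(N^(-1/4)).

Finally the limiting law depends on η only through |η| and, tested against 1-Lipschitz functions, is
Lipschitz in η on [0,1], where |r - η| ≤ |r - η|^(1/2). -/

theorem integrable_pow_gaussianReal (n : ℕ) (v : ℝ≥0) :
    Integrable (fun x : ℝ => x ^ n) (gaussianReal 0 v) := by
  have h := memLp_id_gaussianReal' (μ := 0) (v := v) (n : ℝ≥0∞) (by simp)
  have h2 := h.integrable_norm_pow'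
  refine h2.mono' (by fun_prop) (ae_of_all _ fun x => ?_)
  simp

theorem hasDerivAt_gaussianPDFReal (x : ℝ) :
    HasDerivAt (gaussianPDFReal 0 1) (-x * gaussianPDFReal 0 1 x) x := by
  rw [gaussianPDFReal_def]
  have h : HasDerivAt (fun x : ℝ => -(x - 0) ^ 2 / (2 * ((1 : ℝ≥0) : ℝ))) (-x) x := by
    have := ((((hasDerivAt_id x).sub_const 0).pow 2).neg).div_const (2 * ((1 : ℝ≥0) : ℝ))
    convert! this using 1
    simp
    ring
  convert! (h.exp.const_mul (√(2 * Real.pi * ((1 : ℝ≥0) : ℝ)))⁻¹) using 1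
  ring

/-- Gaussian integration by parts. -/
theorem integral_mul_gaussianReal {f f' : ℝ → ℝ} (hf : ∀ x, HasDerivAt f (f' x) x)
    (h0 : Integrable f (gaussianReal 0 1)) (h1 : Integrable (fun x => x * f x) (gaussianReal 0 1))
    (h2 : Integrable f' (gaussianReal 0 1)) :
    ∫ x, x * f x ∂(gaussianReal 0 1) = ∫ x, f' x ∂(gaussianReal 0 1) := by
  have hint : ∀ g : ℝ → ℝ, Integrable g (gaussianReal 0 1) →
      Integrable (fun x => g x * gaussianPDFReal 0 1 x) := by
    intro g hg
    rw [gaussianReal_of_var_ne_zero _ one_ne_zero,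
      integrable_withDensity_iff (measurable_gaussianPDF _ _)
        (ae_of_all _ fun _ => gaussianPDF_lt_top)] at hg
    simpa using hg
  rw [integral_gaussianReal_eq_integral_smul one_ne_zero,
    integral_gaussianReal_eq_integral_smul one_ne_zero]
  -- The density satisfies φ'(x) = -x φ(x), so x f φ is -f φ' and ordinary integration by parts
  -- applies.
  have key := integral_mul_deriv_eq_deriv_mul_of_integrable (u := f) (u' := f')
    (v := gaussianPDFReal 0 1) (v' := fun x => -x * gaussianPDFReal 0 1 x)
    (fun x _ => hf x) (fun x _ => hasDerivAt_gaussianPDFReal x)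
    (by
      refine (hint _ h1).neg.congr (ae_of_all _ fun x => ?_)
      simp only [Pi.neg_apply, Pi.mul_apply]; ring)
    (hint _ h2) (hint _ h0)
  have e1 : ∀ x, gaussianPDFReal 0 1 x • (x * f x) = -(f x * (-x * gaussianPDFReal 0 1 x)) := by
    intro x; simp only [smul_eq_mul]; ring
  have e2 : ∀ x, gaussianPDFReal 0 1 x • f' x = f' x * gaussianPDFReal 0 1 x := by
    intro x; simp only [smul_eq_mul]; ring
  simp_rw [e1, e2]
  rw [integral_neg, key, neg_neg]

theorem gaussian_moment_succ_succ (n : ℕ) :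
    ∫ x, x ^ (n + 2) ∂(gaussianReal 0 1) = (n + 1) * ∫ x, x ^ n ∂(gaussianReal 0 1) := by
  have := integral_mul_gaussianReal (f := fun x => x ^ (n + 1)) (f' := fun x => (n + 1) * x ^ n)
    (fun x => by simpa using hasDerivAt_pow (n + 1) x)
    (integrable_pow_gaussianReal _ _)
    (by simpa [← pow_succ'] using integrable_pow_gaussianReal (n + 2) 1)
    ((integrable_pow_gaussianReal _ _).const_mul _)
  rw [integral_const_mul] at this
  rw [← this]
  congr 1; ext x; ring

theorem gaussian_moment_two : ∫ x, x ^ 2 ∂(gaussianReal 0 1) = 1 := by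
  have := gaussian_moment_succ_succ 0; simpa using this

theorem gaussian_moment_three : ∫ x, x ^ 3 ∂(gaussianReal 0 1) = 0 := by
  have := gaussian_moment_succ_succ 1; simpa using this

theorem gaussian_moment_four : ∫ x, x ^ 4 ∂(gaussianReal 0 1) = 3 := by
  rw [gaussian_moment_succ_succ 2, gaussian_moment_two]; norm_num

theorem gaussian_moment_six : ∫ x, x ^ 6 ∂(gaussianReal 0 1) = 15 := by
  rw [gaussian_moment_succ_succ 4, gaussian_moment_four]; norm_num

theorem gaussian_moment_eight : ∫ x, x ^ 8 ∂(gaussianReal 0 1) = 105 := by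
  rw [gaussian_moment_succ_succ 6, gaussian_moment_six]; norm_num

theorem aeval_hermite_one (x : ℝ) : Polynomial.aeval x (Polynomial.hermite 1) = x := by
  simp

theorem aeval_hermite_two (x : ℝ) : Polynomial.aeval x (Polynomial.hermite 2) = x ^ 2 - 1 := by
  rw [Polynomial.hermite_succ, Polynomial.hermite_one]; simp; ring

theorem aeval_hermite_three (x : ℝ) :
    Polynomial.aeval x (Polynomial.hermite 3) = x ^ 3 - 3 * x := by
  rw [Polynomial.hermite_succ, Polynomial.hermite_succ, Polynomial.hermite_one]; simp; ring

theorem aeval_hermite_four (x : ℝ) :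
    Polynomial.aeval x (Polynomial.hermite 4) = x ^ 4 - 6 * x ^ 2 + 3 := by
  rw [Polynomial.hermite_succ, Polynomial.hermite_succ, Polynomial.hermite_succ,
    Polynomial.hermite_one]; simp; ring

/-! ### The Gaussian Hilbert space -/

section GaussianSpace

variable {Ω : Type*} [MeasurableSpace Ω] {P : Measure Ω} [IsProbabilityMeasure P]
  {a : ℤ × ℤ → Ω → ℂ}

theorem L2_inner_eq (f g : Lp ℝ 2 P) : inner ℝ f g = ∫ ω, f ω * g ω ∂P := by
  rw [L2.inner_def]
  refine integral_congr_ae (ae_of_all _ fun ω => ?_)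
  simp [mul_comm]

theorem L2_norm_sq_eq (f : Lp ℝ 2 P) : ‖f‖ ^ 2 = ∫ ω, f ω ^ 2 ∂P := by
  rw [← real_inner_self_eq_norm_sq, L2_inner_eq]
  simp_rw [pow_two]

theorem integral_abs_le_L2_norm (f : Lp ℝ 2 P) : ∫ ω, |f ω| ∂P ≤ ‖f‖ := by
  have hf := Lp.memLp f
  have h1 : eLpNorm f 1 P ≤ eLpNorm f 2 P :=
    eLpNorm_le_eLpNorm_of_exponent_le (by norm_num) hf.1
  rw [Lp.norm_def]
  have h2 : ∫ ω, |f ω| ∂P = (eLpNorm f 1 P).toReal := by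
    rw [eLpNorm_one_eq_lintegral_enorm, ← integral_norm_eq_lintegral_enorm hf.1]
    rfl
  rw [h2]
  exact ENNReal.toReal_mono hf.2.ne h1

/-- A half of the lattice `ℤ² \ {0}`. -/
def IsPos (l : ℤ × ℤ) : Prop := 0 < l.1 ∨ (l.1 = 0 ∧ 0 < l.2)

theorem isPos_neg_of_not {l : ℤ × ℤ} (hl : l ≠ 0) (h : ¬ IsPos l) : IsPos (-l) := by
  have : ¬ (l.1 = 0 ∧ l.2 = 0) := fun h => hl (Prod.ext h.1 h.2)
  simp only [IsPos, Prod.fst_neg, Prod.snd_neg] at *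
  omega

theorem not_isPos_neg {l : ℤ × ℤ} (h : IsPos l) : ¬ IsPos (-l) := by
  simp only [IsPos, Prod.fst_neg, Prod.snd_neg] at *
  omega

theorem IsPos.ne_zero {l : ℤ × ℤ} (h : IsPos l) : l ≠ 0 := by
  rintro rfl
  simp [IsPos] at h

theorem IsWaveCoefficients.hasGaussianLaw (ha : IsWaveCoefficients a P) {l : ℤ × ℤ}
    (hl : l ≠ 0) : HasGaussianLaw (a l) P := by
  have h := (ha.indep_re_im l hl).hasGaussianLaw (ha.law_re l hl).hasGaussianLaw
    (ha.law_im l hl).hasGaussianLaw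
  have := h.map_equiv_fun (Complex.equivRealProdCLM.symm)
  refine this.congr (ae_of_all _ fun ω => ?_)
  apply Complex.ext <;> simp

open Classical in
-- Independence is available only for index sets free of opposite pairs. Each frequency is therefore
-- moved to the positive half of the lattice, and the original family is recovered by a real linear
-- map that conjugates where a sign was changed.
theorem IsWaveCoefficients.hasGaussianLaw_pi (ha : IsWaveCoefficients a P)
    {ι : Type*} [Finite ι] (e : ι → ℤ × ℤ) (he : ∀ i, e i ≠ 0) :
    HasGaussianLaw (fun ω i => a (e i) ω) P := by
  have := Fintype.ofFinite ι
  let f : ι → ℤ × ℤ := fun i => if IsPos (e i) then e i else -e i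
  have hf : ∀ i, IsPos (f i) := fun i => by
    by_cases h : IsPos (e i)
    · simp [f, h]
    · simpa [f, h] using isPos_neg_of_not (he i) h
  have h1 : iIndepFun (fun l : {l | IsPos l} => a l) P :=
    ha.indep {l | IsPos l} fun l hl => not_isPos_neg hl
  -- Two indices may carry the same or opposite frequencies; the range of `f` lists each positive
  -- representative once, which is what independence needs.
  let κ := Set.range f
  have : Finite κ := Set.finite_range f
  have := Fintype.ofFinite κ
  let j : κ → {l | IsPos l} := fun k => ⟨k, by obtain ⟨_, i, rfl⟩ := k; exact hf i⟩
  have hj : Function.Injective j := fun x y hxy => by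
    apply Subtype.ext
    simpa [j] using hxy
  have h2 : iIndepFun (fun k : κ => a k) P := h1.precomp hj
  have h3 := h2.hasGaussianLaw (fun k => ha.hasGaussianLaw (j k).2.ne_zero)
  let L : (κ → ℂ) →L[ℝ] (ι → ℂ) := ContinuousLinearMap.pi fun i =>
    if IsPos (e i) then ContinuousLinearMap.proj ⟨f i, i, rfl⟩
    else (Complex.conjCLE.toContinuousLinearMap).comp (ContinuousLinearMap.proj ⟨f i, i, rfl⟩)
  refine (h3.map_fun L).congr ?_
  have h4 : ∀ᵐ ω ∂P, ∀ i, a (-e i) ω = (starRingEnd ℂ) (a (e i) ω) :=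
    ae_all_iff.2 fun i => ha.conj_eq _ (he i)
  filter_upwards [h4] with ω hω
  ext1 i
  by_cases h : IsPos (e i)
  · simp [L, f, h, j]
  · simp [L, f, h, j, hω]

theorem IsWaveCoefficients.integral_re (ha : IsWaveCoefficients a P) {l : ℤ × ℤ} (hl : l ≠ 0) :
    ∫ ω, (a l ω).re ∂P = 0 := by
  rw [(ha.law_re l hl).integral_eq]; simp

theorem IsWaveCoefficients.integral_im (ha : IsWaveCoefficients a P) {l : ℤ × ℤ} (hl : l ≠ 0) :
    ∫ ω, (a l ω).im ∂P = 0 := by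
  rw [(ha.law_im l hl).integral_eq]; simp

theorem IsWaveCoefficients.integral_re_mul (ha : IsWaveCoefficients a P) {l : ℤ × ℤ}
    (hl : l ≠ 0) (w : ℂ) : ∫ ω, (w * a l ω).re ∂P = 0 := by
  have h1 : Integrable (fun ω => (a l ω).re) P := (ha.law_re l hl).hasGaussianLaw.integrable
  have h2 : Integrable (fun ω => (a l ω).im) P := (ha.law_im l hl).hasGaussianLaw.integrable
  simp_rw [Complex.mul_re]
  rw [integral_sub (h1.const_mul _) (h2.const_mul _), integral_const_mul, integral_const_mul,
    ha.integral_re hl, ha.integral_im hl]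
  simp

/-- The finite real linear forms in the coefficients. -/
def IsFiniteForm (a : ℤ × ℤ → Ω → ℂ) (P : Measure Ω) (ξ : Lp ℝ 2 P) : Prop :=
  ∃ z : {l : ℤ × ℤ // l ≠ 0} →₀ ℂ, ξ =ᵐ[P] fun ω => z.sum fun l w => (w * a l ω).re

theorem isFiniteForm_of_mem_span {ξ : Lp ℝ 2 P}
    (hξ : ξ ∈ Submodule.span ℝ {ξ : Lp ℝ 2 P | ∃ l : ℤ × ℤ, l ≠ 0 ∧ ∃ z : ℂ,
      ∀ᵐ ω ∂P, ((ξ ω : ℝ) : ℂ) = z * a l ω + (starRingEnd ℂ) z * a (-l) ω}) :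
    IsFiniteForm a P ξ := by
  classical
  have hadd : ∀ ξ η : Lp ℝ 2 P, IsFiniteForm a P ξ → IsFiniteForm a P η →
      IsFiniteForm a P (ξ + η) := by
    rintro ξ η ⟨z, hz⟩ ⟨w, hw⟩
    refine ⟨z + w, ?_⟩
    filter_upwards [Lp.coeFn_add ξ η, hz, hw] with ω h1 h2 h3
    rw [h1, Pi.add_apply, h2, h3, Finsupp.sum_add_index' (by simp)
      (fun _ _ _ => by rw [add_mul, Complex.add_re])]
  induction hξ using Submodule.span_induction with
  | mem ξ h =>
    obtain ⟨l, hl, z, hz⟩ := h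
    -- The generator is real, so it equals the sum of the real parts of its two terms.
    refine ⟨Finsupp.single ⟨l, hl⟩ z + Finsupp.single ⟨-l, by simpa using hl⟩
      ((starRingEnd ℂ) z), ?_⟩
    filter_upwards [hz] with ω hω
    rw [Finsupp.sum_add_index' (by simp) (fun _ _ _ => by rw [add_mul, Complex.add_re]),
      Finsupp.sum_single_index (by simp), Finsupp.sum_single_index (by simp), ← Complex.add_re,
      ← hω, Complex.ofReal_re]
  | zero =>
    refine ⟨0, ?_⟩
    filter_upwards [Lp.coeFn_zero ℝ 2 P] with ω h1
    simp [h1]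
  | add ξ η _ _ h1 h2 => exact hadd ξ η h1 h2
  | smul c ξ _ h =>
    obtain ⟨z, hz⟩ := h
    refine ⟨c • z, ?_⟩
    filter_upwards [Lp.coeFn_smul c ξ, hz] with ω h1 h2
    rw [h1, Pi.smul_apply, h2, Finsupp.sum_smul_index' (by simp), Finsupp.smul_sum]
    simp [Finsupp.sum, mul_assoc]

theorem IsFiniteForm.hasGaussianLaw (ha : IsWaveCoefficients a P) {ξ : Lp ℝ 2 P}
    (h : IsFiniteForm a P ξ) : HasGaussianLaw ξ P ∧ ∫ ω, ξ ω ∂P = 0 := by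
  obtain ⟨z, hz⟩ := h
  constructor
  · have h1 := ha.hasGaussianLaw_pi (ι := z.support) (fun i => ((i : {l : ℤ × ℤ // l ≠ 0}) : ℤ × ℤ))
      (fun i => i.1.2)
    let L : (z.support → ℂ) →L[ℝ] ℝ := ∑ i : z.support, Complex.reCLM.comp
      ((ContinuousLinearMap.mul ℝ ℂ (z i)).comp (ContinuousLinearMap.proj (R := ℝ) i))
    refine (h1.map_fun L).congr ?_
    filter_upwards [hz] with ω hω
    rw [hω, Finsupp.sum, ← Finset.sum_coe_sort]
    simp [L]
  · rw [integral_congr_ae hz]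
    simp only [Finsupp.sum]
    rw [integral_finsetSum]
    · exact Finset.sum_eq_zero fun l _ => ha.integral_re_mul l.2 _
    · intro l _
      have h1 := (ha.hasGaussianLaw l.2).integrable.const_mul (z l)
      exact h1.re

theorem IsFiniteForm.integral_exp (ha : IsWaveCoefficients a P) {ξ : Lp ℝ 2 P}
    (h : IsFiniteForm a P ξ) (t : ℝ) :
    ∫ ω, Complex.exp (t * ξ ω * Complex.I) ∂P = Complex.exp (-(t ^ 2 * ‖ξ‖ ^ 2 / 2 : ℝ)) := by
  obtain ⟨h1, h2⟩ := h.hasGaussianLaw ha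
  have h3 := h1.charFun_map_eq t
  rw [charFun_apply, integral_map h1.aemeasurable (by fun_prop)] at h3
  simp only [RCLike.inner_apply, conj_trivial] at h3
  have e1 : ∫ ω, ξ ω * t ∂P = 0 := by rw [integral_mul_const, h2, zero_mul]
  have e2 : Var[fun ω => ξ ω * t; P] = t ^ 2 * ‖ξ‖ ^ 2 := by
    rw [variance_of_integral_eq_zero (h1.aemeasurable.mul_const t) e1, L2_norm_sq_eq,
      ← integral_const_mul]
    congr 1; ext ω; ring
  rw [e1, e2] at h3
  convert! h3 using 1
  · congr 1; ext ω; congr 1; push_cast; ring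
  · push_cast; simp

/-- Since |e^{is} - 1| ≤ |s|, the characteristic function at t is |t|-Lipschitz for the L¹ distance,
hence for the L² distance. This carries Gaussianity from finite linear forms to their closure. -/
theorem continuous_integral_exp (t : ℝ) :
    Continuous fun ξ : Lp ℝ 2 P => ∫ ω, Complex.exp (t * ξ ω * Complex.I) ∂P := by
  have hint : ∀ ξ : Lp ℝ 2 P, Integrable (fun ω => Complex.exp (t * ξ ω * Complex.I)) P := by
    intro ξ
    have hm := (Lp.aestronglyMeasurable ξ).aemeasurable
    refine Integrable.of_bound (by fun_prop) 1 (ae_of_all _ fun ω => ?_)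
    rw [← Complex.ofReal_mul, Complex.norm_exp_ofReal_mul_I]
  have : LipschitzWith (Real.toNNReal |t|)
      fun ξ : Lp ℝ 2 P => ∫ ω, Complex.exp (t * ξ ω * Complex.I) ∂P := by
    refine LipschitzWith.of_dist_le_mul fun ξ η => ?_
    rw [dist_eq_norm, dist_eq_norm, ← integral_sub (hint _) (hint _),
      Real.coe_toNNReal _ (abs_nonneg _)]
    refine (norm_integral_le_integral_norm _).trans ?_
    have hd : Integrable (fun ω => (ξ - η) ω) P := (Lp.memLp (ξ - η)).integrable (by norm_num)
    calc _ ≤ ∫ ω, |t| * |(ξ - η) ω| ∂P := by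
          refine integral_mono_ae ((hint _).sub (hint _)).norm (hd.abs.const_mul _) ?_
          filter_upwards [Lp.coeFn_sub ξ η] with ω hω
          rw [hω, Pi.sub_apply, ← abs_mul, mul_sub]
          have h1 : Complex.exp (t * ξ ω * Complex.I) - Complex.exp (t * η ω * Complex.I)
              = Complex.exp (t * η ω * Complex.I)
                * (Complex.exp (Complex.I * ((t * ξ ω - t * η ω : ℝ) : ℂ)) - 1) := by
            rw [mul_sub, ← Complex.exp_add, mul_one]
            congr 2; push_cast; ring
          rw [h1, norm_mul, ← Complex.ofReal_mul, Complex.norm_exp_ofReal_mul_I, one_mul]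
          exact Real.norm_exp_I_mul_ofReal_sub_one_le
      _ ≤ |t| * ‖ξ - η‖ := by
          rw [integral_const_mul]
          exact mul_le_mul_of_nonneg_left (integral_abs_le_L2_norm _) (abs_nonneg t)
  exact this.continuous

/-- Every element of the Gaussian space is a centred Gaussian variable. -/
theorem hasLaw_of_mem_gaussianSpace (ha : IsWaveCoefficients a P) {ξ : Lp ℝ 2 P}
    (hξ : ξ ∈ gaussianSpace a P) : HasLaw ξ (gaussianReal 0 (‖ξ‖₊ ^ 2)) P := by
  have hm := (Lp.aestronglyMeasurable ξ).aemeasurable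
  -- The variance is the squared norm, so both sides of the Gaussian formula are continuous in ξ.
  have hclosed : IsClosed {ξ : Lp ℝ 2 P | ∀ t : ℝ,
      ∫ ω, Complex.exp (t * ξ ω * Complex.I) ∂P = Complex.exp (-(t ^ 2 * ‖ξ‖ ^ 2 / 2 : ℝ))} := by
    simp only [Set.ofPred_forall]
    refine isClosed_iInter fun t => isClosed_eq (continuous_integral_exp t) ?_
    fun_prop
  have hmem : ∀ t : ℝ, ∫ ω, Complex.exp (t * ξ ω * Complex.I) ∂P
      = Complex.exp (-(t ^ 2 * ‖ξ‖ ^ 2 / 2 : ℝ)) := by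
    have : ξ ∈ closure ((Submodule.span ℝ {ξ : Lp ℝ 2 P | ∃ l : ℤ × ℤ, l ≠ 0 ∧ ∃ z : ℂ,
      ∀ᵐ ω ∂P, ((ξ ω : ℝ) : ℂ) = z * a l ω + (starRingEnd ℂ) z * a (-l) ω} :
        Submodule ℝ (Lp ℝ 2 P)) : Set (Lp ℝ 2 P)) := hξ
    exact closure_minimal (fun _ hη t => (isFiniteForm_of_mem_span hη).integral_exp ha t)
      hclosed this
  refine ⟨hm, ?_⟩
  have := Measure.isProbabilityMeasure_map hm
  refine Measure.ext_of_charFun ?_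
  ext t
  rw [charFun_gaussianReal, charFun_apply, integral_map hm (by fun_prop)]
  simp only [RCLike.inner_apply, conj_trivial]
  convert! hmem t using 1
  · congr 1; ext ω; congr 1; push_cast; ring
  · congr 1; push_cast; simp; ring

/-- A vector is Gaussian once all its linear functionals are, and a linear functional of elements of
the Gaussian space is again such an element, to which the one-dimensional statement applies. -/
theorem hasGaussianLaw_pi_of_mem (ha : IsWaveCoefficients a P) {ι : Type*} [Fintype ι]
    {U : ι → Lp ℝ 2 P} (hU : ∀ i, U i ∈ gaussianSpace a P) :
    HasGaussianLaw (fun ω i => U i ω) P := by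
  classical
  have hm : AEMeasurable (fun ω i => U i ω) P :=
    aemeasurable_pi_lambda _ fun i => (Lp.aestronglyMeasurable (U i)).aemeasurable
  refine ⟨isGaussian_of_map_eq_gaussianReal fun L => ?_⟩
  let ξ : Lp ℝ 2 P := ∑ i, L (Pi.single i 1) • U i
  have hξ : ξ ∈ gaussianSpace a P :=
    Submodule.sum_mem _ fun i _ => Submodule.smul_mem _ _ (hU i)
  refine ⟨0, ‖ξ‖₊ ^ 2, ?_⟩
  rw [AEMeasurable.map_map_of_aemeasurable (by fun_prop) hm, ← (hasLaw_of_mem_gaussianSpace ha hξ).map_eq]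
  refine Measure.map_congr ?_
  have h1 : (ξ : Ω → ℝ) =ᵐ[P] fun ω => ∑ i, L (Pi.single i 1) * U i ω := by
    have h2 : ∀ᵐ ω ∂P, ∀ i, (L (Pi.single i 1) • U i : Lp ℝ 2 P) ω = L (Pi.single i 1) * U i ω :=
      ae_all_iff.2 fun i => by
        filter_upwards [Lp.coeFn_smul (L (Pi.single i 1)) (U i)] with ω hω
        rw [hω]; rfl
    have h3 := Lp.coeFn_finsetSum Finset.univ fun i => L (Pi.single i 1) • U i
    filter_upwards [h2, h3] with ω h4 h5
    rw [h5]
    simp [h4]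
  filter_upwards [h1] with ω hω
  rw [hω, Function.comp_apply]
  conv_lhs => rw [← Finset.univ_sum_single (fun i => U i ω)]
  rw [map_sum]
  refine Finset.sum_congr rfl fun i _ => ?_
  have : (Pi.single i (U i ω) : ι → ℝ) = U i ω • Pi.single i 1 := by
    rw [← Pi.single_smul]; simp
  rw [this, map_smul, smul_eq_mul, mul_comm]

theorem integral_eq_zero_of_mem (ha : IsWaveCoefficients a P) {ξ : Lp ℝ 2 P}
    (hξ : ξ ∈ gaussianSpace a P) : ∫ ω, ξ ω ∂P = 0 := by
  rw [(hasLaw_of_mem_gaussianSpace ha hξ).integral_eq]; simp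

theorem covariance_eq_inner (ha : IsWaveCoefficients a P) {ξ η : Lp ℝ 2 P}
    (hξ : ξ ∈ gaussianSpace a P) (hη : η ∈ gaussianSpace a P) :
    cov[ξ, η; P] = inner ℝ ξ η := by
  rw [covariance_eq_sub (Lp.memLp _) (Lp.memLp _), integral_eq_zero_of_mem ha hξ, zero_mul,
    sub_zero, L2_inner_eq]
  rfl

/-- Jointly Gaussian and uncorrelated variables are independent, so orthonormality in L² alone
yields a standard Gaussian vector. -/
theorem hasLaw_pi_of_orthonormal (ha : IsWaveCoefficients a P) {ι : Type*} [Fintype ι]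
    {U : ι → Lp ℝ 2 P} (hU : ∀ i, U i ∈ gaussianSpace a P) (ho : Orthonormal ℝ U) :
    HasLaw (fun ω i => U i ω) (Measure.pi fun _ : ι => gaussianReal 0 1) P := by
  refine iIndepFun.hasLaw_pi (fun i => ?_)
    ((hasGaussianLaw_pi_of_mem ha hU).iIndepFun_of_covariance_eq_zero fun i j hij => ?_)
  · have := hasLaw_of_mem_gaussianSpace ha (hU i)
    have h1 : ‖U i‖₊ = 1 := NNReal.eq (by simpa using ho.1 i)
    rwa [h1, one_pow] at this
  · rw [covariance_eq_inner ha (hU i) (hU j)]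
    exact ho.2 hij

end GaussianSpace

/-! ### Fourth Wick powers and their projection onto an orthonormal family. -/

/-- The fourth Hermite polynomial with variance parameter `s`. -/
def wick4 (x s : ℝ) : ℝ := x ^ 4 - 6 * s * x ^ 2 + 3 * s ^ 2

theorem integrable_fun_sub {α : Type*} [MeasurableSpace α] {μ : Measure α} {f g : α → ℝ}
    (hf : Integrable f μ) (hg : Integrable g μ) : Integrable (fun x => f x - g x) μ :=
  hf.sub hg

/-- Binomial formula for Wick powers: each term but the first carries a Wick power of y of positive
degree. It is centred when y has variance t, so for independent x and y only the first term survives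
in expectation. -/
theorem wick4_add (x y s t : ℝ) :
    wick4 (x + y) (s + t) = wick4 x s + (4 * (x ^ 3 - 3 * s * x)) * y
      + (6 * (x ^ 2 - s)) * (y ^ 2 - t) + (4 * x) * (y ^ 3 - 3 * t * y) + wick4 y t := by
  simp only [wick4]; ring

theorem gaussianReal_eq_map_sqrt (v : ℝ≥0) :
    gaussianReal 0 v = (gaussianReal 0 1).map (fun x => √(v : ℝ) * x) := by
  rw [gaussianReal_map_const_mul]
  congr 1
  · simp
  · ext; simp

theorem integral_pow_gaussianReal (n : ℕ) (v : ℝ≥0) :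
    ∫ x, x ^ n ∂(gaussianReal 0 v) = √(v : ℝ) ^ n * ∫ x, x ^ n ∂(gaussianReal 0 1) := by
  rw [gaussianReal_eq_map_sqrt v, integral_map (by fun_prop) (by fun_prop), ← integral_const_mul]
  simp_rw [mul_pow]

section GaussianSpace

variable {Ω : Type*} [MeasurableSpace Ω] {P : Measure Ω} [IsProbabilityMeasure P]
  {a : ℤ × ℤ → Ω → ℂ}

theorem integrable_pow_of_mem (ha : IsWaveCoefficients a P) {ξ : Lp ℝ 2 P}
    (hξ : ξ ∈ gaussianSpace a P) (n : ℕ) : Integrable (fun ω => ξ ω ^ n) P := by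
  have h := hasLaw_of_mem_gaussianSpace ha hξ
  have h1 := integrable_pow_gaussianReal n (‖ξ‖₊ ^ 2)
  rw [← h.map_eq] at h1
  exact h1.comp_aemeasurable h.aemeasurable

theorem memLp_pow_of_mem (ha : IsWaveCoefficients a P) {ξ : Lp ℝ 2 P}
    (hξ : ξ ∈ gaussianSpace a P) (n : ℕ) : MemLp (fun ω => ξ ω ^ n) 2 P := by
  have hm := (Lp.aestronglyMeasurable ξ)
  rw [memLp_two_iff_integrable_sq (hm.fun_pow n)]
  simp_rw [← pow_mul]
  exact integrable_pow_of_mem ha hξ _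

theorem memLp_wick4_of_mem (ha : IsWaveCoefficients a P) {ξ : Lp ℝ 2 P}
    (hξ : ξ ∈ gaussianSpace a P) (s : ℝ) : MemLp (fun ω => wick4 (ξ ω) s) 2 P :=
  ((memLp_pow_of_mem ha hξ 4).sub ((memLp_pow_of_mem ha hξ 2).const_mul _)).add
    (memLp_const (3 * s ^ 2))

theorem integral_pow_of_mem (ha : IsWaveCoefficients a P) {ξ : Lp ℝ 2 P}
    (hξ : ξ ∈ gaussianSpace a P) (n : ℕ) :
    ∫ ω, ξ ω ^ n ∂P = ‖ξ‖ ^ n * ∫ x, x ^ n ∂(gaussianReal 0 1) := by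
  have h := hasLaw_of_mem_gaussianSpace ha hξ
  have := h.integral_comp (f := fun x : ℝ => x ^ n) (by fun_prop)
  simp only [Function.comp_def] at this
  rw [this, integral_pow_gaussianReal]
  simp

theorem integral_wick_of_mem (ha : IsWaveCoefficients a P) {ξ : Lp ℝ 2 P}
    (hξ : ξ ∈ gaussianSpace a P) :
    ∫ ω, (ξ ω ^ 2 - ‖ξ‖ ^ 2) ∂P = 0 ∧ ∫ ω, (ξ ω ^ 3 - 3 * ‖ξ‖ ^ 2 * ξ ω) ∂P = 0 ∧
      ∫ ω, wick4 (ξ ω) (‖ξ‖ ^ 2) ∂P = 0 := by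
  have i1 := integrable_pow_of_mem ha hξ 1
  have i2 := integrable_pow_of_mem ha hξ 2
  have i3 := integrable_pow_of_mem ha hξ 3
  have i4 := integrable_pow_of_mem ha hξ 4
  simp only [pow_one] at i1
  refine ⟨?_, ?_, ?_⟩
  · rw [integral_sub i2 (integrable_const _), integral_pow_of_mem ha hξ, gaussian_moment_two]
    simp
  · rw [integral_sub i3 (i1.const_mul _), integral_pow_of_mem ha hξ, gaussian_moment_three,
      integral_const_mul, integral_eq_zero_of_mem ha hξ]
    simp
  · simp only [wick4]
    rw [integral_add (integrable_fun_sub i4 (i2.const_mul _)) (integrable_const _), integral_sub i4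
      (i2.const_mul _), integral_const_mul, integral_pow_of_mem ha hξ, integral_pow_of_mem ha hξ,
      gaussian_moment_two, gaussian_moment_four]
    simp; ring

/-- The fourth Wick power of an element of the Gaussian space integrates against a function of an
orthonormal family as if it were projected onto the span of that family. -/
theorem integral_mul_wick4 (ha : IsWaveCoefficients a P) {ι : Type*} [Fintype ι]
    {U : ι → Lp ℝ 2 P} (hU : ∀ i, U i ∈ gaussianSpace a P) (ho : Orthonormal ℝ U)
    {ζ : Lp ℝ 2 P} (hζ : ζ ∈ gaussianSpace a P) {Φ : (ι → ℝ) → ℝ} (hΦ : Measurable Φ)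
    (hΦ2 : MemLp Φ 2 (Measure.pi fun _ : ι => gaussianReal 0 1)) :
    ∫ ω, Φ (fun i => U i ω) * wick4 (ζ ω) (‖ζ‖ ^ 2) ∂P
      = ∫ u, Φ u * wick4 (∑ i, inner ℝ (U i) ζ * u i) (∑ i, inner ℝ (U i) ζ ^ 2)
          ∂(Measure.pi fun _ : ι => gaussianReal 0 1) := by
  set b : ι → ℝ := fun i => inner ℝ (U i) ζ with hb
  -- ζ is split into its projection p on the family and a remainder q. The remainder is jointly
  -- Gaussian with the family and orthogonal to it, hence independent of it.
  let p : Lp ℝ 2 P := ∑ i, b i • U i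
  let q : Lp ℝ 2 P := ζ - p
  have hp : p ∈ gaussianSpace a P := Submodule.sum_mem _ fun i _ => Submodule.smul_mem _ _ (hU i)
  have hq : q ∈ gaussianSpace a P := Submodule.sub_mem _ hζ hp
  have hUq : ∀ i, inner ℝ (U i) q = 0 := fun i => by
    simp only [q, p, inner_sub_right]
    rw [ho.inner_right_fintype]
    simp [hb]
  have hpn : ‖p‖ ^ 2 = ∑ i, b i ^ 2 := by
    rw [← real_inner_self_eq_norm_sq]
    simp only [p]
    rw [ho.inner_sum]
    simp [pow_two]
  have hζn : ‖ζ‖ ^ 2 = ∑ i, b i ^ 2 + ‖q‖ ^ 2 := by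
    have h1 : ζ = p + q := by simp [q]
    have h2 : inner ℝ p q = 0 := by
      simp only [p]
      rw [sum_inner]
      exact Finset.sum_eq_zero fun i _ => by rw [inner_smul_left, hUq]; simp
    rw [← hpn, h1, pow_two, norm_add_sq_eq_norm_sq_add_norm_sq_real h2]
    simp [pow_two, q]
  have hpe : (p : Ω → ℝ) =ᵐ[P] fun ω => ∑ i, b i * U i ω := by
    have h2 : ∀ᵐ ω ∂P, ∀ i, (b i • U i : Lp ℝ 2 P) ω = b i * U i ω :=
      ae_all_iff.2 fun i => by
        filter_upwards [Lp.coeFn_smul (b i) (U i)] with ω hω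
        rw [hω]; rfl
    have h3 := Lp.coeFn_finsetSum Finset.univ fun i => b i • U i
    filter_upwards [h2, h3] with ω h4 h5
    rw [h5]
    simp [h4]
  have hζe : (ζ : Ω → ℝ) =ᵐ[P] fun ω => (∑ i, b i * U i ω) + q ω := by
    filter_upwards [Lp.coeFn_sub ζ p, hpe] with ω h1 h2
    simp only [q]
    rw [h1, Pi.sub_apply, h2]; ring
  have hlaw := hasLaw_pi_of_orthonormal ha hU ho
  -- independence
  have hind : IndepFun (fun ω i => U i ω) (q : Ω → ℝ) P := by
    let V : ι ⊕ Unit → Lp ℝ 2 P := Sum.elim U fun _ => q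
    have hV : ∀ i, V i ∈ gaussianSpace a P := by rintro (i | i) <;> simp [V, hU, hq]
    have h1 := hasGaussianLaw_pi_of_mem ha hV
    let L : (ι ⊕ Unit → ℝ) →L[ℝ] (ι → ℝ) × (Unit → ℝ) :=
      ContinuousLinearMap.prod
        (ContinuousLinearMap.pi fun i => ContinuousLinearMap.proj (Sum.inl i))
        (ContinuousLinearMap.pi fun i => ContinuousLinearMap.proj (Sum.inr i))
    have h2 : HasGaussianLaw (fun ω => (fun i => U i ω, fun _ : Unit => q ω)) P :=
      h1.map_fun L
    have h3 := h2.indepFun_of_covariance_eval (X := fun i => U i) (Y := fun _ : Unit => q)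
      (fun i _ => by rw [covariance_eq_inner ha (hU i) hq, hUq])
    exact h3.comp measurable_id (measurable_pi_apply ())
  -- integrability
  have hΦU : MemLp (fun ω => Φ (fun i => U i ω)) 2 P := by
    rw [← hlaw.map_eq] at hΦ2
    exact hΦ2.comp_of_map hlaw.aemeasurable
  set pu : (ι → ℝ) → ℝ := fun u => ∑ i, b i * u i with hpu
  have hpum : Measurable pu := by fun_prop
  have hΦint : ∀ n : ℕ, Integrable (fun ω => Φ (fun i => U i ω) * pu (fun i => U i ω) ^ n) P := by
    intro n
    refine (hΦU.integrable_mul (memLp_pow_of_mem ha hp n)).congr ?_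
    filter_upwards [hpe] with ω hω
    simp [hω, hpu]
  set s := ∑ i, b i ^ 2
  -- By independence a product of a function of the family and a function of q is integrable, and
  -- its integral vanishes when the second factor is centred. This disposes of the four mixed terms
  -- of `wick4_add`.
  have prodint : ∀ (f : (ι → ℝ) → ℝ) (r : ℝ → ℝ), Measurable f → Measurable r →
      Integrable (fun ω => f (fun i => U i ω)) P → Integrable (fun ω => r (q ω)) P →
      Integrable (fun ω => f (fun i => U i ω) * r (q ω)) P ∧
      (∫ ω, r (q ω) ∂P = 0 → ∫ ω, f (fun i => U i ω) * r (q ω) ∂P = 0) := by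
    intro f r hf hr h1 h2
    have hi := hind.comp hf hr
    refine ⟨hi.integrable_mul h1 h2, fun h0 => ?_⟩
    have := hi.integral_fun_mul_eq_mul_integral h1.1 h2.1
    have h0' : ∫ ω, (r ∘ (q : Ω → ℝ)) ω ∂P = 0 := h0
    rw [h0', mul_zero] at this
    exact this
  obtain ⟨z2, z3, z4⟩ := integral_wick_of_mem ha hq
  set t := ‖q‖ ^ 2
  have iq : ∀ n, Integrable (fun ω => q ω ^ n) P := integrable_pow_of_mem ha hq
  have iq1 : Integrable (fun ω => q ω) P := by simpa using iq 1
  have A1 := prodint (fun u => Φ u * (4 * (pu u ^ 3 - 3 * s * pu u))) (fun y => y)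
    (by fun_prop) (by fun_prop)
    ((((hΦint 3).sub ((hΦint 1).const_mul (3 * s))).const_mul 4).congr
      (ae_of_all _ fun ω => by simp; ring)) iq1
  have A2 := prodint (fun u => Φ u * (6 * (pu u ^ 2 - s))) (fun y => y ^ 2 - t)
    (by fun_prop) (by fun_prop)
    ((((hΦint 2).sub ((hΦint 0).const_mul s)).const_mul 6).congr
      (ae_of_all _ fun ω => by simp; ring)) ((iq 2).sub (integrable_const _))
  have A3 := prodint (fun u => Φ u * (4 * pu u)) (fun y => y ^ 3 - 3 * t * y)
    (by fun_prop) (by fun_prop)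
    (((hΦint 1).const_mul 4).congr
      (ae_of_all _ fun ω => by simp; ring)) ((iq 3).sub (iq1.const_mul _))
  have A4 := prodint Φ (fun y => wick4 y t) hΦ (by unfold wick4; fun_prop)
    (by simpa using hΦint 0) ((memLp_wick4_of_mem ha hq t).integrable (by norm_num))
  have A0 : Integrable (fun ω => Φ (fun i => U i ω) * wick4 (pu (fun i => U i ω)) s) P :=
    (((hΦint 4).sub ((hΦint 2).const_mul (6 * s))).add ((hΦint 0).const_mul (3 * s ^ 2))).congr
      (ae_of_all _ fun ω => by simp [wick4]; ring)
  have e1 : ∫ ω, Φ (fun i => U i ω) * wick4 (ζ ω) (‖ζ‖ ^ 2) ∂P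
      = ∫ ω, ((((Φ (fun i => U i ω) * wick4 (pu (fun i => U i ω)) s
        + (Φ (fun i => U i ω) * (4 * (pu (fun i => U i ω) ^ 3 - 3 * s * pu (fun i => U i ω))))
            * q ω)
        + (Φ (fun i => U i ω) * (6 * (pu (fun i => U i ω) ^ 2 - s))) * (q ω ^ 2 - t))
        + (Φ (fun i => U i ω) * (4 * pu (fun i => U i ω))) * (q ω ^ 3 - 3 * t * q ω))
        + Φ (fun i => U i ω) * wick4 (q ω) t) ∂P := by
    refine integral_congr_ae ?_
    filter_upwards [hζe] with ω hω
    rw [hζn, hω, wick4_add]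
    simp only [hpu]
    ring
  rw [e1, integral_add (((A0.fun_add A1.1).fun_add A2.1).fun_add A3.1) A4.1,
    integral_add ((A0.fun_add A1.1).fun_add A2.1) A3.1, integral_add (A0.fun_add A1.1) A2.1,
    integral_add A0 A1.1, A1.2 (integral_eq_zero_of_mem ha hq), A2.2 z2, A3.2 z3, A4.2 z4]
  simp only [add_zero]
  have := hlaw.integral_comp (f := fun u => Φ u * wick4 (pu u) s)
    (by
      have : Measurable fun u => Φ u * wick4 (pu u) s := by unfold wick4; fun_prop
      exact this.aestronglyMeasurable)
  simpa [Function.comp_def] using this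

end GaussianSpace

/-! ### Polarization of the fourth chaos -/

/-- The product of Hermite polynomials `∏ i, H_{p i}(x i)`, where `p i` is the number of occurrences
of `i` in the list `l`. -/
noncomputable def hermiteProd {k : ℕ} (x : Fin k → ℝ) (l : List (Fin k)) : ℝ :=
  ∏ i, Polynomial.aeval (x i) (Polynomial.hermite (l.count i))

theorem hermiteProd_nil {k : ℕ} (x : Fin k → ℝ) : hermiteProd x [] = 1 := by
  simp [hermiteProd]

/-- Three-term recurrence, with H_m' = m H_{m-1} already substituted; degrees up to four suffice. At
m = 0 the truncated index m - 1 is harmless, being multiplied by m. -/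
theorem aeval_hermite_succ_of_le (x : ℝ) {m : ℕ} (hm : m ≤ 3) :
    Polynomial.aeval x (Polynomial.hermite (m + 1))
      = x * Polynomial.aeval x (Polynomial.hermite m)
        - m * Polynomial.aeval x (Polynomial.hermite (m - 1)) := by
  interval_cases m
  · simp
  · simp only [Nat.reduceAdd, aeval_hermite_one, aeval_hermite_two]; simp; ring
  · simp only [Nat.reduceAdd, Nat.add_one_sub_one, aeval_hermite_one, aeval_hermite_two,
      aeval_hermite_three]; norm_num [aeval_hermite_one]; ring
  · simp only [Nat.reduceAdd, aeval_hermite_three, aeval_hermite_four]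
    norm_num [aeval_hermite_two]; ring

/-- Adding the index a raises only the degree in x a, and erasing one occurrence of a lowers only
that degree, so the three-term recurrence in the variable x a is all that is involved. Iterated, it
produces the contraction formula for Wick products. -/
theorem hermiteProd_cons {k : ℕ} (x : Fin k → ℝ) (a : Fin k) (l : List (Fin k))
    (hl : l.length ≤ 3) :
    hermiteProd x (a :: l) = x a * hermiteProd x l - l.count a * hermiteProd x (l.erase a) := by
  have hc : l.count a ≤ 3 := List.count_le_length.trans hl
  simp only [hermiteProd]
  rw [← Finset.mul_prod_erase _ _ (Finset.mem_univ a), ← Finset.mul_prod_erase _ _ (Finset.mem_univ a),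
    ← Finset.mul_prod_erase Finset.univ (fun i => Polynomial.aeval (x i)
      (Polynomial.hermite ((l.erase a).count i))) (Finset.mem_univ a),
    List.count_cons_self, List.count_erase_self, aeval_hermite_succ_of_le _ hc]
  have h1 : ∀ i ∈ Finset.univ.erase a, Polynomial.aeval (x i)
      (Polynomial.hermite ((a :: l).count i)) = Polynomial.aeval (x i)
      (Polynomial.hermite (l.count i)) := by
    intro i hi
    rw [List.count_cons_of_ne (Finset.ne_of_mem_erase hi).symm]
  have h2 : ∀ i ∈ Finset.univ.erase a, Polynomial.aeval (x i)
      (Polynomial.hermite ((l.erase a).count i)) = Polynomial.aeval (x i)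
      (Polynomial.hermite (l.count i)) := by
    intro i hi
    rw [List.count_erase_of_ne (Finset.ne_of_mem_erase hi)]
  rw [Finset.prod_congr rfl h1, Finset.prod_congr rfl h2]
  ring

/-- Kronecker's symbol. -/
def kron {k : ℕ} (a b : Fin k) : ℝ := if a = b then 1 else 0

theorem hermiteProd_two {k : ℕ} (x : Fin k → ℝ) (a b : Fin k) :
    hermiteProd x [a, b] = x a * x b - kron a b := by
  rw [hermiteProd_cons _ _ _ (by simp), hermiteProd_cons _ _ _ (by simp), hermiteProd_nil]
  by_cases h : a = b
  · subst h; simp [kron, hermiteProd_nil]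
  · simp [kron, h, List.count_singleton, Ne.symm h]

theorem hermiteProd_one {k : ℕ} (x : Fin k → ℝ) (a : Fin k) : hermiteProd x [a] = x a := by
  rw [hermiteProd_cons _ _ _ (by simp), hermiteProd_nil]; simp

theorem hermiteProd_three {k : ℕ} (x : Fin k → ℝ) (a b c : Fin k) :
    hermiteProd x [a, b, c] = x a * (x b * x c - kron b c) - kron a b * x c - kron a c * x b := by
  rw [hermiteProd_cons _ _ _ (by simp), hermiteProd_two]
  by_cases h1 : a = b
  · subst h1
    by_cases h2 : a = c
    · subst h2; simp [kron, hermiteProd_one]; ring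
    · simp [kron, h2, Ne.symm h2, hermiteProd_one, List.count_cons]
  · by_cases h2 : a = c
    · subst h2; simp [kron, h1, Ne.symm h1, hermiteProd_one, List.count_cons, List.erase_cons]
    · simp [kron, h1, h2, Ne.symm h1, Ne.symm h2, List.count_cons]

/-- Wick's formula: a product of four standard variables corrected by all pairwise contractions.
Repeated indices are covered uniformly because the contractions are Kronecker symbols. -/
theorem hermiteProd_four {k : ℕ} (x : Fin k → ℝ) (a b c d : Fin k) :
    hermiteProd x [a, b, c, d] =
      x a * (x b * (x c * x d - kron c d) - kron b c * x d - kron b d * x c)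
      - kron a b * (x c * x d - kron c d) - kron a c * (x b * x d - kron b d)
      - kron a d * (x b * x c - kron b c) := by
  rw [hermiteProd_cons _ _ _ (by simp), hermiteProd_three]
  by_cases h1 : a = b
  · subst h1
    by_cases h2 : a = c
    · subst h2
      by_cases h3 : a = d
      · subst h3; simp [kron, hermiteProd_two]; ring
      · simp [kron, h3, Ne.symm h3, hermiteProd_two]; ring
    · by_cases h3 : a = d
      · subst h3
        simp [kron, h2, Ne.symm h2, hermiteProd_two, List.count_cons]; ring
      · simp [kron, h2, h3, Ne.symm h2, Ne.symm h3, hermiteProd_two]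
  · by_cases h2 : a = c
    · subst h2
      by_cases h3 : a = d
      · subst h3
        simp [kron, h1, Ne.symm h1, hermiteProd_two, List.erase_cons]; ring
      · simp [kron, h1, h3, Ne.symm h1, Ne.symm h3, hermiteProd_two, List.erase_cons]
    · by_cases h3 : a = d
      · subst h3
        simp [kron, h1, h2, Ne.symm h1, Ne.symm h2, hermiteProd_two, List.erase_cons]
      · simp [kron, h1, h2, h3, Ne.symm h1, Ne.symm h2, Ne.symm h3]

/-- Polarization of a quartic form: the signed sum over the eight sign choices isolates the
coefficient of the four-linear monomial, giving 8 · 4! = 192. The parameter s is the variance of the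
signed sum when the variables have Kronecker covariances, and with this choice the lower-order terms
match the contractions. -/
theorem hermiteProd_four_polarization {k : ℕ} (x : Fin k → ℝ) (a b c d : Fin k)
    {s : ℝ → ℝ → ℝ → ℝ}
    (hs : ∀ e f g, s e f g = 1 + e ^ 2 + f ^ 2 + g ^ 2 + 2 * (e * kron a b + f * kron a c
      + g * kron a d + e * f * kron b c + e * g * kron b d + f * g * kron c d)) :
    192 * hermiteProd x [a, b, c, d] =
      wick4 (x a + 1 * x b + 1 * x c + 1 * x d) (s 1 1 1)
      - wick4 (x a + 1 * x b + 1 * x c + (-1) * x d) (s 1 1 (-1))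
      - wick4 (x a + 1 * x b + (-1) * x c + 1 * x d) (s 1 (-1) 1)
      + wick4 (x a + 1 * x b + (-1) * x c + (-1) * x d) (s 1 (-1) (-1))
      - wick4 (x a + (-1) * x b + 1 * x c + 1 * x d) (s (-1) 1 1)
      + wick4 (x a + (-1) * x b + 1 * x c + (-1) * x d) (s (-1) 1 (-1))
      + wick4 (x a + (-1) * x b + (-1) * x c + 1 * x d) (s (-1) (-1) 1)
      - wick4 (x a + (-1) * x b + (-1) * x c + (-1) * x d) (s (-1) (-1) (-1)) := by
  simp only [hs, hermiteProd_four, wick4]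
  ring

/-- Multiplicities of total four are a multiset of four indices, and any enumeration of it gives the
list on which polarization acts. -/
theorem exists_list_of_sum_eq_four {k : ℕ} (p : Fin k → ℕ) (hp : ∑ i, p i = 4) :
    ∃ a b c d : Fin k, ∀ i, [a, b, c, d].count i = p i := by
  let m : Multiset (Fin k) := ∑ i, p i • {i}
  have hm : Multiset.card m = 4 := by simp [m, hp]
  have hc : ∀ i, m.count i = p i := fun i => by
    simp [m, Multiset.count_sum', Multiset.count_singleton]
  obtain ⟨l, hl⟩ := Quot.exists_rep m
  have hl' : (l : Multiset (Fin k)) = m := hl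
  rw [← hl', Multiset.coe_card] at hm
  rw [← hl'] at hc
  simp only [Multiset.coe_count] at hc
  match l, hm with
  | [a, b, c, d], _ => exact ⟨a, b, c, d, hc⟩

section GaussianSpace

variable {Ω : Type*} [MeasurableSpace Ω] {P : Measure Ω} [IsProbabilityMeasure P]
  {a : ℤ × ℤ → Ω → ℂ}

theorem inner_eq_kron_of_hasLaw_pi {k : ℕ} {ξ : Fin k → Lp ℝ 2 P}
    (h : HasLaw (fun ω i => ξ i ω) (Measure.pi fun _ : Fin k => gaussianReal 0 1) P)
    (i j : Fin k) : inner ℝ (ξ i) (ξ j) = kron i j := by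
  have hi : ∀ i, HasLaw (ξ i) (gaussianReal 0 1) P := fun i =>
    (measurePreserving_eval (fun _ : Fin k => gaussianReal 0 1) i).fun_comp_hasLaw h
  have hind := (iIndepFun_iff_hasLaw_pi_pi hi).2 h
  rw [L2_inner_eq]
  by_cases hij : i = j
  · subst hij
    have := (hi i).integral_comp (f := fun x : ℝ => x ^ 2) (by fun_prop)
    rw [gaussian_moment_two] at this
    simp only [kron, if_true, ← this]
    congr 1; ext ω; simp; ring
  · rw [(hind.indepFun hij).integral_fun_mul_eq_mul_integral (Lp.aestronglyMeasurable _)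
      (Lp.aestronglyMeasurable _), (hi i).integral_eq]
    simp [kron, hij]

/-- A square integrable variable is orthogonal to the fourth chaos as soon as it is orthogonal to
all fourth Wick powers. -/
theorem inner_eq_zero_of_forall_wick4 (ha : IsWaveCoefficients a P) {D : Lp ℝ 2 P}
    (hD : ∀ ζ ∈ gaussianSpace a P, ∫ ω, D ω * wick4 (ζ ω) (‖ζ‖ ^ 2) ∂P = 0)
    {F : Lp ℝ 2 P} (hF : F ∈ wienerChaos a P 4) : inner ℝ D F = 0 := by
  have hclosed : IsClosed {F : Lp ℝ 2 P | inner ℝ D F = 0} :=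
    isClosed_eq (by fun_prop) (by fun_prop)
  have hF' : F ∈ (wienerChaos a P 4 : Set (Lp ℝ 2 P)) := hF
  rw [wienerChaos, Submodule.topologicalClosure_coe] at hF'
  refine closure_minimal ?_ hclosed hF'
  intro F hF
  induction hF using Submodule.span_induction with
  | zero => simp
  | add F G _ _ h1 h2 =>
    have h1' : inner ℝ D F = 0 := h1
    have h2' : inner ℝ D G = 0 := h2
    change inner ℝ D (F + G) = 0
    rw [inner_add_right, h1', h2', add_zero]
  | smul c F _ h1 =>
    have h1' : inner ℝ D F = 0 := h1
    change inner ℝ D (c • F) = 0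
    rw [inner_smul_right, h1', mul_zero]
  | mem F h =>
    obtain ⟨k, p, ξ, _, hp, hξ, hlaw, hF⟩ := h
    obtain ⟨i, j, l, m, hc⟩ := exists_list_of_sum_eq_four p hp
    let s : ℝ → ℝ → ℝ → ℝ := fun e f g => 1 + e ^ 2 + f ^ 2 + g ^ 2 + 2 * (e * kron i j
      + f * kron i l + g * kron i m + e * f * kron j l + e * g * kron j m + f * g * kron l m)
    have hterm : ∀ e f g : ℝ,
        Integrable (fun ω => D ω * wick4 (ξ i ω + e * ξ j ω + f * ξ l ω + g * ξ m ω) (s e f g)) P ∧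
        ∫ ω, D ω * wick4 (ξ i ω + e * ξ j ω + f * ξ l ω + g * ξ m ω) (s e f g) ∂P = 0 := by
      intro e f g
      let ζ : Lp ℝ 2 P := ξ i + e • ξ j + f • ξ l + g • ξ m
      have hζ : ζ ∈ gaussianSpace a P := Submodule.add_mem _ (Submodule.add_mem _
        (Submodule.add_mem _ (hξ i) (Submodule.smul_mem _ _ (hξ j)))
        (Submodule.smul_mem _ _ (hξ l))) (Submodule.smul_mem _ _ (hξ m))
      -- The polarization parameter is the true variance of the signed combination, so each of the
      -- eight terms is a genuine Wick power and the hypothesis on `D` applies to it.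
      have hζn : ‖ζ‖ ^ 2 = s e f g := by
        rw [← real_inner_self_eq_norm_sq]
        simp only [ζ, inner_add_left, inner_add_right, inner_smul_left, inner_smul_right,
          inner_eq_kron_of_hasLaw_pi hlaw, s, RCLike.conj_to_real]
        have hsymm : ∀ x y : Fin k, kron x y = kron y x := fun x y => by simp [kron, eq_comm]
        have h1 : ∀ x : Fin k, kron x x = 1 := fun x => by simp [kron]
        rw [hsymm j i, hsymm l i, hsymm l j, hsymm m i, hsymm m j, hsymm m l]
        simp only [h1]
        ring
      have hζe : (ζ : Ω → ℝ) =ᵐ[P] fun ω => ξ i ω + e * ξ j ω + f * ξ l ω + g * ξ m ω := by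
        filter_upwards [Lp.coeFn_add (ξ i + e • ξ j + f • ξ l) (g • ξ m),
          Lp.coeFn_add (ξ i + e • ξ j) (f • ξ l), Lp.coeFn_add (ξ i) (e • ξ j),
          Lp.coeFn_smul e (ξ j), Lp.coeFn_smul f (ξ l), Lp.coeFn_smul g (ξ m)]
          with ω h1 h2 h3 h4 h5 h6
        simp only [ζ, h1, h2, h3, h4, h5, h6, Pi.add_apply, Pi.smul_apply, smul_eq_mul]
      have heq : (fun ω => D ω * wick4 (ζ ω) (‖ζ‖ ^ 2)) =ᵐ[P]
          fun ω => D ω * wick4 (ξ i ω + e * ξ j ω + f * ξ l ω + g * ξ m ω) (s e f g) := by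
        filter_upwards [hζe] with ω hω
        rw [hω, hζn]
      refine ⟨Integrable.congr ?_ heq, by rw [← integral_congr_ae heq, hD ζ hζ]⟩
      exact (Lp.memLp D).integrable_mul (memLp_wick4_of_mem ha hζ _)
    change inner ℝ D F = 0
    rw [L2_inner_eq]
    have hFe : (fun ω => D ω * F ω) =ᵐ[P] fun ω => (1 / 192) * (
        D ω * wick4 (ξ i ω + 1 * ξ j ω + 1 * ξ l ω + 1 * ξ m ω) (s 1 1 1)
        - D ω * wick4 (ξ i ω + 1 * ξ j ω + 1 * ξ l ω + (-1) * ξ m ω) (s 1 1 (-1))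
        - D ω * wick4 (ξ i ω + 1 * ξ j ω + (-1) * ξ l ω + 1 * ξ m ω) (s 1 (-1) 1)
        + D ω * wick4 (ξ i ω + 1 * ξ j ω + (-1) * ξ l ω + (-1) * ξ m ω) (s 1 (-1) (-1))
        - D ω * wick4 (ξ i ω + (-1) * ξ j ω + 1 * ξ l ω + 1 * ξ m ω) (s (-1) 1 1)
        + D ω * wick4 (ξ i ω + (-1) * ξ j ω + 1 * ξ l ω + (-1) * ξ m ω) (s (-1) 1 (-1))
        + D ω * wick4 (ξ i ω + (-1) * ξ j ω + (-1) * ξ l ω + 1 * ξ m ω) (s (-1) (-1) 1)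
        - D ω * wick4 (ξ i ω + (-1) * ξ j ω + (-1) * ξ l ω + (-1) * ξ m ω)
          (s (-1) (-1) (-1))) := by
      filter_upwards [hF] with ω hω
      have h1 : F ω = hermiteProd (fun i => ξ i ω) [i, j, l, m] := by
        rw [hω, hermiteProd]; simp only [hc]
      have h2 := hermiteProd_four_polarization (fun i => ξ i ω) i j l m (s := s)
        (fun e f g => rfl)
      rw [h1]
      linear_combination (1 / 192) * D ω * h2
    rw [integral_congr_ae hFe, integral_const_mul]
    have i1 := (hterm 1 1 1).1
    have i2 := integrable_fun_sub i1 (hterm 1 1 (-1)).1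
    have i3 := integrable_fun_sub i2 (hterm 1 (-1) 1).1
    have i4 := i3.fun_add (hterm 1 (-1) (-1)).1
    have i5 := integrable_fun_sub i4 (hterm (-1) 1 1).1
    have i6 := i5.fun_add (hterm (-1) 1 (-1)).1
    have i7 := i6.fun_add (hterm (-1) (-1) 1).1
    rw [integral_sub i7 (hterm _ _ _).1, integral_add i6 (hterm _ _ _).1,
      integral_add i5 (hterm _ _ _).1, integral_sub i4 (hterm _ _ _).1,
      integral_add i3 (hterm _ _ _).1, integral_sub i2 (hterm _ _ _).1,
      integral_sub i1 (hterm _ _ _).1]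
    simp only [(hterm _ _ _).2]
    simp

end GaussianSpace

/-! ### Length of a regular zero set as a limit of band integrals -/

/-- The normalised integral of `g` over the band `{|u| ≤ ε}`. -/
noncomputable def bandMeasure (u g : ℝ × ℝ → ℝ) (ε : ℝ) : Measure (ℝ × ℝ) :=
  volume.withDensity fun p =>
    ENNReal.ofReal ((2 * ε)⁻¹) * ((Set.Icc (-ε) ε).indicator 1 (u p) * ENNReal.ofReal (g p))

/-- The length measure of the zero set of `u`, transported to `ℝ × ℝ`. -/
noncomputable def zeroLength (u : ℝ × ℝ → ℝ) : Measure (ℝ × ℝ) :=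
  (μH[1].restrict {x : EuclideanSpace ℝ (Fin 2) | u (x 0, x 1) = 0}).map fun x => (x 0, x 1)

theorem zeroLength_apply {u : ℝ × ℝ → ℝ} {V : Set (ℝ × ℝ)} (hV : MeasurableSet V) :
    zeroLength u V = μH[1] {x : EuclideanSpace ℝ (Fin 2) | (x 0, x 1) ∈ V ∧ u (x 0, x 1) = 0} := by
  have hm : Measurable fun x : EuclideanSpace ℝ (Fin 2) => (x 0, x 1) := by fun_prop
  rw [zeroLength, Measure.map_apply hm hV, Measure.restrict_apply (hm hV)]
  rfl

/-- On the cell `V`, the band integrals of `g` converge up to the factor `1 + δ` to the length of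
the zero set. -/
def CellEstimate (u g : ℝ × ℝ → ℝ) (δ : ℝ) (V : Set (ℝ × ℝ)) : Prop :=
  ∃ (f : ℝ → ℝ≥0∞) (L : ℝ≥0∞), L ≠ ∞ ∧ Tendsto f (𝓝[>] 0) (𝓝 L) ∧ L ≤ zeroLength u V ∧
    zeroLength u V ≤ ENNReal.ofReal (1 + δ) * L ∧
    ∀ ε, 0 < ε → f ε ≤ bandMeasure u g ε V ∧ bandMeasure u g ε V ≤ ENNReal.ofReal (1 + δ) * f ε

theorem measurable_band {u : ℝ × ℝ → ℝ} (hu : Continuous u) (ε : ℝ) :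
    Measurable fun p => ((Set.Icc (-ε) ε).indicator 1 (u p) : ℝ≥0∞) :=
  (measurable_one.indicator measurableSet_Icc).comp hu.measurable

section Cell

variable {u ux uy : ℝ × ℝ → ℝ}

/-- Where u_y > 0 the zero set is a graph over the set D of columns on which u passes from
nonpositive to nonnegative. The mean value theorem gives u_x s + u_y t = 0 at some point of the cell
for a chord (s, t) between two zeros, so the squared chord length is (|∇u|²/u_y²) s². Thus
projection to the first axis and the graph map are Lipschitz with constants 1/m and M, and
one-dimensional Hausdorff measure on the line is Lebesgue measure. -/
theorem hausdorff_cell_bounds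
    (hu : ∀ p, HasFDerivAt u (ux p • ContinuousLinearMap.fst ℝ ℝ ℝ
      + uy p • ContinuousLinearMap.snd ℝ ℝ ℝ) p)
    {a b c d m M : ℝ} (hcd : c ≤ d) (hm : 0 < m)
    (hpos : ∀ p ∈ Set.Icc a b ×ˢ Set.Icc c d, 0 < uy p ∧ m * uy p ≤ √(ux p ^ 2 + uy p ^ 2) ∧
      √(ux p ^ 2 + uy p ^ 2) ≤ M * uy p)
    {D : Set ℝ} (hD : D = {x | x ∈ Set.Icc a b ∧ u (x, c) ≤ 0 ∧ 0 ≤ u (x, d)}) :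
    ENNReal.ofReal m * volume D ≤ zeroLength u (Set.Icc a b ×ˢ Set.Icc c d) ∧
    zeroLength u (Set.Icc a b ×ˢ Set.Icc c d) ≤ ENNReal.ofReal M * volume D := by
  have hcont : Continuous u := continuous_iff_continuousAt.2 fun p => (hu p).continuousAt
  set V : Set (ℝ × ℝ) := Set.Icc a b ×ˢ Set.Icc c d with hV
  have hconv : Convex ℝ V := (convex_Icc a b).prod (convex_Icc c d)
  have mvt : ∀ p ∈ V, ∀ q ∈ V, ∃ z ∈ V,
      u q - u p = ux z * (q.1 - p.1) + uy z * (q.2 - p.2) := by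
    intro p hp q hq
    obtain ⟨z, hz, h⟩ := domain_mvt (fun x _ => (hu x).hasFDerivWithinAt) hconv hp hq
    exact ⟨z, hconv.segment_subset hp hq hz, by simpa using h⟩
  have key : ∀ p ∈ V, ∀ q ∈ V, u p = 0 → u q = 0 →
      m ^ 2 * (q.1 - p.1) ^ 2 ≤ (q.1 - p.1) ^ 2 + (q.2 - p.2) ^ 2 ∧
      (q.1 - p.1) ^ 2 + (q.2 - p.2) ^ 2 ≤ M ^ 2 * (q.1 - p.1) ^ 2 := by
    intro p hp q hq h1 h2
    obtain ⟨z, hz, h⟩ := mvt p hp q hq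
    rw [h1, h2, sub_zero] at h
    obtain ⟨h3, h4, h5⟩ := hpos z hz
    set g := √(ux z ^ 2 + uy z ^ 2) with hg
    have hg2 : g ^ 2 = ux z ^ 2 + uy z ^ 2 := Real.sq_sqrt (by positivity)
    set s := q.1 - p.1
    set t := q.2 - p.2
    have e1 : uy z ^ 2 * (s ^ 2 + t ^ 2) = g ^ 2 * s ^ 2 := by
      have : uy z * t = -(ux z * s) := by linarith
      calc uy z ^ 2 * (s ^ 2 + t ^ 2) = uy z ^ 2 * s ^ 2 + (uy z * t) ^ 2 := by ring
        _ = g ^ 2 * s ^ 2 := by rw [this, hg2]; ring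
    have hg0 : 0 ≤ g := Real.sqrt_nonneg _
    have h6 : (m * uy z) ^ 2 ≤ g ^ 2 := by gcongr
    have h7 : g ^ 2 ≤ (M * uy z) ^ 2 := by gcongr
    have hy : 0 < uy z ^ 2 := by positivity
    constructor
    · refine le_of_mul_le_mul_left ?_ hy
      rw [e1]
      nlinarith [mul_le_mul_of_nonneg_right h6 (sq_nonneg s)]
    · refine le_of_mul_le_mul_left ?_ hy
      rw [e1]
      nlinarith [mul_le_mul_of_nonneg_right h7 (sq_nonneg s)]
  have hM : ∀ p ∈ V, 0 ≤ M := by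
    intro p hp
    obtain ⟨h3, h4, h5⟩ := hpos p hp
    have : 0 ≤ M * uy p := (Real.sqrt_nonneg _).trans h5
    exact nonneg_of_mul_nonneg_left this h3
  set Z : Set (EuclideanSpace ℝ (Fin 2)) := {x | (x 0, x 1) ∈ V ∧ u (x 0, x 1) = 0} with hZ
  have hex : ∀ x ∈ D, ∃ y, (x, y) ∈ V ∧ u (x, y) = 0 := by
    intro x hx
    rw [hD] at hx
    obtain ⟨hx1, hx2, hx3⟩ := hx
    have hc : ContinuousOn (fun y => u (x, y)) (Set.Icc c d) := by fun_prop
    obtain ⟨y, hy, hy0⟩ := intermediate_value_Icc hcd hc ⟨hx2, hx3⟩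
    exact ⟨y, ⟨hx1, hy⟩, hy0⟩
  have hZD : ∀ z ∈ Z, z 0 ∈ D := by
    rintro z ⟨⟨hz1, hz2⟩, hz0⟩
    have hz1 : z 0 ∈ Set.Icc a b := hz1
    have hz2 : z 1 ∈ Set.Icc c d := hz2
    have hp : (z 0, z 1) ∈ V := ⟨hz1, hz2⟩
    have hpc : (z 0, c) ∈ V := ⟨hz1, Set.left_mem_Icc.2 hcd⟩
    have hpd : (z 0, d) ∈ V := ⟨hz1, Set.right_mem_Icc.2 hcd⟩
    rw [hD]
    refine ⟨hz1, ?_, ?_⟩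
    · obtain ⟨w, hw, h⟩ := mvt _ hpc _ hp
      simp only [sub_self, mul_zero, zero_add, hz0] at h
      nlinarith [(hpos w hw).1, hz2.1]
    · obtain ⟨w, hw, h⟩ := mvt _ hp _ hpd
      simp only [sub_self, mul_zero, zero_add, hz0] at h
      nlinarith [(hpos w hw).1, hz2.2]
  have hdist : ∀ z w : EuclideanSpace ℝ (Fin 2),
      dist z w ^ 2 = (w 0 - z 0) ^ 2 + (w 1 - z 1) ^ 2 := by
    intro z w
    rw [EuclideanSpace.dist_sq_eq]
    simp [Real.dist_eq]
    ring
  rw [zeroLength_apply (measurableSet_Icc.prod measurableSet_Icc)]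
  change _ ≤ μH[1] Z ∧ μH[1] Z ≤ _
  constructor
  · -- projection to the first coordinate
    have hlip : LipschitzOnWith (Real.toNNReal m⁻¹) (fun z : EuclideanSpace ℝ (Fin 2) => z 0) Z := by
      refine LipschitzOnWith.of_dist_le_mul fun z hz w hw => ?_
      have h := (key _ hz.1 _ hw.1 hz.2 hw.2).1
      rw [← hdist] at h
      rw [Real.coe_toNNReal _ (by positivity), Real.dist_eq, ← div_eq_inv_mul, le_div_iff₀ hm]
      refine abs_le_of_sq_le_sq' ?_ dist_nonneg |>.2
      calc (|z 0 - w 0| * m) ^ 2 = m ^ 2 * (w 0 - z 0) ^ 2 := by rw [mul_pow, sq_abs]; ring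
        _ ≤ _ := h
    have h1 := hlip.hausdorffMeasure_image_le (d := 1) zero_le_one
    have h2 : D ⊆ (fun z : EuclideanSpace ℝ (Fin 2) => z 0) '' Z := by
      intro x hx
      obtain ⟨y, hy, hy0⟩ := hex x hx
      exact ⟨!₂[x, y], by simpa [hZ] using ⟨hy, hy0⟩, by simp⟩
    rw [hausdorffMeasure_real, ENNReal.rpow_one] at h1
    have h3 : volume D ≤ ENNReal.ofReal m⁻¹ * μH[1] Z := (measure_mono h2).trans h1
    calc ENNReal.ofReal m * volume D ≤ ENNReal.ofReal m * (ENNReal.ofReal m⁻¹ * μH[1] Z) := by gcongr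
      _ = μH[1] Z := by
        rw [← mul_assoc, ← ENNReal.ofReal_mul hm.le, mul_inv_cancel₀ hm.ne']; simp
  · choose! γ hγ1 hγ2 using hex
    -- The sign of M is known only through a point of the cell, so the case in which no column is
    -- crossed is treated apart.
    by_cases hDe : D = ∅
    · have : Z = ∅ := Set.eq_empty_of_forall_notMem fun z hz => by
        have := hZD z hz; simp [hDe] at this
      simp [this]
    obtain ⟨x0, hx0⟩ := Set.nonempty_iff_ne_empty.2 hDe
    have hM0 : 0 ≤ M := hM _ (hγ1 x0 hx0)
    have hlip : LipschitzOnWith (Real.toNNReal M)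
        (fun x : ℝ => (!₂[x, γ x] : EuclideanSpace ℝ (Fin 2))) D := by
      refine LipschitzOnWith.of_dist_le_mul fun x hx y hy => ?_
      have h := (key _ (hγ1 x hx) _ (hγ1 y hy) (hγ2 x hx) (hγ2 y hy)).2
      rw [Real.coe_toNNReal _ hM0]
      refine abs_le_of_sq_le_sq' ?_ (by positivity) |>.2
      rw [hdist]
      simp only [Matrix.cons_val_zero, Matrix.cons_val_one, PiLp.toLp_apply]
      rw [mul_pow, Real.dist_eq, sq_abs]
      nlinarith [h]
    have h1 := hlip.hausdorffMeasure_image_le (d := 1) zero_le_one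
    rw [hausdorffMeasure_real, ENNReal.rpow_one] at h1
    refine (measure_mono ?_).trans h1
    intro z hz
    refine ⟨z 0, hZD z hz, ?_⟩
    have hzD := hZD z hz
    have h := (key _ (hγ1 _ hzD) _ hz.1 (hγ2 _ hzD) hz.2).2
    simp only [sub_self] at h
    have h2 : z 1 - γ (z 0) = 0 := by
      have : (z 1 - γ (z 0)) ^ 2 ≤ 0 := by nlinarith [h]
      nlinarith [sq_nonneg (z 1 - γ (z 0)), pow_eq_zero_iff (two_ne_zero) |>.1 (le_antisymm this (sq_nonneg _))]
    ext i
    fin_cases i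
    · simp
    · simp; linarith

end Cell

/-! ### Band integrals on a cell where the vertical derivative is positive. -/

section Cell

variable {u ux uy : ℝ × ℝ → ℝ}

theorem bandMeasure_apply {u g : ℝ × ℝ → ℝ} {ε : ℝ} {V : Set (ℝ × ℝ)} (hV : MeasurableSet V) :
    bandMeasure u g ε V = ∫⁻ p in V, ENNReal.ofReal ((2 * ε)⁻¹) *
      ((Set.Icc (-ε) ε).indicator 1 (u p) * ENNReal.ofReal (g p)) := by
  rw [bandMeasure, withDensity_apply _ hV]

theorem setLIntegral_prod_eq {f : ℝ × ℝ → ℝ≥0∞} (hf : Measurable f) (s t : Set ℝ) :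
    ∫⁻ p in s ×ˢ t, f p = ∫⁻ x in s, ∫⁻ y in t, f (x, y) := by
  rw [Measure.volume_eq_prod, ← Measure.prod_restrict, lintegral_prod _ hf.aemeasurable]

/-- The band integral of the vertical derivative, on a vertical slice along which the function is
increasing. -/
theorem lintegral_slice {w w' : ℝ → ℝ} (hw : ∀ y, HasDerivAt w (w' y) y) {c d ε : ℝ} (hcd : c ≤ d)
    (hpos : ∀ y ∈ Set.Icc c d, 0 ≤ w' y) :
    ∫⁻ y in Set.Icc c d, ENNReal.ofReal (w' y) * (Set.Icc (-ε) ε).indicator 1 (w y)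
      = ENNReal.ofReal (min (w d) ε - max (w c) (-ε)) := by
  have hcont : Continuous w := continuous_iff_continuousAt.2 fun y => (hw y).continuousAt
  have hmono : MonotoneOn w (Set.Icc c d) := by
    refine monotoneOn_of_deriv_nonneg (convex_Icc c d) hcont.continuousOn
      (fun y _ => (hw y).differentiableAt.differentiableWithinAt) fun y hy => ?_
    rw [(hw y).deriv]
    exact hpos y (interior_subset hy)
  rw [← lintegral_image_eq_lintegral_deriv_mul_of_monotoneOn measurableSet_Icc
    (fun y _ => (hw y).hasDerivWithinAt) hmono]
  have himg : w '' Set.Icc c d = Set.Icc (w c) (w d) := by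
    refine Set.Subset.antisymm ?_ (intermediate_value_Icc hcd hcont.continuousOn)
    rintro _ ⟨y, hy, rfl⟩
    exact ⟨hmono (Set.left_mem_Icc.2 hcd) hy hy.1, hmono hy (Set.right_mem_Icc.2 hcd) hy.2⟩
  rw [himg, lintegral_indicator measurableSet_Icc, Measure.restrict_restrict measurableSet_Icc]
  simp only [Pi.one_apply, lintegral_one, Measure.restrict_apply_univ]
  rw [Set.inter_comm, Set.Icc_inter_Icc, Real.volume_Icc]

theorem hasDerivAt_snd_slice
    (hu : ∀ p, HasFDerivAt u (ux p • ContinuousLinearMap.fst ℝ ℝ ℝ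
      + uy p • ContinuousLinearMap.snd ℝ ℝ ℝ) p) (x y : ℝ) :
    HasDerivAt (fun y => u (x, y)) (uy (x, y)) y := by
  have h1 : HasDerivAt (fun y : ℝ => (x, y)) ((0 : ℝ), (1 : ℝ)) y :=
    (hasDerivAt_const y x).prodMk (hasDerivAt_id y)
  have := (hu (x, y)).comp_hasDerivAt y h1
  simpa using! this

/-- On the cell |∇u| lies between m u_y and (1+δ) m u_y. The band integral of u_y itself is
explicit: on each column it is the length of the part of [-ε, ε] swept by u. Divided by 2ε this is
at most 1, and it is eventually 1 on columns that are crossed and 0 on the others, provided u does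
not vanish at the two ends of the column; hence the null hypotheses on the horizontal edges.
Dominated convergence gives the limit m |D|, which the preceding geometric bounds compare with the
length. -/
theorem cellEstimate_vertical
    (hu : ∀ p, HasFDerivAt u (ux p • ContinuousLinearMap.fst ℝ ℝ ℝ
      + uy p • ContinuousLinearMap.snd ℝ ℝ ℝ) p) (hux : Continuous ux) (huy : Continuous uy)
    {a b c d m δ : ℝ} (hcd : c ≤ d) (hm : 0 < m) (hδ : 0 ≤ δ)
    (hpos : ∀ p ∈ Set.Icc a b ×ˢ Set.Icc c d, 0 < uy p ∧ m * uy p ≤ √(ux p ^ 2 + uy p ^ 2) ∧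
      √(ux p ^ 2 + uy p ^ 2) ≤ (1 + δ) * m * uy p)
    (hc0 : volume {x | u (x, c) = 0} = 0) (hd0 : volume {x | u (x, d) = 0} = 0) :
    CellEstimate u (fun p => √(ux p ^ 2 + uy p ^ 2)) δ (Set.Icc a b ×ˢ Set.Icc c d) := by
  have hcont : Continuous u := continuous_iff_continuousAt.2 fun p => (hu p).continuousAt
  set D : Set ℝ := {x | x ∈ Set.Icc a b ∧ u (x, c) ≤ 0 ∧ 0 ≤ u (x, d)} with hD
  obtain ⟨h1, h2⟩ := hausdorff_cell_bounds hu hcd hm hpos hD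
  have hVm : MeasurableSet (Set.Icc a b ×ˢ Set.Icc c d) := measurableSet_Icc.prod measurableSet_Icc
  have hDm : MeasurableSet D := by
    have e1 : MeasurableSet {x : ℝ | u (x, c) ≤ 0} :=
      (isClosed_le (by fun_prop) continuous_const).measurableSet
    have e2 : MeasurableSet {x : ℝ | 0 ≤ u (x, d)} :=
      (isClosed_le continuous_const (by fun_prop)).measurableSet
    exact measurableSet_Icc.inter (e1.inter e2)
  -- Fraction of [-ε, ε] swept by u along the column over x; `ENNReal.ofReal` sends the negative
  -- value of an empty intersection to zero.
  set q : ℝ → ℝ → ℝ≥0∞ := fun ε x => ENNReal.ofReal ((2 * ε)⁻¹) *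
    ENNReal.ofReal (min (u (x, d)) ε - max (u (x, c)) (-ε)) with hq
  refine ⟨fun ε => ENNReal.ofReal m * ∫⁻ x in Set.Icc a b, q ε x, ENNReal.ofReal m * volume D,
    ?_, ?_, h1, ?_, ?_⟩
  · refine ENNReal.mul_ne_top ENNReal.ofReal_ne_top (ne_of_lt ?_)
    exact (measure_mono (fun x hx => hx.1)).trans_lt (measure_Icc_lt_top (a := a) (b := b))
  · refine ENNReal.Tendsto.const_mul ?_ (Or.inr ENNReal.ofReal_ne_top)
    have hlim : volume D = ∫⁻ x in Set.Icc a b, D.indicator 1 x := by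
      rw [lintegral_indicator hDm, Measure.restrict_restrict hDm]
      simp only [Pi.one_apply, lintegral_one, Measure.restrict_apply_univ]
      congr 1
      ext x; simp [hD]; tauto
    rw [hlim]
    refine tendsto_lintegral_filter_of_dominated_convergence (fun _ => 1) ?_ ?_ ?_ ?_
    · exact Eventually.of_forall fun ε => by simp only [hq]; fun_prop
    · filter_upwards [self_mem_nhdsWithin] with ε (hε : 0 < ε)
      refine ae_of_all _ fun x => ?_
      simp only [hq]
      rw [← ENNReal.ofReal_mul (by positivity)]
      refine ENNReal.ofReal_le_one.2 ?_
      have e1 : min (u (x, d)) ε - max (u (x, c)) (-ε) ≤ 2 * ε := by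
        have := min_le_right (u (x, d)) ε
        have := le_max_right (u (x, c)) (-ε)
        linarith
      calc (2 * ε)⁻¹ * (min (u (x, d)) ε - max (u (x, c)) (-ε)) ≤ (2 * ε)⁻¹ * (2 * ε) := by gcongr
        _ = 1 := inv_mul_cancel₀ (by positivity)
    · simp
    · have hae : ∀ᵐ x, u (x, c) ≠ 0 ∧ u (x, d) ≠ 0 := by
        have e1 : ∀ᵐ x, ¬ u (x, c) = 0 := by rw [ae_iff]; simpa using hc0
        have e2 : ∀ᵐ x, ¬ u (x, d) = 0 := by rw [ae_iff]; simpa using hd0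
        filter_upwards [e1, e2] with x h3 h4 using ⟨h3, h4⟩
      filter_upwards [ae_restrict_of_ae hae, ae_restrict_mem measurableSet_Icc] with x hx hxI
      by_cases hxD : x ∈ D
      · have e1 : u (x, c) < 0 := lt_of_le_of_ne hxD.2.1 hx.1
        have e2 : 0 < u (x, d) := lt_of_le_of_ne hxD.2.2 (Ne.symm hx.2)
        rw [Set.indicator_of_mem hxD]
        refine tendsto_const_nhds.congr' ?_
        have e3 : ∀ᶠ ε in 𝓝[>] (0 : ℝ), ε < min (u (x, d)) (-u (x, c)) :=
          mem_nhdsWithin_of_mem_nhds (Iio_mem_nhds (lt_min e2 (by linarith)))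
        filter_upwards [self_mem_nhdsWithin, e3] with ε (hε : 0 < ε) h3
        have h4 := lt_min_iff.1 h3
        simp only [hq]
        rw [min_eq_right h4.1.le, max_eq_right (by linarith), ← ENNReal.ofReal_mul (by positivity)]
        have : (2 * ε)⁻¹ * (ε - -ε) = 1 := by field_simp; ring
        rw [this]; simp
      · rw [Set.indicator_of_notMem hxD]
        refine tendsto_const_nhds.congr' ?_
        have e0 : 0 < u (x, c) ∨ u (x, d) < 0 := by
          by_contra! hcon
          exact hxD ⟨hxI, hcon.1, hcon.2⟩
        have e3 : ∀ᶠ ε in 𝓝[>] (0 : ℝ), ε < max (u (x, c)) (-u (x, d)) :=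
          mem_nhdsWithin_of_mem_nhds (Iio_mem_nhds (by
            rcases e0 with h | h
            · exact lt_max_of_lt_left h
            · exact lt_max_of_lt_right (by linarith)))
        filter_upwards [self_mem_nhdsWithin, e3] with ε (hε : 0 < ε) h3
        simp only [hq]
        have : min (u (x, d)) ε - max (u (x, c)) (-ε) ≤ 0 := by
          rcases lt_max_iff.1 h3 with h | h
          · have := min_le_right (u (x, d)) ε
            have := le_max_left (u (x, c)) (-ε)
            linarith
          · have := min_le_left (u (x, d)) ε
            have := le_max_right (u (x, c)) (-ε)
            linarith
        rw [ENNReal.ofReal_of_nonpos this, mul_zero]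
  · refine h2.trans (le_of_eq ?_)
    rw [ENNReal.ofReal_mul (by linarith), mul_assoc]
  · intro ε hε
    have hslice : ∫⁻ x in Set.Icc a b, q ε x = ∫⁻ p in Set.Icc a b ×ˢ Set.Icc c d,
        ENNReal.ofReal ((2 * ε)⁻¹) *
          (ENNReal.ofReal (uy p) * (Set.Icc (-ε) ε).indicator 1 (u p)) := by
      have hmeas : Measurable fun p : ℝ × ℝ =>
          ENNReal.ofReal (uy p) * (Set.Icc (-ε) ε).indicator 1 (u p) :=
        (by fun_prop : Measurable fun p => ENNReal.ofReal (uy p)).mul (measurable_band hcont ε)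
      rw [setLIntegral_prod_eq (hmeas.const_mul _)]
      refine setLIntegral_congr_fun measurableSet_Icc fun x hx => ?_
      simp only [hq]
      have hmx : Measurable fun y =>
          ENNReal.ofReal (uy (x, y)) * (Set.Icc (-ε) ε).indicator 1 (u (x, y)) :=
        hmeas.comp measurable_prodMk_left
      rw [lintegral_const_mul _ hmx, ← lintegral_slice (hasDerivAt_snd_slice hu x) hcd
        fun y hy => (hpos (x, y) ⟨hx, hy⟩).1.le]
    rw [bandMeasure_apply hVm]
    simp only
    rw [hslice]
    have hmeas : Measurable fun p : ℝ × ℝ => ENNReal.ofReal ((2 * ε)⁻¹) *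
          (ENNReal.ofReal (uy p) * (Set.Icc (-ε) ε).indicator 1 (u p)) :=
      ((by fun_prop : Measurable fun p => ENNReal.ofReal (uy p)).mul
        (measurable_band hcont ε)).const_mul _
    constructor
    · rw [← lintegral_const_mul _ hmeas]
      refine setLIntegral_mono_ae' hVm (ae_of_all _ fun p hp => ?_)
      obtain ⟨h3, h4, h5⟩ := hpos p hp
      have : ENNReal.ofReal m * ENNReal.ofReal (uy p) ≤ ENNReal.ofReal √(ux p ^ 2 + uy p ^ 2) := by
        rw [← ENNReal.ofReal_mul hm.le]; exact ENNReal.ofReal_le_ofReal h4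
      calc _ = ENNReal.ofReal ((2 * ε)⁻¹) * ((Set.Icc (-ε) ε).indicator 1 (u p) *
            (ENNReal.ofReal m * ENNReal.ofReal (uy p))) := by ring
        _ ≤ _ := by gcongr
    · rw [← lintegral_const_mul _ hmeas, ← lintegral_const_mul _ (hmeas.const_mul _)]
      refine setLIntegral_mono_ae' hVm (ae_of_all _ fun p hp => ?_)
      obtain ⟨h3, h4, h5⟩ := hpos p hp
      have : ENNReal.ofReal √(ux p ^ 2 + uy p ^ 2) ≤
          ENNReal.ofReal (1 + δ) * (ENNReal.ofReal m * ENNReal.ofReal (uy p)) := by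
        rw [← ENNReal.ofReal_mul hm.le, ← ENNReal.ofReal_mul (by linarith), ← mul_assoc]
        exact ENNReal.ofReal_le_ofReal h5
      calc _ ≤ ENNReal.ofReal ((2 * ε)⁻¹) * ((Set.Icc (-ε) ε).indicator 1 (u p) *
            (ENNReal.ofReal (1 + δ) * (ENNReal.ofReal m * ENNReal.ofReal (uy p)))) := by gcongr
        _ = _ := by ring

end Cell

/-! ### The cell estimate near an arbitrary point. -/

section Cell

variable {u ux uy : ℝ × ℝ → ℝ}

/-- By compactness |u| is bounded below on the cell, so thin bands miss it; the comparison function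
is the band integral itself, with limit zero. -/
theorem cellEstimate_of_ne_zero {g : ℝ × ℝ → ℝ} (hu : Continuous u) {δ : ℝ} (hδ : 0 ≤ δ)
    {V : Set (ℝ × ℝ)} (hV : IsCompact V) (hne : ∀ p ∈ V, u p ≠ 0) : CellEstimate u g δ V := by
  have hVm := hV.measurableSet
  have hz : zeroLength u V = 0 := by
    rw [zeroLength_apply hVm]
    have : {x : EuclideanSpace ℝ (Fin 2) | (x 0, x 1) ∈ V ∧ u (x 0, x 1) = 0} = ∅ :=
      Set.eq_empty_of_forall_notMem fun x hx => hne _ hx.1 hx.2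
    rw [this, measure_empty]
  refine ⟨fun ε => bandMeasure u g ε V, 0, by simp, ?_, by simp, by simp [hz], ?_⟩
  · obtain ⟨c, hc, hcV⟩ : ∃ c > 0, ∀ p ∈ V, c ≤ |u p| := by
      rcases V.eq_empty_or_nonempty with rfl | hVn
      · exact ⟨1, one_pos, by simp⟩
      · obtain ⟨p, hp, hmin⟩ := hV.exists_isMinOn hVn hu.abs.continuousOn
        exact ⟨|u p|, abs_pos.2 (hne p hp), fun q hq => hmin hq⟩
    refine tendsto_const_nhds.congr' ?_
    filter_upwards [mem_nhdsWithin_of_mem_nhds (Iio_mem_nhds hc)] with ε (hε : ε < c)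
    rw [bandMeasure_apply hVm]
    refine (setLIntegral_eq_zero hVm fun p hp => ?_).symm
    have : u p ∉ Set.Icc (-ε) ε := fun h => by
      have := hcV p hp
      have := abs_le.2 h
      linarith
    simp [this]
  · intro ε _
    refine ⟨le_rfl, le_mul_of_one_le_left (by simp) ?_⟩
    rw [← ENNReal.ofReal_one]
    exact ENNReal.ofReal_le_ofReal (by linarith)

theorem zeroLength_neg (u : ℝ × ℝ → ℝ) : zeroLength (fun p => -u p) = zeroLength u := by
  simp [zeroLength]

theorem bandMeasure_neg (u g : ℝ × ℝ → ℝ) (ε : ℝ) :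
    bandMeasure (fun p => -u p) g ε = bandMeasure u g ε := by
  simp only [bandMeasure]
  congr 1
  ext p
  congr 2
  simp only [Set.indicator, Set.mem_Icc, neg_le_neg_iff, Pi.one_apply]
  congr 1
  simp only [eq_iff_iff]
  constructor <;> rintro ⟨h1, h2⟩ <;> constructor <;> linarith

theorem cellEstimate_neg {g : ℝ × ℝ → ℝ} {δ : ℝ} {V : Set (ℝ × ℝ)}
    (h : CellEstimate (fun p => -u p) g δ V) : CellEstimate u g δ V := by
  simpa only [CellEstimate, zeroLength_neg, bandMeasure_neg] using h

theorem zeroLength_swap (u : ℝ × ℝ → ℝ) {V : Set (ℝ × ℝ)} (hV : MeasurableSet V) :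
    zeroLength (fun p => u p.swap) (Prod.swap ⁻¹' V) = zeroLength u V := by
  rw [zeroLength_apply hV, zeroLength_apply (measurable_swap hV)]
  let e : EuclideanSpace ℝ (Fin 2) ≃ₗᵢ[ℝ] EuclideanSpace ℝ (Fin 2) :=
    LinearIsometryEquiv.piLpCongrLeft 2 ℝ ℝ (Equiv.swap 0 1)
  rw [← e.toIsometryEquiv.hausdorffMeasure_preimage]
  congr 1

theorem bandMeasure_swap {g : ℝ × ℝ → ℝ} (hu : Continuous u) (hg : Continuous g) (ε : ℝ)
    {V : Set (ℝ × ℝ)} (hV : MeasurableSet V) :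
    bandMeasure (fun p => u p.swap) (fun p => g p.swap) ε (Prod.swap ⁻¹' V)
      = bandMeasure u g ε V := by
  rw [bandMeasure_apply hV, bandMeasure_apply (measurable_swap hV)]
  have hmp : MeasurePreserving (Prod.swap : ℝ × ℝ → ℝ × ℝ) volume volume :=
    ⟨measurable_swap, Measure.prod_swap⟩
  have := hmp.setLIntegral_comp_preimage hV (f := fun p => ENNReal.ofReal ((2 * ε)⁻¹) *
      ((Set.Icc (-ε) ε).indicator 1 (u p) * ENNReal.ofReal (g p)))
    (((measurable_band hu ε).mul (by fun_prop)).const_mul _)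
  exact this

theorem cellEstimate_of_swap {g : ℝ × ℝ → ℝ} (hu : Continuous u) (hg : Continuous g) {δ : ℝ}
    {V : Set (ℝ × ℝ)} (hV : MeasurableSet V)
    (h : CellEstimate (fun p => u p.swap) (fun p => g p.swap) δ (Prod.swap ⁻¹' V)) :
    CellEstimate u g δ V := by
  simpa only [CellEstimate, zeroLength_swap u hV, bandMeasure_swap hu hg _ hV] using h

/-- A regular function of two variables satisfies the cell estimate near each point. -/
theorem exists_open_cellEstimate
    (hu : ∀ p, HasFDerivAt u (ux p • ContinuousLinearMap.fst ℝ ℝ ℝ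
      + uy p • ContinuousLinearMap.snd ℝ ℝ ℝ) p) (hux : Continuous ux) (huy : Continuous uy)
    {δ : ℝ} (hδ : 0 < δ) (p : ℝ × ℝ) (hreg : u p = 0 → ux p ≠ 0 ∨ uy p ≠ 0) :
    ∃ W : Set (ℝ × ℝ), IsOpen W ∧ p ∈ W ∧ ∀ a b c d : ℝ, a ≤ b → c ≤ d →
      Set.Icc a b ×ˢ Set.Icc c d ⊆ W →
      volume {x | u (x, c) = 0} = 0 → volume {x | u (x, d) = 0} = 0 →
      volume {y | u (a, y) = 0} = 0 → volume {y | u (b, y) = 0} = 0 →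
      CellEstimate u (fun p => √(ux p ^ 2 + uy p ^ 2)) δ (Set.Icc a b ×ˢ Set.Icc c d) := by
  have hcont : Continuous u := continuous_iff_continuousAt.2 fun p => (hu p).continuousAt
  -- the case of a positive vertical derivative
  have main : ∀ {u ux uy : ℝ × ℝ → ℝ}, (∀ p, HasFDerivAt u (ux p • ContinuousLinearMap.fst ℝ ℝ ℝ
      + uy p • ContinuousLinearMap.snd ℝ ℝ ℝ) p) → Continuous ux → Continuous uy →
      ∀ p, 0 < uy p → ∃ W : Set (ℝ × ℝ), IsOpen W ∧ p ∈ W ∧ ∀ a b c d : ℝ, a ≤ b → c ≤ d →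
      Set.Icc a b ×ˢ Set.Icc c d ⊆ W →
      volume {x | u (x, c) = 0} = 0 → volume {x | u (x, d) = 0} = 0 →
      CellEstimate u (fun p => √(ux p ^ 2 + uy p ^ 2)) δ (Set.Icc a b ×ˢ Set.Icc c d) := by
    intro u ux uy hu hux huy p hp
    set g : ℝ × ℝ → ℝ := fun p => √(ux p ^ 2 + uy p ^ 2) with hg
    have hgc : Continuous g := by fun_prop
    have hgp : 0 < g p := Real.sqrt_pos.2 (by positivity)
    -- With this choice the ratio |∇u|/u_y at p is (1 + δ/2) m, strictly between m and (1+δ) m, so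
    -- the two-sided comparison persists on a neighbourhood.
    set m : ℝ := g p / ((1 + δ / 2) * uy p) with hm
    have hm0 : 0 < m := by positivity
    have hmu : m * uy p = g p / (1 + δ / 2) := by rw [hm]; field_simp
    refine ⟨{q | 0 < uy q} ∩ ({q | m * uy q < g q} ∩ {q | g q < (1 + δ) * m * uy q}),
      (isOpen_lt continuous_const huy).inter ((isOpen_lt (by fun_prop) hgc).inter
        (isOpen_lt hgc (by fun_prop))), ⟨hp, ?_, ?_⟩, ?_⟩
    · change m * uy p < g p
      rw [hmu, div_lt_iff₀ (by positivity)]; nlinarith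
    · change g p < (1 + δ) * m * uy p
      rw [mul_assoc, hmu, mul_div_assoc', lt_div_iff₀ (by positivity)]; nlinarith
    · intro a b c d _ hcd hW h1 h2
      exact cellEstimate_vertical hu hux huy hcd hm0 hδ.le
        (fun q hq => ⟨(hW hq).1, (hW hq).2.1.le, (hW hq).2.2.le⟩) h1 h2
  have hneg : ∀ {u ux uy : ℝ × ℝ → ℝ}, (∀ p, HasFDerivAt u (ux p • ContinuousLinearMap.fst ℝ ℝ ℝ
      + uy p • ContinuousLinearMap.snd ℝ ℝ ℝ) p) → Continuous ux → Continuous uy →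
      ∀ p, uy p ≠ 0 → ∃ W : Set (ℝ × ℝ), IsOpen W ∧ p ∈ W ∧ ∀ a b c d : ℝ, a ≤ b → c ≤ d →
      Set.Icc a b ×ˢ Set.Icc c d ⊆ W →
      volume {x | u (x, c) = 0} = 0 → volume {x | u (x, d) = 0} = 0 →
      CellEstimate u (fun p => √(ux p ^ 2 + uy p ^ 2)) δ (Set.Icc a b ×ˢ Set.Icc c d) := by
    intro u ux uy hu hux huy p hp
    rcases lt_or_gt_of_ne hp with h | h
    · obtain ⟨W, hW, hpW, hcell⟩ := main (u := fun p => -u p) (ux := fun p => -ux p)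
        (uy := fun p => -uy p) (fun p => by
          convert! (hu p).neg using 1
          ext <;> simp) hux.neg huy.neg p (by simpa using h)
      refine ⟨W, hW, hpW, fun a b c d hab hcd hs h1 h2 => cellEstimate_neg ?_⟩
      simpa using hcell a b c d hab hcd hs (by simpa using h1) (by simpa using h2)
    · exact main hu hux huy p h
  by_cases h0 : u p = 0
  · rcases hreg h0 with hx | hy
    -- When the horizontal derivative is the nonzero one, the coordinates are exchanged; length,
    -- area and the gradient norm are invariant, while the roles of rows and columns are
    -- interchanged.
    · obtain ⟨W, hW, hpW, hcell⟩ := hneg (u := fun p => u p.swap) (ux := fun p => uy p.swap)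
        (uy := fun p => ux p.swap) (fun p => by
          have h1 : HasFDerivAt (Prod.swap : ℝ × ℝ → ℝ × ℝ)
              ((ContinuousLinearMap.snd ℝ ℝ ℝ).prod (ContinuousLinearMap.fst ℝ ℝ ℝ)) p :=
            ((ContinuousLinearMap.snd ℝ ℝ ℝ).prod (ContinuousLinearMap.fst ℝ ℝ ℝ)).hasFDerivAt
          have h2 := (hu p.swap).comp p h1
          convert! h2 using 1
          ext <;> simp) (huy.comp continuous_swap) (hux.comp continuous_swap) p.swap
          (by simpa using hx)
      refine ⟨Prod.swap ⁻¹' W, hW.preimage continuous_swap, hpW,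
        fun a b c d hab hcd hs h1 h2 h3 h4 => ?_⟩
      refine cellEstimate_of_swap hcont (by fun_prop) (measurableSet_Icc.prod measurableSet_Icc) ?_
      rw [Set.preimage_swap_prod]
      have hs' : Set.Icc c d ×ˢ Set.Icc a b ⊆ W := by
        rintro ⟨x, y⟩ ⟨hx, hy⟩
        exact hs (show (y, x) ∈ Set.Icc a b ×ˢ Set.Icc c d from ⟨hy, hx⟩)
      have := hcell c d a b hcd hab hs' (by simpa using h3) (by simpa using h4)
      simpa only [add_comm] using this
    · obtain ⟨W, hW, hpW, hcell⟩ := hneg hu hux huy p hy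
      exact ⟨W, hW, hpW, fun a b c d hab hcd hs h1 h2 _ _ => hcell a b c d hab hcd hs h1 h2⟩
  · refine ⟨{q | u q ≠ 0}, isOpen_ne_fun hcont continuous_const, h0,
      fun a b c d _ _ hs _ _ _ _ => ?_⟩
    exact cellEstimate_of_ne_zero hcont hδ.le (isCompact_Icc.prod isCompact_Icc)
      fun q hq => hs hq

end Cell

/-! ### Gluing the cells of a grid on the unit square. -/

section Cell

variable {u g ux uy : ℝ × ℝ → ℝ}

theorem cellEstimate_congr {δ : ℝ} {V V' : Set (ℝ × ℝ)} (h1 : zeroLength u V = zeroLength u V')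
    (h2 : ∀ ε, bandMeasure u g ε V = bandMeasure u g ε V') (h : CellEstimate u g δ V) :
    CellEstimate u g δ V' := by
  simpa only [CellEstimate, h1, h2] using h

theorem cellEstimate_biUnion {ι : Type*} {δ : ℝ} {s : Finset ι} {V : ι → Set (ℝ × ℝ)}
    (hd : (s : Set ι).PairwiseDisjoint V) (hm : ∀ i ∈ s, MeasurableSet (V i))
    (h : ∀ i ∈ s, CellEstimate u g δ (V i)) : CellEstimate u g δ (⋃ i ∈ s, V i) := by
  unfold CellEstimate at h
  choose! f L hL hf h1 h2 h3 using h
  refine ⟨fun ε => ∑ i ∈ s, f i ε, ∑ i ∈ s, L i, ?_, tendsto_finsetSum s fun i hi => hf i hi, ?_, ?_,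
    fun ε hε => ?_⟩
  · exact (ENNReal.sum_lt_top.2 fun i hi => (hL i hi).lt_top).ne
  · rw [measure_biUnion_finset hd hm]
    exact Finset.sum_le_sum h1
  · rw [measure_biUnion_finset hd hm, Finset.mul_sum]
    exact Finset.sum_le_sum h2
  · rw [measure_biUnion_finset hd hm, Finset.mul_sum]
    exact ⟨Finset.sum_le_sum fun i hi => (h3 i hi ε hε).1,
      Finset.sum_le_sum fun i hi => (h3 i hi ε hε).2⟩

/-- A line embeds isometrically, so a null set of zeros on it has no length. The edges of the grid
are thus negligible, which allows closed cells, where the local estimates hold, to be exchanged for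
half-open cells, which tile the square. -/
theorem zeroLength_row {q : ℝ} (h : volume {x | u (x, q) = 0} = 0) :
    zeroLength u {p | p.2 = q} = 0 := by
  have hm : MeasurableSet {p : ℝ × ℝ | p.2 = q} := measurable_snd (measurableSet_singleton q)
  rw [zeroLength_apply hm]
  have hl : LipschitzWith 1 fun x : ℝ => (!₂[x, q] : EuclideanSpace ℝ (Fin 2)) := by
    refine LipschitzWith.of_dist_le_mul fun x y => ?_
    rw [EuclideanSpace.dist_eq]
    simp [Real.sqrt_sq_eq_abs, Real.dist_eq]
  have h1 := (hl.lipschitzOnWith (s := {x | u (x, q) = 0})).hausdorffMeasure_image_le (d := 1)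
    zero_le_one
  rw [hausdorffMeasure_real, h, mul_zero] at h1
  refine measure_mono_null ?_ (le_antisymm h1 bot_le)
  rintro z ⟨hz1, hz2⟩
  have hz1 : z 1 = q := hz1
  refine ⟨z 0, by simpa [hz1] using hz2, ?_⟩
  ext i
  fin_cases i <;> simp [hz1]

theorem zeroLength_col {q : ℝ} (h : volume {y | u (q, y) = 0} = 0) :
    zeroLength u {p | p.1 = q} = 0 := by
  have hm : MeasurableSet {p : ℝ × ℝ | p.1 = q} := measurable_fst (measurableSet_singleton q)
  rw [zeroLength_apply hm]
  have hl : LipschitzWith 1 fun y : ℝ => (!₂[q, y] : EuclideanSpace ℝ (Fin 2)) := by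
    refine LipschitzWith.of_dist_le_mul fun x y => ?_
    rw [EuclideanSpace.dist_eq]
    simp [Real.sqrt_sq_eq_abs, Real.dist_eq]
  have h1 := (hl.lipschitzOnWith (s := {y | u (q, y) = 0})).hausdorffMeasure_image_le (d := 1)
    zero_le_one
  rw [hausdorffMeasure_real, h, mul_zero] at h1
  refine measure_mono_null ?_ (le_antisymm h1 bot_le)
  rintro z ⟨hz1, hz2⟩
  have hz1 : z 0 = q := hz1
  refine ⟨z 1, by simpa [hz1] using hz2, ?_⟩
  ext i
  fin_cases i <;> simp [hz1]

theorem volume_row (q : ℝ) : volume {p : ℝ × ℝ | p.2 = q} = 0 := by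
  have : {p : ℝ × ℝ | p.2 = q} = Set.univ ×ˢ {q} := by ext p; simp
  rw [this, Measure.volume_eq_prod, Measure.prod_prod]
  simp

theorem volume_col (q : ℝ) : volume {p : ℝ × ℝ | p.1 = q} = 0 := by
  have : {p : ℝ × ℝ | p.1 = q} = {q} ×ˢ Set.univ := by ext p; simp
  rw [this, Measure.volume_eq_prod, Measure.prod_prod]
  simp

theorem measure_Icc_prod_eq (μ : Measure (ℝ × ℝ)) {a b c d : ℝ} (h1 : μ {p | p.1 = b} = 0)
    (h2 : μ {p | p.2 = d} = 0) :
    μ (Set.Icc a b ×ˢ Set.Icc c d) = μ (Set.Ico a b ×ˢ Set.Ico c d) := by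
  refine le_antisymm ?_ (measure_mono (Set.prod_mono Set.Ico_subset_Icc_self
    Set.Ico_subset_Icc_self))
  calc μ (Set.Icc a b ×ˢ Set.Icc c d)
      ≤ μ (Set.Ico a b ×ˢ Set.Ico c d ∪ ({p | p.1 = b} ∪ {p | p.2 = d})) := by
        refine measure_mono ?_
        rintro p ⟨⟨h1, h2⟩, h3, h4⟩
        by_cases h5 : p.1 = b
        · exact Or.inr (Or.inl h5)
        by_cases h6 : p.2 = d
        · exact Or.inr (Or.inr h6)
        exact Or.inl ⟨⟨h1, lt_of_le_of_ne h2 h5⟩, h3, lt_of_le_of_ne h4 h6⟩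
    _ ≤ μ (Set.Ico a b ×ˢ Set.Ico c d) + (μ {p | p.1 = b} + μ {p | p.2 = d}) :=
        (measure_union_le _ _).trans (by gcongr; exact measure_union_le _ _)
    _ = _ := by rw [h1, h2]; simp

/-- The square `[0, 1)²`. -/
def unitSquare : Set (ℝ × ℝ) := Set.Ico 0 1 ×ˢ Set.Ico 0 1

theorem measurableSet_unitSquare : MeasurableSet unitSquare :=
  measurableSet_Ico.prod measurableSet_Ico

/-- The neighbourhoods that support the local estimate cover the compact square, and a grid finer
than the Lebesgue number of the cover has each cell inside one of them. The grid lines have rational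
coordinates, so only countably many lines have to avoid a non-null set of zeros; in the random
setting this is an almost sure event. -/
theorem cellEstimate_unitSquare
    (hu : ∀ p, HasFDerivAt u (ux p • ContinuousLinearMap.fst ℝ ℝ ℝ
      + uy p • ContinuousLinearMap.snd ℝ ℝ ℝ) p) (hux : Continuous ux) (huy : Continuous uy)
    (hreg : ∀ p ∈ Set.Icc (0 : ℝ) 1 ×ˢ Set.Icc (0 : ℝ) 1, u p = 0 → ux p ≠ 0 ∨ uy p ≠ 0)
    (hrow : ∀ q : ℚ, volume {x | u (x, (q : ℝ)) = 0} = 0)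
    (hcol : ∀ q : ℚ, volume {y | u ((q : ℝ), y) = 0} = 0) {δ : ℝ} (hδ : 0 < δ) :
    CellEstimate u (fun p => √(ux p ^ 2 + uy p ^ 2)) δ unitSquare := by
  have h1 : ∀ p : (Set.Icc (0 : ℝ) 1 ×ˢ Set.Icc (0 : ℝ) 1 : Set (ℝ × ℝ)), _ := fun p =>
    exists_open_cellEstimate hu hux huy hδ p.1 (hreg p.1 p.2)
  choose W hW hpW hcell using h1
  obtain ⟨r, hr, hball⟩ := lebesgue_number_lemma_of_metric
    ((isCompact_Icc (a := (0 : ℝ)) (b := 1)).prod (isCompact_Icc (a := (0 : ℝ)) (b := 1))) hW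
    (fun p hp => Set.mem_iUnion.2 ⟨⟨p, hp⟩, hpW _⟩)
  -- The distance on the product is the maximum of the coordinate distances, so a cell of side
  -- 1/(k+1) < r lies in the ball of radius r about its lower left corner.
  obtain ⟨k, hk⟩ := exists_nat_one_div_lt hr
  set K : ℝ := (k : ℝ) + 1 with hK
  have hK0 : 0 < K := by positivity
  let C : ℕ × ℕ → Set (ℝ × ℝ) := fun i =>
    Set.Ico (i.1 / K) ((i.1 + 1) / K) ×ˢ Set.Ico (i.2 / K) ((i.2 + 1) / K)
  have hmem : ∀ (i : ℕ) (x : ℝ), x ∈ Set.Ico (i / K) ((i + 1) / K) ↔ i = ⌊K * x⌋₊ ∧ 0 ≤ x := by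
    intro i x
    rw [Set.mem_Ico, div_le_iff₀ hK0, lt_div_iff₀ hK0, mul_comm x K]
    constructor
    · rintro ⟨h1, h2⟩
      have h3 : 0 ≤ K * x := (Nat.cast_nonneg i).trans h1
      exact ⟨((Nat.floor_eq_iff h3).2 ⟨h1, h2⟩).symm, nonneg_of_mul_nonneg_right h3 hK0⟩
    · rintro ⟨rfl, h⟩
      exact (Nat.floor_eq_iff (by positivity)).1 rfl
  have hS : unitSquare = ⋃ i ∈ Finset.range (k + 1) ×ˢ Finset.range (k + 1), C i := by
    have hfl : ∀ x : ℝ, 0 ≤ x → (⌊K * x⌋₊ < k + 1 ↔ x < 1) := fun x hx => by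
      rw [Nat.floor_lt (by positivity)]
      push_cast
      rw [← hK]
      constructor <;> intro h <;> nlinarith
    ext p
    simp only [unitSquare, Set.mem_prod, Set.mem_iUnion, Finset.mem_product, Finset.mem_range, C,
      hmem, exists_prop, Set.mem_Ico]
    constructor
    · rintro ⟨⟨h1, h2⟩, h3, h4⟩
      exact ⟨(⌊K * p.1⌋₊, ⌊K * p.2⌋₊), ⟨(hfl _ h1).2 h2, (hfl _ h3).2 h4⟩, ⟨rfl, h1⟩, rfl, h3⟩
    · rintro ⟨i, ⟨h1, h2⟩, ⟨h3, h4⟩, h5, h6⟩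
      exact ⟨⟨h4, (hfl _ h4).1 (h3 ▸ h1)⟩, h6, (hfl _ h6).1 (h5 ▸ h2)⟩
  have hdisj : ((Finset.range (k + 1) ×ˢ Finset.range (k + 1) : Finset (ℕ × ℕ)) :
      Set (ℕ × ℕ)).PairwiseDisjoint C := by
    intro i _ j _ hij
    refine Set.disjoint_left.2 fun p hp hq => hij ?_
    have h1 := (hmem _ _).1 hp.1
    have h2 := (hmem _ _).1 hp.2
    have h3 := (hmem _ _).1 hq.1
    have h4 := (hmem _ _).1 hq.2
    exact Prod.ext (h1.1.trans h3.1.symm) (h2.1.trans h4.1.symm)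
  rw [hS]
  refine cellEstimate_biUnion hdisj (fun i _ => measurableSet_Ico.prod measurableSet_Ico) ?_
  rintro ⟨i, j⟩ hij
  simp only [Finset.mem_product, Finset.mem_range] at hij
  have hcast : ∀ m : ℕ, ((m / ((k : ℚ) + 1) : ℚ) : ℝ) = m / K := fun m => by
    push_cast; rw [hK]
  have hrow' : ∀ m : ℕ, volume {x | u (x, m / K) = 0} = 0 := fun m => by
    rw [← hcast]; exact hrow _
  have hcol' : ∀ m : ℕ, volume {y | u (m / K, y) = 0} = 0 := fun m => by
    rw [← hcast]; exact hcol _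
  have hrow1 : volume {x | u (x, (j + 1) / K) = 0} = 0 := by exact_mod_cast hrow' (j + 1)
  have hcol1 : volume {y | u ((i + 1) / K, y) = 0} = 0 := by exact_mod_cast hcol' (i + 1)
  have hle : ∀ m : ℕ, (m : ℝ) / K ≤ (m + 1) / K := fun m => by gcongr; linarith
  have hp : ((i / K, j / K) : ℝ × ℝ) ∈ Set.Icc (0 : ℝ) 1 ×ˢ Set.Icc (0 : ℝ) 1 := by
    have h1 : (i : ℝ) ≤ k := by exact_mod_cast Nat.lt_succ_iff.1 hij.1
    have h2 : (j : ℝ) ≤ k := by exact_mod_cast Nat.lt_succ_iff.1 hij.2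
    refine ⟨⟨by positivity, ?_⟩, by positivity, ?_⟩ <;>
      · rw [div_le_one hK0]; linarith
  obtain ⟨p, hpb⟩ := hball _ hp
  have hsub : Set.Icc (i / K) ((i + 1) / K) ×ˢ Set.Icc (j / K) ((j + 1) / K) ⊆ W p := by
    refine Set.Subset.trans ?_ hpb
    rintro ⟨x, y⟩ ⟨⟨h1, h2⟩, h3, h4⟩
    simp only at h1 h2 h3 h4
    rw [add_div] at h2 h4
    rw [Metric.mem_ball, Prod.dist_eq, Real.dist_eq, Real.dist_eq]
    simp only
    rw [abs_of_nonneg (by linarith), abs_of_nonneg (by linarith)]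
    exact max_lt (by linarith) (by linarith)
  refine cellEstimate_congr ?_ (fun ε => ?_) (hcell p _ _ _ _ (hle i) (hle j) hsub (hrow' j) hrow1
    (hcol' i) hcol1)
  · exact measure_Icc_prod_eq _ (zeroLength_col hcol1) (zeroLength_row hrow1)
  · have hac : bandMeasure u (fun p => √(ux p ^ 2 + uy p ^ 2)) ε ≪ volume :=
      withDensity_absolutelyContinuous _ _
    exact measure_Icc_prod_eq _ (hac (volume_col _)) (hac (volume_row _))

/-- The length of a regular zero set in the unit square is the limit of the band integrals. -/
theorem tendsto_bandMeasure_unitSquare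
    (hu : ∀ p, HasFDerivAt u (ux p • ContinuousLinearMap.fst ℝ ℝ ℝ
      + uy p • ContinuousLinearMap.snd ℝ ℝ ℝ) p) (hux : Continuous ux) (huy : Continuous uy)
    (hreg : ∀ p ∈ Set.Icc (0 : ℝ) 1 ×ˢ Set.Icc (0 : ℝ) 1, u p = 0 → ux p ≠ 0 ∨ uy p ≠ 0)
    (hrow : ∀ q : ℚ, volume {x | u (x, (q : ℝ)) = 0} = 0)
    (hcol : ∀ q : ℚ, volume {y | u ((q : ℝ), y) = 0} = 0) :
    zeroLength u unitSquare ≠ ∞ ∧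
    Tendsto (fun ε => bandMeasure u (fun p => √(ux p ^ 2 + uy p ^ 2)) ε unitSquare) (𝓝[>] 0)
      (𝓝 (zeroLength u unitSquare)) := by
  have hce := fun δ (hδ : 0 < δ) => cellEstimate_unitSquare hu hux huy hreg hrow hcol hδ
  set g : ℝ × ℝ → ℝ := fun p => √(ux p ^ 2 + uy p ^ 2)
  constructor
  · obtain ⟨f, L, hL, hf, h1, h2, h3⟩ := hce 1 one_pos
    exact (h2.trans_lt (ENNReal.mul_lt_top ENNReal.ofReal_lt_top hL.lt_top)).ne
  · have hlim : ∀ x : ℝ≥0∞, Tendsto (fun δ : ℝ => ENNReal.ofReal (1 + δ) * x) (𝓝[>] 0) (𝓝 x) := by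
      intro x
      have h1 : Tendsto (fun δ : ℝ => ENNReal.ofReal (1 + δ)) (𝓝[>] 0) (𝓝 1) := by
        have : Continuous fun δ : ℝ => ENNReal.ofReal (1 + δ) :=
          ENNReal.continuous_ofReal.comp (by fun_prop)
        have := (this.tendsto 0).mono_left (nhdsWithin_le_nhds (s := Set.Ioi 0))
        simpa using this
      simpa using ENNReal.Tendsto.mul_const h1 (Or.inl one_ne_zero) (b := x)
    -- For each δ the length is squeezed, up to a factor 1 + δ, by the lower and upper limits of the
    -- band integrals; then δ tends to zero.
    refine tendsto_of_le_liminf_of_limsup_le ?_ ?_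
    · refine ge_of_tendsto (hlim _) ?_
      filter_upwards [self_mem_nhdsWithin] with δ (hδ : 0 < δ)
      obtain ⟨f, L, hL, hf, h1, h2, h3⟩ := hce δ hδ
      refine h2.trans ?_
      gcongr
      rw [← hf.liminf_eq]
      refine liminf_le_liminf ?_
      filter_upwards [self_mem_nhdsWithin] with ε hε using (h3 ε hε).1
    · refine ge_of_tendsto (hlim _) ?_
      filter_upwards [self_mem_nhdsWithin] with δ (hδ : 0 < δ)
      obtain ⟨f, L, hL, hf, h1, h2, h3⟩ := hce δ hδ
      have h4 := ENNReal.Tendsto.const_mul hf (Or.inr (ENNReal.ofReal_ne_top (r := 1 + δ)))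
      refine le_trans ?_ (mul_le_mul_right h1 _)
      rw [← h4.limsup_eq]
      refine limsup_le_limsup ?_
      filter_upwards [self_mem_nhdsWithin] with ε hε using (h3 ε hε).2

end Cell

/-! ### Trigonometric sums -/

/-- `e_λ` as a function on `ℝ × ℝ`. -/
noncomputable def planeExp (l : ℤ × ℤ) (p : ℝ × ℝ) : ℂ :=
  Complex.exp (((2 * Real.pi * (l.1 * p.1 + l.2 * p.2) : ℝ) : ℂ) * Complex.I)

/-- The real trigonometric sum with coefficients `c`. -/
noncomputable def trigSum (s : Finset (ℤ × ℤ)) (c : ℤ × ℤ → ℂ) (p : ℝ × ℝ) : ℝ :=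
  ∑ l ∈ s, (c l * planeExp l p).re

/-- Coefficients of the derivative in the first variable. -/
noncomputable def coeffX (c : ℤ × ℤ → ℂ) (l : ℤ × ℤ) : ℂ := (2 * Real.pi * l.1 : ℝ) * Complex.I * c l

/-- Coefficients of the derivative in the second variable. -/
noncomputable def coeffY (c : ℤ × ℤ → ℂ) (l : ℤ × ℤ) : ℂ := (2 * Real.pi * l.2 : ℝ) * Complex.I * c l

theorem re_mul_exp (c : ℂ) (t : ℝ) :
    (c * Complex.exp (t * Complex.I)).re = c.re * Real.cos t - c.im * Real.sin t := by
  rw [Complex.mul_re, Complex.exp_ofReal_mul_I_re, Complex.exp_ofReal_mul_I_im]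

theorem hasFDerivAt_trigSum (s : Finset (ℤ × ℤ)) (c : ℤ × ℤ → ℂ) (p : ℝ × ℝ) :
    HasFDerivAt (trigSum s c) (trigSum s (coeffX c) p • ContinuousLinearMap.fst ℝ ℝ ℝ
      + trigSum s (coeffY c) p • ContinuousLinearMap.snd ℝ ℝ ℝ) p := by
  have hterm : ∀ l ∈ s, HasFDerivAt (fun p => (c l * planeExp l p).re)
      ((coeffX c l * planeExp l p).re • ContinuousLinearMap.fst ℝ ℝ ℝ
        + (coeffY c l * planeExp l p).re • ContinuousLinearMap.snd ℝ ℝ ℝ) p := by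
    intro l _
    have h1 : HasFDerivAt (fun p : ℝ × ℝ => 2 * Real.pi * (l.1 * p.1 + l.2 * p.2))
        ((2 * Real.pi) • ((l.1 : ℝ) • ContinuousLinearMap.fst ℝ ℝ ℝ
          + (l.2 : ℝ) • ContinuousLinearMap.snd ℝ ℝ ℝ)) p :=
      ((hasFDerivAt_fst.const_mul _).add (hasFDerivAt_snd.const_mul _)).const_mul _
    set t := 2 * Real.pi * (l.1 * p.1 + l.2 * p.2) with ht
    have h2 : HasDerivAt (fun t => (c l).re * Real.cos t - (c l).im * Real.sin t)
        ((c l).re * -Real.sin t - (c l).im * Real.cos t) t :=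
      ((Real.hasDerivAt_cos t).const_mul _).sub ((Real.hasDerivAt_sin t).const_mul _)
    have h3 := h2.comp_hasFDerivAt p h1
    convert! h3 using 1
    · ext p
      simp only [planeExp, re_mul_exp, Function.comp]
    · simp only [planeExp, re_mul_exp, coeffX, coeffY, ← ht]
      ext <;> simp <;> ring
  have h := HasFDerivAt.fun_sum hterm
  convert! h using 1
  simp only [trigSum, Finset.sum_smul, Finset.sum_add_distrib]

theorem continuous_trigSum (s : Finset (ℤ × ℤ)) (c : ℤ × ℤ → ℂ) : Continuous (trigSum s c) :=
  continuous_iff_continuousAt.2 fun p => (hasFDerivAt_trigSum s c p).continuousAt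

/-! ### Critical points on slices and a deterministic bound for band integrals. -/

/-- A real trigonometric polynomial of degree at most `n` vanishes identically or has at most `2n`
zeros in a period. -/
theorem zeros_trig_le {ι : Type*} (s : Finset ι) (k : ι → ℤ) (b : ι → ℂ) (n : ℕ)
    (hk : ∀ i ∈ s, |k i| ≤ n) :
    (∀ y : ℝ, ∑ i ∈ s, (b i * Complex.exp ((2 * Real.pi * (k i * y) : ℝ) * Complex.I)).re = 0) ∨
    ∃ F : Finset ℝ, F.card ≤ 2 * n ∧ ∀ y ∈ Set.Ico (0 : ℝ) 1,
      ∑ i ∈ s, (b i * Complex.exp ((2 * Real.pi * (k i * y) : ℝ) * Complex.I)).re = 0 → y ∈ F := by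
  set w : ℝ → ℝ := fun y =>
    ∑ i ∈ s, (b i * Complex.exp ((2 * Real.pi * (k i * y) : ℝ) * Complex.I)).re with hw
  set ζ : ℝ → ℂ := fun y => Complex.exp ((2 * Real.pi * y : ℝ) * Complex.I) with hζ
  -- With z = e^{2πiy} this polynomial takes the value 2 zⁿ w(y): adding the conjugate term produces
  -- twice the real part, and the shift by n clears negative exponents. Its degree is at most 2n,
  -- and y ↦ z is injective on a period.
  set q : Polynomial ℂ := ∑ i ∈ s, (Polynomial.C (b i) * Polynomial.X ^ ((n : ℤ) + k i).toNat
    + Polynomial.C ((starRingEnd ℂ) (b i)) * Polynomial.X ^ ((n : ℤ) - k i).toNat) with hq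
  have hζ0 : ∀ y, ζ y ≠ 0 := fun y => Complex.exp_ne_zero _
  have hval : ∀ y, q.eval (ζ y) = 2 * ζ y ^ n * (w y : ℂ) := by
    intro y
    simp only [hq, hw, Polynomial.eval_finsetSum, Complex.ofReal_sum, Finset.mul_sum]
    refine Finset.sum_congr rfl fun i hi => ?_
    have h1 := abs_le.1 (hk i hi)
    have e1 : ∀ m : ℤ, 0 ≤ (n : ℤ) + m → ζ y ^ ((n : ℤ) + m).toNat = ζ y ^ n *
        Complex.exp ((2 * Real.pi * (m * y) : ℝ) * Complex.I) := by
      intro m hm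
      rw [← zpow_natCast, Int.toNat_of_nonneg hm, zpow_add₀ (hζ0 y), zpow_natCast]
      congr 1
      simp only [hζ]
      rw [← Complex.exp_int_mul]
      congr 1
      push_cast; ring
    have e2 : ((n : ℤ) - k i) = (n : ℤ) + (-k i) := by ring
    simp only [Polynomial.eval_add, Polynomial.eval_mul, Polynomial.eval_C, Polynomial.eval_pow,
      Polynomial.eval_X]
    rw [e2, e1 _ (by linarith), e1 _ (by linarith)]
    have e3 : Complex.exp ((2 * Real.pi * ((-k i : ℤ) * y) : ℝ) * Complex.I)
        = (starRingEnd ℂ) (Complex.exp ((2 * Real.pi * (k i * y) : ℝ) * Complex.I)) := by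
      rw [← Complex.exp_conj]
      congr 1
      simp only [map_mul, Complex.conj_ofReal, Complex.conj_I]
      push_cast; ring
    rw [e3, Complex.re_eq_add_conj, map_mul]
    ring
  by_cases h0 : q = 0
  · left
    intro y
    have := hval y
    rw [h0, Polynomial.eval_zero] at this
    have h2 : (2 * ζ y ^ n : ℂ) ≠ 0 := mul_ne_zero two_ne_zero (pow_ne_zero _ (hζ0 y))
    exact_mod_cast (mul_eq_zero.1 this.symm).resolve_left h2
  · right
    have hinj : Set.InjOn ζ (Set.Ico (0 : ℝ) 1) := by
      intro y hy z hz h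
      obtain ⟨m, hm⟩ := Complex.exp_eq_exp_iff_exists_int.1 h
      have h1 : (2 * Real.pi * y : ℝ) = 2 * Real.pi * z + m * (2 * Real.pi) := by
        have h2 : ((2 * Real.pi * y : ℝ) : ℂ) * Complex.I
            = ((2 * Real.pi * z + m * (2 * Real.pi) : ℝ) : ℂ) * Complex.I := by
          rw [hm]; push_cast; ring
        exact_mod_cast mul_right_cancel₀ Complex.I_ne_zero h2
      have h3 : y = z + m := by
        have hp := Real.pi_pos
        have : 2 * Real.pi * (y - (z + m)) = 0 := by linarith
        rcases mul_eq_zero.1 this with h | h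
        · linarith
        · linarith
      have h4 : (m : ℝ) < 1 := by linarith [hy.2, hz.1]
      have h5 : (-1 : ℝ) < m := by linarith [hy.1, hz.2]
      have h6 : m = 0 := by
        have : m < 1 := by exact_mod_cast h4
        have : -1 < m := by exact_mod_cast h5
        omega
      simpa [h6] using h3
    set Z : Set ℝ := {y | y ∈ Set.Ico (0 : ℝ) 1 ∧ w y = 0} with hZ
    have hmaps : Set.MapsTo ζ Z q.roots.toFinset := by
      intro y hy
      simp only [Finset.mem_coe, Multiset.mem_toFinset, Polynomial.mem_roots h0, Polynomial.IsRoot]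
      rw [hval, hy.2]; simp
    have hinj' : Set.InjOn ζ Z := hinj.mono fun y hy => hy.1
    have hfin : Z.Finite := Set.Finite.of_injOn hmaps hinj' (Finset.finite_toSet _)
    refine ⟨hfin.toFinset, ?_, fun y hy h => hfin.mem_toFinset.2 ⟨hy, h⟩⟩
    have hdeg : q.natDegree ≤ 2 * n := by
      refine Polynomial.natDegree_sum_le_of_forall_le _ _ fun i hi => ?_
      have h1 := abs_le.1 (hk i hi)
      refine Polynomial.natDegree_add_le_of_degree_le ?_ ?_ <;>
      · refine (Polynomial.natDegree_C_mul_X_pow_le _ _).trans ?_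
        omega
    calc hfin.toFinset.card ≤ q.roots.toFinset.card :=
          Finset.card_le_card_of_injOn ζ (by simpa using hmaps) (by simpa using hinj')
      _ ≤ Multiset.card q.roots := Multiset.toFinset_card_le _
      _ ≤ q.natDegree := Polynomial.card_roots' q
      _ ≤ 2 * n := hdeg

/-- A derivative without zeros keeps its sign, so w is monotone and sweeps [-ε, ε] at most once. -/
theorem lintegral_slice_le_of_sign {w w' : ℝ → ℝ} (hw : ∀ y, HasDerivAt w (w' y) y)
    (hw' : Continuous w') {c d ε : ℝ} (hε : 0 < ε) (hcd : c ≤ d)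
    (hne : ∀ y ∈ Set.Ioo c d, w' y ≠ 0) :
    ∫⁻ y in Set.Icc c d, ENNReal.ofReal |w' y| * (Set.Icc (-ε) ε).indicator 1 (w y)
      ≤ ENNReal.ofReal (2 * ε) := by
  rcases hcd.eq_or_lt with rfl | hlt
  · simp
  have key : ∀ {w w' : ℝ → ℝ}, (∀ y, HasDerivAt w (w' y) y) → Continuous w' →
      (∀ y ∈ Set.Ioo c d, 0 < w' y) →
      ∫⁻ y in Set.Icc c d, ENNReal.ofReal |w' y| * (Set.Icc (-ε) ε).indicator 1 (w y)
      ≤ ENNReal.ofReal (2 * ε) := by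
    intro w w' hw hw' hpos
    have hnn : ∀ y ∈ Set.Icc c d, 0 ≤ w' y := by
      have h1 : closure (Set.Ioo c d) ⊆ {y | 0 ≤ w' y} :=
        closure_minimal (fun y hy => (hpos y hy).le) (isClosed_le continuous_const hw')
      rwa [closure_Ioo hlt.ne] at h1
    calc _ = ∫⁻ y in Set.Icc c d, ENNReal.ofReal (w' y) * (Set.Icc (-ε) ε).indicator 1 (w y) :=
          setLIntegral_congr_fun measurableSet_Icc fun y hy => by
            simp only [abs_of_nonneg (hnn y hy)]
      _ = ENNReal.ofReal (min (w d) ε - max (w c) (-ε)) := lintegral_slice hw hcd hnn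
      _ ≤ _ := ENNReal.ofReal_le_ofReal (by
          have := min_le_right (w d) ε
          have := le_max_right (w c) (-ε)
          linarith)
  by_cases hp : ∀ y ∈ Set.Ioo c d, 0 < w' y
  · exact key hw hw' hp
  · push Not at hp
    obtain ⟨z, hz, hz0⟩ := hp
    have hz1 : w' z < 0 := lt_of_le_of_ne hz0 (hne z hz)
    have hneg : ∀ y ∈ Set.Ioo c d, 0 < -w' y := by
      intro y hy
      by_contra! hcon
      have h1 : 0 ≤ w' y := by linarith
      obtain ⟨t, ht, ht0⟩ := isPreconnected_Ioo.intermediate_value hz hy hw'.continuousOn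
        ⟨hz1.le, h1⟩
      exact hne t ht ht0
    have := key (w := fun y => -w y) (w' := fun y => -w' y) (fun y => (hw y).neg) hw'.neg hneg
    convert! this using 4 with y
    · rw [abs_neg]
    · simp only [Set.indicator, Set.mem_Icc, Pi.one_apply]
      congr 1
      simp only [eq_iff_iff]
      constructor <;> rintro ⟨h1, h2⟩ <;> constructor <;> linarith

/-- Splitting at a critical point divides the others between the two sides. By induction there are
at most m + 1 monotone pieces, each contributing at most 2ε. -/
theorem lintegral_slice_le {w w' : ℝ → ℝ} (hw : ∀ y, HasDerivAt w (w' y) y)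
    (hw' : Continuous w') {ε : ℝ} (hε : 0 < ε) (m : ℕ) : ∀ {c d : ℝ}, c ≤ d → ∀ F : Finset ℝ,
    F.card ≤ m → (∀ y ∈ Set.Ioo c d, w' y = 0 → y ∈ F) →
    ∫⁻ y in Set.Icc c d, ENNReal.ofReal |w' y| * (Set.Icc (-ε) ε).indicator 1 (w y)
      ≤ (m + 1) * ENNReal.ofReal (2 * ε) := by
  induction m using Nat.strong_induction_on with
  | _ m ih =>
    intro c d hcd F hF hz
    by_cases hne : ∀ y ∈ Set.Ioo c d, w' y ≠ 0
    · refine (lintegral_slice_le_of_sign hw hw' hε hcd hne).trans ?_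
      exact le_mul_of_one_le_left (by simp) (by simp)
    · push Not at hne
      obtain ⟨t, ht, ht0⟩ := hne
      have htF := hz t ht ht0
      set F1 := F.filter (· < t)
      set F2 := F.filter (t < ·)
      have hcard : F1.card + F2.card + 1 ≤ F.card := by
        have hd : Disjoint F1 F2 := Finset.disjoint_filter.2 fun x _ h1 h2 => lt_asymm h1 h2
        rw [← Finset.card_union_of_disjoint hd]
        refine Finset.card_lt_card ⟨Finset.union_subset (Finset.filter_subset _ _)
          (Finset.filter_subset _ _), fun h => ?_⟩
        have := h htF
        simp [F1, F2] at this
      have h1 := ih F1.card (by omega) ht.1.le F1 le_rfl fun y hy h0 =>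
        Finset.mem_filter.2 ⟨hz y ⟨hy.1, hy.2.trans ht.2⟩ h0, hy.2⟩
      have h2 := ih F2.card (by omega) ht.2.le F2 le_rfl fun y hy h0 =>
        Finset.mem_filter.2 ⟨hz y ⟨ht.1.trans hy.1, hy.2⟩ h0, hy.1⟩
      rw [← Set.Icc_union_Icc_eq_Icc ht.1.le ht.2.le]
      refine (lintegral_union_le _ _ _).trans ((add_le_add h1 h2).trans ?_)
      rw [← add_mul]
      refine mul_le_mul' ?_ le_rfl
      have : F1.card + 1 + (F2.card + 1) ≤ m + 1 := by omega
      exact_mod_cast this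

theorem lintegral_slice_trig_le {w w' : ℝ → ℝ} (hw : ∀ y, HasDerivAt w (w' y) y)
    (hw' : Continuous w') {ε : ℝ} (hε : 0 < ε) {ι : Type*} (s : Finset ι) (k : ι → ℤ)
    (b : ι → ℂ) (n : ℕ) (hk : ∀ i ∈ s, |k i| ≤ n)
    (heq : ∀ y, w' y = ∑ i ∈ s, (b i * Complex.exp ((2 * Real.pi * (k i * y) : ℝ) * Complex.I)).re) :
    ∫⁻ y in Set.Ico (0 : ℝ) 1, ENNReal.ofReal |w' y| * (Set.Icc (-ε) ε).indicator 1 (w y)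
      ≤ (2 * n + 1) * ENNReal.ofReal (2 * ε) := by
  rcases zeros_trig_le s k b n hk with h | ⟨F, hF, h⟩
  · have h0 : ∀ y, w' y = 0 := fun y => (heq y).trans (h y)
    simp [h0]
  · refine (lintegral_mono_set Set.Ico_subset_Icc_self).trans ?_
    have := lintegral_slice_le hw hw' hε (2 * n) zero_le_one F hF fun y hy h0 =>
      h y ⟨hy.1.le, hy.2⟩ (by rw [← heq, h0])
    exact_mod_cast this

theorem abs_le_of_mem_freq {n : ℕ} {l : ℤ × ℤ} (hl : l ∈ freq n) : |l.1| ≤ n ∧ |l.2| ≤ n := by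
  simp only [freq, Finset.mem_filter, Finset.mem_product, Finset.mem_Icc] at hl
  exact ⟨abs_le.2 hl.1.1, abs_le.2 hl.1.2⟩

/-- The gradient norm is at most |u_x| + |u_y|, and each term is integrated along slices in its own
direction. A slice derivative is a trigonometric polynomial of degree at most n, with at most 2n
zeros unless it vanishes identically, so each direction contributes at most 2n + 1. The bound
depends neither on ε nor on the coefficients; it later serves as the dominating constant. -/
theorem bandMeasure_trigSum_le (n : ℕ) (c : ℤ × ℤ → ℂ) {ε : ℝ} (hε : 0 < ε) :
    bandMeasure (trigSum (freq n) c) (fun p => √(trigSum (freq n) (coeffX c) p ^ 2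
      + trigSum (freq n) (coeffY c) p ^ 2)) ε unitSquare ≤ 2 * (2 * n + 1) := by
  set u := trigSum (freq n) c
  set ux := trigSum (freq n) (coeffX c) with hux
  set uy := trigSum (freq n) (coeffY c) with huy
  have hu : Continuous u := continuous_trigSum _ _
  have huxc : Continuous ux := continuous_trigSum _ _
  have huyc : Continuous uy := continuous_trigSum _ _
  have hx : Measurable fun p : ℝ × ℝ =>
      ENNReal.ofReal |ux p| * (Set.Icc (-ε) ε).indicator 1 (u p) :=
    (by fun_prop : Measurable fun p => ENNReal.ofReal |ux p|).mul (measurable_band hu ε)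
  have hy : Measurable fun p : ℝ × ℝ =>
      ENNReal.ofReal |uy p| * (Set.Icc (-ε) ε).indicator 1 (u p) :=
    (by fun_prop : Measurable fun p => ENNReal.ofReal |uy p|).mul (measurable_band hu ε)
  have hxy : Measurable fun p : ℝ × ℝ =>
      ENNReal.ofReal |ux p| * (Set.Icc (-ε) ε).indicator 1 (u p)
        + ENNReal.ofReal |uy p| * (Set.Icc (-ε) ε).indicator 1 (u p) := hx.add hy
  have by_ : ∫⁻ p in unitSquare, ENNReal.ofReal |uy p| * (Set.Icc (-ε) ε).indicator 1 (u p)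
      ≤ (2 * n + 1) * ENNReal.ofReal (2 * ε) := by
    rw [unitSquare, setLIntegral_prod_eq hy]
    calc _ ≤ ∫⁻ _ in Set.Ico (0 : ℝ) 1, (2 * n + 1) * ENNReal.ofReal (2 * ε) := by
          refine lintegral_mono fun x => ?_
          -- On a vertical slice the phase in x is absorbed into the coefficients, which leaves a
          -- trigonometric sum in y with integer frequencies.
          refine lintegral_slice_trig_le (w := fun y => u (x, y)) (w' := fun y => uy (x, y))
            (hasDerivAt_snd_slice (hasFDerivAt_trigSum _ _) x) (by fun_prop) hε (freq n) Prod.snd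
            (fun l => coeffY c l * Complex.exp ((2 * Real.pi * (l.1 * x) : ℝ) * Complex.I)) n
            (fun l hl => (abs_le_of_mem_freq hl).2) fun y => ?_
          simp only [huy, trigSum, planeExp]
          refine Finset.sum_congr rfl fun l _ => ?_
          rw [mul_assoc (_ : ℂ) (Complex.exp _), ← Complex.exp_add]
          congr 3
          push_cast; ring
      _ = _ := by simp
  have bx : ∫⁻ p in unitSquare, ENNReal.ofReal |ux p| * (Set.Icc (-ε) ε).indicator 1 (u p)
      ≤ (2 * n + 1) * ENNReal.ofReal (2 * ε) := by
    rw [unitSquare, Measure.volume_eq_prod, ← Measure.prod_restrict,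
      lintegral_prod_symm _ hx.aemeasurable]
    calc _ ≤ ∫⁻ _ in Set.Ico (0 : ℝ) 1, (2 * n + 1) * ENNReal.ofReal (2 * ε) := by
          refine lintegral_mono fun y => ?_
          refine lintegral_slice_trig_le (w := fun x => u (x, y)) (w' := fun x => ux (x, y))
            (fun x => ?_) (by fun_prop) hε (freq n) Prod.fst
            (fun l => coeffX c l * Complex.exp ((2 * Real.pi * (l.2 * y) : ℝ) * Complex.I)) n
            (fun l hl => (abs_le_of_mem_freq hl).1) fun x => ?_
          · have h1 : HasDerivAt (fun x : ℝ => (x, y)) ((1 : ℝ), (0 : ℝ)) x :=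
              (hasDerivAt_id x).prodMk (hasDerivAt_const x y)
            have := (hasFDerivAt_trigSum (freq n) c (x, y)).comp_hasDerivAt x h1
            simpa using! this
          simp only [hux, trigSum, planeExp]
          refine Finset.sum_congr rfl fun l _ => ?_
          rw [mul_assoc (_ : ℂ) (Complex.exp _), ← Complex.exp_add]
          congr 3
          push_cast; ring
      _ = _ := by simp
  rw [bandMeasure_apply measurableSet_unitSquare]
  calc _ ≤ ∫⁻ p in unitSquare, ENNReal.ofReal ((2 * ε)⁻¹) *
        (ENNReal.ofReal |ux p| * (Set.Icc (-ε) ε).indicator 1 (u p)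
          + ENNReal.ofReal |uy p| * (Set.Icc (-ε) ε).indicator 1 (u p)) := by
        refine lintegral_mono fun p => ?_
        simp only
        rw [← add_mul, mul_comm ((Set.Icc (-ε) ε).indicator _ _),
          ← ENNReal.ofReal_add (abs_nonneg _) (abs_nonneg _)]
        gcongr
        refine Real.sqrt_le_iff.2 ⟨by positivity, ?_⟩
        rw [add_sq, sq_abs, sq_abs]
        nlinarith [mul_nonneg (abs_nonneg (ux p)) (abs_nonneg (uy p))]
    _ = ENNReal.ofReal ((2 * ε)⁻¹) * ((∫⁻ p in unitSquare,
          ENNReal.ofReal |ux p| * (Set.Icc (-ε) ε).indicator 1 (u p)) + ∫⁻ p in unitSquare,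
          ENNReal.ofReal |uy p| * (Set.Icc (-ε) ε).indicator 1 (u p)) := by
        rw [lintegral_const_mul _ hxy, lintegral_add_left hx]
    _ ≤ ENNReal.ofReal ((2 * ε)⁻¹) * ((2 * n + 1) * ENNReal.ofReal (2 * ε)
          + (2 * n + 1) * ENNReal.ofReal (2 * ε)) := by gcongr
    _ = 2 * (2 * n + 1) * (ENNReal.ofReal ((2 * ε)⁻¹) * ENNReal.ofReal (2 * ε)) := by ring
    _ = _ := by
        rw [← ENNReal.ofReal_mul (by positivity), inv_mul_cancel₀ (by positivity)]
        simp

/-! ### Linear forms in the coefficients -/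

section LinForm

variable {Ω : Type*} [MeasurableSpace Ω] {P : Measure Ω} [IsProbabilityMeasure P]
  {a : ℤ × ℤ → Ω → ℂ}

/-- The real linear form with coefficients `z` in the `a_λ`. -/
noncomputable def linForm (a : ℤ × ℤ → Ω → ℂ) (s : Finset (ℤ × ℤ)) (z : ℤ × ℤ → ℂ) (ω : Ω) : ℝ :=
  ∑ l ∈ s, (z l * a l ω).re

theorem memLp_re (ha : IsWaveCoefficients a P) {l : ℤ × ℤ} (hl : l ≠ 0) :
    MemLp (fun ω => (a l ω).re) 2 P := (ha.law_re l hl).hasGaussianLaw.memLp_two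

theorem memLp_im (ha : IsWaveCoefficients a P) {l : ℤ × ℤ} (hl : l ≠ 0) :
    MemLp (fun ω => (a l ω).im) 2 P := (ha.law_im l hl).hasGaussianLaw.memLp_two

theorem memLp_re_mul (ha : IsWaveCoefficients a P) {l : ℤ × ℤ} (hl : l ≠ 0) (w : ℂ) :
    MemLp (fun ω => (w * a l ω).re) 2 P := by
  simp_rw [Complex.mul_re]
  exact ((memLp_re ha hl).const_mul _).sub ((memLp_im ha hl).const_mul _)

theorem re_mul_mem (ha : IsWaveCoefficients a P) {l : ℤ × ℤ} (hl : l ≠ 0) (w : ℂ) :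
    (memLp_re_mul ha hl w).toLp _ ∈ gaussianSpace a P := by
  -- Re(w a_λ) is (w/2) a_λ plus its conjugate, and the conjugate of a_λ is a_{-λ}.
  refine Submodule.le_topologicalClosure _ (Submodule.subset_span ⟨l, hl, w / 2, ?_⟩)
  filter_upwards [(memLp_re_mul ha hl w).coeFn_toLp, ha.conj_eq l hl] with ω h1 h2
  rw [h1, h2, Complex.re_eq_add_conj]
  simp only [map_mul, map_div₀, Complex.conj_ofNat]
  ring

theorem memLp_linForm (ha : IsWaveCoefficients a P) {s : Finset (ℤ × ℤ)} (hs : ∀ l ∈ s, l ≠ 0)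
    (z : ℤ × ℤ → ℂ) : MemLp (linForm a s z) 2 P :=
  memLp_finsetSum s fun l hl => memLp_re_mul ha (hs l hl) (z l)

theorem linForm_mem (ha : IsWaveCoefficients a P) {s : Finset (ℤ × ℤ)} (hs : ∀ l ∈ s, l ≠ 0)
    (z : ℤ × ℤ → ℂ) : (memLp_linForm ha hs z).toLp _ ∈ gaussianSpace a P := by
  have : (memLp_linForm ha hs z).toLp _
      = ∑ l : s, (memLp_re_mul ha (hs l l.2) (z l)).toLp _ := by
    refine Lp.ext ?_
    have h2 : ∀ᵐ ω ∂P, ∀ l : s, (memLp_re_mul ha (hs l l.2) (z l)).toLp _ ω = (z l * a l ω).re :=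
      ae_all_iff.2 fun l => (memLp_re_mul ha (hs l l.2) (z l)).coeFn_toLp
    filter_upwards [(memLp_linForm ha hs z).coeFn_toLp, h2, Lp.coeFn_finsetSum Finset.univ
      fun l : s => (memLp_re_mul ha (hs l l.2) (z l)).toLp _] with ω h1 h2 h3
    rw [h1, h3, Finset.sum_apply]
    simp only [h2, linForm]
    rw [Finset.sum_coe_sort s fun l => (z l * a l ω).re]
  rw [this]
  exact Submodule.sum_mem _ fun l _ => re_mul_mem ha (hs l l.2) _

/-- The coefficient `E[ζ a_λ]`. -/
noncomputable def waveCoeff (a : ℤ × ℤ → Ω → ℂ) (P : Measure Ω) (ζ : Lp ℝ 2 P) (l : ℤ × ℤ) : ℂ :=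
  ⟨∫ ω, ζ ω * (a l ω).re ∂P, ∫ ω, ζ ω * (a l ω).im ∂P⟩

theorem waveCoeff_neg (ha : IsWaveCoefficients a P) (ζ : Lp ℝ 2 P) {l : ℤ × ℤ} (hl : l ≠ 0) :
    waveCoeff a P ζ (-l) = (starRingEnd ℂ) (waveCoeff a P ζ l) := by
  apply Complex.ext
  · simp only [waveCoeff, Complex.conj_re]
    refine integral_congr_ae ?_
    filter_upwards [ha.conj_eq l hl] with ω h
    rw [h, Complex.conj_re]
  · simp only [waveCoeff, Complex.conj_im]
    rw [← integral_neg]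
    refine integral_congr_ae ?_
    filter_upwards [ha.conj_eq l hl] with ω h
    rw [h, Complex.conj_im]; ring

theorem inner_linForm_right (ha : IsWaveCoefficients a P) {s : Finset (ℤ × ℤ)}
    (hs : ∀ l ∈ s, l ≠ 0) (z : ℤ × ℤ → ℂ) (ζ : Lp ℝ 2 P) :
    inner ℝ ζ ((memLp_linForm ha hs z).toLp _) = ∑ l ∈ s, (z l * waveCoeff a P ζ l).re := by
  have h1 : ∀ l ∈ s, Integrable (fun ω => ζ ω * (a l ω).re) P := fun l hl =>
    (Lp.memLp ζ).integrable_mul (memLp_re ha (hs l hl))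
  have h2 : ∀ l ∈ s, Integrable (fun ω => ζ ω * (a l ω).im) P := fun l hl =>
    (Lp.memLp ζ).integrable_mul (memLp_im ha (hs l hl))
  rw [L2_inner_eq]
  calc _ = ∫ ω, ∑ l ∈ s, ((z l).re * (ζ ω * (a l ω).re) - (z l).im * (ζ ω * (a l ω).im)) ∂P := by
        refine integral_congr_ae ?_
        filter_upwards [(memLp_linForm ha hs z).coeFn_toLp] with ω h
        rw [h, linForm, Finset.mul_sum]
        refine Finset.sum_congr rfl fun l _ => ?_
        rw [Complex.mul_re]; ring
    _ = _ := by
        rw [integral_finsetSum _ fun l hl => integrable_fun_sub ((h1 l hl).const_mul _)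
          ((h2 l hl).const_mul _)]
        refine Finset.sum_congr rfl fun l hl => ?_
        rw [integral_sub ((h1 l hl).const_mul _) ((h2 l hl).const_mul _), integral_const_mul,
          integral_const_mul, Complex.mul_re]
        rfl

theorem integral_sq_gaussianReal_half : ∫ x : ℝ, x ^ 2 ∂(gaussianReal 0 (1 / 2)) = 1 / 2 := by
  have h := variance_id_gaussianReal (μ := 0) (v := 1 / 2)
  rw [variance_eq_integral aemeasurable_id] at h
  simpa using h

/-- `E[Re(w a_λ) Re(z a_μ)]`. -/
theorem integral_re_mul_mul_re_mul (ha : IsWaveCoefficients a P) {l m : ℤ × ℤ} (hl : l ≠ 0)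
    (hm : m ≠ 0) (w z : ℂ) :
    ∫ ω, (w * a l ω).re * (z * a m ω).re ∂P
      = (if m = l then (1 / 2) * (w * (starRingEnd ℂ) z).re else 0)
        + (if m = -l then (1 / 2) * (w * z).re else 0) := by
  have hne : l ≠ -l := fun h => hl (by
    have h1 := congrArg Prod.fst h
    have h2 := congrArg Prod.snd h
    simp only [Prod.fst_neg, Prod.snd_neg] at h1 h2
    exact Prod.ext (by simp; omega) (by simp; omega))
  have same : ∀ w z : ℂ, ∫ ω, (w * a l ω).re * (z * a l ω).re ∂P
      = (1 / 2) * (w * (starRingEnd ℂ) z).re := by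
    intro w z
    have hr := memLp_re ha hl
    have hi := memLp_im ha hl
    have i1 : Integrable (fun ω => (a l ω).re ^ 2) P := hr.integrable_sq
    have i2 : Integrable (fun ω => (a l ω).im ^ 2) P := hi.integrable_sq
    have i3 : Integrable (fun ω => (a l ω).re * (a l ω).im) P := hr.integrable_mul hi
    have e1 : ∫ ω, (a l ω).re ^ 2 ∂P = 1 / 2 := by
      rw [← integral_sq_gaussianReal_half,
        ← (ha.law_re l hl).integral_comp (f := fun x => x ^ 2) (by fun_prop)]
      rfl
    have e2 : ∫ ω, (a l ω).im ^ 2 ∂P = 1 / 2 := by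
      rw [← integral_sq_gaussianReal_half,
        ← (ha.law_im l hl).integral_comp (f := fun x => x ^ 2) (by fun_prop)]
      rfl
    have e3 : ∫ ω, (a l ω).re * (a l ω).im ∂P = 0 := by
      have := (ha.indep_re_im l hl).integral_fun_mul_eq_mul_integral hr.1 hi.1
      rw [this, ha.integral_re hl, zero_mul]
    calc _ = ∫ ω, (w.re * z.re * (a l ω).re ^ 2 + w.im * z.im * (a l ω).im ^ 2)
          - (w.re * z.im + w.im * z.re) * ((a l ω).re * (a l ω).im) ∂P := by
          refine integral_congr_ae (ae_of_all _ fun ω => ?_)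
          simp only [Complex.mul_re]; ring
      _ = _ := by
          rw [integral_sub ((i1.const_mul _).fun_add (i2.const_mul _)) (i3.const_mul _),
            integral_add (i1.const_mul _) (i2.const_mul _), integral_const_mul, integral_const_mul,
            integral_const_mul, e1, e2, e3]
          simp only [Complex.mul_re, Complex.conj_re, Complex.conj_im]
          ring
  by_cases h1 : m = l
  · subst h1
    rw [if_pos rfl, if_neg hne, add_zero]
    exact same w z
  · rw [if_neg h1, zero_add]
    by_cases h2 : m = -l
    · subst h2
      rw [if_pos rfl]
      have : ∫ ω, (w * a l ω).re * (z * a (-l) ω).re ∂P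
          = ∫ ω, (w * a l ω).re * ((starRingEnd ℂ) z * a l ω).re ∂P := by
        refine integral_congr_ae ?_
        filter_upwards [ha.conj_eq l hl] with ω h
        rw [h]
        simp [Complex.mul_re]
      rw [this, same, Complex.conj_conj]
    · rw [if_neg h2]
      -- Once m = ±l is excluded the pair contains no opposite frequencies, so the two coefficients
      -- are independent and centred.
      have hs : ∀ k ∈ ({l, m} : Set (ℤ × ℤ)), -k ∉ ({l, m} : Set (ℤ × ℤ)) := by
        rintro k (rfl | rfl)
        · rintro (h | h)
          · exact hne h.symm
          · exact h2 h.symm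
        · rintro (h | h)
          · exact h2 (neg_eq_iff_eq_neg.1 h)
          · have h : -k = k := h
            have e1 := congrArg Prod.fst h
            have e2 := congrArg Prod.snd h
            simp only [Prod.fst_neg, Prod.snd_neg] at e1 e2
            exact hm (Prod.ext (by simp; omega) (by simp; omega))
      have hind := (ha.indep {l, m} hs).indepFun
        (i := ⟨l, by simp⟩) (j := ⟨m, by simp⟩) (by simpa using Ne.symm h1)
      have hind2 : IndepFun (fun ω => (w * a l ω).re) (fun ω => (z * a m ω).re) P :=
        hind.comp (φ := fun x : ℂ => (w * x).re) (ψ := fun x : ℂ => (z * x).re)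
          (by fun_prop) (by fun_prop)
      rw [hind2.integral_fun_mul_eq_mul_integral (memLp_re_mul ha hl w).1 (memLp_re_mul ha hm z).1,
        ha.integral_re_mul hl, zero_mul]

/-- Each frequency correlates with itself and with its opposite. The two contributions are one half
each, and they agree because the coefficients z have the conjugation symmetry. -/
theorem inner_linForm (ha : IsWaveCoefficients a P) {s : Finset (ℤ × ℤ)} (hs : ∀ l ∈ s, l ≠ 0)
    (hneg : ∀ l ∈ s, -l ∈ s) {w z : ℤ × ℤ → ℂ} (hz : ∀ l ∈ s, z (-l) = (starRingEnd ℂ) (z l)) :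
    inner ℝ ((memLp_linForm ha hs w).toLp _) ((memLp_linForm ha hs z).toLp _)
      = ∑ l ∈ s, (w l * (starRingEnd ℂ) (z l)).re := by
  have hint : ∀ l ∈ s, ∀ m ∈ s, Integrable (fun ω => (w l * a l ω).re * (z m * a m ω).re) P :=
    fun l hl m hm => (memLp_re_mul ha (hs l hl) _).integrable_mul (memLp_re_mul ha (hs m hm) _)
  rw [L2_inner_eq]
  calc _ = ∫ ω, ∑ l ∈ s, ∑ m ∈ s, (w l * a l ω).re * (z m * a m ω).re ∂P := by
        refine integral_congr_ae ?_
        filter_upwards [(memLp_linForm ha hs w).coeFn_toLp, (memLp_linForm ha hs z).coeFn_toLp]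
          with ω h1 h2
        rw [h1, h2, linForm, linForm, Finset.sum_mul_sum]
    _ = ∑ l ∈ s, ∑ m ∈ s, ∫ ω, (w l * a l ω).re * (z m * a m ω).re ∂P := by
        rw [integral_finsetSum _ fun l hl => integrable_finsetSum _ fun m hm => hint l hl m hm]
        exact Finset.sum_congr rfl fun l hl => integral_finsetSum _ fun m hm => hint l hl m hm
    _ = _ := by
        refine Finset.sum_congr rfl fun l hl => ?_
        rw [Finset.sum_congr rfl fun m hm => integral_re_mul_mul_re_mul ha (hs l hl) (hs m hm) _ _,
          Finset.sum_add_distrib, Finset.sum_ite_eq' s l, Finset.sum_ite_eq' s (-l), if_pos hl,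
          if_pos (hneg l hl), hz l hl]
        ring

end LinForm

/-! ### Symmetries of the frequency set -/

theorem neg_mem_freq {n : ℕ} {l : ℤ × ℤ} (h : l ∈ freq n) : -l ∈ freq n := by
  rw [mem_freq] at *
  simpa using h

theorem swap_mem_freq {n : ℕ} {l : ℤ × ℤ} (h : l ∈ freq n) : l.swap ∈ freq n := by
  rw [mem_freq] at *
  simpa [add_comm] using h

theorem reflect_mem_freq {n : ℕ} {l : ℤ × ℤ} (h : l ∈ freq n) : (l.1, -l.2) ∈ freq n := by
  rw [mem_freq] at *
  simpa using h

theorem ne_zero_of_mem_freq {n : ℕ} (hn : 0 < n) {l : ℤ × ℤ} (h : l ∈ freq n) : l ≠ 0 := by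
  rintro rfl
  rw [mem_freq] at h
  simp at h
  omega

theorem freq_ne_zero {n : ℕ} (hn : 0 < n) : ∀ l ∈ freq n, l ≠ 0 :=
  fun _ => ne_zero_of_mem_freq hn

theorem sum_freq_neg {M : Type*} [AddCommMonoid M] (n : ℕ) (f : ℤ × ℤ → M) :
    ∑ l ∈ freq n, f (-l) = ∑ l ∈ freq n, f l :=
  Finset.sum_bij' (fun l _ => -l) (fun l _ => -l) (fun _ h => neg_mem_freq h)
    (fun _ h => neg_mem_freq h) (by simp) (by simp) (by simp)

theorem sum_freq_swap {M : Type*} [AddCommMonoid M] (n : ℕ) (f : ℤ × ℤ → M) :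
    ∑ l ∈ freq n, f l.swap = ∑ l ∈ freq n, f l :=
  Finset.sum_bij' (fun l _ => l.swap) (fun l _ => l.swap) (fun _ h => swap_mem_freq h)
    (fun _ h => swap_mem_freq h) (by simp) (by simp) (by simp)

theorem sum_freq_reflect {M : Type*} [AddCommMonoid M] (n : ℕ) (f : ℤ × ℤ → M) :
    ∑ l ∈ freq n, f (l.1, -l.2) = ∑ l ∈ freq n, f l :=
  Finset.sum_bij' (fun l _ => (l.1, -l.2)) (fun l _ => (l.1, -l.2)) (fun _ h => reflect_mem_freq h)
    (fun _ h => reflect_mem_freq h) (by simp) (by simp) (by simp)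

theorem sum_freq_norm (n : ℕ) {l : ℤ × ℤ} (h : l ∈ freq n) : (l.1 : ℝ) ^ 2 + (l.2 : ℝ) ^ 2 = n := by
  rw [mem_freq] at h
  exact_mod_cast h

/-- Exchange of coordinates preserves the lattice points, so the two squared coordinates share the
total n N equally. This isotropy gives both partial derivatives of the wave the same variance. -/
theorem sum_freq_sq_fst (n : ℕ) : ∑ l ∈ freq n, (l.1 : ℝ) ^ 2 = n * freqCard n / 2 := by
  have h1 := sum_freq_swap n fun l => (l.1 : ℝ) ^ 2
  have h2 : ∑ l ∈ freq n, ((l.1 : ℝ) ^ 2 + (l.2 : ℝ) ^ 2) = ∑ _l ∈ freq n, (n : ℝ) :=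
    Finset.sum_congr rfl fun l hl => sum_freq_norm n hl
  simp only [Prod.fst_swap] at h1
  rw [Finset.sum_add_distrib, Finset.sum_const, h1, nsmul_eq_mul] at h2
  rw [freqCard]
  linarith

theorem sum_freq_sq_snd (n : ℕ) : ∑ l ∈ freq n, (l.2 : ℝ) ^ 2 = n * freqCard n / 2 := by
  rw [← sum_freq_sq_fst, ← sum_freq_swap]
  rfl

theorem sum_freq_mul (n : ℕ) : ∑ l ∈ freq n, (l.1 : ℝ) * l.2 = 0 := by
  have h1 := sum_freq_reflect n fun l => (l.1 : ℝ) * l.2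
  simp only [Int.cast_neg, mul_neg, Finset.sum_neg_distrib] at h1
  linarith

theorem freq_nonempty {n : ℕ} (hn : n ∈ sumTwoSquares) : (freq n).Nonempty := by
  obtain ⟨_, x, y, h⟩ := hn
  exact ⟨(x, y), (mem_freq n _).2 h.symm⟩

theorem freqCard_pos {n : ℕ} (hn : n ∈ sumTwoSquares) : 0 < freqCard n :=
  Finset.card_pos.2 (freq_nonempty hn)

/-! ### The wave and its derivatives at a point -/

section Wave

variable {Ω : Type*} [MeasurableSpace Ω] {P : Measure Ω} [IsProbabilityMeasure P]
  {a : ℤ × ℤ → Ω → ℂ}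

/-- The standard deviation of the partial derivatives of the wave. -/
noncomputable def derivScale (n : ℕ) : ℝ := √(2 * n) * Real.pi

theorem derivScale_pos {n : ℕ} (hn : 0 < n) : 0 < derivScale n := by
  unfold derivScale
  have := Real.pi_pos
  positivity

theorem derivScale_sq (n : ℕ) : derivScale n ^ 2 = 2 * Real.pi ^ 2 * n := by
  rw [derivScale, mul_pow, Real.sq_sqrt (by positivity)]; ring

/-- Coefficients of the wave and of its normalised partial derivatives at the point `p`. -/
noncomputable def jetCoeff (n : ℕ) (p : ℝ × ℝ) : Fin 3 → ℤ × ℤ → ℂ :=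
  ![fun l => ((√(freqCard n : ℝ))⁻¹ : ℝ) * planeExp l p,
    fun l => ((√(freqCard n : ℝ))⁻¹ * (2 * Real.pi * l.1 / derivScale n) : ℝ) * Complex.I
      * planeExp l p,
    fun l => ((√(freqCard n : ℝ))⁻¹ * (2 * Real.pi * l.2 / derivScale n) : ℝ) * Complex.I
      * planeExp l p]

theorem planeExp_neg (l : ℤ × ℤ) (p : ℝ × ℝ) :
    planeExp (-l) p = (starRingEnd ℂ) (planeExp l p) := by
  rw [planeExp, planeExp, ← Complex.exp_conj]
  congr 1
  simp only [map_mul, Complex.conj_ofReal, Complex.conj_I, Prod.fst_neg, Prod.snd_neg]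
  push_cast; ring

theorem norm_planeExp (l : ℤ × ℤ) (p : ℝ × ℝ) : ‖planeExp l p‖ = 1 := by
  rw [planeExp, Complex.norm_exp_ofReal_mul_I]

theorem planeExp_mul_conj (l : ℤ × ℤ) (p : ℝ × ℝ) :
    planeExp l p * (starRingEnd ℂ) (planeExp l p) = 1 := by
  rw [Complex.mul_conj, Complex.normSq_eq_norm_sq, norm_planeExp]; simp

theorem jetCoeff_neg (n : ℕ) (p : ℝ × ℝ) (i : Fin 3) (l : ℤ × ℤ) :
    jetCoeff n p i (-l) = (starRingEnd ℂ) (jetCoeff n p i l) := by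
  fin_cases i <;> simp [jetCoeff, planeExp_neg, Complex.conj_ofNat] <;> ring

/-- The wave and its normalised partial derivatives at the point `p`. -/
noncomputable def jet (ha : IsWaveCoefficients a P) {n : ℕ} (hn : 0 < n) (p : ℝ × ℝ) (i : Fin 3) :
    Lp ℝ 2 P :=
  (memLp_linForm ha (freq_ne_zero hn)
    (jetCoeff n p i)).toLp _

theorem jet_mem (ha : IsWaveCoefficients a P) {n : ℕ} (hn : 0 < n) (p : ℝ × ℝ) (i : Fin 3) :
    jet ha hn p i ∈ gaussianSpace a P := linForm_mem ha (freq_ne_zero hn) _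

/-- Covariances are sums over lattice points in which the exponentials cancel. The value and a
derivative are orthogonal because their products are purely imaginary; the derivatives are
orthogonal to each other by reflection, and have unit norm by isotropy and the choice of
`derivScale`. -/
theorem orthonormal_jet (ha : IsWaveCoefficients a P) {n : ℕ} (hn : n ∈ sumTwoSquares)
    (p : ℝ × ℝ) : Orthonormal ℝ (jet ha hn.1 p) := by
  have hN : (0 : ℝ) < freqCard n := by exact_mod_cast freqCard_pos hn
  have hn0 : (0 : ℝ) < n := by exact_mod_cast hn.1
  have hk := derivScale_pos hn.1
  have hk2 := derivScale_sq n
  have hpi := Real.pi_pos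
  rw [orthonormal_iff_ite]
  have hsq : (√(freqCard n : ℝ))⁻¹ ^ 2 = (freqCard n : ℝ)⁻¹ := by
    rw [inv_pow, Real.sq_sqrt hN.le]
  have key : ∀ (x y e : ℂ), e * (starRingEnd ℂ) e = 1 →
      (x * e * (starRingEnd ℂ) (y * e)).re = (x * (starRingEnd ℂ) y).re := by
    intro x y e he
    have : x * e * (starRingEnd ℂ) (y * e) = x * (starRingEnd ℂ) y * (e * (starRingEnd ℂ) e) := by
      rw [map_mul]; ring
    rw [this, he, mul_one]
  have hval : ∀ i j, inner ℝ (jet ha hn.1 p i) (jet ha hn.1 p j)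
      = ∑ l ∈ freq n, (jetCoeff n p i l * (starRingEnd ℂ) (jetCoeff n p j l)).re := fun i j =>
    inner_linForm ha (freq_ne_zero hn.1) (fun l hl => neg_mem_freq hl) fun l _ => jetCoeff_neg n p j l
  have h00 : ∑ l ∈ freq n, (jetCoeff n p 0 l * (starRingEnd ℂ) (jetCoeff n p 0 l)).re = 1 := by
    have : ∀ l ∈ freq n, (jetCoeff n p 0 l * (starRingEnd ℂ) (jetCoeff n p 0 l)).re
        = (freqCard n : ℝ)⁻¹ := fun l _ => by
      simp only [jetCoeff, Matrix.cons_val]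
      rw [key _ _ _ (planeExp_mul_conj l p), Complex.conj_ofReal, ← Complex.ofReal_mul,
        Complex.ofReal_re, ← hsq, pow_two]
    rw [Finset.sum_congr rfl this, Finset.sum_const, nsmul_eq_mul]
    exact mul_inv_cancel₀ hN.ne'
  have h11 : ∑ l ∈ freq n, (jetCoeff n p 1 l * (starRingEnd ℂ) (jetCoeff n p 1 l)).re = 1 := by
    have : ∀ l ∈ freq n, (jetCoeff n p 1 l * (starRingEnd ℂ) (jetCoeff n p 1 l)).re
        = (freqCard n : ℝ)⁻¹ * (4 * Real.pi ^ 2 / derivScale n ^ 2) * (l.1 : ℝ) ^ 2 := fun l _ => by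
      simp only [jetCoeff, Matrix.cons_val]
      rw [key _ _ _ (planeExp_mul_conj l p), ← hsq]
      simp [Complex.mul_re]
      field_simp
      rw [Real.sq_sqrt hN.le]; ring
    rw [Finset.sum_congr rfl this, ← Finset.mul_sum, sum_freq_sq_fst, hk2]
    field_simp; norm_num
  have h22 : ∑ l ∈ freq n, (jetCoeff n p 2 l * (starRingEnd ℂ) (jetCoeff n p 2 l)).re = 1 := by
    have : ∀ l ∈ freq n, (jetCoeff n p 2 l * (starRingEnd ℂ) (jetCoeff n p 2 l)).re
        = (freqCard n : ℝ)⁻¹ * (4 * Real.pi ^ 2 / derivScale n ^ 2) * (l.2 : ℝ) ^ 2 := fun l _ => by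
      simp only [jetCoeff, Matrix.cons_val]
      rw [key _ _ _ (planeExp_mul_conj l p), ← hsq]
      simp [Complex.mul_re]
      field_simp
      rw [Real.sq_sqrt hN.le]; ring
    rw [Finset.sum_congr rfl this, ← Finset.mul_sum, sum_freq_sq_snd, hk2]
    field_simp; norm_num
  have h12 : ∑ l ∈ freq n, (jetCoeff n p 1 l * (starRingEnd ℂ) (jetCoeff n p 2 l)).re = 0 := by
    have : ∀ l ∈ freq n, (jetCoeff n p 1 l * (starRingEnd ℂ) (jetCoeff n p 2 l)).re
        = (freqCard n : ℝ)⁻¹ * (4 * Real.pi ^ 2 / derivScale n ^ 2) * ((l.1 : ℝ) * l.2) :=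
        fun l _ => by
      simp only [jetCoeff, Matrix.cons_val]
      rw [key _ _ _ (planeExp_mul_conj l p), ← hsq]
      simp [Complex.mul_re]
      field_simp
      rw [Real.sq_sqrt hN.le]; ring
    rw [Finset.sum_congr rfl this, ← Finset.mul_sum, sum_freq_mul, mul_zero]
  have h01 : ∑ l ∈ freq n, (jetCoeff n p 0 l * (starRingEnd ℂ) (jetCoeff n p 1 l)).re = 0 := by
    refine Finset.sum_eq_zero fun l _ => ?_
    simp only [jetCoeff, Matrix.cons_val]
    rw [key _ _ _ (planeExp_mul_conj l p)]
    simp [Complex.mul_re]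
  have h02 : ∑ l ∈ freq n, (jetCoeff n p 0 l * (starRingEnd ℂ) (jetCoeff n p 2 l)).re = 0 := by
    refine Finset.sum_eq_zero fun l _ => ?_
    simp only [jetCoeff, Matrix.cons_val]
    rw [key _ _ _ (planeExp_mul_conj l p)]
    simp [Complex.mul_re]
  intro i j
  have hsymm := fun i j => real_inner_comm (jet ha hn.1 p i) (jet ha hn.1 p j)
  fin_cases i <;> fin_cases j
  · exact (hval 0 0).trans h00
  · exact (hval 0 1).trans h01
  · exact (hval 0 2).trans h02
  · exact (hsymm 0 1).trans ((hval 0 1).trans h01)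
  · exact (hval 1 1).trans h11
  · exact (hval 1 2).trans h12
  · exact (hsymm 0 2).trans ((hval 0 2).trans h02)
  · exact (hsymm 1 2).trans ((hval 1 2).trans h12)
  · exact (hval 2 2).trans h22

/-- The wave on `ℝ × ℝ`. -/
noncomputable def planeWave (a : ℤ × ℤ → Ω → ℂ) (n : ℕ) (ω : Ω) : ℝ × ℝ → ℝ :=
  trigSum (freq n) fun l => ((√(freqCard n : ℝ))⁻¹ : ℝ) * a l ω

/-- The first partial derivative of the wave. -/
noncomputable def planeWaveX (a : ℤ × ℤ → Ω → ℂ) (n : ℕ) (ω : Ω) : ℝ × ℝ → ℝ :=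
  trigSum (freq n) (coeffX fun l => ((√(freqCard n : ℝ))⁻¹ : ℝ) * a l ω)

/-- The second partial derivative of the wave. -/
noncomputable def planeWaveY (a : ℤ × ℤ → Ω → ℂ) (n : ℕ) (ω : Ω) : ℝ × ℝ → ℝ :=
  trigSum (freq n) (coeffY fun l => ((√(freqCard n : ℝ))⁻¹ : ℝ) * a l ω)

theorem wave_eq_planeWave (a : ℤ × ℤ → Ω → ℂ) (n : ℕ) (ω : Ω) (x : EuclideanSpace ℝ (Fin 2)) :
    wave a n ω x = planeWave a n ω (x 0, x 1) := by
  rw [wave, planeWave, trigSum, Finset.mul_sum, Complex.re_sum]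
  refine Finset.sum_congr rfl fun l _ => ?_
  rw [← mul_assoc, Complex.ofReal_inv]
  congr 3
  rw [torusExp, planeExp]
  congr 1
  push_cast; ring

theorem jet_zero_ae (ha : IsWaveCoefficients a P) {n : ℕ} (hn : 0 < n) (p : ℝ × ℝ) :
    ∀ᵐ ω ∂P, jet ha hn p 0 ω = planeWave a n ω p := by
  filter_upwards [(memLp_linForm ha (freq_ne_zero hn)
    (jetCoeff n p 0)).coeFn_toLp] with ω h
  rw [jet, h, linForm, planeWave, trigSum]
  refine Finset.sum_congr rfl fun l _ => ?_
  simp only [jetCoeff, Matrix.cons_val]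
  rw [mul_right_comm]

theorem jet_one_ae (ha : IsWaveCoefficients a P) {n : ℕ} (hn : 0 < n) (p : ℝ × ℝ) :
    ∀ᵐ ω ∂P, jet ha hn p 1 ω = planeWaveX a n ω p / derivScale n := by
  filter_upwards [(memLp_linForm ha (freq_ne_zero hn)
    (jetCoeff n p 1)).coeFn_toLp] with ω h
  rw [jet, h, linForm, planeWaveX, trigSum, Finset.sum_div]
  refine Finset.sum_congr rfl fun l _ => ?_
  simp only [jetCoeff, Matrix.cons_val, coeffX]
  rw [← Complex.div_ofReal_re]
  congr 1
  push_cast; ring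

theorem jet_two_ae (ha : IsWaveCoefficients a P) {n : ℕ} (hn : 0 < n) (p : ℝ × ℝ) :
    ∀ᵐ ω ∂P, jet ha hn p 2 ω = planeWaveY a n ω p / derivScale n := by
  filter_upwards [(memLp_linForm ha (freq_ne_zero hn)
    (jetCoeff n p 2)).coeFn_toLp] with ω h
  rw [jet, h, linForm, planeWaveY, trigSum, Finset.sum_div]
  refine Finset.sum_congr rfl fun l _ => ?_
  simp only [jetCoeff, Matrix.cons_val, coeffY]
  rw [← Complex.div_ofReal_re]
  congr 1
  push_cast; ring

end Wave

/-! ### Almost sure regularity of the nodal set -/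

theorem gaussianReal_Icc_le {t : ℝ} (ht : 0 ≤ t) :
    gaussianReal 0 1 (Set.Icc (-t) t) ≤ ENNReal.ofReal t := by
  rw [gaussianReal_apply 0 one_ne_zero]
  calc ∫⁻ x in Set.Icc (-t) t, gaussianPDF 0 1 x
      ≤ ∫⁻ _ in Set.Icc (-t) t, ENNReal.ofReal (1 / 2) := by
        refine lintegral_mono fun x => ENNReal.ofReal_le_ofReal ?_
        rw [gaussianPDFReal]
        have h1 : (2 : ℝ) ≤ √(2 * Real.pi * (1 : ℝ≥0)) := by
          refine Real.le_sqrt_of_sq_le ?_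
          have := Real.pi_gt_three
          simp; linarith
        have h2 : (√(2 * Real.pi * (1 : ℝ≥0)))⁻¹ ≤ 1 / 2 := by
          rw [inv_le_comm₀ (by linarith) (by norm_num)]; simpa using h1
        have h3 : Real.exp (-(x - 0) ^ 2 / (2 * (1 : ℝ≥0))) ≤ 1 := by
          refine Real.exp_le_one_iff.2 ?_
          simp only [sub_zero, NNReal.coe_one, mul_one]
          have := sq_nonneg x
          linarith
        exact (mul_le_mul h2 h3 (Real.exp_pos _).le (by norm_num)).trans (by norm_num)
    _ = ENNReal.ofReal t := by
        rw [setLIntegral_const, Real.volume_Icc, ← ENNReal.ofReal_mul (by norm_num)]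
        congr 1; ring

theorem abs_trigSum_sub_le {n : ℕ} (c : ℤ × ℤ → ℂ) (p q : ℝ × ℝ) :
    |trigSum (freq n) c p - trigSum (freq n) c q|
      ≤ 4 * Real.pi * n * (∑ l ∈ freq n, ‖c l‖) * dist p q := by
  rw [trigSum, trigSum, ← Finset.sum_sub_distrib, Finset.mul_sum, Finset.sum_mul]
  refine (Finset.abs_sum_le_sum_abs _ _).trans (Finset.sum_le_sum fun l hl => ?_)
  have hpi := Real.pi_pos
  have h1 : ‖planeExp l p - planeExp l q‖
      ≤ |2 * Real.pi * (l.1 * p.1 + l.2 * p.2) - 2 * Real.pi * (l.1 * q.1 + l.2 * q.2)| := by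
    set s := 2 * Real.pi * (l.1 * p.1 + l.2 * p.2)
    set t := 2 * Real.pi * (l.1 * q.1 + l.2 * q.2)
    have e : planeExp l p - planeExp l q
        = planeExp l q * (Complex.exp (Complex.I * ((s - t : ℝ) : ℂ)) - 1) := by
      rw [mul_sub, mul_one, planeExp, planeExp, ← Complex.exp_add]
      congr 2
      simp only [s, t]
      push_cast; ring
    rw [e, norm_mul, norm_planeExp, one_mul]
    exact Real.norm_exp_I_mul_ofReal_sub_one_le
  have h2 : |2 * Real.pi * (l.1 * p.1 + l.2 * p.2) - 2 * Real.pi * (l.1 * q.1 + l.2 * q.2)|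
      ≤ 4 * Real.pi * n * dist p q := by
    have e1 : |(l.1 : ℝ)| ≤ n := by exact_mod_cast (abs_le_of_mem_freq hl).1
    have e2 : |(l.2 : ℝ)| ≤ n := by exact_mod_cast (abs_le_of_mem_freq hl).2
    have e3 : |p.1 - q.1| ≤ dist p q := le_max_left _ _
    have e4 : |p.2 - q.2| ≤ dist p q := le_max_right _ _
    calc _ = 2 * Real.pi * |l.1 * (p.1 - q.1) + l.2 * (p.2 - q.2)| := by
          rw [← abs_of_pos (by positivity : 0 < 2 * Real.pi), ← abs_mul,
            abs_of_pos (by positivity : 0 < 2 * Real.pi)]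
          congr 1; ring
      _ ≤ 2 * Real.pi * (n * dist p q + n * dist p q) := by
          gcongr
          refine (abs_add_le _ _).trans ?_
          rw [abs_mul, abs_mul]
          gcongr
      _ = _ := by ring
  rw [← Complex.sub_re, ← mul_sub]
  calc _ ≤ ‖c l * (planeExp l p - planeExp l q)‖ := Complex.abs_re_le_norm _
    _ ≤ ‖c l‖ * (4 * Real.pi * n * dist p q) := by
        rw [norm_mul]
        gcongr
        exact h1.trans h2
    _ = _ := by ring

section Regular

variable {Ω : Type*} [MeasurableSpace Ω] {P : Measure Ω} [IsProbabilityMeasure P]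
  {a : ℤ × ℤ → Ω → ℂ}

theorem jet_ae (ha : IsWaveCoefficients a P) {n : ℕ} (hn : 0 < n) (p : ℝ × ℝ) :
    ∀ᵐ ω ∂P, (fun i => jet ha hn p i ω) = ![planeWave a n ω p, planeWaveX a n ω p / derivScale n,
      planeWaveY a n ω p / derivScale n] := by
  filter_upwards [jet_zero_ae ha hn p, jet_one_ae ha hn p, jet_two_ae ha hn p] with ω h0 h1 h2
  ext i
  fin_cases i
  · exact h0
  · exact h1
  · exact h2

theorem hasLaw_jet (ha : IsWaveCoefficients a P) {n : ℕ} (hn : n ∈ sumTwoSquares) (p : ℝ × ℝ) :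
    HasLaw (fun ω => ![planeWave a n ω p, planeWaveX a n ω p / derivScale n,
      planeWaveY a n ω p / derivScale n]) (Measure.pi fun _ : Fin 3 => gaussianReal 0 1) P :=
  (hasLaw_pi_of_orthonormal ha (jet_mem ha hn.1 p) (orthonormal_jet ha hn p)).congr
    ((jet_ae ha hn.1 p).mono fun _ h => h.symm)

/-- Three independent standard Gaussians each lie in [-t, t] with probability at most t. The
exponent three exceeds the dimension two of the torus, which is what rules out singular zeros. -/
theorem measure_jet_le (ha : IsWaveCoefficients a P) {n : ℕ} (hn : n ∈ sumTwoSquares) (p : ℝ × ℝ)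
    {t : ℝ} (ht : 0 ≤ t) :
    P {ω | |planeWave a n ω p| ≤ t ∧ |planeWaveX a n ω p / derivScale n| ≤ t ∧
      |planeWaveY a n ω p / derivScale n| ≤ t} ≤ ENNReal.ofReal t ^ 3 := by
  have h := hasLaw_jet ha hn p
  have hm : MeasurableSet (Set.univ.pi fun _ : Fin 3 => Set.Icc (-t) t) :=
    MeasurableSet.univ_pi fun _ => measurableSet_Icc
  have h1 : P {ω | |planeWave a n ω p| ≤ t ∧ |planeWaveX a n ω p / derivScale n| ≤ t ∧
      |planeWaveY a n ω p / derivScale n| ≤ t}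
      = (Measure.pi fun _ : Fin 3 => gaussianReal 0 1)
        (Set.univ.pi fun _ : Fin 3 => Set.Icc (-t) t) := by
    rw [← h.map_eq, Measure.map_apply_of_aemeasurable h.aemeasurable hm]
    congr 1
    ext ω
    simp only [Set.mem_preimage, Set.mem_univ_pi, Set.mem_Icc, ← abs_le, Fin.forall_fin_succ]
    simp
  rw [h1, Measure.pi_pi]
  simp only [Finset.prod_const, Finset.card_univ, Fintype.card_fin]
  exact pow_le_pow_left' (gaussianReal_Icc_le ht) 3

theorem measure_planeWave_eq_zero (ha : IsWaveCoefficients a P) {n : ℕ} (hn : n ∈ sumTwoSquares)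
    (p : ℝ × ℝ) : P {ω | planeWave a n ω p = 0} = 0 := by
  have h := hasLaw_jet ha hn p
  have h0 : HasLaw (fun ω => planeWave a n ω p) (gaussianReal 0 1) P :=
    HasLaw.comp (Y := fun u : Fin 3 → ℝ => u 0)
      ⟨(measurable_pi_apply 0).aemeasurable,
        (measurePreserving_eval (fun _ : Fin 3 => gaussianReal 0 1) 0).map_eq⟩ h
  have hm : MeasurableSet ({0} : Set ℝ) := measurableSet_singleton 0
  have h1 : P {ω | planeWave a n ω p = 0} = gaussianReal 0 1 {0} := by
    rw [← h0.map_eq, Measure.map_apply_of_aemeasurable h0.aemeasurable hm]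
    rfl
  rw [h1]
  have := nullSingletonClass_gaussianReal (μ := 0) (v := 1) one_ne_zero
  exact measure_singleton 0

theorem measurable_trigSum_prod {s : Finset (ℤ × ℤ)} {c : Ω → ℤ × ℤ → ℂ}
    (hc : ∀ l, Measurable fun ω => c ω l) :
    Measurable fun q : Ω × (ℝ × ℝ) => trigSum s (c q.1) q.2 := by
  unfold trigSum planeExp
  refine Finset.measurable_sum _ fun l _ => ?_
  have h2 : Measurable fun q : Ω × (ℝ × ℝ) => c q.1 l := (hc l).comp measurable_fst
  fun_prop

theorem measurable_planeWave (ha : IsWaveCoefficients a P) (n : ℕ) :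
    Measurable fun q : Ω × (ℝ × ℝ) => planeWave a n q.1 q.2 :=
  measurable_trigSum_prod (c := fun ω l => ((√(freqCard n : ℝ))⁻¹ : ℝ) * a l ω)
    fun l => (ha.measurable l).const_mul _

theorem measurable_planeWaveX (ha : IsWaveCoefficients a P) (n : ℕ) :
    Measurable fun q : Ω × (ℝ × ℝ) => planeWaveX a n q.1 q.2 :=
  measurable_trigSum_prod (c := fun ω => coeffX fun l => ((√(freqCard n : ℝ))⁻¹ : ℝ) * a l ω)
    fun l => by
      have := ha.measurable l
      unfold coeffX
      fun_prop

theorem measurable_planeWaveY (ha : IsWaveCoefficients a P) (n : ℕ) :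
    Measurable fun q : Ω × (ℝ × ℝ) => planeWaveY a n q.1 q.2 :=
  measurable_trigSum_prod (c := fun ω => coeffY fun l => ((√(freqCard n : ℝ))⁻¹ : ℝ) * a l ω)
    fun l => by
      have := ha.measurable l
      unfold coeffY
      fun_prop

/-- The wave vanishes with probability zero at any given point, so Fubini makes almost every
realisation nonzero at almost every point of a curve. -/
theorem ae_line_null (ha : IsWaveCoefficients a P) {n : ℕ} (hn : n ∈ sumTwoSquares)
    {γ : ℝ → ℝ × ℝ} (hγ : Measurable γ) :
    ∀ᵐ ω ∂P, volume {x | planeWave a n ω (γ x) = 0} = 0 := by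
  have hm : MeasurableSet {q : ℝ × Ω | planeWave a n q.2 (γ q.1) ≠ 0} := by
    have hmf : Measurable fun q : ℝ × Ω => planeWave a n q.2 (γ q.1) :=
      (measurable_planeWave ha n).comp (g := fun q : Ω × (ℝ × ℝ) => planeWave a n q.1 q.2)
        (f := fun q : ℝ × Ω => (q.2, γ q.1)) (measurable_snd.prodMk (hγ.comp measurable_fst))
    exact (measurableSet_eq_fun hmf measurable_const).compl
  have h1 : ∀ᵐ x ∂(volume : Measure ℝ), ∀ᵐ ω ∂P, planeWave a n ω (γ x) ≠ 0 :=
    ae_of_all _ fun x => by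
      rw [ae_iff]
      simpa using measure_planeWave_eq_zero ha hn (γ x)
  filter_upwards [(Measure.ae_ae_comm hm).1 h1] with ω h
  rw [ae_iff] at h
  simpa using h

/-- Almost surely the wave has no singular zero in the closed unit square. -/
theorem ae_no_singular_zero (ha : IsWaveCoefficients a P) {n : ℕ} (hn : n ∈ sumTwoSquares) :
    ∀ᵐ ω ∂P, ∀ p ∈ Set.Icc (0 : ℝ) 1 ×ˢ Set.Icc (0 : ℝ) 1, planeWave a n ω p = 0 →
      planeWaveX a n ω p ≠ 0 ∨ planeWaveY a n ω p ≠ 0 := by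
  have hpi := Real.pi_gt_three
  have hn1 : (1 : ℝ) ≤ n := by exact_mod_cast hn.1
  have hN : (1 : ℝ) ≤ freqCard n := by exact_mod_cast freqCard_pos hn
  have hk : 1 ≤ derivScale n := by
    have h1 := derivScale_sq n
    have h2 := derivScale_pos hn.1
    nlinarith
  set A : Ω → ℝ := fun ω => ∑ l ∈ freq n, ‖a l ω‖ with hA
  have hA0 : ∀ ω, 0 ≤ A ω := fun ω => Finset.sum_nonneg fun l _ => norm_nonneg _
  -- A common Lipschitz factor for the wave and its normalised derivatives, to be multiplied by the
  -- random sum A of the moduli of the coefficients; each differentiation costs at most 2πn.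
  set B : ℝ := 8 * Real.pi ^ 2 * n ^ 2 with hB
  have hB0 : 0 ≤ B := by positivity
  have hc : ∀ ω l, ‖(((√(freqCard n : ℝ))⁻¹ : ℝ) : ℂ) * a l ω‖ ≤ ‖a l ω‖ := by
    intro ω l
    rw [norm_mul, Complex.norm_real, Real.norm_of_nonneg (by positivity)]
    refine mul_le_of_le_one_left (norm_nonneg _) (inv_le_one_of_one_le₀ ?_)
    exact Real.one_le_sqrt.2 hN
  have hlip0 : ∀ ω p q, |planeWave a n ω p - planeWave a n ω q| ≤ B * A ω * dist p q := by
    intro ω p q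
    refine (abs_trigSum_sub_le _ p q).trans ?_
    gcongr
    · rw [hB]
      have : 1 ≤ Real.pi * n := by nlinarith
      nlinarith [mul_nonneg (by linarith : 0 ≤ Real.pi) (by linarith : 0 ≤ (n : ℝ))]
    · exact Finset.sum_le_sum fun l _ => hc _ _
  have hderiv : ∀ ω p q (k : ℤ × ℤ → ℝ), (∀ l ∈ freq n, |k l| ≤ n) →
      |trigSum (freq n) (fun l => ((2 * Real.pi * k l : ℝ) : ℂ) * Complex.I *
        ((((√(freqCard n : ℝ))⁻¹ : ℝ) : ℂ) * a l ω)) p / derivScale n -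
      trigSum (freq n) (fun l => ((2 * Real.pi * k l : ℝ) : ℂ) * Complex.I *
        ((((√(freqCard n : ℝ))⁻¹ : ℝ) : ℂ) * a l ω)) q / derivScale n| ≤ B * A ω * dist p q := by
    intro ω p q k hkn
    rw [← sub_div, abs_div, abs_of_pos (by linarith : 0 < derivScale n)]
    refine (div_le_self (abs_nonneg _) hk).trans ((abs_trigSum_sub_le _ p q).trans ?_)
    have e : ∑ l ∈ freq n, ‖((2 * Real.pi * k l : ℝ) : ℂ) * Complex.I *
        ((((√(freqCard n : ℝ))⁻¹ : ℝ) : ℂ) * a l ω)‖ ≤ 2 * Real.pi * n * A ω := by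
      rw [hA, Finset.mul_sum]
      refine Finset.sum_le_sum fun l hl => ?_
      rw [norm_mul, norm_mul, Complex.norm_I, mul_one, Complex.norm_real, Real.norm_eq_abs,
        abs_mul, abs_of_pos (by positivity : 0 < 2 * Real.pi)]
      exact mul_le_mul (mul_le_mul_of_nonneg_left (hkn l hl) (by positivity)) (hc ω l)
        (norm_nonneg _) (by positivity)
    calc _ ≤ 4 * Real.pi * n * (2 * Real.pi * n * A ω) * dist p q := by gcongr
      _ = _ := by rw [hB]; ring
  have hlip1 : ∀ ω p q, |planeWaveX a n ω p / derivScale n - planeWaveX a n ω q / derivScale n|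
      ≤ B * A ω * dist p q := fun ω p q => hderiv ω p q (fun l => l.1) fun l hl => by
        exact_mod_cast (abs_le_of_mem_freq hl).1
  have hlip2 : ∀ ω p q, |planeWaveY a n ω p / derivScale n - planeWaveY a n ω q / derivScale n|
      ≤ B * A ω * dist p q := fun ω p q => hderiv ω p q (fun l => l.2) fun l hl => by
        exact_mod_cast (abs_le_of_mem_freq hl).2
  set E : ℕ → Set Ω := fun M => {ω | A ω ≤ M ∧ ∃ p ∈ Set.Icc (0 : ℝ) 1 ×ˢ Set.Icc (0 : ℝ) 1,
    planeWave a n ω p = 0 ∧ planeWaveX a n ω p = 0 ∧ planeWaveY a n ω p = 0} with hE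
  have hnull : ∀ M, P (E M) = 0 := by
    intro M
    -- Bulinskaya's argument: on A ≤ M a singular zero makes the jet at most t = BM/K at a nearby
    -- point of a grid of mesh 1/K. There are at most 4K² grid points, each with probability at most
    -- t³, so the total is O(1/K).
    have hbound : ∀ k : ℕ, P (E M) ≤ ENNReal.ofReal (4 * (B * M) ^ 3 / ((k : ℝ) + 1)) := by
      intro k
      set K : ℝ := (k : ℝ) + 1 with hK
      have hK0 : 0 < K := by positivity
      have hK1 : 1 ≤ K := by rw [hK]; linarith [Nat.cast_nonneg (α := ℝ) k]
      set t : ℝ := B * M / K with ht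
      have ht0 : 0 ≤ t := by positivity
      set G : ℕ × ℕ → Set Ω := fun i => {ω | |planeWave a n ω (i.1 / K, i.2 / K)| ≤ t ∧
        |planeWaveX a n ω (i.1 / K, i.2 / K) / derivScale n| ≤ t ∧
        |planeWaveY a n ω (i.1 / K, i.2 / K) / derivScale n| ≤ t}
      have hsub : E M ⊆ ⋃ i ∈ Finset.range (k + 2) ×ˢ Finset.range (k + 2), G i := by
        rintro ω ⟨hAM, p, ⟨⟨h1, h2⟩, h3, h4⟩, h5, h6, h7⟩
        have hfl : ∀ x : ℝ, 0 ≤ x → x ≤ 1 → ⌊K * x⌋₊ < k + 2 ∧ |(⌊K * x⌋₊ : ℝ) / K - x| ≤ 1 / K := by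
          intro x hx0 hx1
          have e0 : 0 ≤ K * x := by positivity
          have e1 := Nat.floor_le e0
          have e2 := Nat.lt_floor_add_one (K * x)
          constructor
          · rw [Nat.floor_lt e0]
            push_cast
            nlinarith
          · have : (⌊K * x⌋₊ : ℝ) / K - x = (⌊K * x⌋₊ - K * x) / K := by field_simp
            rw [this, abs_div, abs_of_pos hK0]
            gcongr
            rw [abs_le]; constructor <;> linarith
        obtain ⟨f1, f2⟩ := hfl p.1 h1 h2
        obtain ⟨f3, f4⟩ := hfl p.2 h3 h4
        simp only [Set.mem_iUnion, Finset.mem_product, Finset.mem_range, exists_prop]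
        refine ⟨(⌊K * p.1⌋₊, ⌊K * p.2⌋₊), ⟨f1, f3⟩, ?_⟩
        set q : ℝ × ℝ := ((⌊K * p.1⌋₊ : ℝ) / K, (⌊K * p.2⌋₊ : ℝ) / K) with hq
        have hdist : dist q p ≤ 1 / K := by
          rw [Prod.dist_eq, Real.dist_eq, Real.dist_eq]
          exact max_le f2 f4
        have hBt : B * A ω * dist q p ≤ t := by
          calc B * A ω * dist q p ≤ B * M * (1 / K) := by gcongr
            _ = t := by rw [ht]; ring
        refine ⟨?_, ?_, ?_⟩
        · have := (hlip0 ω q p).trans hBt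
          rwa [h5, sub_zero] at this
        · have := (hlip1 ω q p).trans hBt
          rwa [h6, zero_div, sub_zero] at this
        · have := (hlip2 ω q p).trans hBt
          rwa [h7, zero_div, sub_zero] at this
      calc P (E M) ≤ P (⋃ i ∈ Finset.range (k + 2) ×ˢ Finset.range (k + 2), G i) :=
            measure_mono hsub
        _ ≤ ∑ i ∈ Finset.range (k + 2) ×ˢ Finset.range (k + 2), P (G i) :=
            measure_biUnion_finset_le _ _
        _ ≤ ∑ i ∈ Finset.range (k + 2) ×ˢ Finset.range (k + 2), ENNReal.ofReal t ^ 3 :=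
            Finset.sum_le_sum fun i _ => measure_jet_le ha hn _ ht0
        _ = ENNReal.ofReal (((k : ℝ) + 2) ^ 2 * t ^ 3) := by
            rw [Finset.sum_const, Finset.card_product, Finset.card_range, nsmul_eq_mul,
              ENNReal.ofReal_mul (by positivity), ENNReal.ofReal_pow ht0]
            congr 1
            rw [← ENNReal.ofReal_natCast]
            congr 1
            push_cast; ring
        _ ≤ ENNReal.ofReal (4 * (B * M) ^ 3 / K) := by
            refine ENNReal.ofReal_le_ofReal ?_
            have h1 : ((k : ℝ) + 2) ^ 2 ≤ 4 * K ^ 2 := by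
              rw [hK]; nlinarith [Nat.cast_nonneg (α := ℝ) k]
            calc ((k : ℝ) + 2) ^ 2 * t ^ 3 ≤ 4 * K ^ 2 * t ^ 3 := by gcongr
              _ = _ := by rw [ht]; field_simp
    have hlim : Tendsto (fun k : ℕ => ENNReal.ofReal (4 * (B * M) ^ 3 / ((k : ℝ) + 1))) atTop
        (𝓝 0) := by
      rw [← ENNReal.ofReal_zero]
      refine ENNReal.tendsto_ofReal ?_
      have := (tendsto_one_div_add_atTop_nhds_zero_nat (𝕜 := ℝ)).const_mul (4 * (B * M) ^ 3)
      simpa [mul_one_div, div_eq_mul_inv] using this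
    exact le_antisymm (ge_of_tendsto' hlim hbound) bot_le
  have hae : ∀ᵐ ω ∂P, ∀ M, ω ∉ E M := ae_all_iff.2 fun M => measure_eq_zero_iff_ae_notMem.1 (hnull M)
  filter_upwards [hae] with ω h p hp h0
  by_contra! hcon
  obtain ⟨M, hM⟩ := exists_nat_ge (A ω)
  exact h M ⟨hM, p, hp, h0, hcon⟩

/-! ### The nodal length -/

/-- The length of the gradient of the wave. -/
noncomputable def gradNorm (a : ℤ × ℤ → Ω → ℂ) (n : ℕ) (ω : Ω) (p : ℝ × ℝ) : ℝ :=
  √(planeWaveX a n ω p ^ 2 + planeWaveY a n ω p ^ 2)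

/-- The band integrals approximating the nodal length. -/
noncomputable def bandLength (a : ℤ × ℤ → Ω → ℂ) (n : ℕ) (ε : ℝ) (ω : Ω) : ℝ :=
  (bandMeasure (planeWave a n ω) (gradNorm a n ω) ε unitSquare).toReal

theorem nodalLength_eq (a : ℤ × ℤ → Ω → ℂ) (n : ℕ) (ω : Ω) :
    nodalLength a n ω = (zeroLength (planeWave a n ω) unitSquare).toReal := by
  rw [nodalLength, zeroLength_apply measurableSet_unitSquare]
  simp only [wave_eq_planeWave, Fin.forall_fin_two, unitSquare, Set.mem_prod]

theorem nodalLength_nonneg (a : ℤ × ℤ → Ω → ℂ) (n : ℕ) (ω : Ω) : 0 ≤ nodalLength a n ω :=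
  ENNReal.toReal_nonneg

theorem bandMeasure_planeWave_le (a : ℤ × ℤ → Ω → ℂ) (n : ℕ) (ω : Ω) {ε : ℝ} (hε : 0 < ε) :
    bandMeasure (planeWave a n ω) (gradNorm a n ω) ε unitSquare ≤ 2 * (2 * n + 1) :=
  bandMeasure_trigSum_le n _ hε

theorem bandLength_le (a : ℤ × ℤ → Ω → ℂ) (n : ℕ) (ω : Ω) {ε : ℝ} (hε : 0 < ε) :
    bandLength a n ε ω ≤ 2 * (2 * n + 1) := by
  have h := ENNReal.toReal_mono (by finiteness) (bandMeasure_planeWave_le a n ω hε)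
  refine h.trans (le_of_eq ?_)
  have : (2 * (2 * n + 1) : ℝ≥0∞) = ((2 * (2 * n + 1) : ℕ) : ℝ≥0∞) := by push_cast; ring
  rw [this, ENNReal.toReal_natCast]
  push_cast; ring

theorem bandLength_nonneg (a : ℤ × ℤ → Ω → ℂ) (n : ℕ) (ε : ℝ) (ω : Ω) : 0 ≤ bandLength a n ε ω :=
  ENNReal.toReal_nonneg

theorem ae_tendsto_bandLength (ha : IsWaveCoefficients a P) {n : ℕ} (hn : n ∈ sumTwoSquares) :
    ∀ᵐ ω ∂P, Tendsto (fun ε => bandLength a n ε ω) (𝓝[>] 0) (𝓝 (nodalLength a n ω)) := by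
  have hrow : ∀ᵐ ω ∂P, ∀ q : ℚ, volume {x | planeWave a n ω (x, (q : ℝ)) = 0} = 0 :=
    ae_all_iff.2 fun q => ae_line_null ha hn (by fun_prop : Measurable fun x : ℝ => (x, (q : ℝ)))
  have hcol : ∀ᵐ ω ∂P, ∀ q : ℚ, volume {y | planeWave a n ω ((q : ℝ), y) = 0} = 0 :=
    ae_all_iff.2 fun q => ae_line_null ha hn (by fun_prop : Measurable fun y : ℝ => ((q : ℝ), y))
  filter_upwards [hrow, hcol, ae_no_singular_zero ha hn] with ω h1 h2 h3
  have h := tendsto_bandMeasure_unitSquare (u := planeWave a n ω) (ux := planeWaveX a n ω)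
    (uy := planeWaveY a n ω) (hasFDerivAt_trigSum _ _) (continuous_trigSum _ _)
    (continuous_trigSum _ _) h3 h1 h2
  rw [nodalLength_eq]
  exact (ENNReal.tendsto_toReal h.1).comp h.2

theorem measurable_bandIntegrand (ha : IsWaveCoefficients a P) (n : ℕ) (ε : ℝ) :
    Measurable fun q : Ω × (ℝ × ℝ) => ENNReal.ofReal ((2 * ε)⁻¹) *
      ((Set.Icc (-ε) ε).indicator 1 (planeWave a n q.1 q.2) * ENNReal.ofReal (gradNorm a n q.1 q.2)) := by
  have h0 := measurable_planeWave ha n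
  have h1 := measurable_planeWaveX ha n
  have h2 := measurable_planeWaveY ha n
  have h3 : Measurable fun q : Ω × (ℝ × ℝ) =>
      ((Set.Icc (-ε) ε).indicator 1 (planeWave a n q.1 q.2) : ℝ≥0∞) :=
    (measurable_one.indicator measurableSet_Icc).comp h0
  unfold gradNorm
  fun_prop

theorem measurable_bandLength (ha : IsWaveCoefficients a P) (n : ℕ) (ε : ℝ) :
    Measurable (bandLength a n ε) := by
  unfold bandLength
  simp_rw [bandMeasure_apply measurableSet_unitSquare]
  exact ((measurable_bandIntegrand ha n ε).lintegral_prod_right' (ν := volume.restrict unitSquare)).ennreal_toReal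

theorem aestronglyMeasurable_nodalLength (ha : IsWaveCoefficients a P) {n : ℕ}
    (hn : n ∈ sumTwoSquares) : AEStronglyMeasurable (nodalLength a n) P :=
  aestronglyMeasurable_of_tendsto_ae (𝓝[>] (0 : ℝ))
    (fun ε => (measurable_bandLength ha n ε).aestronglyMeasurable) (ae_tendsto_bandLength ha hn)

theorem ae_nodalLength_le (ha : IsWaveCoefficients a P) {n : ℕ} (hn : n ∈ sumTwoSquares) :
    ∀ᵐ ω ∂P, ‖nodalLength a n ω‖ ≤ 2 * (2 * n + 1) := by
  filter_upwards [ae_tendsto_bandLength ha hn] with ω h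
  rw [Real.norm_of_nonneg (nodalLength_nonneg a n ω)]
  refine le_of_tendsto h ?_
  filter_upwards [self_mem_nhdsWithin] with ε (hε : 0 < ε) using bandLength_le a n ω hε

theorem memLp_nodalLength (ha : IsWaveCoefficients a P) {n : ℕ} (hn : n ∈ sumTwoSquares) :
    MemLp (nodalLength a n) 2 P :=
  MemLp.of_bound (aestronglyMeasurable_nodalLength ha hn) _ (ae_nodalLength_le ha hn)

end Regular

/-! ### Gaussian integrals of the gradient length -/

theorem integral_gaussian_prod (F : ℝ × ℝ → ℝ) :
    ∫ z, F z ∂((gaussianReal 0 1).prod (gaussianReal 0 1))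
      = ∫ z : ℝ × ℝ, (2 * Real.pi)⁻¹ * Real.exp (-(z.1 ^ 2 + z.2 ^ 2) / 2) * F z := by
  rw [gaussianReal_of_var_ne_zero 0 one_ne_zero,
    prod_withDensity (measurable_gaussianPDF 0 1) (measurable_gaussianPDF 0 1),
    integral_withDensity_eq_integral_toReal_smul
      (by have := measurable_gaussianPDF 0 1; fun_prop)
      (ae_of_all _ fun z => ENNReal.mul_lt_top gaussianPDF_lt_top gaussianPDF_lt_top),
    ← Measure.volume_eq_prod]
  refine integral_congr_ae (ae_of_all _ fun z => ?_)
  simp only [ENNReal.toReal_mul, toReal_gaussianPDF, smul_eq_mul]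
  congr 1
  rw [gaussianPDFReal, gaussianPDFReal]
  have h : √(2 * Real.pi * (1 : ℝ≥0)) * √(2 * Real.pi * (1 : ℝ≥0)) = 2 * Real.pi := by
    rw [Real.mul_self_sqrt (by positivity)]; simp
  rw [mul_mul_mul_comm, ← mul_inv, h, ← Real.exp_add]
  congr 2
  simp
  ring

/-- The integrand is even, so the half-line carries half of the Gaussian moment with its normalising
constant removed. -/
theorem integral_radial (m : ℕ) (hm : Even m) :
    ∫ r in Set.Ioi (0 : ℝ), r ^ m * Real.exp (-r ^ 2 / 2)
      = √(2 * Real.pi) / 2 * ∫ x, x ^ m ∂(gaussianReal 0 1) := by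
  have h1 := integral_comp_abs (f := fun r : ℝ => r ^ m * Real.exp (-r ^ 2 / 2))
  simp only [hm.pow_abs, sq_abs] at h1
  rw [integral_gaussianReal_eq_integral_smul one_ne_zero]
  have h2 : ∀ x : ℝ, gaussianPDFReal 0 1 x • x ^ m
      = (√(2 * Real.pi))⁻¹ * (x ^ m * Real.exp (-x ^ 2 / 2)) := fun x => by
    rw [gaussianPDFReal, smul_eq_mul]
    simp only [NNReal.coe_one, mul_one, sub_zero]
    ring
  simp_rw [h2]
  rw [integral_const_mul, h1]
  have : √(2 * Real.pi) ≠ 0 := by have := Real.pi_pos; positivity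
  field_simp

/-- In polar coordinates the length, the k-th power and the Jacobian give the radial power k + 2,
while the linear form leaves a purely angular integral; the two factors separate. -/
theorem integral_norm_mul_pow (β : ℝ × ℝ) (k : ℕ) (hk : Even k) :
    ∫ z : ℝ × ℝ, √(z.1 ^ 2 + z.2 ^ 2) * (β.1 * z.1 + β.2 * z.2) ^ k
      ∂((gaussianReal 0 1).prod (gaussianReal 0 1))
    = (2 * Real.pi)⁻¹ * (√(2 * Real.pi) / 2 * ∫ x, x ^ (k + 2) ∂(gaussianReal 0 1))
      * ∫ θ in (-Real.pi)..Real.pi, (β.1 * Real.cos θ + β.2 * Real.sin θ) ^ k := by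
  rw [integral_gaussian_prod, ← integral_comp_polarCoord_symm,
    ← integral_radial (k + 2) (hk.add even_two)]
  have hpi := Real.pi_pos
  have ht : polarCoord.target = Set.Ioi (0 : ℝ) ×ˢ Set.Ioo (-Real.pi) Real.pi := rfl
  have hmeas : MeasurableSet polarCoord.target := polarCoord.open_target.measurableSet
  have hJ := setIntegral_prod_mul (μ := volume) (ν := volume)
    (fun r : ℝ => r ^ (k + 2) * Real.exp (-r ^ 2 / 2))
    (fun θ : ℝ => (β.1 * Real.cos θ + β.2 * Real.sin θ) ^ k) (Set.Ioi 0)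
    (Set.Ioo (-Real.pi) Real.pi)
  rw [intervalIntegral.integral_of_le (by linarith), integral_Ioc_eq_integral_Ioo,
    mul_assoc, ← hJ, ← integral_const_mul, ← ht, ← Measure.volume_eq_prod]
  refine setIntegral_congr_fun hmeas fun p hp => ?_
  have hp1 : 0 < p.1 := hp.1
  simp only [polarCoord_symm_apply, smul_eq_mul]
  have e1 : (p.1 * Real.cos p.2) ^ 2 + (p.1 * Real.sin p.2) ^ 2 = p.1 ^ 2 := by
    rw [mul_pow, mul_pow, ← mul_add, Real.cos_sq_add_sin_sq, mul_one]
  rw [e1, Real.sqrt_sq hp1.le]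
  have e2 : β.1 * (p.1 * Real.cos p.2) + β.2 * (p.1 * Real.sin p.2)
      = p.1 * (β.1 * Real.cos p.2 + β.2 * Real.sin p.2) := by ring
  rw [e2, mul_pow]
  ring

theorem integral_angular_two (x y : ℝ) :
    ∫ θ in (-Real.pi)..Real.pi, (x * Real.cos θ + y * Real.sin θ) ^ 2
      = Real.pi * (x ^ 2 + y ^ 2) := by
  have hd : ∀ θ ∈ Set.uIcc (-Real.pi) Real.pi, HasDerivAt
      (fun θ => (x ^ 2 + y ^ 2) / 2 * θ + (x ^ 2 - y ^ 2) / 2 * (Real.sin θ * Real.cos θ)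
        + x * y * Real.sin θ ^ 2)
      ((x * Real.cos θ + y * Real.sin θ) ^ 2) θ := by
    intro θ _
    have hs := Real.hasDerivAt_sin θ
    have hc := Real.hasDerivAt_cos θ
    have := ((((hasDerivAt_id θ).const_mul ((x ^ 2 + y ^ 2) / 2)).add
      ((hs.mul hc).const_mul ((x ^ 2 - y ^ 2) / 2))).add ((hs.pow 2).const_mul (x * y)))
    convert! this using 1
    have h := Real.sin_sq_add_cos_sq θ
    simp only [mul_one, Nat.cast_ofNat, Nat.add_one_sub_one, pow_one]
    linear_combination ((x ^ 2 + y ^ 2) / 2) * h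
  rw [intervalIntegral.integral_eq_sub_of_hasDerivAt hd
    (Continuous.intervalIntegrable (by fun_prop) _ _)]
  simp
  ring

theorem integral_angular_four (x y : ℝ) :
    ∫ θ in (-Real.pi)..Real.pi, (x * Real.cos θ + y * Real.sin θ) ^ 4
      = 3 / 4 * Real.pi * (x ^ 2 + y ^ 2) ^ 2 := by
  -- The squared linear form is A + B cos 2θ + C sin 2θ with B² + C² = A², so its square has an
  -- explicit primitive whose only non-periodic part is (3/2) A² θ.
  set A := (x ^ 2 + y ^ 2) / 2 with hA
  set B := (x ^ 2 - y ^ 2) / 2 with hB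
  set C := x * y with hC
  have hABC : B ^ 2 + C ^ 2 = A ^ 2 := by rw [hA, hB, hC]; ring
  have hd : ∀ θ ∈ Set.uIcc (-Real.pi) Real.pi, HasDerivAt
      (fun θ => 3 / 2 * A ^ 2 * θ + A * B * Real.sin (2 * θ) - A * C * Real.cos (2 * θ)
        + (B ^ 2 - C ^ 2) / 4 * (Real.sin (2 * θ) * Real.cos (2 * θ))
        + B * C / 2 * Real.sin (2 * θ) ^ 2)
      ((x * Real.cos θ + y * Real.sin θ) ^ 4) θ := by
    intro θ _
    have h2 : HasDerivAt (fun θ : ℝ => 2 * θ) 2 θ := by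
      simpa using (hasDerivAt_id θ).const_mul 2
    have hs := h2.sin
    have hc := h2.cos
    have := (((((hasDerivAt_id θ).const_mul (3 / 2 * A ^ 2)).add (hs.const_mul (A * B))).sub
      (hc.const_mul (A * C))).add ((hs.mul hc).const_mul ((B ^ 2 - C ^ 2) / 4))).add
      ((hs.pow 2).const_mul (B * C / 2))
    convert! this using 1
    have h := Real.sin_sq_add_cos_sq (2 * θ)
    have e : (x * Real.cos θ + y * Real.sin θ) ^ 2
        = A + B * Real.cos (2 * θ) + C * Real.sin (2 * θ) := by
      rw [Real.cos_two_mul, Real.sin_two_mul, hA, hB, hC]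
      have h := Real.sin_sq_add_cos_sq θ
      linear_combination (y ^ 2) * h
    have e4 : (x * Real.cos θ + y * Real.sin θ) ^ 4
        = (A + B * Real.cos (2 * θ) + C * Real.sin (2 * θ)) ^ 2 := by rw [← e]; ring
    rw [e4]
    simp only [mul_one, Nat.cast_ofNat, Nat.add_one_sub_one, pow_one]
    linear_combination (B ^ 2 + C ^ 2) / 2 * h + (1 / 2) * hABC
  rw [intervalIntegral.integral_eq_sub_of_hasDerivAt hd
    (Continuous.intervalIntegrable (by fun_prop) _ _)]
  simp
  ring

theorem integral_norm (β : ℝ × ℝ) : ∫ z : ℝ × ℝ, √(z.1 ^ 2 + z.2 ^ 2) *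
    (β.1 * z.1 + β.2 * z.2) ^ 0 ∂((gaussianReal 0 1).prod (gaussianReal 0 1))
      = √(2 * Real.pi) / 2 := by
  rw [integral_norm_mul_pow β 0 Even.zero, gaussian_moment_two]
  have := Real.pi_pos
  simp
  field_simp
  norm_num

theorem integral_norm_mul_sq (β : ℝ × ℝ) : ∫ z : ℝ × ℝ, √(z.1 ^ 2 + z.2 ^ 2) *
    (β.1 * z.1 + β.2 * z.2) ^ 2 ∂((gaussianReal 0 1).prod (gaussianReal 0 1))
      = √(2 * Real.pi) / 2 * (3 / 2 * (β.1 ^ 2 + β.2 ^ 2)) := by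
  rw [integral_norm_mul_pow β 2 even_two, gaussian_moment_four, integral_angular_two]
  have := Real.pi_pos
  field_simp

theorem integral_norm_mul_four (β : ℝ × ℝ) : ∫ z : ℝ × ℝ, √(z.1 ^ 2 + z.2 ^ 2) *
    (β.1 * z.1 + β.2 * z.2) ^ 4 ∂((gaussianReal 0 1).prod (gaussianReal 0 1))
      = √(2 * Real.pi) / 2 * (45 / 8 * (β.1 ^ 2 + β.2 ^ 2) ^ 2) := by
  rw [integral_norm_mul_pow β 4 (by decide), gaussian_moment_six, integral_angular_four]
  have := Real.pi_pos
  field_simp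
  ring

theorem integrable_norm_mul_pow (β : ℝ × ℝ) (k : ℕ) :
    Integrable (fun z : ℝ × ℝ => √(z.1 ^ 2 + z.2 ^ 2) * (β.1 * z.1 + β.2 * z.2) ^ k)
      ((gaussianReal 0 1).prod (gaussianReal 0 1)) := by
  have h := (IsGaussian.memLp_id ((gaussianReal 0 1).prod (gaussianReal 0 1)) ((k + 1 : ℕ) : ℝ≥0∞)
    (by finiteness)).integrable_norm_pow (by simp)
  refine (h.const_mul (2 * (|β.1| + |β.2|) ^ k)).mono' (by fun_prop) (ae_of_all _ fun z => ?_)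
  have h1 : |z.1| ≤ ‖z‖ := norm_fst_le z
  have h2 : |z.2| ≤ ‖z‖ := norm_snd_le z
  have h3 : √(z.1 ^ 2 + z.2 ^ 2) ≤ 2 * ‖z‖ := by
    refine Real.sqrt_le_iff.2 ⟨by positivity, ?_⟩
    have := pow_le_pow_left₀ (abs_nonneg _) h1 2
    have := pow_le_pow_left₀ (abs_nonneg _) h2 2
    rw [sq_abs] at *
    nlinarith [sq_nonneg ‖z‖]
  have h4 : |β.1 * z.1 + β.2 * z.2| ≤ (|β.1| + |β.2|) * ‖z‖ := by
    refine (abs_add_le _ _).trans ?_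
    rw [abs_mul, abs_mul, add_mul]
    gcongr
  rw [norm_mul, norm_pow, Real.norm_of_nonneg (Real.sqrt_nonneg _), Real.norm_eq_abs]
  calc _ ≤ 2 * ‖z‖ * ((|β.1| + |β.2|) * ‖z‖) ^ k := by gcongr
    _ = _ := by rw [mul_pow, id, pow_succ]; ring

/-! ### Gaussian integrals over a small band -/

/-- The Gaussian integral of `x ^ k` over `[-ε, ε]`. -/
noncomputable def bandMoment (ε : ℝ) (k : ℕ) : ℝ :=
  ∫ x, (Set.Icc (-ε) ε).indicator 1 x * x ^ k ∂(gaussianReal 0 1)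

theorem integrable_bandMoment (ε : ℝ) (k : ℕ) :
    Integrable (fun x => (Set.Icc (-ε) ε).indicator 1 x * x ^ k) (gaussianReal 0 1) := by
  refine (integrable_pow_gaussianReal k 1).norm.mono' ?_ (ae_of_all _ fun x => ?_)
  · exact ((measurable_one.indicator measurableSet_Icc).mul (by fun_prop)).aestronglyMeasurable
  · rw [norm_mul]
    refine mul_le_of_le_one_left (norm_nonneg _) ?_
    by_cases h : x ∈ Set.Icc (-ε) ε
    · rw [Set.indicator_of_mem h]; simp
    · rw [Set.indicator_of_notMem h]; simp

theorem bandMoment_odd (ε : ℝ) {k : ℕ} (hk : Odd k) : bandMoment ε k = 0 := by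
  have hm : Measurable fun x : ℝ => (Set.Icc (-ε) ε).indicator 1 x * x ^ k :=
    (measurable_one.indicator measurableSet_Icc).mul (by fun_prop)
  have h1 : bandMoment ε k = ∫ x, (Set.Icc (-ε) ε).indicator 1 (-x) * (-x) ^ k ∂(gaussianReal 0 1) := by
    rw [bandMoment]
    conv_lhs => rw [show gaussianReal 0 1 = (gaussianReal 0 1).map (fun x => -x) by
      rw [gaussianReal_map_neg, neg_zero]]
    rw [integral_map (by fun_prop) hm.aestronglyMeasurable]
  have h2 : ∀ x : ℝ, (Set.Icc (-ε) ε).indicator (1 : ℝ → ℝ) (-x) * (-x) ^ k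
      = -((Set.Icc (-ε) ε).indicator 1 x * x ^ k) := fun x => by
    have : (Set.Icc (-ε) ε).indicator (1 : ℝ → ℝ) (-x) = (Set.Icc (-ε) ε).indicator 1 x := by
      simp only [Set.indicator, Set.mem_Icc, Pi.one_apply]
      congr 1
      simp only [eq_iff_iff]
      constructor <;> rintro ⟨h1, h2⟩ <;> constructor <;> linarith
    rw [this, hk.neg_pow]; ring
  simp_rw [h2] at h1
  rw [integral_neg] at h1
  rw [bandMoment] at *
  linarith

/-- Averages of a continuous function over intervals shrinking to 0 tend to its value there, here
the Gaussian density times x^k. Only k = 0 gives a nonzero limit. The average is read off from the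
derivative at 0 of x ↦ ∫_{-x}^{x}. -/
theorem tendsto_bandMoment (k : ℕ) :
    Tendsto (fun ε => (2 * ε)⁻¹ * bandMoment ε k) (𝓝[>] 0) (𝓝 ((√(2 * Real.pi))⁻¹ * 0 ^ k)) := by
  set f : ℝ → ℝ := fun x => gaussianPDFReal 0 1 x * x ^ k with hf
  have hfc : Continuous f := by
    have : Continuous (gaussianPDFReal 0 1) := by
      rw [gaussianPDFReal_def]; fun_prop
    fun_prop
  have hf0 : f 0 = (√(2 * Real.pi))⁻¹ * 0 ^ k := by
    simp [hf, gaussianPDFReal]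
  have hG : HasDerivAt (fun x => ∫ t in (0 : ℝ)..x, f t) (f 0) 0 :=
    intervalIntegral.integral_hasDerivAt_right (hfc.intervalIntegrable _ _)
      (hfc.stronglyMeasurableAtFilter _ _) hfc.continuousAt
  have hG0 : HasDerivAt (fun x => ∫ t in (0 : ℝ)..x, f t) (f 0) (-(0 : ℝ)) := by rwa [neg_zero]
  have hG' : HasDerivAt (fun x => ∫ t in (0 : ℝ)..(-x), f t) (f 0 * (-1)) 0 :=
    hG0.comp (0 : ℝ) (hasDerivAt_neg (0 : ℝ))
  have hF := (hasDerivAt_iff_tendsto_slope_zero.1 (hG.sub hG')).const_mul (1 / 2)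
  have hF2 := hF.mono_left (nhdsGT_le_nhdsNE (0 : ℝ))
  rw [← hf0]
  have hlim : 1 / 2 * (f 0 - f 0 * -1) = f 0 := by ring
  rw [hlim] at hF2
  refine hF2.congr' ?_
  filter_upwards [self_mem_nhdsWithin] with ε (hε : 0 < ε)
  have e1 : bandMoment ε k = ∫ x in (-ε)..ε, f x := by
    rw [bandMoment, integral_gaussianReal_eq_integral_smul one_ne_zero,
      intervalIntegral.integral_of_le (by linarith), ← integral_Icc_eq_integral_Ioc,
      ← integral_indicator measurableSet_Icc]
    refine integral_congr_ae (ae_of_all _ fun x => ?_)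
    by_cases h : x ∈ Set.Icc (-ε) ε
    · simp [Set.indicator_of_mem h, hf]
    · simp [Set.indicator_of_notMem h]
  rw [e1, ← intervalIntegral.integral_add_adjacent_intervals (b := 0)
    (hfc.intervalIntegrable _ _) (hfc.intervalIntegrable _ _), intervalIntegral.integral_symm]
  simp
  field_simp
  ring

/-- The Gaussian integral of the band integrand against a fourth Wick power. -/
noncomputable def bandWick (ε : ℝ) (b : Fin 3 → ℝ) : ℝ :=
  ∫ u : Fin 3 → ℝ, (Set.Icc (-ε) ε).indicator 1 (u 0) * √(u 1 ^ 2 + u 2 ^ 2) *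
    wick4 (∑ i, b i * u i) (∑ i, b i ^ 2) ∂(Measure.pi fun _ => gaussianReal 0 1)

theorem measurePreserving_finThree : MeasurePreserving
    (fun u : Fin 3 → ℝ => (u 0, (u 1, u 2))) (Measure.pi fun _ => gaussianReal 0 1)
    ((gaussianReal 0 1).prod ((gaussianReal 0 1).prod (gaussianReal 0 1))) := by
  have h1 := measurePreserving_piFinSuccAbove (fun _ : Fin 3 => gaussianReal 0 1) 0
  have h2 := ((MeasurePreserving.id (gaussianReal 0 1)).prod
    (measurePreserving_finTwoArrow (gaussianReal 0 1))).comp h1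
  exact h2

/-- The value of the field and the gradient are independent, so after expanding the Wick power every
term factors into a band moment and a planar integral. Relative to the mean gradient length √(2π)/2,
the planar moments of orders 2 and 4 are (3/2)|β|² and (45/8)|β|⁴ with β = (b₁, b₂); odd powers
vanish. -/
theorem bandWick_eq (ε : ℝ) (b : Fin 3 → ℝ) :
    bandWick ε b = √(2 * Real.pi) / 2 * (b 0 ^ 4 * bandMoment ε 4
      + (9 * b 0 ^ 2 * (b 1 ^ 2 + b 2 ^ 2) - 6 * (b 0 ^ 2 + b 1 ^ 2 + b 2 ^ 2) * b 0 ^ 2)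
        * bandMoment ε 2
      + (45 / 8 * (b 1 ^ 2 + b 2 ^ 2) ^ 2
        - 9 * (b 0 ^ 2 + b 1 ^ 2 + b 2 ^ 2) * (b 1 ^ 2 + b 2 ^ 2)
        + 3 * (b 0 ^ 2 + b 1 ^ 2 + b 2 ^ 2) ^ 2) * bandMoment ε 0) := by
  set s := b 0 ^ 2 + b 1 ^ 2 + b 2 ^ 2 with hs
  set f : ℕ → ℝ → ℝ := fun k x => (Set.Icc (-ε) ε).indicator 1 x * x ^ k with hf
  set g : ℕ → ℝ × ℝ → ℝ := fun k z => √(z.1 ^ 2 + z.2 ^ 2) * (b 1 * z.1 + b 2 * z.2) ^ k with hg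
  set F : ℝ × (ℝ × ℝ) → ℝ := fun p => (Set.Icc (-ε) ε).indicator 1 p.1 *
    √(p.2.1 ^ 2 + p.2.2 ^ 2) * wick4 (b 0 * p.1 + (b 1 * p.2.1 + b 2 * p.2.2)) s with hF
  have hFm : Measurable F := by
    have h1 : Measurable fun p : ℝ × (ℝ × ℝ) => (Set.Icc (-ε) ε).indicator (1 : ℝ → ℝ) p.1 :=
      (measurable_one.indicator measurableSet_Icc).comp measurable_fst
    simp only [hF, wick4]
    fun_prop
  have h1 : bandWick ε b = ∫ p, F p ∂((gaussianReal 0 1).prod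
      ((gaussianReal 0 1).prod (gaussianReal 0 1))) := by
    rw [← measurePreserving_finThree.map_eq, integral_map
      measurePreserving_finThree.measurable.aemeasurable hFm.aestronglyMeasurable, bandWick]
    refine integral_congr_ae (ae_of_all _ fun u => ?_)
    simp only [hF, Fin.sum_univ_three, hs, add_assoc]
  -- Each entry lists a coefficient, the power of the field value and the power of the gradient
  -- form; the last three entries have odd powers and integrate to zero.
  set t : Fin 9 → ℝ × ℕ × ℕ := ![(b 0 ^ 4, 4, 0), (6 * b 0 ^ 2, 2, 2), (1, 0, 4),
    (-6 * s * b 0 ^ 2, 2, 0), (-6 * s, 0, 2), (3 * s ^ 2, 0, 0), (4 * b 0 ^ 3, 3, 1),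
    (4 * b 0, 1, 3), (-12 * s * b 0, 1, 1)] with ht
  have h2 : ∀ p, F p = ∑ i, (t i).1 * (f (t i).2.1 p.1 * g (t i).2.2 p.2) := by
    intro p
    simp only [hF, hf, hg, ht, Fin.sum_univ_succ, wick4]
    simp
    ring
  rw [h1]
  simp_rw [h2]
  rw [integral_finsetSum _ fun i _ => ((integrable_bandMoment ε _).mul_prod
    (integrable_norm_mul_pow (b 1, b 2) _)).const_mul _]
  rw [Finset.sum_congr rfl fun i _ => (integral_const_mul _ _).trans
    (congrArg _ (integral_prod_mul (f (t i).2.1) (g (t i).2.2)))]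
  have hA : ∀ k, ∫ x, f k x ∂(gaussianReal 0 1) = bandMoment ε k := fun k => rfl
  have g0 : ∫ z, g 0 z ∂((gaussianReal 0 1).prod (gaussianReal 0 1)) = _ :=
    integral_norm (b 1, b 2)
  have g2 : ∫ z, g 2 z ∂((gaussianReal 0 1).prod (gaussianReal 0 1)) = _ :=
    integral_norm_mul_sq (b 1, b 2)
  have g4 : ∫ z, g 4 z ∂((gaussianReal 0 1).prod (gaussianReal 0 1)) = _ :=
    integral_norm_mul_four (b 1, b 2)
  simp only [hA, ht, Fin.sum_univ_succ]
  simp [g0, g2, g4, bandMoment_odd ε (by decide : Odd 1), bandMoment_odd ε (by decide : Odd 3)]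
  ring

/-! ### The nodal length against a fourth Wick power -/

section Correlation

variable {Ω : Type*} [MeasurableSpace Ω] {P : Measure Ω} [IsProbabilityMeasure P]
  {a : ℤ × ℤ → Ω → ℂ}

/-- The band function of a jet. -/
noncomputable def bandFun (ε : ℝ) (u : Fin 3 → ℝ) : ℝ :=
  (Set.Icc (-ε) ε).indicator 1 (u 0) * √(u 1 ^ 2 + u 2 ^ 2)

theorem measurable_bandFun (ε : ℝ) : Measurable (bandFun ε) := by
  have h1 : Measurable fun u : Fin 3 → ℝ => (Set.Icc (-ε) ε).indicator (1 : ℝ → ℝ) (u 0) :=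
    (measurable_one.indicator measurableSet_Icc).comp (measurable_pi_apply 0)
  unfold bandFun
  fun_prop

theorem bandFun_nonneg (ε : ℝ) (u : Fin 3 → ℝ) : 0 ≤ bandFun ε u :=
  mul_nonneg (Set.indicator_nonneg (by simp) _) (Real.sqrt_nonneg _)

theorem memLp_bandFun (ε : ℝ) : MemLp (bandFun ε) 2 (Measure.pi fun _ : Fin 3 => gaussianReal 0 1) := by
  have h0 : MemLp (id : ℝ → ℝ) 2 (gaussianReal 0 1) := memLp_id_gaussianReal 2
  have h : ∀ i : Fin 3, MemLp (fun u : Fin 3 → ℝ => u i) 2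
      (Measure.pi fun _ : Fin 3 => gaussianReal 0 1) := fun i =>
    h0.comp_measurePreserving (measurePreserving_eval (fun _ : Fin 3 => gaussianReal 0 1) i)
  refine ((h 1).norm.add (h 2).norm).mono' (measurable_bandFun ε).aestronglyMeasurable
    (ae_of_all _ fun u => ?_)
  rw [Real.norm_of_nonneg (bandFun_nonneg ε u), bandFun]
  have h1 : (Set.Icc (-ε) ε).indicator (1 : ℝ → ℝ) (u 0) ≤ 1 :=
    Set.indicator_le_self' (by simp) _
  refine (mul_le_of_le_one_left (Real.sqrt_nonneg _) h1).trans ?_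
  refine Real.sqrt_le_iff.2 ⟨add_nonneg (norm_nonneg _) (norm_nonneg _), ?_⟩
  simp only [Pi.add_apply, Real.norm_eq_abs]
  rw [add_sq, sq_abs, sq_abs]
  nlinarith [mul_nonneg (abs_nonneg (u 1)) (abs_nonneg (u 2))]

theorem bandLength_eq_integral (ha : IsWaveCoefficients a P) {n : ℕ} (hn : 0 < n) {ε : ℝ}
    (hε : 0 < ε) (ω : Ω) :
    Integrable (fun p => derivScale n * (2 * ε)⁻¹ * bandFun ε ![planeWave a n ω p,
      planeWaveX a n ω p / derivScale n, planeWaveY a n ω p / derivScale n])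
      (volume.restrict unitSquare) ∧
    bandLength a n ε ω = ∫ p in unitSquare, derivScale n * (2 * ε)⁻¹ * bandFun ε
      ![planeWave a n ω p, planeWaveX a n ω p / derivScale n, planeWaveY a n ω p / derivScale n] := by
  have hk := derivScale_pos hn
  have hval : ∀ p, derivScale n * (2 * ε)⁻¹ * bandFun ε ![planeWave a n ω p,
      planeWaveX a n ω p / derivScale n, planeWaveY a n ω p / derivScale n]
      = (2 * ε)⁻¹ * ((Set.Icc (-ε) ε).indicator 1 (planeWave a n ω p) * gradNorm a n ω p) := by
    intro p
    simp only [bandFun, gradNorm, Matrix.cons_val]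
    have : √((planeWaveX a n ω p / derivScale n) ^ 2 + (planeWaveY a n ω p / derivScale n) ^ 2)
        = √(planeWaveX a n ω p ^ 2 + planeWaveY a n ω p ^ 2) / derivScale n := by
      rw [div_pow, div_pow, ← add_div, Real.sqrt_div (by positivity), Real.sqrt_sq hk.le]
    rw [this]
    field_simp
  simp_rw [hval]
  have hnn : ∀ p, 0 ≤ (2 * ε)⁻¹ *
      ((Set.Icc (-ε) ε).indicator 1 (planeWave a n ω p) * gradNorm a n ω p) := fun p =>
    mul_nonneg (by positivity) (mul_nonneg (Set.indicator_nonneg (by simp) _) (Real.sqrt_nonneg _))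
  have hofReal : ∀ p, ENNReal.ofReal ((2 * ε)⁻¹ *
      ((Set.Icc (-ε) ε).indicator 1 (planeWave a n ω p) * gradNorm a n ω p))
      = ENNReal.ofReal ((2 * ε)⁻¹) * ((Set.Icc (-ε) ε).indicator 1 (planeWave a n ω p)
        * ENNReal.ofReal (gradNorm a n ω p)) := by
    intro p
    rw [ENNReal.ofReal_mul (by positivity),
      ENNReal.ofReal_mul (Set.indicator_nonneg (by simp) _)]
    congr 2
    by_cases h : planeWave a n ω p ∈ Set.Icc (-ε) ε
    · simp only [Set.indicator_of_mem h]; simp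
    · simp only [Set.indicator_of_notMem h]; simp
  have hmeas : Measurable fun p => (2 * ε)⁻¹ *
      ((Set.Icc (-ε) ε).indicator (1 : ℝ → ℝ) (planeWave a n ω p) * gradNorm a n ω p) := by
    have h0 : Continuous (planeWave a n ω) := continuous_trigSum _ _
    have h1 : Continuous (planeWaveX a n ω) := continuous_trigSum _ _
    have h2 : Continuous (planeWaveY a n ω) := continuous_trigSum _ _
    have h3 : Measurable fun p => (Set.Icc (-ε) ε).indicator (1 : ℝ → ℝ) (planeWave a n ω p) :=
      (measurable_one.indicator measurableSet_Icc).comp h0.measurable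
    unfold gradNorm
    fun_prop
  have hlint : ∫⁻ p in unitSquare, ENNReal.ofReal ((2 * ε)⁻¹ *
      ((Set.Icc (-ε) ε).indicator 1 (planeWave a n ω p) * gradNorm a n ω p))
      = bandMeasure (planeWave a n ω) (gradNorm a n ω) ε unitSquare := by
    rw [bandMeasure_apply measurableSet_unitSquare]
    simp_rw [hofReal]
  constructor
  · refine ⟨hmeas.aestronglyMeasurable, ?_⟩
    rw [hasFiniteIntegral_iff_ofReal (ae_of_all _ hnn), hlint]
    exact (bandMeasure_planeWave_le a n ω hε).trans_lt (by finiteness)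
  · rw [integral_eq_lintegral_of_nonneg_ae (ae_of_all _ hnn) hmeas.aestronglyMeasurable, hlint]
    rfl

theorem aestronglyMeasurable_wick4 (ζ : Lp ℝ 2 P) (s : ℝ) :
    AEStronglyMeasurable (fun ω => wick4 (ζ ω) s) P := by
  have := Lp.aestronglyMeasurable ζ
  unfold wick4
  exact ((this.pow 4).sub ((this.pow 2).const_mul _)).add aestronglyMeasurable_const

/-- The coordinates of `ζ` along the jet at `p`. -/
noncomputable def jetCoord (ha : IsWaveCoefficients a P) {n : ℕ} (hn : 0 < n) (ζ : Lp ℝ 2 P)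
    (p : ℝ × ℝ) (i : Fin 3) : ℝ := inner ℝ (jet ha hn p i) ζ

theorem jetCoord_eq (ha : IsWaveCoefficients a P) {n : ℕ} (hn : 0 < n) (ζ : Lp ℝ 2 P)
    (p : ℝ × ℝ) (i : Fin 3) :
    jetCoord ha hn ζ p i = ∑ l ∈ freq n, (jetCoeff n p i l * waveCoeff a P ζ l).re := by
  rw [jetCoord, real_inner_comm, jet]
  exact inner_linForm_right ha (freq_ne_zero hn) _ ζ

theorem continuous_jetCoord (ha : IsWaveCoefficients a P) {n : ℕ} (hn : 0 < n) (ζ : Lp ℝ 2 P)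
    (i : Fin 3) : Continuous fun p => jetCoord ha hn ζ p i := by
  simp_rw [jetCoord_eq]
  refine continuous_finsetSum _ fun l _ => ?_
  fin_cases i <;> simp only [jetCoeff, planeExp] <;> fun_prop

/-- Fubini moves the expectation inside the area integral. At each point the jet is an orthonormal
family, so only the projection of ζ on it matters and the expectation becomes the explicit
three-dimensional integral `bandWick`. -/
theorem integral_bandLength_mul_wick4 (ha : IsWaveCoefficients a P) {n : ℕ}
    (hn : n ∈ sumTwoSquares) {ζ : Lp ℝ 2 P} (hζ : ζ ∈ gaussianSpace a P) {ε : ℝ} (hε : 0 < ε) :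
    ∫ ω, bandLength a n ε ω * wick4 (ζ ω) (‖ζ‖ ^ 2) ∂P
      = ∫ p in unitSquare, derivScale n * (2 * ε)⁻¹ * bandWick ε (jetCoord ha hn.1 ζ p) := by
  set J : Ω → ℝ × ℝ → Fin 3 → ℝ := fun ω p => ![planeWave a n ω p,
      planeWaveX a n ω p / derivScale n, planeWaveY a n ω p / derivScale n] with hJ
  set w : Ω → ℝ := fun ω => wick4 (ζ ω) (‖ζ‖ ^ 2) with hw
  set k := derivScale n * (2 * ε)⁻¹ with hk
  have hk0 : 0 < k := mul_pos (derivScale_pos hn.1) (by positivity)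
  have hwint : Integrable w P := (memLp_wick4_of_mem ha hζ _).integrable (by norm_num)
  have hJm : Measurable fun q : Ω × (ℝ × ℝ) => J q.1 q.2 := by
    refine measurable_pi_lambda _ fun i => ?_
    fin_cases i
    · exact measurable_planeWave ha n
    · exact (measurable_planeWaveX ha n).div_const _
    · exact (measurable_planeWaveY ha n).div_const _
  have hprod : Integrable (fun q : Ω × (ℝ × ℝ) => k * bandFun ε (J q.1 q.2) * w q.1)
      (P.prod (volume.restrict unitSquare)) := by
    have hm : AEStronglyMeasurable (fun q : Ω × (ℝ × ℝ) => k * bandFun ε (J q.1 q.2) * w q.1)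
        (P.prod (volume.restrict unitSquare)) := by
      refine AEStronglyMeasurable.mul ?_ (aestronglyMeasurable_wick4 ζ _).comp_fst
      exact (((measurable_bandFun ε).comp hJm).const_mul k).aestronglyMeasurable
    refine (integrable_prod_iff hm).2 ⟨ae_of_all _ fun ω => ?_, ?_⟩
    · exact ((bandLength_eq_integral ha hn.1 hε ω).1).mul_const (w ω)
    · have : ∀ ω, ∫ p in unitSquare, ‖k * bandFun ε (J ω p) * w ω‖
          = bandLength a n ε ω * ‖w ω‖ := by
        intro ω
        simp_rw [norm_mul _ (w ω)]
        rw [integral_mul_const, (bandLength_eq_integral ha hn.1 hε ω).2]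
        congr 1
        refine integral_congr_ae (ae_of_all _ fun p => ?_)
        exact Real.norm_of_nonneg (mul_nonneg hk0.le (bandFun_nonneg _ _))
      simp_rw [this]
      refine hwint.norm.bdd_mul (c := 2 * (2 * n + 1)) (measurable_bandLength ha n ε).aestronglyMeasurable
        (ae_of_all _ fun ω => ?_)
      rw [Real.norm_of_nonneg (bandLength_nonneg _ _ _ _)]
      exact bandLength_le a n ω hε
  calc ∫ ω, bandLength a n ε ω * w ω ∂P
      = ∫ ω, (∫ p in unitSquare, k * bandFun ε (J ω p) * w ω) ∂P := by
        refine integral_congr_ae (ae_of_all _ fun ω => ?_)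
        simp only
        rw [integral_mul_const, (bandLength_eq_integral ha hn.1 hε ω).2]
    _ = ∫ p in unitSquare, (∫ ω, k * bandFun ε (J ω p) * w ω ∂P) := integral_integral_swap hprod
    _ = _ := by
        refine integral_congr_ae (ae_of_all _ fun p => ?_)
        simp only [mul_assoc k]
        rw [integral_const_mul]
        congr 1
        rw [bandWick]
        have h := integral_mul_wick4 ha (jet_mem ha hn.1 p) (orthonormal_jet ha hn p) hζ
          (measurable_bandFun ε) (memLp_bandFun ε)
        refine Eq.trans ?_ h
        refine integral_congr_ae ?_
        filter_upwards [jet_ae ha hn.1 p] with ω hω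
        rw [hω]

/-- The correlation of the nodal length with a fourth Wick power. -/
theorem integral_nodalLength_mul_wick4 (ha : IsWaveCoefficients a P) {n : ℕ}
    (hn : n ∈ sumTwoSquares) {ζ : Lp ℝ 2 P} (hζ : ζ ∈ gaussianSpace a P) :
    ∫ ω, nodalLength a n ω * wick4 (ζ ω) (‖ζ‖ ^ 2) ∂P
      = derivScale n / 2 * ∫ p in unitSquare, (3 * jetCoord ha hn.1 ζ p 0 ^ 4
        - 3 * jetCoord ha hn.1 ζ p 0 ^ 2
          * (jetCoord ha hn.1 ζ p 1 ^ 2 + jetCoord ha hn.1 ζ p 2 ^ 2)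
        - 3 / 8 * (jetCoord ha hn.1 ζ p 1 ^ 2 + jetCoord ha hn.1 ζ p 2 ^ 2) ^ 2) := by
  set b := jetCoord ha hn.1 ζ with hb
  have hwint : Integrable (fun ω => wick4 (ζ ω) (‖ζ‖ ^ 2)) P :=
    (memLp_wick4_of_mem ha hζ _).integrable (by norm_num)
  have hlim1 : Tendsto (fun ε => ∫ ω, bandLength a n ε ω * wick4 (ζ ω) (‖ζ‖ ^ 2) ∂P) (𝓝[>] 0)
      (𝓝 (∫ ω, nodalLength a n ω * wick4 (ζ ω) (‖ζ‖ ^ 2) ∂P)) := by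
    refine tendsto_integral_filter_of_dominated_convergence
      (fun ω => 2 * (2 * n + 1) * ‖wick4 (ζ ω) (‖ζ‖ ^ 2)‖) ?_ ?_ (hwint.norm.const_mul _) ?_
    · exact Eventually.of_forall fun ε =>
        (measurable_bandLength ha n ε).aestronglyMeasurable.mul (aestronglyMeasurable_wick4 ζ _)
    · filter_upwards [self_mem_nhdsWithin] with ε (hε : 0 < ε)
      refine ae_of_all _ fun ω => ?_
      rw [norm_mul, Real.norm_of_nonneg (bandLength_nonneg _ _ _ _)]
      gcongr
      exact bandLength_le a n ω hε
    · filter_upwards [ae_tendsto_bandLength ha hn] with ω h using h.mul_const _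
  have hcont : ∀ i, Continuous fun p => b p i := fun i => continuous_jetCoord ha hn.1 ζ i
  have hint : ∀ f : ℝ × ℝ → ℝ, Continuous f → Integrable f (volume.restrict unitSquare) := by
    intro f hf
    have : IntegrableOn f (Set.Icc 0 1 ×ˢ Set.Icc 0 1) :=
      hf.continuousOn.integrableOn_compact (isCompact_Icc.prod isCompact_Icc)
    exact this.mono_set (Set.prod_mono Set.Ico_subset_Icc_self Set.Ico_subset_Icc_self)
  set f4 : ℝ × ℝ → ℝ := fun p => b p 0 ^ 4 with hf4
  set f2 : ℝ × ℝ → ℝ := fun p => 9 * b p 0 ^ 2 * (b p 1 ^ 2 + b p 2 ^ 2)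
    - 6 * (b p 0 ^ 2 + b p 1 ^ 2 + b p 2 ^ 2) * b p 0 ^ 2 with hf2
  set f0 : ℝ × ℝ → ℝ := fun p => 45 / 8 * (b p 1 ^ 2 + b p 2 ^ 2) ^ 2
        - 9 * (b p 0 ^ 2 + b p 1 ^ 2 + b p 2 ^ 2) * (b p 1 ^ 2 + b p 2 ^ 2)
        + 3 * (b p 0 ^ 2 + b p 1 ^ 2 + b p 2 ^ 2) ^ 2 with hf0
  have hc0 := hcont 0
  have hc1 := hcont 1
  have hc2 := hcont 2
  have i4 : Integrable f4 (volume.restrict unitSquare) := hint _ (by fun_prop)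
  have i2 : Integrable f2 (volume.restrict unitSquare) := hint _ (by fun_prop)
  have i0 : Integrable f0 (volume.restrict unitSquare) := hint _ (by fun_prop)
  -- As ε tends to 0 only the zeroth band moment survives, so the limit is governed by `f0` alone.
  -- Expanding the total variance in it leaves 3x² - 3xy - (3/8)y² with x = b₀² and y = b₁² + b₂².
  have hlim2 := ((((tendsto_bandMoment 4).mul_const (∫ p in unitSquare, f4 p)).add
    ((tendsto_bandMoment 2).mul_const (∫ p in unitSquare, f2 p))).add
    ((tendsto_bandMoment 0).mul_const (∫ p in unitSquare, f0 p))).const_mul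
    (derivScale n * (√(2 * Real.pi) / 2))
  have heq := tendsto_nhds_unique hlim1 (hlim2.congr' ?_)
  · rw [heq]
    have hpi : √(2 * Real.pi) ≠ 0 := by have := Real.pi_pos; positivity
    have : ∫ p in unitSquare, (3 * b p 0 ^ 4 - 3 * b p 0 ^ 2 * (b p 1 ^ 2 + b p 2 ^ 2)
        - 3 / 8 * (b p 1 ^ 2 + b p 2 ^ 2) ^ 2) = ∫ p in unitSquare, f0 p := by
      refine integral_congr_ae (ae_of_all _ fun p => ?_)
      simp only [hf0]; ring
    rw [this]
    simp
    field_simp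
  · filter_upwards [self_mem_nhdsWithin] with ε (hε : 0 < ε)
    rw [integral_bandLength_mul_wick4 ha hn hζ hε]
    have : ∀ p, derivScale n * (2 * ε)⁻¹ * bandWick ε (jetCoord ha hn.1 ζ p)
        = derivScale n * (√(2 * Real.pi) / 2) * ((2 * ε)⁻¹ * bandMoment ε 4) * f4 p
        + derivScale n * (√(2 * Real.pi) / 2) * ((2 * ε)⁻¹ * bandMoment ε 2) * f2 p
        + derivScale n * (√(2 * Real.pi) / 2) * ((2 * ε)⁻¹ * bandMoment ε 0) * f0 p := by
      intro p
      rw [bandWick_eq]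
      simp only [hf4, hf2, hf0, hb]
      ring
    simp_rw [this]
    rw [integral_add ((i4.const_mul _).fun_add (i2.const_mul _)) (i0.const_mul _),
      integral_add (i4.const_mul _) (i2.const_mul _), integral_const_mul, integral_const_mul,
      integral_const_mul]
    ring

end Correlation

/-! ### Quadruples of lattice points on a circle with zero sum -/

/-- Equality of the four norms makes the vectors l₁ + l₂, l₁ + l₃ and l₂ + l₃ pairwise orthogonal.
Three pairwise orthogonal vectors in the plane cannot all be nonzero, and each vanishing is one of
the pairings. -/
theorem eq_neg_of_zero_sum {n : ℕ} {l₁ l₂ l₃ l₄ : ℤ × ℤ} (h1 : l₁ ∈ freq n) (h2 : l₂ ∈ freq n)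
    (h3 : l₃ ∈ freq n) (h4 : l₄ ∈ freq n) (h : l₁ + l₂ + l₃ + l₄ = 0) :
    (l₂ = -l₁ ∧ l₄ = -l₃) ∨ (l₃ = -l₁ ∧ l₄ = -l₂) ∨ (l₄ = -l₁ ∧ l₃ = -l₂) := by
  rw [mem_freq] at h1 h2 h3 h4
  obtain ⟨a1, a2⟩ := l₁
  obtain ⟨b1, b2⟩ := l₂
  obtain ⟨c1, c2⟩ := l₃
  obtain ⟨d1, d2⟩ := l₄
  simp only [Prod.mk_add_mk, Prod.mk_eq_zero, Prod.neg_mk, Prod.mk.injEq] at *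
  obtain ⟨e1, e2⟩ := h
  obtain rfl : d1 = -(a1 + b1 + c1) := by linarith
  obtain rfl : d2 = -(a2 + b2 + c2) := by linarith
  have hs : (a1 + b1) * (a1 + c1) + (a2 + b2) * (a2 + c2) = 0 := by
    have : 2 * ((a1 + b1) * (a1 + c1) + (a2 + b2) * (a2 + c2)) = 0 := by
      linear_combination h4 + h1 - h2 - h3
    linarith
  have ht : (a1 + b1) * (b1 + c1) + (a2 + b2) * (b2 + c2) = 0 := by
    have : 2 * ((a1 + b1) * (b1 + c1) + (a2 + b2) * (b2 + c2)) = 0 := by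
      linear_combination h4 + h2 - h1 - h3
    linarith
  have hd : (a1 + c1) * (b1 + c1) + (a2 + c2) * (b2 + c2) = 0 := by
    have : 2 * ((a1 + c1) * (b1 + c1) + (a2 + c2) * (b2 + c2)) = 0 := by
      linear_combination h4 + h3 - h1 - h2
    linarith
  by_cases h0 : a1 + b1 = 0 ∧ a2 + b2 = 0
  · left; omega
  · have hdet : (a1 + c1) * (b2 + c2) - (a2 + c2) * (b1 + c1) = 0 := by
      by_cases h5 : a1 + b1 = 0
      · have h6 : a2 + b2 ≠ 0 := fun h => h0 ⟨h5, h⟩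
        refine (mul_eq_zero.1 (?_ : (a2 + b2) * _ = 0)).resolve_left h6
        linear_combination (a1 + c1) * ht - (b1 + c1) * hs
      · refine (mul_eq_zero.1 (?_ : (a1 + b1) * _ = 0)).resolve_left h5
        linear_combination (b2 + c2) * hs - (a2 + c2) * ht
    have hprod : ((a1 + c1) ^ 2 + (a2 + c2) ^ 2) * ((b1 + c1) ^ 2 + (b2 + c2) ^ 2) = 0 := by
      linear_combination ((a1 + c1) * (b1 + c1) + (a2 + c2) * (b2 + c2)) * hd
        + ((a1 + c1) * (b2 + c2) - (a2 + c2) * (b1 + c1)) * hdet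
    have hsq : ∀ x y : ℤ, x ^ 2 + y ^ 2 = 0 → x = 0 ∧ y = 0 := fun x y h => by
      have hx := sq_nonneg x
      have hy := sq_nonneg y
      exact ⟨(pow_eq_zero_iff two_ne_zero).1 (by linarith),
        (pow_eq_zero_iff two_ne_zero).1 (by linarith)⟩
    rcases mul_eq_zero.1 hprod with h | h
    · obtain ⟨h5, h6⟩ := hsq _ _ h
      right; left; omega
    · obtain ⟨h5, h6⟩ := hsq _ _ h
      right; right; omega

/-- The Kronecker symbol. -/
def pairDelta (l m : ℤ × ℤ) : ℂ := if l = m then 1 else 0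

theorem pairDelta_self (l : ℤ × ℤ) : pairDelta l l = 1 := if_pos rfl

theorem pairDelta_ne {l m : ℤ × ℤ} (h : l ≠ m) : pairDelta l m = 0 := if_neg h

theorem sum_mul_pairDelta {s : Finset (ℤ × ℤ)} {m : ℤ × ℤ} (hm : m ∈ s) (F : ℤ × ℤ → ℂ) :
    ∑ l ∈ s, F l * pairDelta l m = F m := by
  simp [pairDelta, Finset.sum_ite_eq', hm]

theorem ne_neg_self {l : ℤ × ℤ} (hl : l ≠ 0) : l ≠ -l := fun h => hl (by
  have h1 := congrArg Prod.fst h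
  have h2 := congrArg Prod.snd h
  simp only [Prod.fst_neg, Prod.snd_neg] at h1 h2
  exact Prod.ext (by simp; omega) (by simp; omega))

/-- Inclusion and exclusion over the three pairings. Two of them hold together exactly in the three
degenerate configurations subtracted at the end; all three together would force l₁ = -l₁, which is
impossible on a circle of positive radius. -/
theorem pairDelta_zero_sum {n : ℕ} (hn : 0 < n) {l₁ l₂ l₃ l₄ : ℤ × ℤ} (h1 : l₁ ∈ freq n)
    (h2 : l₂ ∈ freq n) (h3 : l₃ ∈ freq n) (h4 : l₄ ∈ freq n) :
    pairDelta (l₁ + l₂ + l₃ + l₄) 0 = pairDelta l₂ (-l₁) * pairDelta l₄ (-l₃) + pairDelta l₃ (-l₁) * pairDelta l₄ (-l₂)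
      + pairDelta l₃ (-l₂) * pairDelta l₄ (-l₁) - pairDelta l₂ (-l₁) * pairDelta l₃ (-l₁) * pairDelta l₄ l₁
      - pairDelta l₂ (-l₁) * pairDelta l₃ l₁ * pairDelta l₄ (-l₁) - pairDelta l₂ l₁ * pairDelta l₃ (-l₁) * pairDelta l₄ (-l₁) := by
  have hne : ∀ l ∈ freq n, l ≠ -l := fun l hl => ne_neg_self (freq_ne_zero hn l hl)
  by_cases h : l₁ + l₂ + l₃ + l₄ = 0
  · rw [h, pairDelta_self]
    have e1 := hne _ h1
    have e3 := hne _ h3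
    have e2 := hne _ h2
    rcases eq_neg_of_zero_sum h1 h2 h3 h4 h with ⟨rfl, rfl⟩ | ⟨rfl, rfl⟩ | ⟨rfl, rfl⟩
    · simp only [pairDelta, neg_neg, neg_inj, if_true]
      by_cases h5 : l₃ = l₁
      · subst h5; simp [e1, e1.symm]
      · by_cases h6 : l₃ = -l₁
        · subst h6; simp [e1, e1.symm]
        · have h7 : -l₃ ≠ l₁ := fun h => h6 (by rw [← h, neg_neg])
          simp [h5, h6, h7]
    · simp only [pairDelta, neg_neg, neg_inj, if_true]
      by_cases h5 : l₂ = l₁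
      · subst h5; simp [e1, e1.symm]
      · by_cases h6 : l₂ = -l₁
        · subst h6; simp [e1, e1.symm]
        · have h7 : -l₂ ≠ l₁ := fun h => h6 (by rw [← h, neg_neg])
          have h8 : ¬ l₁ = l₂ := fun h => h5 h.symm
          simp [h5, h6, h7, h8]
    · simp only [pairDelta, neg_neg, neg_inj, if_true]
      by_cases h5 : l₂ = l₁
      · subst h5; simp [e1, e1.symm]
      · by_cases h6 : l₂ = -l₁
        · subst h6; simp [e1, e1.symm]
        · have h7 : -l₂ ≠ l₁ := fun h => h6 (by rw [← h, neg_neg])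
          have h8 : ¬ l₁ = l₂ := fun h => h5 h.symm
          simp [h5, h6, h7, h8]
  · rw [pairDelta_ne h]
    have z2 : ∀ {a b c d : ℤ × ℤ}, ¬ (a = b ∧ c = d) → pairDelta a b * pairDelta c d = 0 := by
      intro a b c d h
      by_cases h5 : a = b
      · rw [pairDelta_ne fun h6 => h ⟨h5, h6⟩, mul_zero]
      · rw [pairDelta_ne h5, zero_mul]
    have z3 : ∀ {a b c d e f : ℤ × ℤ}, ¬ (a = b ∧ c = d ∧ e = f) →
        pairDelta a b * pairDelta c d * pairDelta e f = 0 := by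
      intro a b c d e f h
      by_cases h5 : a = b ∧ c = d
      · rw [pairDelta_ne fun h6 => h ⟨h5.1, h5.2, h6⟩, mul_zero]
      · rw [z2 h5, zero_mul]
    rw [z2, z2, z2, z3, z3, z3]
    · ring
    all_goals
      rintro ⟨rfl, rfl, rfl⟩
      exact h (by abel)

theorem sum_zero_quadruple {n : ℕ} (hn : 0 < n) (F : ℤ × ℤ → ℤ × ℤ → ℤ × ℤ → ℤ × ℤ → ℂ) :
    ∑ l₁ ∈ freq n, ∑ l₂ ∈ freq n, ∑ l₃ ∈ freq n, ∑ l₄ ∈ freq n,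
      F l₁ l₂ l₃ l₄ * pairDelta (l₁ + l₂ + l₃ + l₄) 0
    = ∑ l ∈ freq n, ∑ m ∈ freq n, (F l (-l) m (-m) + F l m (-l) (-m) + F l m (-m) (-l))
      - ∑ l ∈ freq n, (F l (-l) (-l) l + F l (-l) l (-l) + F l l (-l) (-l)) := by
  rw [← Finset.sum_sub_distrib]
  refine Finset.sum_congr rfl fun l₁ h1 => ?_
  have hN := fun l h => neg_mem_freq (n := n) (l := l) h
  have step : ∀ l₂ ∈ freq n, ∑ l₃ ∈ freq n, ∑ l₄ ∈ freq n,
      F l₁ l₂ l₃ l₄ * pairDelta (l₁ + l₂ + l₃ + l₄) 0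
      = (∑ l₃ ∈ freq n, F l₁ l₂ l₃ (-l₃)) * pairDelta l₂ (-l₁) + F l₁ l₂ (-l₁) (-l₂)
        + F l₁ l₂ (-l₂) (-l₁) - F l₁ l₂ (-l₁) l₁ * pairDelta l₂ (-l₁)
        - F l₁ l₂ l₁ (-l₁) * pairDelta l₂ (-l₁) - F l₁ l₂ (-l₁) (-l₁) * pairDelta l₂ l₁ := by
    intro l₂ h2
    have step2 : ∀ l₃ ∈ freq n, ∑ l₄ ∈ freq n, F l₁ l₂ l₃ l₄ * pairDelta (l₁ + l₂ + l₃ + l₄) 0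
        = F l₁ l₂ l₃ (-l₃) * pairDelta l₂ (-l₁) + F l₁ l₂ l₃ (-l₂) * pairDelta l₃ (-l₁)
          + F l₁ l₂ l₃ (-l₁) * pairDelta l₃ (-l₂) - F l₁ l₂ l₃ l₁ * pairDelta l₂ (-l₁) * pairDelta l₃ (-l₁)
          - F l₁ l₂ l₃ (-l₁) * pairDelta l₂ (-l₁) * pairDelta l₃ l₁
          - F l₁ l₂ l₃ (-l₁) * pairDelta l₂ l₁ * pairDelta l₃ (-l₁) := by
      intro l₃ h3
      have : ∀ l₄ ∈ freq n, F l₁ l₂ l₃ l₄ * pairDelta (l₁ + l₂ + l₃ + l₄) 0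
          = (F l₁ l₂ l₃ l₄ * pairDelta l₂ (-l₁)) * pairDelta l₄ (-l₃)
          + (F l₁ l₂ l₃ l₄ * pairDelta l₃ (-l₁)) * pairDelta l₄ (-l₂)
          + (F l₁ l₂ l₃ l₄ * pairDelta l₃ (-l₂)) * pairDelta l₄ (-l₁)
          - (F l₁ l₂ l₃ l₄ * pairDelta l₂ (-l₁) * pairDelta l₃ (-l₁)) * pairDelta l₄ l₁
          - (F l₁ l₂ l₃ l₄ * pairDelta l₂ (-l₁) * pairDelta l₃ l₁) * pairDelta l₄ (-l₁)
          - (F l₁ l₂ l₃ l₄ * pairDelta l₂ l₁ * pairDelta l₃ (-l₁)) * pairDelta l₄ (-l₁) := fun l₄ h4 => by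
        rw [pairDelta_zero_sum hn h1 h2 h3 h4]; ring
      rw [Finset.sum_congr rfl this]
      simp only [Finset.sum_add_distrib, Finset.sum_sub_distrib]
      rw [sum_mul_pairDelta (hN _ h3), sum_mul_pairDelta (hN _ h2), sum_mul_pairDelta (hN _ h1),
        sum_mul_pairDelta h1, sum_mul_pairDelta (hN _ h1), sum_mul_pairDelta (hN _ h1)]
    rw [Finset.sum_congr rfl step2]
    simp only [Finset.sum_add_distrib, Finset.sum_sub_distrib]
    rw [sum_mul_pairDelta (hN _ h1), sum_mul_pairDelta (hN _ h2), sum_mul_pairDelta (hN _ h1),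
      sum_mul_pairDelta h1, sum_mul_pairDelta (hN _ h1), Finset.sum_mul]
  rw [Finset.sum_congr rfl step]
  simp only [Finset.sum_add_distrib, Finset.sum_sub_distrib]
  rw [sum_mul_pairDelta (hN _ h1), sum_mul_pairDelta (hN _ h1), sum_mul_pairDelta (hN _ h1), sum_mul_pairDelta h1]
  ring

/-! ### Integrals of products of four trigonometric sums -/

theorem planeExp_add (k l : ℤ × ℤ) (p : ℝ × ℝ) :
    planeExp (k + l) p = planeExp k p * planeExp l p := by
  rw [planeExp, planeExp, planeExp, ← Complex.exp_add]
  congr 1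
  simp only [Prod.fst_add, Prod.snd_add]
  push_cast; ring

theorem integral_exp_period (k : ℤ) :
    ∫ x in Set.Ico (0 : ℝ) 1, Complex.exp ((2 * Real.pi * (k * x) : ℝ) * Complex.I)
      = if k = 0 then 1 else 0 := by
  by_cases hk : k = 0
  · simp [hk]
  · rw [if_neg hk, integral_Ico_eq_integral_Ioc, ← intervalIntegral.integral_of_le zero_le_one]
    have hc : (2 * Real.pi * k * Complex.I : ℂ) ≠ 0 := by
      have : (k : ℂ) ≠ 0 := by exact_mod_cast hk
      have : (Real.pi : ℂ) ≠ 0 := by exact_mod_cast Real.pi_ne_zero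
      simp_all
    have := integral_exp_mul_complex (a := 0) (b := 1) hc
    calc _ = ∫ x in (0 : ℝ)..1, Complex.exp (2 * Real.pi * k * Complex.I * x) := by
          congr 1; ext x; congr 1; push_cast; ring
      _ = 0 := by
          rw [this]
          have e : (2 * Real.pi * k * Complex.I * (1 : ℝ) : ℂ) = k * (2 * Real.pi * Complex.I) := by
            push_cast; ring
          rw [e, Complex.exp_int_mul_two_pi_mul_I]
          simp

theorem integral_planeExp (k : ℤ × ℤ) : ∫ p in unitSquare, planeExp k p = pairDelta k 0 := by
  have h : ∀ p : ℝ × ℝ, planeExp k p = Complex.exp ((2 * Real.pi * (k.1 * p.1) : ℝ) * Complex.I)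
      * Complex.exp ((2 * Real.pi * (k.2 * p.2) : ℝ) * Complex.I) := fun p => by
    rw [planeExp, ← Complex.exp_add]
    congr 1
    push_cast; ring
  simp_rw [h]
  rw [unitSquare, Measure.volume_eq_prod]
  have := setIntegral_prod_mul (μ := volume) (ν := volume)
    (fun x : ℝ => Complex.exp ((2 * Real.pi * (k.1 * x) : ℝ) * Complex.I))
    (fun x : ℝ => Complex.exp ((2 * Real.pi * (k.2 * x) : ℝ) * Complex.I)) (Set.Ico 0 1)
    (Set.Ico 0 1)
  rw [this, integral_exp_period, integral_exp_period, pairDelta]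
  by_cases h1 : k.1 = 0 <;> by_cases h2 : k.2 = 0 <;> simp [h1, h2, Prod.ext_iff]

theorem continuous_planeExp (k : ℤ × ℤ) : Continuous (planeExp k) := by
  unfold planeExp
  fun_prop

/-- The complex trigonometric sum with coefficients `f * c`. -/
noncomputable def weightedSum (n : ℕ) (c : ℤ × ℤ → ℂ) (f : ℤ × ℤ → ℝ) (p : ℝ × ℝ) : ℂ :=
  ∑ l ∈ freq n, f l * c l * planeExp l p

theorem integrable_unitSquare {f : ℝ × ℝ → ℂ} (hf : Continuous f) :
    Integrable f (volume.restrict unitSquare) := by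
  have : IntegrableOn f (Set.Icc 0 1 ×ˢ Set.Icc 0 1) :=
    hf.continuousOn.integrableOn_compact (isCompact_Icc.prod isCompact_Icc)
  exact this.mono_set (Set.prod_mono Set.Ico_subset_Icc_self Set.Ico_subset_Icc_self)

theorem continuous_weightedSum (n : ℕ) (c : ℤ × ℤ → ℂ) (f : ℤ × ℤ → ℝ) :
    Continuous (weightedSum n c f) :=
  continuous_finsetSum _ fun l _ => continuous_const.mul (continuous_planeExp l)

/-- Orthogonality of the exponentials keeps the quadruples of zero sum. In each pairing the
coefficients combine through c(-l) = conj c(l) into squared moduli. -/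
theorem integral_weightedSum_mul {n : ℕ} (hn : 0 < n) {c : ℤ × ℤ → ℂ}
    (hc : ∀ l ∈ freq n, c (-l) = (starRingEnd ℂ) (c l)) (f₁ f₂ f₃ f₄ : ℤ × ℤ → ℝ) :
    ∫ p in unitSquare, weightedSum n c f₁ p * weightedSum n c f₂ p * weightedSum n c f₃ p
        * weightedSum n c f₄ p
      = ((∑ l ∈ freq n, ∑ m ∈ freq n, Complex.normSq (c l) * Complex.normSq (c m) *
          (f₁ l * f₂ (-l) * f₃ m * f₄ (-m) + f₁ l * f₂ m * f₃ (-l) * f₄ (-m)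
            + f₁ l * f₂ m * f₃ (-m) * f₄ (-l))
        - ∑ l ∈ freq n, Complex.normSq (c l) ^ 2 *
          (f₁ l * f₂ (-l) * f₃ (-l) * f₄ l + f₁ l * f₂ (-l) * f₃ l * f₄ (-l)
            + f₁ l * f₂ l * f₃ (-l) * f₄ (-l)) : ℝ) : ℂ) := by
  set F : ℤ × ℤ → ℤ × ℤ → ℤ × ℤ → ℤ × ℤ → ℂ := fun l₁ l₂ l₃ l₄ =>
    (f₁ l₁ * c l₁) * (f₂ l₂ * c l₂) * (f₃ l₃ * c l₃) * (f₄ l₄ * c l₄) with hF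
  have h1 : ∀ p, weightedSum n c f₁ p * weightedSum n c f₂ p * weightedSum n c f₃ p
      * weightedSum n c f₄ p = ∑ l₁ ∈ freq n, ∑ l₂ ∈ freq n, ∑ l₃ ∈ freq n, ∑ l₄ ∈ freq n,
        F l₁ l₂ l₃ l₄ * planeExp (l₁ + l₂ + l₃ + l₄) p := by
    intro p
    rw [mul_assoc, mul_assoc]
    simp only [weightedSum]
    rw [Finset.sum_mul]
    refine Finset.sum_congr rfl fun l₁ _ => ?_
    rw [Finset.sum_mul, Finset.mul_sum]
    refine Finset.sum_congr rfl fun l₂ _ => ?_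
    rw [Finset.sum_mul, Finset.mul_sum, Finset.mul_sum]
    refine Finset.sum_congr rfl fun l₃ _ => ?_
    rw [Finset.mul_sum, Finset.mul_sum, Finset.mul_sum]
    refine Finset.sum_congr rfl fun l₄ _ => ?_
    rw [planeExp_add, planeExp_add, planeExp_add, hF]
    ring
  simp_rw [h1]
  have hi : ∀ l₁ l₂ l₃ l₄, Integrable (fun p => F l₁ l₂ l₃ l₄ * planeExp (l₁ + l₂ + l₃ + l₄) p)
      (volume.restrict unitSquare) := fun l₁ l₂ l₃ l₄ =>
    integrable_unitSquare (continuous_const.mul (continuous_planeExp _))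
  have h2 : ∫ p in unitSquare, ∑ l₁ ∈ freq n, ∑ l₂ ∈ freq n, ∑ l₃ ∈ freq n, ∑ l₄ ∈ freq n,
        F l₁ l₂ l₃ l₄ * planeExp (l₁ + l₂ + l₃ + l₄) p
      = ∑ l₁ ∈ freq n, ∑ l₂ ∈ freq n, ∑ l₃ ∈ freq n, ∑ l₄ ∈ freq n,
        F l₁ l₂ l₃ l₄ * pairDelta (l₁ + l₂ + l₃ + l₄) 0 := by
    rw [integral_finsetSum _ fun l₁ _ => integrable_finsetSum _ fun l₂ _ =>
      integrable_finsetSum _ fun l₃ _ => integrable_finsetSum _ fun l₄ _ => hi l₁ l₂ l₃ l₄]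
    refine Finset.sum_congr rfl fun l₁ _ => ?_
    rw [integral_finsetSum _ fun l₂ _ =>
      integrable_finsetSum _ fun l₃ _ => integrable_finsetSum _ fun l₄ _ => hi l₁ l₂ l₃ l₄]
    refine Finset.sum_congr rfl fun l₂ _ => ?_
    rw [integral_finsetSum _ fun l₃ _ => integrable_finsetSum _ fun l₄ _ => hi l₁ l₂ l₃ l₄]
    refine Finset.sum_congr rfl fun l₃ _ => ?_
    rw [integral_finsetSum _ fun l₄ _ => hi l₁ l₂ l₃ l₄]
    refine Finset.sum_congr rfl fun l₄ _ => ?_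
    rw [integral_const_mul, integral_planeExp]
  rw [h2, sum_zero_quadruple hn]
  have hq : ∀ l ∈ freq n, c l * c (-l) = (Complex.normSq (c l) : ℂ) := fun l hl => by
    rw [hc l hl, Complex.mul_conj]
  push_cast
  congr 1
  · refine Finset.sum_congr rfl fun l hl => Finset.sum_congr rfl fun m hm => ?_
    rw [← hq l hl, ← hq m hm]
    simp only [hF]
    ring
  · refine Finset.sum_congr rfl fun l hl => ?_
    rw [← hq l hl]
    simp only [hF]
    ring

/-! ### The quartic form produced by integration over the torus. -/

/-- `cos (2 (φ_l - φ_m))` for two lattice points on the circle of radius `√n`. -/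
noncomputable def cosDouble (n : ℕ) (l m : ℤ × ℤ) : ℝ :=
  2 * ((l.1 * m.1 + l.2 * m.2) / n) ^ 2 - 1

/-- The quartic form of the coefficients that governs the fourth chaos. -/
noncomputable def quarticForm (n : ℕ) (c : ℤ × ℤ → ℂ) : ℝ :=
  ∑ l ∈ freq n, Complex.normSq (c l) ^ 2
    - ∑ l ∈ freq n, ∑ m ∈ freq n, cosDouble n l m * (Complex.normSq (c l) * Complex.normSq (c m))

theorem sum_jetCoeff_eq {n : ℕ} {c : ℤ × ℤ → ℂ} (hc : ∀ l ∈ freq n, c (-l) = (starRingEnd ℂ) (c l))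
    (p : ℝ × ℝ) (i : Fin 3) :
    ((∑ l ∈ freq n, (jetCoeff n p i l * c l).re : ℝ) : ℂ) = ∑ l ∈ freq n, jetCoeff n p i l * c l := by
  have h := sum_freq_neg n fun l => jetCoeff n p i l * c l
  have h2 : ∑ l ∈ freq n, (starRingEnd ℂ) (jetCoeff n p i l * c l)
      = ∑ l ∈ freq n, jetCoeff n p i l * c l := by
    rw [← h]
    refine Finset.sum_congr rfl fun l hl => ?_
    rw [jetCoeff_neg, hc l hl, map_mul]
  rw [← Complex.re_sum]
  refine Complex.conj_eq_iff_re.1 ?_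
  rw [map_sum, h2]

/-- A derivative multiplies a coefficient by i times a coordinate of the frequency, so the factor i²
reverses the sign of the mixed term. With x = ⟨l, m⟩/n, the weight of a pair (l, m) is 9 + (-6 +
12x) - (3/2)(1 + 2x²). The linear part cancels by symmetry and the remainder is -(3/2)(2x² - 1), a
multiple of the cosine of the doubled angle difference. -/
theorem integral_quartic_jet {n : ℕ} (hn : n ∈ sumTwoSquares) {c : ℤ × ℤ → ℂ}
    (hc : ∀ l ∈ freq n, c (-l) = (starRingEnd ℂ) (c l)) {b : ℝ × ℝ → Fin 3 → ℝ}
    (hb : ∀ p i, b p i = ∑ l ∈ freq n, (jetCoeff n p i l * c l).re) :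
    ∫ p in unitSquare, (3 * b p 0 ^ 4 - 3 * b p 0 ^ 2 * (b p 1 ^ 2 + b p 2 ^ 2)
        - 3 / 8 * (b p 1 ^ 2 + b p 2 ^ 2) ^ 2)
      = 3 / 2 * ((freqCard n : ℝ) ^ 2)⁻¹ * quarticForm n c := by
  have hN : (0 : ℝ) < freqCard n := by exact_mod_cast freqCard_pos hn
  have hn0 : (0 : ℝ) < n := by exact_mod_cast hn.1
  have hk := derivScale_pos hn.1
  have hk2 := derivScale_sq n
  have hpi := Real.pi_pos
  set r : ℝ := (√(freqCard n : ℝ))⁻¹ with hr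
  have hr2 : r ^ 2 = (freqCard n : ℝ)⁻¹ := by rw [hr, inv_pow, Real.sq_sqrt hN.le]
  set t : ℝ := 2 * Real.pi / derivScale n with ht
  have ht2 : t ^ 2 = 2 / n := by
    rw [ht, div_pow, hk2]; field_simp
  set W := weightedSum n c with hW
  set f0 : ℤ × ℤ → ℝ := fun _ => 1 with hf0
  set f1 : ℤ × ℤ → ℝ := fun l => l.1 with hf1
  set f2 : ℤ × ℤ → ℝ := fun l => l.2 with hf2
  have hb0 : ∀ p, (b p 0 : ℂ) = r * W f0 p := fun p => by
    rw [hb, sum_jetCoeff_eq hc, hW, weightedSum, Finset.mul_sum]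
    refine Finset.sum_congr rfl fun l _ => ?_
    simp only [jetCoeff, Matrix.cons_val, hf0, Complex.ofReal_one]
    ring
  have hb1 : ∀ p, (b p 1 : ℂ) = r * t * Complex.I * W f1 p := fun p => by
    rw [hb, sum_jetCoeff_eq hc, hW, weightedSum, Finset.mul_sum]
    refine Finset.sum_congr rfl fun l _ => ?_
    simp only [jetCoeff, Matrix.cons_val, hf1, ht, hr]
    push_cast
    ring
  have hb2 : ∀ p, (b p 2 : ℂ) = r * t * Complex.I * W f2 p := fun p => by
    rw [hb, sum_jetCoeff_eq hc, hW, weightedSum, Finset.mul_sum]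
    refine Finset.sum_congr rfl fun l _ => ?_
    simp only [jetCoeff, Matrix.cons_val, hf2, ht, hr]
    push_cast
    ring
  have hcW : ∀ f, Continuous (W f) := fun f => continuous_weightedSum n c f
  have hI : ∀ g₁ g₂ g₃ g₄, Integrable (fun p => W g₁ p * W g₂ p * W g₃ p * W g₄ p)
      (volume.restrict unitSquare) := fun g₁ g₂ g₃ g₄ =>
    integrable_unitSquare ((((hcW g₁).mul (hcW g₂)).mul (hcW g₃)).mul (hcW g₄))
  set V : (ℤ × ℤ → ℝ) → (ℤ × ℤ → ℝ) → (ℤ × ℤ → ℝ) → (ℤ × ℤ → ℝ) → ℝ := fun f₁ f₂ f₃ f₄ =>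
    ∑ l ∈ freq n, ∑ m ∈ freq n, Complex.normSq (c l) * Complex.normSq (c m) *
          (f₁ l * f₂ (-l) * f₃ m * f₄ (-m) + f₁ l * f₂ m * f₃ (-l) * f₄ (-m)
            + f₁ l * f₂ m * f₃ (-m) * f₄ (-l))
        - ∑ l ∈ freq n, Complex.normSq (c l) ^ 2 *
          (f₁ l * f₂ (-l) * f₃ (-l) * f₄ l + f₁ l * f₂ (-l) * f₃ l * f₄ (-l)
            + f₁ l * f₂ l * f₃ (-l) * f₄ (-l)) with hVdef
  have hV : ∀ g₁ g₂ g₃ g₄, ∫ p in unitSquare, W g₁ p * W g₂ p * W g₃ p * W g₄ p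
      = (V g₁ g₂ g₃ g₄ : ℂ) := fun g₁ g₂ g₃ g₄ => integral_weightedSum_mul hn.1 hc g₁ g₂ g₃ g₄
  have hmain : ∫ p in unitSquare, (3 * b p 0 ^ 4 - 3 * b p 0 ^ 2 * (b p 1 ^ 2 + b p 2 ^ 2)
        - 3 / 8 * (b p 1 ^ 2 + b p 2 ^ 2) ^ 2)
      = r ^ 4 * (3 * V f0 f0 f0 f0 + 3 * t ^ 2 * (V f0 f0 f1 f1 + V f0 f0 f2 f2)
        - 3 / 8 * t ^ 4 * (V f1 f1 f1 f1 + V f1 f1 f2 f2 + V f2 f2 f1 f1 + V f2 f2 f2 f2)) := by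
    apply Complex.ofReal_injective
    rw [← integral_complex_ofReal]
    have e : ∀ p, ((3 * b p 0 ^ 4 - 3 * b p 0 ^ 2 * (b p 1 ^ 2 + b p 2 ^ 2)
        - 3 / 8 * (b p 1 ^ 2 + b p 2 ^ 2) ^ 2 : ℝ) : ℂ)
        = (3 * r ^ 4 : ℝ) * (W f0 p * W f0 p * W f0 p * W f0 p)
          + (3 * r ^ 4 * t ^ 2 : ℝ) * (W f0 p * W f0 p * W f1 p * W f1 p)
          + (3 * r ^ 4 * t ^ 2 : ℝ) * (W f0 p * W f0 p * W f2 p * W f2 p)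
          + (-3 / 8 * r ^ 4 * t ^ 4 : ℝ) * (W f1 p * W f1 p * W f1 p * W f1 p)
          + (-3 / 8 * r ^ 4 * t ^ 4 : ℝ) * (W f1 p * W f1 p * W f2 p * W f2 p)
          + (-3 / 8 * r ^ 4 * t ^ 4 : ℝ) * (W f2 p * W f2 p * W f1 p * W f1 p)
          + (-3 / 8 * r ^ 4 * t ^ 4 : ℝ) * (W f2 p * W f2 p * W f2 p * W f2 p) := by
      intro p
      push_cast
      rw [hb0, hb1, hb2]
      have hII := Complex.I_sq
      have hI4 : Complex.I ^ 4 = 1 := Complex.I_pow_four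
      simp only [mul_pow, mul_add, add_sq, ← pow_mul, hII]
      norm_num [hI4]
      ring
    simp_rw [e]
    have i1 := hI f0 f0 f0 f0
    have i2 := hI f0 f0 f1 f1
    have i3 := hI f0 f0 f2 f2
    have i4 := hI f1 f1 f1 f1
    have i5 := hI f1 f1 f2 f2
    have i6 := hI f2 f2 f2 f2
    have i7 := hI f2 f2 f1 f1
    rw [integral_add ((((((i1.const_mul _).fun_add (i2.const_mul _)).fun_add
        (i3.const_mul _)).fun_add (i4.const_mul _)).fun_add (i5.const_mul _)).fun_add
        (i7.const_mul _)) (i6.const_mul _), integral_add (((((i1.const_mul _).fun_add (i2.const_mul _)).fun_add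
        (i3.const_mul _)).fun_add (i4.const_mul _)).fun_add (i5.const_mul _)) (i7.const_mul _),
      integral_add ((((i1.const_mul _).fun_add (i2.const_mul _)).fun_add
        (i3.const_mul _)).fun_add (i4.const_mul _)) (i5.const_mul _),
      integral_add (((i1.const_mul _).fun_add (i2.const_mul _)).fun_add
        (i3.const_mul _)) (i4.const_mul _),
      integral_add ((i1.const_mul _).fun_add (i2.const_mul _)) (i3.const_mul _),
      integral_add (i1.const_mul _) (i2.const_mul _)]
    simp only [integral_const_mul]
    rw [hV, hV, hV, hV, hV, hV, hV]
    push_cast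
    ring
  rw [hmain]
  have hr4 : r ^ 4 = ((freqCard n : ℝ) ^ 2)⁻¹ := by
    rw [show r ^ 4 = (r ^ 2) ^ 2 by ring, hr2, inv_pow]
  have ht4 : t ^ 4 = 4 / n ^ 2 := by
    rw [show t ^ 4 = (t ^ 2) ^ 2 by ring, ht2]; ring
  rw [hr4, ht2, ht4]
  -- The summand is odd in m, since squared moduli of the coefficients are even.
  have hodd : ∑ l ∈ freq n, ∑ m ∈ freq n, Complex.normSq (c l) * Complex.normSq (c m) *
      ((l.1 : ℝ) * m.1 + l.2 * m.2) = 0 := by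
    refine Finset.sum_eq_zero fun l _ => ?_
    have h := sum_freq_neg n fun m => Complex.normSq (c l) * Complex.normSq (c m) *
      ((l.1 : ℝ) * m.1 + l.2 * m.2)
    have h2 : ∑ m ∈ freq n, Complex.normSq (c l) * Complex.normSq (c (-m)) *
        ((l.1 : ℝ) * ((-m).1 : ℤ) + l.2 * ((-m).2 : ℤ)) = -∑ m ∈ freq n,
        Complex.normSq (c l) * Complex.normSq (c m) * ((l.1 : ℝ) * m.1 + l.2 * m.2) := by
      rw [← Finset.sum_neg_distrib]
      refine Finset.sum_congr rfl fun m hm => ?_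
      rw [hc m hm, Complex.normSq_conj]
      simp only [Prod.fst_neg, Prod.snd_neg]
      push_cast; ring
    rw [h2] at h
    linarith
  -- The identity holds term by term, separately for the pair sums S and for the diagonal
  -- corrections T; it uses only that the lattice points have squared norm n.
  have hfinal : 3 * V f0 f0 f0 f0 + 3 * (2 / n) * (V f0 f0 f1 f1 + V f0 f0 f2 f2)
        - 3 / 8 * (4 / (n : ℝ) ^ 2) * (V f1 f1 f1 f1 + V f1 f1 f2 f2 + V f2 f2 f1 f1 + V f2 f2 f2 f2)
      = 3 / 2 * quarticForm n c + 12 / n * ∑ l ∈ freq n, ∑ m ∈ freq n,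
          Complex.normSq (c l) * Complex.normSq (c m) * ((l.1 : ℝ) * m.1 + l.2 * m.2) := by
    set S : (ℤ × ℤ → ℤ × ℤ → ℝ) → ℝ := fun g =>
      ∑ l ∈ freq n, ∑ m ∈ freq n, Complex.normSq (c l) * Complex.normSq (c m) * g l m with hS
    set T : (ℤ × ℤ → ℝ) → ℝ := fun g => ∑ l ∈ freq n, Complex.normSq (c l) ^ 2 * g l with hT
    set A : (ℤ × ℤ → ℝ) → (ℤ × ℤ → ℝ) → (ℤ × ℤ → ℝ) → (ℤ × ℤ → ℝ) → ℤ × ℤ → ℤ × ℤ → ℝ :=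
      fun f₁ f₂ f₃ f₄ l m => f₁ l * f₂ (-l) * f₃ m * f₄ (-m) + f₁ l * f₂ m * f₃ (-l) * f₄ (-m)
            + f₁ l * f₂ m * f₃ (-m) * f₄ (-l) with hA
    set B : (ℤ × ℤ → ℝ) → (ℤ × ℤ → ℝ) → (ℤ × ℤ → ℝ) → (ℤ × ℤ → ℝ) → ℤ × ℤ → ℝ :=
      fun f₁ f₂ f₃ f₄ l => f₁ l * f₂ (-l) * f₃ (-l) * f₄ l + f₁ l * f₂ (-l) * f₃ l * f₄ (-l)
            + f₁ l * f₂ l * f₃ (-l) * f₄ (-l) with hB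
    have hVS : ∀ g₁ g₂ g₃ g₄, V g₁ g₂ g₃ g₄ = S (A g₁ g₂ g₃ g₄) - T (B g₁ g₂ g₃ g₄) :=
      fun _ _ _ _ => rfl
    have hSsum : 3 * S (A f0 f0 f0 f0) + 3 * (2 / n) * (S (A f0 f0 f1 f1) + S (A f0 f0 f2 f2))
        - 3 / 8 * (4 / (n : ℝ) ^ 2) * (S (A f1 f1 f1 f1) + S (A f1 f1 f2 f2) + S (A f2 f2 f1 f1)
          + S (A f2 f2 f2 f2))
        = -(3 / 2) * S (cosDouble n) + 12 / n * S (fun l m => (l.1 : ℝ) * m.1 + l.2 * m.2) := by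
      simp only [hS, Finset.mul_sum, ← Finset.sum_add_distrib, ← Finset.sum_sub_distrib]
      refine Finset.sum_congr rfl fun l hl => Finset.sum_congr rfl fun m hm => ?_
      have hnl := sum_freq_norm n hl
      have hnm := sum_freq_norm n hm
      simp only [hA, hf0, hf1, hf2, cosDouble, Prod.fst_neg, Prod.snd_neg]
      push_cast
      have hlm : ((l.1 : ℝ) ^ 2 + (l.2 : ℝ) ^ 2) * ((m.1 : ℝ) ^ 2 + (m.2 : ℝ) ^ 2) = n ^ 2 := by
        rw [hnl, hnm]; ring
      have hx : (n : ℝ) * (n : ℝ)⁻¹ = 1 := mul_inv_cancel₀ hn0.ne'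
      linear_combination (Complex.normSq (c l) * Complex.normSq (c m)) *
        (-6 * (n : ℝ)⁻¹ * hnm - 3 / 2 * (n : ℝ)⁻¹ ^ 2 * hlm
          + (-6 - 3 / 2 * (n * (n : ℝ)⁻¹ + 1)) * hx)
    have hTsum : 3 * T (B f0 f0 f0 f0) + 3 * (2 / n) * (T (B f0 f0 f1 f1) + T (B f0 f0 f2 f2))
        - 3 / 8 * (4 / (n : ℝ) ^ 2) * (T (B f1 f1 f1 f1) + T (B f1 f1 f2 f2) + T (B f2 f2 f1 f1)
          + T (B f2 f2 f2 f2)) = -(3 / 2) * T (fun _ => 1) := by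
      simp only [hT, Finset.mul_sum, ← Finset.sum_add_distrib, ← Finset.sum_sub_distrib]
      refine Finset.sum_congr rfl fun l hl => ?_
      have hnl := sum_freq_norm n hl
      simp only [hB, hf0, hf1, hf2, Prod.fst_neg, Prod.snd_neg]
      push_cast
      have hll : ((l.1 : ℝ) ^ 2 + (l.2 : ℝ) ^ 2) ^ 2 = n ^ 2 := by rw [hnl]
      have hx : (n : ℝ) * (n : ℝ)⁻¹ = 1 := mul_inv_cancel₀ hn0.ne'
      linear_combination (Complex.normSq (c l)) ^ 2 * (-6 * (n : ℝ)⁻¹ * hnl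
        - 9 / 2 * (n : ℝ)⁻¹ ^ 2 * hll + (-6 - 9 / 2 * (n * (n : ℝ)⁻¹ + 1)) * hx)
    have hQ : quarticForm n c = T (fun _ => 1) - S (cosDouble n) := by
      simp only [quarticForm, hT, hS, mul_one]
      congr 1
      refine Finset.sum_congr rfl fun l _ => Finset.sum_congr rfl fun m _ => by ring
    rw [hQ]
    simp only [hVS]
    linear_combination hSsum - hTsum
  rw [hfinal, hodd, mul_zero, add_zero]
  ring

section FourthChaos

variable {Ω : Type*} [MeasurableSpace Ω] {P : Measure Ω} [IsProbabilityMeasure P]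
  {a : ℤ × ℤ → Ω → ℂ}

/-! ### The fourth chaos of the nodal length -/

theorem integral_wick4_sq_gaussianReal :
    ∫ x, wick4 x 1 * wick4 x 1 ∂(gaussianReal 0 1) = 24 := by
  have h : ∀ x : ℝ, wick4 x 1 * wick4 x 1
      = x ^ 8 - 12 * x ^ 6 + 42 * x ^ 4 - 36 * x ^ 2 + 9 := fun x => by
    simp only [wick4]; ring
  have i := fun k => integrable_pow_gaussianReal k 1
  simp_rw [h]
  have j1 := integrable_fun_sub (i 8) ((i 6).const_mul 12)
  have j2 := j1.fun_add ((i 4).const_mul 42)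
  have j3 := integrable_fun_sub j2 ((i 2).const_mul 36)
  rw [integral_add j3 (integrable_const _), integral_sub j2 ((i 2).const_mul _),
    integral_add j1 ((i 4).const_mul _), integral_sub (i 8) ((i 6).const_mul _)]
  simp only [integral_const_mul, gaussian_moment_eight, gaussian_moment_six, gaussian_moment_four,
    gaussian_moment_two, integral_const]
  norm_num

theorem wick4_smul (c x s : ℝ) : wick4 (c * x) (c ^ 2 * s) = c ^ 4 * wick4 x s := by
  simp only [wick4]; ring

/-- Orthogonality of fourth Wick powers. -/
theorem integral_wick4_mul_wick4 (ha : IsWaveCoefficients a P) {ξ ζ : Lp ℝ 2 P}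
    (hξ : ξ ∈ gaussianSpace a P) (hζ : ζ ∈ gaussianSpace a P) :
    ∫ ω, wick4 (ξ ω) (‖ξ‖ ^ 2) * wick4 (ζ ω) (‖ζ‖ ^ 2) ∂P = 24 * inner ℝ ξ ζ ^ 4 := by
  rcases eq_or_ne ξ 0 with rfl | h0
  · have : ∀ᵐ ω ∂P, wick4 ((0 : Lp ℝ 2 P) ω) (‖(0 : Lp ℝ 2 P)‖ ^ 2)
        * wick4 (ζ ω) (‖ζ‖ ^ 2) = 0 := by
      filter_upwards [Lp.coeFn_zero ℝ 2 P] with ω h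
      rw [h]
      simp [wick4]
    rw [integral_congr_ae this]
    simp
  have hn : ‖ξ‖ ≠ 0 := norm_ne_zero_iff.2 h0
  -- The normalised ξ is a one-element orthonormal family, so ζ may be replaced by its component
  -- along ξ, and the claim becomes E[H₄²] = 4! together with homogeneity.
  let U : Unit → Lp ℝ 2 P := fun _ => ‖ξ‖⁻¹ • ξ
  have hU : ∀ i, U i ∈ gaussianSpace a P := fun _ => Submodule.smul_mem _ _ hξ
  have ho : Orthonormal ℝ U := by
    refine ⟨fun i => by simp [U, norm_smul, hn], fun i j hij => absurd (Subsingleton.elim i j) hij⟩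
  have hm : MemLp (fun u : Unit → ℝ => wick4 (u ()) 1) 2
      (Measure.pi fun _ : Unit => gaussianReal 0 1) := by
    have := memLp_wick4_of_mem ha (hU ()) 1
    have hl := hasLaw_pi_of_orthonormal ha hU ho
    rw [← hl.map_eq]
    exact (memLp_map_measure_iff (by unfold wick4; fun_prop) hl.aemeasurable).2 this
  have h := integral_mul_wick4 ha hU ho hζ (Φ := fun u => wick4 (u ()) 1)
    (by unfold wick4; fun_prop) hm
  have e1 : ∀ᵐ ω ∂P, wick4 (ξ ω) (‖ξ‖ ^ 2) * wick4 (ζ ω) (‖ζ‖ ^ 2)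
      = ‖ξ‖ ^ 4 * (wick4 (U () ω) 1 * wick4 (ζ ω) (‖ζ‖ ^ 2)) := by
    filter_upwards [Lp.coeFn_smul ‖ξ‖⁻¹ ξ] with ω h1
    have h2 : ξ ω = ‖ξ‖ * U () ω := by
      simp only [U, h1, Pi.smul_apply, smul_eq_mul]; field_simp
    have := wick4_smul ‖ξ‖ (U () ω) 1
    rw [mul_one, ← h2] at this
    rw [this]; ring
  rw [integral_congr_ae e1, integral_const_mul, h]
  simp only [Finset.univ_unique, Finset.sum_singleton]
  have e2 : ∀ u : Unit → ℝ, wick4 (u ()) 1 * wick4 (inner ℝ (U default) ζ * u default)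
      (inner ℝ (U default) ζ ^ 2) = inner ℝ (U ()) ζ ^ 4 * (wick4 (u ()) 1 * wick4 (u ()) 1) := by
    intro u
    have := wick4_smul (inner ℝ (U ()) ζ) (u ()) 1
    rw [mul_one] at this
    change _ * wick4 (inner ℝ (U ()) ζ * u ()) (inner ℝ (U ()) ζ ^ 2) = _
    rw [this]; ring
  simp_rw [e2]
  have e3 : ∫ u : Unit → ℝ, wick4 (u ()) 1 * wick4 (u ()) 1
      ∂(Measure.pi fun _ : Unit => gaussianReal 0 1) = 24 := by
    have hp := measurePreserving_eval (fun _ : Unit => gaussianReal 0 1) ()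
    rw [← integral_wick4_sq_gaussianReal]
    conv_rhs => rw [← hp.map_eq]
    rw [integral_map hp.aemeasurable (by unfold wick4; fun_prop)]
  rw [integral_const_mul, e3]
  simp only [U, inner_smul_left, RCLike.conj_to_real]
  rw [← mul_assoc, mul_pow, inv_pow]
  field_simp

/-- Polarization for a repeated pair: for orthonormal variables x ± y have variance 2, so all four
terms are genuine Wick powers. -/
theorem hermiteSq_mul_eq_wick4 (x y : ℝ) : (x ^ 2 - 1) * (y ^ 2 - 1)
    = 12⁻¹ * (wick4 (x + y) 2 + wick4 (x - y) 2 - 2 * wick4 x 1 - 2 * wick4 y 1) := by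
  simp only [wick4]; ring

/-- For an orthonormal pair, the product of second Hermite polynomials. -/
theorem integral_hermiteSq_mul_wick4 (ha : IsWaveCoefficients a P) {ξ χ ζ : Lp ℝ 2 P}
    (hξ : ξ ∈ gaussianSpace a P) (hχ : χ ∈ gaussianSpace a P) (hζ : ζ ∈ gaussianSpace a P)
    (h1 : ‖ξ‖ = 1) (h2 : ‖χ‖ = 1) (h3 : inner ℝ ξ χ = 0) :
    ∫ ω, ((ξ ω ^ 2 - 1) * (χ ω ^ 2 - 1)) * wick4 (ζ ω) (‖ζ‖ ^ 2) ∂P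
      = 24 * (inner ℝ ξ ζ ^ 2 * inner ℝ χ ζ ^ 2) := by
  have hp : ξ + χ ∈ gaussianSpace a P := Submodule.add_mem _ hξ hχ
  have hm : ξ - χ ∈ gaussianSpace a P := Submodule.sub_mem _ hξ hχ
  have np : ‖ξ + χ‖ ^ 2 = 2 := by rw [norm_add_sq_real, h1, h2, h3]; norm_num
  have nm : ‖ξ - χ‖ ^ 2 = 2 := by rw [norm_sub_sq_real, h1, h2, h3]; norm_num
  have i : ∀ {θ : Lp ℝ 2 P}, θ ∈ gaussianSpace a P → ∀ s : ℝ,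
      Integrable (fun ω => wick4 (θ ω) s * wick4 (ζ ω) (‖ζ‖ ^ 2)) P := fun hθ s =>
    (memLp_wick4_of_mem ha hθ s).integrable_mul (memLp_wick4_of_mem ha hζ (‖ζ‖ ^ 2))
  have j1 := (i hp 2).fun_add (i hm 2)
  have j2 := integrable_fun_sub j1 ((i hξ 1).const_mul 2)
  have e := fun {θ : Lp ℝ 2 P} (hθ : θ ∈ gaussianSpace a P) => integral_wick4_mul_wick4 ha hθ hζ
  have e1 := e hp; have e2 := e hm; have e3 := e hξ; have e4 := e hχ
  rw [np] at e1; rw [nm] at e2; rw [h1, one_pow] at e3; rw [h2, one_pow] at e4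
  have h : ∀ᵐ ω ∂P, ((ξ ω ^ 2 - 1) * (χ ω ^ 2 - 1)) * wick4 (ζ ω) (‖ζ‖ ^ 2)
      = 12⁻¹ * (wick4 ((ξ + χ : Lp ℝ 2 P) ω) 2 * wick4 (ζ ω) (‖ζ‖ ^ 2)
        + wick4 ((ξ - χ : Lp ℝ 2 P) ω) 2 * wick4 (ζ ω) (‖ζ‖ ^ 2)
        - 2 * (wick4 (ξ ω) 1 * wick4 (ζ ω) (‖ζ‖ ^ 2))
        - 2 * (wick4 (χ ω) 1 * wick4 (ζ ω) (‖ζ‖ ^ 2))) := by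
    filter_upwards [Lp.coeFn_add ξ χ, Lp.coeFn_sub ξ χ] with ω k1 k2
    rw [hermiteSq_mul_eq_wick4, k1, k2]
    simp only [Pi.add_apply, Pi.sub_apply]
    ring
  rw [integral_congr_ae h, integral_const_mul,
    integral_sub j2 ((i hχ 1).const_mul _), integral_sub j1 ((i hξ 1).const_mul _),
    integral_add (i hp 2) (i hm 2), integral_const_mul, integral_const_mul, e1, e2, e3, e4,
    inner_add_left, inner_sub_left]
  ring

/-! ### Independent real coordinates and the Hermite basis of the relevant part of the chaos. -/

open Classical in
/-- The rotation that turns `a_λ` into a standard real Gaussian variable. -/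
noncomputable def stdRotation (l : ℤ × ℤ) : ℂ :=
  if IsPos l then ((√2 : ℝ) : ℂ) else -((√2 : ℝ) : ℂ) * Complex.I

/-- Independent standard Gaussian variables from which the `a_λ` are recovered. -/
noncomputable def stdField (ha : IsWaveCoefficients a P) (l : ℤ × ℤ) : Lp ℝ 2 P :=
  if h : l ≠ 0 then (memLp_re_mul ha h (stdRotation l)).toLp _ else 0

theorem stdField_ae (ha : IsWaveCoefficients a P) {l : ℤ × ℤ} (hl : l ≠ 0) :
    ∀ᵐ ω ∂P, stdField ha l ω = (stdRotation l * a l ω).re := by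
  rw [stdField, dif_pos hl]
  exact (memLp_re_mul ha hl (stdRotation l)).coeFn_toLp

theorem stdField_mem (ha : IsWaveCoefficients a P) (l : ℤ × ℤ) :
    stdField ha l ∈ gaussianSpace a P := by
  by_cases hl : l ≠ 0
  · rw [stdField, dif_pos hl]; exact re_mul_mem ha hl _
  · rw [stdField, dif_neg hl]; exact Submodule.zero_mem _

theorem stdRotation_mul_conj (l : ℤ × ℤ) :
    (stdRotation l * (starRingEnd ℂ) (stdRotation l)).re = 2 := by
  have : √(2 : ℝ) * √2 = 2 := Real.mul_self_sqrt (by norm_num)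
  unfold stdRotation
  split_ifs <;> simp [this]

theorem stdRotation_mul_neg {l : ℤ × ℤ} (hl : l ≠ 0) :
    (stdRotation l * stdRotation (-l)).re = 0 := by
  unfold stdRotation
  by_cases h : IsPos l
  · simp [h, not_isPos_neg h]
  · simp [h, isPos_neg_of_not hl h]

/-- Up to sign, the rotated values at l and -l are √2 times the real and the imaginary part of one
complex number, so their squares add up to twice its squared modulus. -/
theorem re_stdRotation_sq_add {l : ℤ × ℤ} (hl : l ≠ 0) (z : ℂ) :
    (stdRotation l * z).re ^ 2 + (stdRotation (-l) * (starRingEnd ℂ) z).re ^ 2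
      = 2 * Complex.normSq z := by
  have : √(2 : ℝ) ^ 2 = 2 := Real.sq_sqrt (by norm_num)
  unfold stdRotation
  by_cases h : IsPos l
  · simp [h, not_isPos_neg h, Complex.normSq_apply, mul_pow, this]; ring
  · simp [h, isPos_neg_of_not hl h, Complex.normSq_apply, mul_pow, this]; ring

theorem inner_stdField (ha : IsWaveCoefficients a P) {l m : ℤ × ℤ} (hl : l ≠ 0) (hm : m ≠ 0) :
    inner ℝ (stdField ha l) (stdField ha m) = if l = m then 1 else 0 := by
  have hne : l ≠ -l := fun h => hl (by
    have h1 := congrArg Prod.fst h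
    have h2 := congrArg Prod.snd h
    simp only [Prod.fst_neg, Prod.snd_neg] at h1 h2
    exact Prod.ext (by simp only [Prod.fst_zero]; omega) (by simp only [Prod.snd_zero]; omega))
  have h : ∫ ω, stdField ha l ω * stdField ha m ω ∂P
      = ∫ ω, (stdRotation l * a l ω).re * (stdRotation m * a m ω).re ∂P := by
    refine integral_congr_ae ?_
    filter_upwards [stdField_ae ha hl, stdField_ae ha hm] with ω h1 h2
    rw [h1, h2]
  rw [L2_inner_eq, h, integral_re_mul_mul_re_mul ha hl hm]
  by_cases h1 : m = l
  · subst h1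
    rw [if_pos rfl, if_neg hne, if_pos rfl, stdRotation_mul_conj]; norm_num
  · rw [if_neg h1, if_neg (Ne.symm h1)]
    by_cases h2 : m = -l
    · rw [if_pos h2, h2, stdRotation_mul_neg hl]; norm_num
    · rw [if_neg h2, add_zero]

theorem norm_stdField (ha : IsWaveCoefficients a P) {l : ℤ × ℤ} (hl : l ≠ 0) :
    ‖stdField ha l‖ = 1 := by
  have h := real_inner_self_eq_norm_sq (stdField ha l)
  rw [inner_stdField ha hl hl, if_pos rfl] at h
  exact (pow_eq_one_iff_of_nonneg (norm_nonneg _) two_ne_zero).1 h.symm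

theorem orthonormal_stdField (ha : IsWaveCoefficients a P) {n : ℕ} (hn : 0 < n) :
    Orthonormal ℝ fun l : freq n => stdField ha l := by
  refine ⟨fun l => norm_stdField ha (freq_ne_zero hn l l.2), fun l m hlm => ?_⟩
  change inner ℝ (stdField ha l) (stdField ha m) = 0
  rw [inner_stdField ha (freq_ne_zero hn l l.2) (freq_ne_zero hn m m.2), if_neg]
  exact fun h => hlm (Subtype.ext h)

theorem inner_stdField_right (ha : IsWaveCoefficients a P) (ζ : Lp ℝ 2 P) {l : ℤ × ℤ} (hl : l ≠ 0) :
    inner ℝ (stdField ha l) ζ = (stdRotation l * waveCoeff a P ζ l).re := by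
  have h1 : Integrable (fun ω => ζ ω * (a l ω).re) P := (Lp.memLp ζ).integrable_mul (memLp_re ha hl)
  have h2 : Integrable (fun ω => ζ ω * (a l ω).im) P := (Lp.memLp ζ).integrable_mul (memLp_im ha hl)
  rw [L2_inner_eq]
  have h : ∀ᵐ ω ∂P, stdField ha l ω * ζ ω
      = (stdRotation l).re * (ζ ω * (a l ω).re) - (stdRotation l).im * (ζ ω * (a l ω).im) := by
    filter_upwards [stdField_ae ha hl] with ω h
    rw [h, Complex.mul_re]; ring
  rw [integral_congr_ae h, integral_sub (h1.const_mul _) (h2.const_mul _), integral_const_mul,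
    integral_const_mul, Complex.mul_re]
  rfl

theorem inner_stdField_sq_add (ha : IsWaveCoefficients a P) (ζ : Lp ℝ 2 P) {l : ℤ × ℤ} (hl : l ≠ 0) :
    inner ℝ (stdField ha l) ζ ^ 2 + inner ℝ (stdField ha (-l)) ζ ^ 2
      = 2 * Complex.normSq (waveCoeff a P ζ l) := by
  rw [inner_stdField_right ha ζ hl, inner_stdField_right ha ζ (neg_ne_zero.2 hl), waveCoeff_neg ha ζ hl,
    re_stdRotation_sq_add hl]

/-- The polynomial that represents the fourth chaos, with variance parameter `s`. -/
noncomputable def chaosPoly (n : ℕ) (s : ℝ) (x : ℤ × ℤ → ℝ) : ℝ :=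
  ∑ l ∈ freq n, ((x l ^ 2 + x (-l) ^ 2) / 2) ^ 2
    - ∑ l ∈ freq n, ∑ m ∈ freq n, cosDouble n l m * ((x l ^ 2 - s) * (x m ^ 2 - s))

theorem cosDouble_neg_right (n : ℕ) (l m : ℤ × ℤ) : cosDouble n l (-m) = cosDouble n l m := by
  simp only [cosDouble, Prod.fst_neg, Prod.snd_neg]; push_cast; ring

theorem cosDouble_neg_left (n : ℕ) (l m : ℤ × ℤ) : cosDouble n (-l) m = cosDouble n l m := by
  simp only [cosDouble, Prod.fst_neg, Prod.snd_neg]; push_cast; ring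

theorem cosDouble_self {n : ℕ} (hn : 0 < n) {l : ℤ × ℤ} (hl : l ∈ freq n) : cosDouble n l l = 1 := by
  have h := sum_freq_norm n hl
  have hn' : (n : ℝ) ≠ 0 := by exact_mod_cast hn.ne'
  rw [cosDouble, ← pow_two, ← pow_two, h, div_self hn']; norm_num

/-- Coefficients of the chaos polynomial in the Hermite basis. -/
noncomputable def chaosWeight (n : ℕ) (l m : ℤ × ℤ) : ℝ :=
  if l = m then -(1 / 2) else (if m = -l then 1 / 2 else 0) - cosDouble n l m

theorem sum_freq_ite_neg {n : ℕ} {l : ℤ × ℤ} (hl : l ∈ freq n) (f : ℤ × ℤ → ℝ) :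
    ∑ m ∈ freq n, (if m = -l then 1 / 2 else 0) * f m = f (-l) / 2 := by
  simp only [ite_mul, zero_mul]
  rw [Finset.sum_ite_eq' (freq n) (-l), if_pos (neg_mem_freq hl)]
  ring

/-- On the diagonal (x² - s)² is not a Wick power; the sum of fourth powers of moduli supplies
exactly what turns it into a multiple of `wick4`, the leftover quadratic terms cancelling under l ↦
-l. The same weights serve s = 1, the chaos element, and s = 0, its symbol. -/
theorem chaosPoly_eq {n : ℕ} (hn : 0 < n) (s : ℝ) (x : ℤ × ℤ → ℝ) :
    chaosPoly n s x = ∑ l ∈ freq n, ∑ m ∈ freq n, chaosWeight n l m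
      * if l = m then wick4 (x l) s else (x l ^ 2 - s) * (x m ^ 2 - s) := by
  have h1 : ∀ l ∈ freq n, (∑ m ∈ freq n, chaosWeight n l m
        * if l = m then wick4 (x l) s else (x l ^ 2 - s) * (x m ^ 2 - s))
      = 1 / 2 * x l ^ 4 + 1 / 2 * (x l ^ 2 * x (-l) ^ 2) + s / 2 * x l ^ 2 - s / 2 * x (-l) ^ 2
        - ∑ m ∈ freq n, cosDouble n l m * ((x l ^ 2 - s) * (x m ^ 2 - s)) := by
    intro l hl
    have e : ∀ m ∈ freq n, (chaosWeight n l m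
          * if l = m then wick4 (x l) s else (x l ^ 2 - s) * (x m ^ 2 - s))
        = ((if m = -l then 1 / 2 else 0) * ((x l ^ 2 - s) * (x m ^ 2 - s))
          - cosDouble n l m * ((x l ^ 2 - s) * (x m ^ 2 - s)))
          + if l = m then (x m ^ 2 - s) ^ 2 - 1 / 2 * wick4 (x m) s else 0 := by
      intro m hm
      by_cases h : l = m
      · subst h
        simp only [chaosWeight, if_true, if_neg (ne_neg_self (ne_zero_of_mem_freq hn hl)),
          cosDouble_self hn hl]
        ring
      · simp only [chaosWeight, if_neg h]
        ring
    rw [Finset.sum_congr rfl e, Finset.sum_add_distrib, Finset.sum_sub_distrib,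
      sum_freq_ite_neg hl fun m => (x l ^ 2 - s) * (x m ^ 2 - s), Finset.sum_ite_eq, if_pos hl]
    simp only [wick4]
    ring
  rw [Finset.sum_congr rfl fun l hl => by rw [h1 l hl]]
  have h2 := sum_freq_neg n fun l => x l ^ 4
  have h3 := sum_freq_neg n fun l => x l ^ 2
  have e1 : ∑ l ∈ freq n, ((x l ^ 2 + x (-l) ^ 2) / 2) ^ 2
      = ∑ l ∈ freq n, (1 / 4 * x l ^ 4 + 1 / 4 * x (-l) ^ 4 + 1 / 2 * (x l ^ 2 * x (-l) ^ 2)) :=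
    Finset.sum_congr rfl fun l _ => by ring
  rw [chaosPoly, e1]
  simp only [Finset.sum_add_distrib, Finset.sum_sub_distrib, ← Finset.mul_sum, h2, h3]
  ring

theorem memLp_hermiteSq_mul (ha : IsWaveCoefficients a P) {ξ χ : Lp ℝ 2 P}
    (hξ : ξ ∈ gaussianSpace a P) (hχ : χ ∈ gaussianSpace a P) :
    MemLp (fun ω => (ξ ω ^ 2 - 1) * (χ ω ^ 2 - 1)) 2 P := by
  have h : ∀ᵐ ω ∂P, 12⁻¹ * (wick4 ((ξ + χ : Lp ℝ 2 P) ω) 2 + wick4 ((ξ - χ : Lp ℝ 2 P) ω) 2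
      - 2 * wick4 (ξ ω) 1 - 2 * wick4 (χ ω) 1) = (ξ ω ^ 2 - 1) * (χ ω ^ 2 - 1) := by
    filter_upwards [Lp.coeFn_add ξ χ, Lp.coeFn_sub ξ χ] with ω k1 k2
    rw [hermiteSq_mul_eq_wick4, k1, k2]
    rfl
  refine MemLp.ae_eq h ((((memLp_wick4_of_mem ha (Submodule.add_mem _ hξ hχ) 2).add
    (memLp_wick4_of_mem ha (Submodule.sub_mem _ hξ hχ) 2)).sub
      ((memLp_wick4_of_mem ha hξ 1).const_mul 2)).sub
      ((memLp_wick4_of_mem ha hχ 1).const_mul 2) |>.const_mul _)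

theorem wick4_toLp_mem (ha : IsWaveCoefficients a P) {l : ℤ × ℤ} (hl : l ≠ 0) :
    (memLp_wick4_of_mem ha (stdField_mem ha l) 1).toLp _ ∈ wienerChaos a P 4 := by
  refine Submodule.le_topologicalClosure _ (Submodule.subset_span
    ⟨1, fun _ => 4, fun _ => stdField ha l, le_rfl, by simp, fun _ => stdField_mem ha l, ?_, ?_⟩)
  · refine hasLaw_pi_of_orthonormal ha (fun _ => stdField_mem ha l)
      ⟨fun _ => norm_stdField ha hl, fun i j hij => absurd (Subsingleton.elim i j) hij⟩
  · filter_upwards [(memLp_wick4_of_mem ha (stdField_mem ha l) 1).coeFn_toLp] with ω h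
    rw [h]
    simp only [Finset.univ_unique, Finset.prod_singleton, aeval_hermite_four, wick4]
    ring

theorem hermiteSq_mul_toLp_mem (ha : IsWaveCoefficients a P) {l m : ℤ × ℤ} (hl : l ≠ 0)
    (hm : m ≠ 0) (hlm : l ≠ m) :
    (memLp_hermiteSq_mul ha (stdField_mem ha l) (stdField_mem ha m)).toLp _
      ∈ wienerChaos a P 4 := by
  refine Submodule.le_topologicalClosure _ (Submodule.subset_span
    ⟨2, fun _ => 2, ![stdField ha l, stdField ha m], by norm_num, by simp, ?_, ?_, ?_⟩)
  · intro i; fin_cases i <;> exact stdField_mem ha _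
  · refine hasLaw_pi_of_orthonormal ha (fun i => by fin_cases i <;> exact stdField_mem ha _) ?_
    refine ⟨fun i => by fin_cases i; exacts [norm_stdField ha hl, norm_stdField ha hm], ?_⟩
    intro i j hij
    fin_cases i <;> fin_cases j <;> simp [inner_stdField ha, hl, hm, hlm, hlm.symm] at hij ⊢
  · filter_upwards [(memLp_hermiteSq_mul ha (stdField_mem ha l) (stdField_mem ha m)).coeFn_toLp]
      with ω h
    rw [h]
    simp [Fin.prod_univ_two, pow_two]

/-- The Hermite basis of the fourth chaos attached to pairs of frequencies. -/
noncomputable def wickPair (ha : IsWaveCoefficients a P) (l m : ℤ × ℤ) (ω : Ω) : ℝ :=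
  if l = m then wick4 (stdField ha l ω) 1
  else (stdField ha l ω ^ 2 - 1) * (stdField ha m ω ^ 2 - 1)

/-- Linear combinations of the Hermite basis. -/
noncomputable def wickSum (ha : IsWaveCoefficients a P) (n : ℕ) (M : ℤ × ℤ → ℤ × ℤ → ℝ)
    (ω : Ω) : ℝ := ∑ l ∈ freq n, ∑ m ∈ freq n, M l m * wickPair ha l m ω

theorem memLp_wickPair (ha : IsWaveCoefficients a P) (l m : ℤ × ℤ) :
    MemLp (wickPair ha l m) 2 P := by
  unfold wickPair
  split_ifs
  · exact memLp_wick4_of_mem ha (stdField_mem ha l) 1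
  · exact memLp_hermiteSq_mul ha (stdField_mem ha l) (stdField_mem ha m)

theorem memLp_wickSum (ha : IsWaveCoefficients a P) (n : ℕ) (M : ℤ × ℤ → ℤ × ℤ → ℝ) :
    MemLp (wickSum ha n M) 2 P :=
  memLp_finsetSum _ fun l _ => memLp_finsetSum _ fun m _ => (memLp_wickPair ha l m).const_mul _

/-- The fourth chaos polynomial evaluated at the underlying Gaussian variables. -/
noncomputable def chaosVar (ha : IsWaveCoefficients a P) (n : ℕ) (ω : Ω) : ℝ :=
  chaosPoly n 1 fun l => stdField ha l ω

theorem chaosVar_eq (ha : IsWaveCoefficients a P) {n : ℕ} (hn : 0 < n) :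
    chaosVar ha n = wickSum ha n (chaosWeight n) := by
  funext ω
  rw [chaosVar, chaosPoly_eq hn]
  rfl

theorem memLp_chaosVar (ha : IsWaveCoefficients a P) {n : ℕ} (hn : 0 < n) :
    MemLp (chaosVar ha n) 2 P := by
  rw [chaosVar_eq ha hn]
  exact memLp_wickSum ha n _

/-- A random variable that represents an element of the fourth chaos. -/
def IsChaotic (a : ℤ × ℤ → Ω → ℂ) (P : Measure Ω) (F : Ω → ℝ) : Prop :=
  ∃ G ∈ wienerChaos a P 4, G =ᵐ[P] F

theorem IsChaotic.zero : IsChaotic a P fun _ => 0 :=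
  ⟨0, Submodule.zero_mem _, Lp.coeFn_zero ℝ 2 P⟩

theorem IsChaotic.add {F G : Ω → ℝ} (hF : IsChaotic a P F) (hG : IsChaotic a P G) :
    IsChaotic a P fun ω => F ω + G ω := by
  obtain ⟨F', h1, h2⟩ := hF
  obtain ⟨G', h3, h4⟩ := hG
  exact ⟨F' + G', Submodule.add_mem _ h1 h3, (Lp.coeFn_add F' G').trans (h2.add h4)⟩

theorem IsChaotic.const_mul {F : Ω → ℝ} (hF : IsChaotic a P F) (c : ℝ) :
    IsChaotic a P fun ω => c * F ω := by
  obtain ⟨F', h1, h2⟩ := hF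
  refine ⟨c • F', Submodule.smul_mem _ _ h1, ?_⟩
  filter_upwards [Lp.coeFn_smul c F', h2] with ω h3 h4
  rw [h3, Pi.smul_apply, h4, smul_eq_mul]

theorem IsChaotic.sum {ι : Type*} {s : Finset ι} {F : ι → Ω → ℝ}
    (h : ∀ i ∈ s, IsChaotic a P (F i)) : IsChaotic a P fun ω => ∑ i ∈ s, F i ω := by
  classical
  induction s using Finset.induction_on with
  | empty => simpa using IsChaotic.zero
  | insert i s hi ih =>
    simp_rw [Finset.sum_insert hi]
    exact (h i (Finset.mem_insert_self i s)).add (ih fun j hj => h j (Finset.mem_insert_of_mem hj))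

theorem isChaotic_chaosVar (ha : IsWaveCoefficients a P) {n : ℕ} (hn : 0 < n) :
    IsChaotic a P (chaosVar ha n) := by
  rw [chaosVar_eq ha hn]
  refine IsChaotic.sum fun l hl => IsChaotic.sum fun m hm => IsChaotic.const_mul ?_ _
  unfold wickPair
  split_ifs with hlm
  · exact ⟨_, wick4_toLp_mem ha (freq_ne_zero hn l hl), MemLp.coeFn_toLp _⟩
  · exact ⟨_, hermiteSq_mul_toLp_mem ha (freq_ne_zero hn l hl) (freq_ne_zero hn m hm) hlm,
      MemLp.coeFn_toLp _⟩

theorem integral_wickPair_mul_wick4 (ha : IsWaveCoefficients a P) {l m : ℤ × ℤ} (hl : l ≠ 0)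
    (hm : m ≠ 0) {ζ : Lp ℝ 2 P} (hζ : ζ ∈ gaussianSpace a P) :
    ∫ ω, wickPair ha l m ω * wick4 (ζ ω) (‖ζ‖ ^ 2) ∂P
      = 24 * (inner ℝ (stdField ha l) ζ ^ 2 * inner ℝ (stdField ha m) ζ ^ 2) := by
  unfold wickPair
  split_ifs with hlm
  · subst hlm
    have e1 := integral_wick4_mul_wick4 ha (stdField_mem ha l) hζ
    rw [norm_stdField ha hl, one_pow] at e1
    rw [e1]; ring
  · exact integral_hermiteSq_mul_wick4 ha (stdField_mem ha l) (stdField_mem ha m)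
      hζ (norm_stdField ha hl) (norm_stdField ha hm) (by rw [inner_stdField ha hl hm, if_neg hlm])

theorem integral_wickSum_mul (ha : IsWaveCoefficients a P) (n : ℕ) (M : ℤ × ℤ → ℤ × ℤ → ℝ)
    {F : Ω → ℝ} (hF : MemLp F 2 P) :
    ∫ ω, wickSum ha n M ω * F ω ∂P
      = ∑ l ∈ freq n, ∑ m ∈ freq n, M l m * ∫ ω, wickPair ha l m ω * F ω ∂P := by
  have h : ∀ l m, Integrable (fun ω => M l m * (wickPair ha l m ω * F ω)) P := fun l m =>
    ((memLp_wickPair ha l m).integrable_mul hF).const_mul _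
  simp_rw [wickSum, Finset.sum_mul, mul_assoc]
  rw [integral_finsetSum _ fun l _ => integrable_finsetSum _ fun m _ => h l m]
  refine Finset.sum_congr rfl fun l _ => ?_
  rw [integral_finsetSum _ fun m _ => h l m]
  exact Finset.sum_congr rfl fun m _ => integral_const_mul _ _

theorem integral_wickSum_mul_wick4 (ha : IsWaveCoefficients a P) {n : ℕ} (hn : 0 < n)
    (M : ℤ × ℤ → ℤ × ℤ → ℝ) {ζ : Lp ℝ 2 P} (hζ : ζ ∈ gaussianSpace a P) :
    ∫ ω, wickSum ha n M ω * wick4 (ζ ω) (‖ζ‖ ^ 2) ∂P = 24 * ∑ l ∈ freq n, ∑ m ∈ freq n,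
      M l m * (inner ℝ (stdField ha l) ζ ^ 2 * inner ℝ (stdField ha m) ζ ^ 2) := by
  rw [integral_wickSum_mul ha n M (memLp_wick4_of_mem ha hζ _), Finset.mul_sum]
  refine Finset.sum_congr rfl fun l hl => ?_
  rw [Finset.mul_sum]
  refine Finset.sum_congr rfl fun m hm => ?_
  rw [integral_wickPair_mul_wick4 ha (freq_ne_zero hn l hl) (freq_ne_zero hn m hm) hζ]
  ring

theorem integral_wickPair (ha : IsWaveCoefficients a P) {l m : ℤ × ℤ} (hl : l ≠ 0) (hm : m ≠ 0) :
    ∫ ω, wickPair ha l m ω ∂P = 0 := by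
  have hw := fun {ξ : Lp ℝ 2 P} (hξ : ξ ∈ gaussianSpace a P) => (integral_wick_of_mem ha hξ).2.2
  have h1 := hw (stdField_mem ha l)
  have h2 := hw (stdField_mem ha m)
  have h3 := hw (Submodule.add_mem _ (stdField_mem ha l) (stdField_mem ha m))
  have h4 := hw (Submodule.sub_mem _ (stdField_mem ha l) (stdField_mem ha m))
  rw [norm_stdField ha hl, one_pow] at h1
  rw [norm_stdField ha hm, one_pow] at h2
  unfold wickPair
  split_ifs with hlm
  · exact h1
  rw [norm_add_sq_real, norm_stdField ha hl, norm_stdField ha hm, inner_stdField ha hl hm,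
    if_neg hlm, show (1 : ℝ) ^ 2 + 2 * 0 + 1 ^ 2 = 2 by norm_num] at h3
  rw [norm_sub_sq_real, norm_stdField ha hl, norm_stdField ha hm, inner_stdField ha hl hm,
    if_neg hlm, show (1 : ℝ) ^ 2 - 2 * 0 + 1 ^ 2 = 2 by norm_num] at h4
  have i : ∀ {θ : Lp ℝ 2 P}, θ ∈ gaussianSpace a P → ∀ s : ℝ,
      Integrable (fun ω => wick4 (θ ω) s) P := fun hθ s =>
    (memLp_wick4_of_mem ha hθ s).integrable one_le_two
  have hp := Submodule.add_mem _ (stdField_mem ha l) (stdField_mem ha m)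
  have hm := Submodule.sub_mem _ (stdField_mem ha l) (stdField_mem ha m)
  have j1 := (i hp 2).fun_add (i hm 2)
  have j2 := integrable_fun_sub j1 ((i (stdField_mem ha l) 1).const_mul 2)
  have h : ∀ᵐ ω ∂P, (stdField ha l ω ^ 2 - 1) * (stdField ha m ω ^ 2 - 1)
      = 12⁻¹ * (wick4 ((stdField ha l + stdField ha m : Lp ℝ 2 P) ω) 2
        + wick4 ((stdField ha l - stdField ha m : Lp ℝ 2 P) ω) 2
        - 2 * wick4 (stdField ha l ω) 1 - 2 * wick4 (stdField ha m ω) 1) := by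
    filter_upwards [Lp.coeFn_add (stdField ha l) (stdField ha m),
      Lp.coeFn_sub (stdField ha l) (stdField ha m)] with ω k1 k2
    rw [hermiteSq_mul_eq_wick4, k1, k2]
    rfl
  rw [integral_congr_ae h, integral_const_mul,
    integral_sub j2 ((i (stdField_mem ha m) 1).const_mul _),
    integral_sub j1 ((i (stdField_mem ha l) 1).const_mul _),
    integral_add (i hp 2) (i hm 2), integral_const_mul, integral_const_mul, h1, h2, h3, h4]
  norm_num

theorem integral_wickSum (ha : IsWaveCoefficients a P) {n : ℕ} (hn : 0 < n)
    (M : ℤ × ℤ → ℤ × ℤ → ℝ) : ∫ ω, wickSum ha n M ω ∂P = 0 := by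
  have h := integral_wickSum_mul ha n M (F := fun _ => 1) (memLp_const 1)
  simp only [mul_one] at h
  rw [h]
  refine Finset.sum_eq_zero fun l hl => Finset.sum_eq_zero fun m hm => ?_
  rw [integral_wickPair ha (freq_ne_zero hn l hl) (freq_ne_zero hn m hm), mul_zero]

theorem sum_kron_sq {n : ℕ} {l m : ℤ × ℤ} (hl : l ∈ freq n) (hm : m ∈ freq n)
    (M : ℤ × ℤ → ℤ × ℤ → ℝ) (e f : ℝ) :
    ∑ i ∈ freq n, ∑ j ∈ freq n, M i j * (((if i = l then e else 0) + if i = m then f else 0)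
      * ((if j = l then e else 0) + if j = m then f else 0))
      = e ^ 2 * M l l + e * f * (M l m + M m l) + f ^ 2 * M m m := by
  simp only [mul_add, add_mul, mul_ite, ite_mul, zero_mul, mul_zero, Finset.sum_add_distrib,
    Finset.sum_ite_eq', hl, hm, if_true, ite_self]
  ring

/-- A diagonal basis element has squared norm 4! = 24. An off-diagonal one has squared norm 4 and
occurs at both (l, m) and (m, l), whence 8. The computation polarizes the second factor, so that
only pairings with Wick powers are needed. -/
theorem integral_wickSum_mul_wickPair (ha : IsWaveCoefficients a P) {n : ℕ} (hn : 0 < n)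
    {M : ℤ × ℤ → ℤ × ℤ → ℝ} (hM : ∀ l m, M l m = M m l) {l m : ℤ × ℤ} (hl : l ∈ freq n)
    (hm : m ∈ freq n) :
    ∫ ω, wickSum ha n M ω * wickPair ha l m ω ∂P = (if l = m then 24 else 8) * M l m := by
  have hl0 := freq_ne_zero hn l hl
  have hm0 := freq_ne_zero hn m hm
  have gl := stdField_mem ha l
  have gm := stdField_mem ha m
  have hp := Submodule.add_mem _ gl gm
  have hs := Submodule.sub_mem _ gl gm
  have e := fun {θ : Lp ℝ 2 P} (hθ : θ ∈ gaussianSpace a P) => integral_wickSum_mul_wick4 ha hn M hθ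
  have hin : ∀ k ∈ freq n, ∀ l ∈ freq n, inner ℝ (stdField ha k) (stdField ha l)
      = if k = l then (1 : ℝ) else 0 := fun k hk l hl =>
    inner_stdField ha (freq_ne_zero hn k hk) (freq_ne_zero hn l hl)
  have e1 : ∀ l ∈ freq n, ∫ ω, wickSum ha n M ω * wick4 (stdField ha l ω) 1 ∂P
      = 24 * M l l := fun l hl => by
    have h := e (stdField_mem ha l)
    rw [norm_stdField ha (freq_ne_zero hn l hl), one_pow] at h
    rw [h]
    congr 1
    have := sum_kron_sq hl hl M 1 0
    simp only [ite_self, add_zero] at this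
    rw [← show (1 : ℝ) ^ 2 * M l l + 1 * 0 * (M l l + M l l) + 0 ^ 2 * M l l = M l l by ring,
      ← this]
    refine Finset.sum_congr rfl fun i hi => Finset.sum_congr rfl fun j hj => ?_
    rw [hin i hi l hl, hin j hj l hl]
    split_ifs <;> norm_num
  unfold wickPair
  split_ifs with hlm
  · subst hlm; exact e1 l hl
  have np : ‖stdField ha l + stdField ha m‖ ^ 2 = 2 := by
    rw [norm_add_sq_real, norm_stdField ha hl0, norm_stdField ha hm0, hin l hl m hm, if_neg hlm]
    norm_num
  have ns : ‖stdField ha l - stdField ha m‖ ^ 2 = 2 := by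
    rw [norm_sub_sq_real, norm_stdField ha hl0, norm_stdField ha hm0, hin l hl m hm, if_neg hlm]
    norm_num
  have hk := sum_kron_sq hl hm M 1 1
  have e2 := e hp
  have e3 := e hs
  rw [np] at e2
  rw [ns] at e3
  have e2' : ∑ i ∈ freq n, ∑ j ∈ freq n, M i j
      * (inner ℝ (stdField ha i) (stdField ha l + stdField ha m) ^ 2
        * inner ℝ (stdField ha j) (stdField ha l + stdField ha m) ^ 2)
      = 1 ^ 2 * M l l + 1 * 1 * (M l m + M m l) + 1 ^ 2 * M m m := by
    rw [← hk]
    refine Finset.sum_congr rfl fun i hi => Finset.sum_congr rfl fun j hj => ?_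
    rw [inner_add_right, inner_add_right, hin i hi l hl, hin j hj l hl, hin i hi m hm, hin j hj m hm]
    congr 2
    · split_ifs with h1 h2
      · exact absurd (h1.symm.trans h2) hlm
      all_goals norm_num
    · split_ifs with h1 h2
      · exact absurd (h1.symm.trans h2) hlm
      all_goals norm_num
  have e3' : ∑ i ∈ freq n, ∑ j ∈ freq n, M i j
      * (inner ℝ (stdField ha i) (stdField ha l - stdField ha m) ^ 2
        * inner ℝ (stdField ha j) (stdField ha l - stdField ha m) ^ 2)
      = 1 ^ 2 * M l l + 1 * 1 * (M l m + M m l) + 1 ^ 2 * M m m := by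
    rw [← hk]
    refine Finset.sum_congr rfl fun i hi => Finset.sum_congr rfl fun j hj => ?_
    rw [inner_sub_right, inner_sub_right, hin i hi l hl, hin j hj l hl, hin i hi m hm, hin j hj m hm]
    congr 2
    · split_ifs with h1 h2
      · exact absurd (h1.symm.trans h2) hlm
      all_goals norm_num
    · split_ifs with h1 h2
      · exact absurd (h1.symm.trans h2) hlm
      all_goals norm_num
  have i : ∀ {θ : Lp ℝ 2 P}, θ ∈ gaussianSpace a P → ∀ s : ℝ,
      Integrable (fun ω => wickSum ha n M ω * wick4 (θ ω) s) P := fun hθ s =>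
    (memLp_wickSum ha n M).integrable_mul (memLp_wick4_of_mem ha hθ s)
  have j1 := (i hp 2).fun_add (i hs 2)
  have j2 := integrable_fun_sub j1 ((i gl 1).const_mul 2)
  have h : ∀ᵐ ω ∂P, wickSum ha n M ω * ((stdField ha l ω ^ 2 - 1) * (stdField ha m ω ^ 2 - 1))
      = 12⁻¹ * (wickSum ha n M ω * wick4 ((stdField ha l + stdField ha m : Lp ℝ 2 P) ω) 2
        + wickSum ha n M ω * wick4 ((stdField ha l - stdField ha m : Lp ℝ 2 P) ω) 2
        - 2 * (wickSum ha n M ω * wick4 (stdField ha l ω) 1)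
        - 2 * (wickSum ha n M ω * wick4 (stdField ha m ω) 1)) := by
    filter_upwards [Lp.coeFn_add (stdField ha l) (stdField ha m),
      Lp.coeFn_sub (stdField ha l) (stdField ha m)] with ω k1 k2
    rw [hermiteSq_mul_eq_wick4, k1, k2]
    simp only [Pi.add_apply, Pi.sub_apply]
    ring
  rw [integral_congr_ae h, integral_const_mul, integral_sub j2 ((i gm 1).const_mul _),
    integral_sub j1 ((i gl 1).const_mul _), integral_add (i hp 2) (i hs 2), integral_const_mul,
    integral_const_mul, e2, e3, e2', e3', e1 l hl, e1 m hm, hM m l]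
  ring

theorem integral_wickSum_sq (ha : IsWaveCoefficients a P) {n : ℕ} (hn : 0 < n)
    {M : ℤ × ℤ → ℤ × ℤ → ℝ} (hM : ∀ l m, M l m = M m l) :
    ∫ ω, wickSum ha n M ω ^ 2 ∂P
      = ∑ l ∈ freq n, ∑ m ∈ freq n, (if l = m then 24 else 8) * M l m ^ 2 := by
  simp_rw [pow_two (wickSum ha n M _)]
  rw [integral_wickSum_mul ha n M (memLp_wickSum ha n M)]
  refine Finset.sum_congr rfl fun l hl => Finset.sum_congr rfl fun m hm => ?_
  simp_rw [mul_comm (wickPair ha l m _)]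
  rw [integral_wickSum_mul_wickPair ha hn hM hl hm]
  ring

/-- The kernel is even in each argument, so replacing y by its even part does not change the form.
-/
theorem sum_cosDouble_neg (n : ℕ) (y : ℤ × ℤ → ℝ) :
    ∑ l ∈ freq n, ∑ m ∈ freq n, cosDouble n l m * ((y l + y (-l)) / 2 * ((y m + y (-m)) / 2))
      = ∑ l ∈ freq n, ∑ m ∈ freq n, cosDouble n l m * (y l * y m) := by
  have h1 : ∀ l, ∑ m ∈ freq n, cosDouble n l m * y (-m) = ∑ m ∈ freq n, cosDouble n l m * y m :=
    fun l => by
      rw [← sum_freq_neg n fun m => cosDouble n l m * y m]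
      simp_rw [cosDouble_neg_right]
  have h2 : ∑ l ∈ freq n, y (-l) * ∑ m ∈ freq n, cosDouble n l m * y m
      = ∑ l ∈ freq n, y l * ∑ m ∈ freq n, cosDouble n l m * y m := by
    rw [← sum_freq_neg n fun l => y l * ∑ m ∈ freq n, cosDouble n l m * y m]
    simp_rw [cosDouble_neg_left]
  have e1 : ∀ l ∈ freq n, ∑ m ∈ freq n, cosDouble n l m * ((y l + y (-l)) / 2 * ((y m + y (-m)) / 2))
      = 1 / 2 * (y l * ∑ m ∈ freq n, cosDouble n l m * y m)
        + 1 / 2 * (y (-l) * ∑ m ∈ freq n, cosDouble n l m * y m) := by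
    intro l _
    have : ∀ m ∈ freq n, cosDouble n l m * ((y l + y (-l)) / 2 * ((y m + y (-m)) / 2))
        = (y l + y (-l)) / 4 * (cosDouble n l m * y m + cosDouble n l m * y (-m)) :=
      fun m _ => by ring
    rw [Finset.sum_congr rfl this, ← Finset.mul_sum, Finset.sum_add_distrib, h1]
    ring
  have e2 : ∀ l ∈ freq n, ∑ m ∈ freq n, cosDouble n l m * (y l * y m)
      = y l * ∑ m ∈ freq n, cosDouble n l m * y m := fun l _ => by
    rw [Finset.mul_sum]
    exact Finset.sum_congr rfl fun m _ => by ring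
  rw [Finset.sum_congr rfl e1, Finset.sum_congr rfl e2, Finset.sum_add_distrib, ← Finset.mul_sum,
    ← Finset.mul_sum, h2]
  ring

/-- The squared modulus of E[ζ a_λ] is the half sum of the squared real coordinates of ζ at λ and
-λ. This identifies the quartic form with the symbol, s = 0, of the chaos polynomial. -/
theorem quarticForm_waveCoeff (ha : IsWaveCoefficients a P) {n : ℕ} (hn : 0 < n) (ζ : Lp ℝ 2 P) :
    quarticForm n (waveCoeff a P ζ) = chaosPoly n 0 fun l => inner ℝ (stdField ha l) ζ := by
  have h : ∀ l ∈ freq n, Complex.normSq (waveCoeff a P ζ l)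
      = (inner ℝ (stdField ha l) ζ ^ 2 + inner ℝ (stdField ha (-l)) ζ ^ 2) / 2 := fun l hl => by
    rw [inner_stdField_sq_add ha ζ (freq_ne_zero hn l hl)]; ring
  rw [quarticForm, chaosPoly]
  simp only [sub_zero]
  rw [← sum_cosDouble_neg n fun l => inner ℝ (stdField ha l) ζ ^ 2]
  congr 1
  · exact Finset.sum_congr rfl fun l hl => by rw [h l hl]
  · exact Finset.sum_congr rfl fun l hl => Finset.sum_congr rfl fun m hm => by rw [h l hl, h m hm]

/-- Pairing with a Wick power of ζ replaces each Hermite monomial by 24 times the ordinary monomial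
in the coordinates of ζ, so the polynomial with s = 1 becomes the one with s = 0. -/
theorem integral_chaosVar_mul_wick4 (ha : IsWaveCoefficients a P) {n : ℕ} (hn : 0 < n)
    {ζ : Lp ℝ 2 P} (hζ : ζ ∈ gaussianSpace a P) :
    ∫ ω, chaosVar ha n ω * wick4 (ζ ω) (‖ζ‖ ^ 2) ∂P = 24 * quarticForm n (waveCoeff a P ζ) := by
  rw [quarticForm_waveCoeff ha hn, chaosPoly_eq hn, chaosVar_eq ha hn,
    integral_wickSum_mul_wick4 ha hn _ hζ]
  congr 1
  refine Finset.sum_congr rfl fun l _ => Finset.sum_congr rfl fun m _ => ?_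
  split_ifs with hlm
  · subst hlm; simp only [wick4]; ring
  · ring

/-- The constant in front of the fourth chaos. -/
noncomputable def chaosScale (n : ℕ) : ℝ := derivScale n / (32 * (freqCard n : ℝ) ^ 2)

/-- The fourth chaotic component of the nodal length is a multiple of the chaos polynomial. -/
theorem fourthComponent_ae (ha : IsWaveCoefficients a P) {n : ℕ} (hn : n ∈ sumTwoSquares) :
    ∀ᵐ ω ∂P, fourthComponent a P n ω = chaosScale n * chaosVar ha n ω := by
  obtain ⟨G, hG, hGe⟩ := (isChaotic_chaosVar ha hn.1).const_mul (chaosScale n)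
  suffices h : fourthComponent a P n = G by rw [h]; exact hGe
  rw [fourthComponent, chaosComponent, dif_pos (memLp_nodalLength ha hn)]
  -- The projection is the chaos element with orthogonal residual, and orthogonality need only be
  -- tested on Wick powers. The two correlations agree because 24/32 = (1/2)(3/2), which is the
  -- origin of the constant 32 in `chaosScale`.
  refine Submodule.eq_starProjection_of_mem_of_inner_eq_zero hG fun F hF => ?_
  refine inner_eq_zero_of_forall_wick4 ha (fun ζ hζ => ?_) hF
  have hw := memLp_wick4_of_mem ha hζ (‖ζ‖ ^ 2)
  have h : ∀ᵐ ω ∂P, ((memLp_nodalLength ha hn).toLp _ - G : Lp ℝ 2 P) ω * wick4 (ζ ω) (‖ζ‖ ^ 2)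
      = nodalLength a n ω * wick4 (ζ ω) (‖ζ‖ ^ 2)
        - chaosScale n * (chaosVar ha n ω * wick4 (ζ ω) (‖ζ‖ ^ 2)) := by
    filter_upwards [Lp.coeFn_sub ((memLp_nodalLength ha hn).toLp _) G,
      (memLp_nodalLength ha hn).coeFn_toLp, hGe] with ω h1 h2 h3
    rw [h1, Pi.sub_apply, h2, h3]; ring
  have i1 : Integrable (fun ω => nodalLength a n ω * wick4 (ζ ω) (‖ζ‖ ^ 2)) P :=
    (memLp_nodalLength ha hn).integrable_mul hw
  have i2 : Integrable (fun ω => chaosVar ha n ω * wick4 (ζ ω) (‖ζ‖ ^ 2)) P :=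
    (memLp_chaosVar ha hn.1).integrable_mul hw
  rw [integral_congr_ae h, integral_sub i1 (i2.const_mul _), integral_const_mul,
    integral_chaosVar_mul_wick4 ha hn.1 hζ, integral_nodalLength_mul_wick4 ha hn hζ,
    integral_quartic_jet hn (fun l hl => waveCoeff_neg ha ζ (freq_ne_zero hn.1 l hl))
      (jetCoord_eq ha hn.1 ζ), chaosScale]
  ring

end FourthChaos

/-! ### Angles, the fourth Fourier coefficient and the variance -/

/-- The cosine of the doubled angle of a lattice point. -/
noncomputable def cosTwo (n : ℕ) (l : ℤ × ℤ) : ℝ := ((l.1 : ℝ) ^ 2 - (l.2 : ℝ) ^ 2) / n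

/-- The sine of the doubled angle of a lattice point. -/
noncomputable def sinTwo (n : ℕ) (l : ℤ × ℤ) : ℝ := 2 * (l.1 : ℝ) * l.2 / n

theorem cosTwo_sq_add_sinTwo_sq {n : ℕ} (hn : 0 < n) {l : ℤ × ℤ} (hl : l ∈ freq n) :
    cosTwo n l ^ 2 + sinTwo n l ^ 2 = 1 := by
  have h := sum_freq_norm n hl
  have hn' : (n : ℝ) ≠ 0 := by exact_mod_cast hn.ne'
  rw [cosTwo, sinTwo]
  field_simp
  rw [← h]; ring

theorem cosDouble_eq {n : ℕ} (hn : 0 < n) {l m : ℤ × ℤ} (hl : l ∈ freq n) (hm : m ∈ freq n) :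
    cosDouble n l m = cosTwo n l * cosTwo n m + sinTwo n l * sinTwo n m := by
  have h1 := sum_freq_norm n hl
  have h2 := sum_freq_norm n hm
  have hn' : (n : ℝ) ≠ 0 := by exact_mod_cast hn.ne'
  rw [cosDouble, cosTwo, sinTwo, cosTwo, sinTwo]
  field_simp
  rw [show (n : ℝ) ^ 2 = ((l.1 : ℝ) ^ 2 + (l.2 : ℝ) ^ 2) * ((m.1 : ℝ) ^ 2 + (m.2 : ℝ) ^ 2) by
    rw [h1, h2]; ring]
  ring

/-- The real fourth Fourier coefficient of the lattice points of a circle. -/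
noncomputable def anisotropy (n : ℕ) : ℝ :=
  (freqCard n : ℝ)⁻¹ * ∑ l ∈ freq n, (cosTwo n l ^ 2 - sinTwo n l ^ 2)

theorem sum_cosTwo_mul_sinTwo (n : ℕ) : ∑ l ∈ freq n, cosTwo n l * sinTwo n l = 0 := by
  have h := sum_freq_reflect n fun l => cosTwo n l * sinTwo n l
  have : ∀ l ∈ freq n, cosTwo n (l.1, -l.2) * sinTwo n (l.1, -l.2) = -(cosTwo n l * sinTwo n l) := by
    intro l _
    simp only [cosTwo, sinTwo]; push_cast; ring
  rw [Finset.sum_congr rfl this, Finset.sum_neg_distrib] at h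
  linarith

theorem sum_cosTwo_sq_add {n : ℕ} (hn : 0 < n) :
    ∑ l ∈ freq n, (cosTwo n l ^ 2 + sinTwo n l ^ 2) = freqCard n := by
  rw [Finset.sum_congr rfl fun l hl => cosTwo_sq_add_sinTwo_sq hn hl]
  simp [freqCard]

theorem sum_cosTwo_sq {n : ℕ} (hn : n ∈ sumTwoSquares) :
    ∑ l ∈ freq n, cosTwo n l ^ 2 = freqCard n * (1 + anisotropy n) / 2 := by
  have hN : (freqCard n : ℝ) ≠ 0 := by exact_mod_cast (freqCard_pos hn).ne'
  have h := sum_cosTwo_sq_add hn.1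
  rw [anisotropy, mul_add, ← mul_assoc, mul_inv_cancel₀ hN, Finset.sum_sub_distrib]
  rw [Finset.sum_add_distrib] at h
  linarith

theorem sum_sinTwo_sq {n : ℕ} (hn : n ∈ sumTwoSquares) :
    ∑ l ∈ freq n, sinTwo n l ^ 2 = freqCard n * (1 - anisotropy n) / 2 := by
  have h := sum_cosTwo_sq_add hn.1
  rw [Finset.sum_add_distrib, sum_cosTwo_sq hn] at h
  linarith

theorem abs_anisotropy_le {n : ℕ} (hn : n ∈ sumTwoSquares) : |anisotropy n| ≤ 1 := by
  have hN : (0 : ℝ) < freqCard n := by exact_mod_cast freqCard_pos hn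
  have h1 := sum_cosTwo_sq hn
  have h2 := sum_sinTwo_sq hn
  have h3 : 0 ≤ ∑ l ∈ freq n, cosTwo n l ^ 2 := Finset.sum_nonneg fun l _ => sq_nonneg _
  have h4 : 0 ≤ ∑ l ∈ freq n, sinTwo n l ^ 2 := Finset.sum_nonneg fun l _ => sq_nonneg _
  rw [h1] at h3
  rw [h2] at h4
  rw [abs_le]
  constructor <;> nlinarith

/-- On the unit circle the inverse is the conjugate, so the inverse fourth power has real part cos
4φ = cos² 2φ - sin² 2φ; the imaginary parts cancel under reflection of the lattice points. -/
theorem norm_fourthFourier {n : ℕ} (hn : n ∈ sumTwoSquares) :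
    ‖fourthFourier (angularMeasure n)‖ = |anisotropy n| := by
  have hn0 : (0 : ℝ) < n := by exact_mod_cast hn.1
  have hs : ((√(n : ℝ) : ℝ) : ℂ) ^ 2 = n := by
    rw [← Complex.ofReal_pow, Real.sq_sqrt hn0.le]; simp
  have hnc : (n : ℂ) ≠ 0 := by exact_mod_cast hn.1.ne'
  have hs0 : ((√(n : ℝ) : ℝ) : ℂ) ≠ 0 := by
    exact_mod_cast (Real.sqrt_pos.2 hn0).ne'
  have hpt : ∀ l ∈ freq n, (((l.1 : ℂ) + (l.2 : ℂ) * Complex.I) / ((√(n : ℝ) : ℝ) : ℂ)) ^ (-4 : ℤ)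
      = ((cosTwo n l ^ 2 - sinTwo n l ^ 2 : ℝ) : ℂ)
        - 2 * ((cosTwo n l * sinTwo n l : ℝ) : ℂ) * Complex.I := by
    intro l hl
    have h1 : (l.1 : ℂ) ^ 2 + (l.2 : ℂ) ^ 2 = n := by
      have := (mem_freq n l).1 hl
      exact_mod_cast congrArg (Int.cast : ℤ → ℂ) this
    have hI := Complex.I_sq
    have h2 : ((l.1 : ℂ) + (l.2 : ℂ) * Complex.I) * ((l.1 : ℂ) - (l.2 : ℂ) * Complex.I) = n := by
      linear_combination h1 - (l.2 : ℂ) ^ 2 * hI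
    have h3 : ((l.1 : ℂ) + (l.2 : ℂ) * Complex.I) ≠ 0 := fun h => by
      rw [h, zero_mul] at h2; exact hnc h2.symm
    have h4 : (((l.1 : ℂ) + (l.2 : ℂ) * Complex.I) / ((√(n : ℝ) : ℝ) : ℂ))⁻¹
        = ((l.1 : ℂ) - (l.2 : ℂ) * Complex.I) / ((√(n : ℝ) : ℝ) : ℂ) := by
      rw [inv_div, div_eq_div_iff h3 hs0, ← pow_two, hs, ← h2]; ring
    have h5 : ((√(n : ℝ) : ℝ) : ℂ) ^ 4 = (n : ℂ) ^ 2 := by rw [← hs]; ring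
    rw [zpow_neg, ← inv_zpow, h4, zpow_ofNat, div_pow, h5, cosTwo, sinTwo]
    push_cast
    field_simp
    have h6 : Complex.I ^ 4 = 1 := Complex.I_pow_four
    have h7 : Complex.I ^ 3 = -Complex.I := Complex.I_pow_three
    ring_nf
    simp only [hI, h6, h7]
    ring
  have hm : fourthFourier (angularMeasure n) = (anisotropy n : ℂ) := by
    rw [fourthFourier, angularMeasure, integral_smul_measure,
      integral_finsetSum_measure fun l _ => by
        exact (integrable_dirac (by simp)).mono_measure le_rfl]
    simp only [integral_dirac]
    rw [Finset.sum_congr rfl hpt, Finset.sum_sub_distrib, ← Finset.sum_mul, ← Finset.mul_sum,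
      ← Complex.ofReal_sum, ← Complex.ofReal_sum, sum_cosTwo_mul_sinTwo, anisotropy]
    simp [ENNReal.toReal_inv]
  rw [hm, Complex.norm_real, Real.norm_eq_abs]

/-- After expansion by the addition formula the mixed terms vanish by reflection, and the rest is
the sum of the squares of the two second moments N(1 ± ρ)/2. -/
theorem sum_cosDouble_sq {n : ℕ} (hn : n ∈ sumTwoSquares) :
    ∑ l ∈ freq n, ∑ m ∈ freq n, cosDouble n l m ^ 2
      = (freqCard n : ℝ) ^ 2 * (1 + anisotropy n ^ 2) / 2 := by
  have h : ∀ l ∈ freq n, ∑ m ∈ freq n, cosDouble n l m ^ 2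
      = cosTwo n l ^ 2 * (freqCard n * (1 + anisotropy n) / 2)
        + sinTwo n l ^ 2 * (freqCard n * (1 - anisotropy n) / 2) := by
    intro l hl
    have e : ∀ m ∈ freq n, cosDouble n l m ^ 2 = cosTwo n l ^ 2 * cosTwo n m ^ 2
        + sinTwo n l ^ 2 * sinTwo n m ^ 2
        + 2 * (cosTwo n l * sinTwo n l) * (cosTwo n m * sinTwo n m) := fun m hm => by
      rw [cosDouble_eq hn.1 hl hm]; ring
    rw [Finset.sum_congr rfl e, Finset.sum_add_distrib, Finset.sum_add_distrib, ← Finset.mul_sum,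
      ← Finset.mul_sum, ← Finset.mul_sum, sum_cosTwo_sq hn, sum_sinTwo_sq hn,
      sum_cosTwo_mul_sinTwo]
    ring
  rw [Finset.sum_congr rfl h, Finset.sum_add_distrib, ← Finset.sum_mul, ← Finset.sum_mul,
    sum_cosTwo_sq hn, sum_sinTwo_sq hn]
  ring

theorem cosDouble_comm (n : ℕ) (l m : ℤ × ℤ) : cosDouble n l m = cosDouble n m l := by
  simp only [cosDouble]; ring

theorem chaosWeight_comm (n : ℕ) (l m : ℤ × ℤ) : chaosWeight n l m = chaosWeight n m l := by
  have h : (m = -l) = (l = -m) := propext ⟨fun h => by rw [h, neg_neg], fun h => by rw [h, neg_neg]⟩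
  simp only [chaosWeight, cosDouble_comm n l m, h, eq_comm (a := l) (b := m)]

/-- Every row has the main part 8 Σ cos². The diagonal entry contributes 24/4 = 6 and the antipodal
entry 8/4 = 2, where the main part would count 8 each; the row correction is -2 - 6 = -8. -/
theorem sum_chaosWeight_sq {n : ℕ} (hn : n ∈ sumTwoSquares) :
    ∑ l ∈ freq n, ∑ m ∈ freq n, (if l = m then 24 else 8) * chaosWeight n l m ^ 2
      = 4 * (freqCard n : ℝ) ^ 2 * (1 + anisotropy n ^ 2) - 8 * freqCard n := by
  have h : ∀ l ∈ freq n, ∑ m ∈ freq n, (if l = m then 24 else 8) * chaosWeight n l m ^ 2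
      = 8 * ∑ m ∈ freq n, cosDouble n l m ^ 2 - 8 := by
    intro l hl
    have hl0 := ne_zero_of_mem_freq hn.1 hl
    have e : ∀ m ∈ freq n, (if l = m then 24 else 8) * chaosWeight n l m ^ 2
        = 8 * cosDouble n l m ^ 2 + (if l = m then (-2 : ℝ) else 0)
          + (if m = -l then 1 / 2 else 0) * (-12) := by
      intro m hm
      by_cases h1 : l = m
      · subst h1
        simp only [chaosWeight, if_true, if_neg (ne_neg_self hl0), cosDouble_self hn.1 hl]
        norm_num
      · simp only [chaosWeight, if_neg h1]
        by_cases h2 : m = -l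
        · rw [if_pos h2, h2, cosDouble_neg_right, cosDouble_self hn.1 hl]; norm_num
        · simp only [if_neg h2]; ring
    rw [Finset.sum_congr rfl e, Finset.sum_add_distrib, Finset.sum_add_distrib,
      sum_freq_ite_neg hl fun _ => (-12 : ℝ), Finset.sum_ite_eq, if_pos hl, ← Finset.mul_sum]
    ring
  rw [Finset.sum_congr rfl h, Finset.sum_sub_distrib, ← Finset.mul_sum, sum_cosDouble_sq hn,
    Finset.sum_const, nsmul_eq_mul]
  simp only [freqCard]
  ring

/-- The four quarter turns of a nonzero lattice point are distinct. This is what makes 4N² - 8N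
positive. -/
theorem four_le_freqCard {n : ℕ} (hn : n ∈ sumTwoSquares) : 4 ≤ freqCard n := by
  obtain ⟨⟨x, y⟩, hl⟩ := freq_nonempty hn
  have hl0 := ne_zero_of_mem_freq hn.1 hl
  have h0 : ¬ (x = 0 ∧ y = 0) := fun h => hl0 (Prod.ext h.1 h.2)
  rw [mem_freq] at hl
  let t : Finset (ℤ × ℤ) := {(x, y), (-x, -y), (-y, x), (y, -x)}
  have ht : t ⊆ freq n := by
    intro m hm
    rw [mem_freq]
    simp only [t, Finset.mem_insert, Finset.mem_singleton] at hm
    rcases hm with rfl | rfl | rfl | rfl <;> rw [← hl] <;> ring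
  have hc : t.card = 4 := by
    rw [Finset.card_insert_of_notMem, Finset.card_insert_of_notMem,
      Finset.card_insert_of_notMem, Finset.card_singleton]
    all_goals
      simp only [Finset.mem_insert, Finset.mem_singleton, Prod.mk.injEq]
      omega
  rw [freqCard, ← hc]
  exact Finset.card_le_card ht

/-! ### The variance and the normalised fourth component. -/

section Variance

variable {Ω : Type*} [MeasurableSpace Ω] {P : Measure Ω} [IsProbabilityMeasure P]
  {a : ℤ × ℤ → Ω → ℂ}

theorem integral_chaosVar (ha : IsWaveCoefficients a P) {n : ℕ} (hn : 0 < n) :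
    ∫ ω, chaosVar ha n ω ∂P = 0 := by
  rw [chaosVar_eq ha hn, integral_wickSum ha hn]

theorem integral_chaosVar_sq (ha : IsWaveCoefficients a P) {n : ℕ} (hn : n ∈ sumTwoSquares) :
    ∫ ω, chaosVar ha n ω ^ 2 ∂P
      = 4 * (freqCard n : ℝ) ^ 2 * (1 + anisotropy n ^ 2) - 8 * freqCard n := by
  rw [chaosVar_eq ha hn.1, integral_wickSum_sq ha hn.1 (chaosWeight_comm n), sum_chaosWeight_sq hn]

/-- The variance of the chaos polynomial. -/
noncomputable def chaosVariance (n : ℕ) : ℝ :=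
  4 * (freqCard n : ℝ) ^ 2 * (1 + anisotropy n ^ 2) - 8 * freqCard n

theorem chaosVariance_pos {n : ℕ} (hn : n ∈ sumTwoSquares) : 0 < chaosVariance n := by
  have h : (4 : ℝ) ≤ freqCard n := by exact_mod_cast four_le_freqCard hn
  rw [chaosVariance]
  nlinarith [sq_nonneg ((freqCard n : ℝ) * anisotropy n)]

theorem chaosScale_pos {n : ℕ} (hn : n ∈ sumTwoSquares) : 0 < chaosScale n := by
  have hN : (0 : ℝ) < freqCard n := by exact_mod_cast freqCard_pos hn
  have := derivScale_pos hn.1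
  rw [chaosScale]; positivity

theorem variance_fourthComponent (ha : IsWaveCoefficients a P) {n : ℕ} (hn : n ∈ sumTwoSquares) :
    variance (fun ω => fourthComponent a P n ω) P = chaosScale n ^ 2 * chaosVariance n := by
  have h := fourthComponent_ae ha hn
  have hm := memLp_chaosVar ha hn.1
  rw [variance_congr h, variance_const_mul, variance_eq_sub hm, integral_chaosVar ha hn.1]
  simp only [Pi.pow_apply]
  rw [integral_chaosVar_sq ha hn, chaosVariance]
  ring

theorem normalizedFourth_ae (ha : IsWaveCoefficients a P) {n : ℕ} (hn : n ∈ sumTwoSquares) :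
    ∀ᵐ ω ∂P, normalizedFourth a P n ω = chaosVar ha n ω / √(chaosVariance n) := by
  have hs := chaosScale_pos hn
  have hv := Real.sqrt_pos.2 (chaosVariance_pos hn)
  filter_upwards [fourthComponent_ae ha hn] with ω h
  rw [normalizedFourth, variance_fourthComponent ha hn, h, Real.sqrt_mul (sq_nonneg _),
    Real.sqrt_sq hs.le]
  field_simp

end Variance

/-! ### Gaussian integration by parts in several variables -/

section PiGaussian

variable {κ : Type*} [Fintype κ]

/-- Continuous functions of polynomial growth. -/
def PolyGrowth (Φ : (κ → ℝ) → ℝ) : Prop :=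
  Continuous Φ ∧ ∃ (C : ℝ) (m : ℕ), 0 ≤ C ∧ ∀ z, |Φ z| ≤ C * (1 + ‖z‖) ^ m

theorem PolyGrowth.of_bounded {Φ : (κ → ℝ) → ℝ} (hc : Continuous Φ) {C : ℝ} (hC : ∀ z, |Φ z| ≤ C) :
    PolyGrowth Φ :=
  ⟨hc, C, 0, (abs_nonneg _).trans (hC 0), fun z => by simpa using hC z⟩

theorem PolyGrowth.const (c : ℝ) : PolyGrowth fun _ : κ → ℝ => c :=
  PolyGrowth.of_bounded continuous_const fun _ => le_rfl

theorem PolyGrowth.coord (k : κ) : PolyGrowth fun z : κ → ℝ => z k :=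
  ⟨continuous_apply k, 1, 1, zero_le_one, fun z => by
    have := norm_le_pi_norm z k
    rw [Real.norm_eq_abs] at this
    linarith⟩

theorem PolyGrowth.mono {Φ Ψ : (κ → ℝ) → ℝ} (hΨ : PolyGrowth Ψ) (hc : Continuous Φ)
    (h : ∀ z, |Φ z| ≤ |Ψ z|) : PolyGrowth Φ := by
  obtain ⟨_, C, m, h0, hm⟩ := hΨ
  exact ⟨hc, C, m, h0, fun z => (h z).trans (hm z)⟩

theorem PolyGrowth.abs {Φ : (κ → ℝ) → ℝ} (h : PolyGrowth Φ) : PolyGrowth fun z => |Φ z| :=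
  h.mono h.1.abs fun z => by rw [abs_abs]

theorem PolyGrowth.mul {Φ Ψ : (κ → ℝ) → ℝ} (hΦ : PolyGrowth Φ) (hΨ : PolyGrowth Ψ) :
    PolyGrowth fun z => Φ z * Ψ z := by
  obtain ⟨h1, C, m, h0, hm⟩ := hΦ
  obtain ⟨h2, D, k, k0, hk⟩ := hΨ
  refine ⟨h1.mul h2, C * D, m + k, mul_nonneg h0 k0, fun z => ?_⟩
  rw [abs_mul, pow_add]
  calc |Φ z| * |Ψ z| ≤ (C * (1 + ‖z‖) ^ m) * (D * (1 + ‖z‖) ^ k) :=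
        mul_le_mul (hm z) (hk z) (abs_nonneg _) (by positivity)
    _ = _ := by ring

theorem PolyGrowth.add {Φ Ψ : (κ → ℝ) → ℝ} (hΦ : PolyGrowth Φ) (hΨ : PolyGrowth Ψ) :
    PolyGrowth fun z => Φ z + Ψ z := by
  obtain ⟨h1, C, m, h0, hm⟩ := hΦ
  obtain ⟨h2, D, k, k0, hk⟩ := hΨ
  refine ⟨h1.add h2, C + D, m + k, add_nonneg h0 k0, fun z => (abs_add_le _ _).trans ?_⟩
  have hz : (1 : ℝ) ≤ 1 + ‖z‖ := by linarith [norm_nonneg z]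
  have e1 : (1 + ‖z‖) ^ m ≤ (1 + ‖z‖) ^ (m + k) := pow_le_pow_right₀ hz (by omega)
  have e2 : (1 + ‖z‖) ^ k ≤ (1 + ‖z‖) ^ (m + k) := pow_le_pow_right₀ hz (by omega)
  nlinarith [hm z, hk z, mul_le_mul_of_nonneg_left e1 h0, mul_le_mul_of_nonneg_left e2 k0]

theorem PolyGrowth.const_mul {Φ : (κ → ℝ) → ℝ} (h : PolyGrowth Φ) (c : ℝ) :
    PolyGrowth fun z => c * Φ z := (PolyGrowth.const c).mul h

theorem PolyGrowth.sub {Φ Ψ : (κ → ℝ) → ℝ} (hΦ : PolyGrowth Φ) (hΨ : PolyGrowth Ψ) :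
    PolyGrowth fun z => Φ z - Ψ z := by
  simpa [sub_eq_add_neg] using hΦ.add (hΨ.const_mul (-1))

theorem PolyGrowth.pow {Φ : (κ → ℝ) → ℝ} (h : PolyGrowth Φ) (m : ℕ) :
    PolyGrowth fun z => Φ z ^ m := by
  induction m with
  | zero => simpa using PolyGrowth.const 1
  | succ m ih => simpa [pow_succ] using ih.mul h

theorem PolyGrowth.sum {ι : Type*} {s : Finset ι} {Φ : ι → (κ → ℝ) → ℝ}
    (h : ∀ i ∈ s, PolyGrowth (Φ i)) : PolyGrowth fun z => ∑ i ∈ s, Φ i z := by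
  classical
  induction s using Finset.induction_on with
  | empty => simpa using PolyGrowth.const 0
  | insert i s hi ih =>
    simp_rw [Finset.sum_insert hi]
    exact (h i (Finset.mem_insert_self i s)).add (ih fun j hj => h j (Finset.mem_insert_of_mem hj))

/-- The standard Gaussian measure on `κ → ℝ`. -/
noncomputable abbrev stdGauss (κ : Type*) [Fintype κ] : Measure (κ → ℝ) :=
  Measure.pi fun _ : κ => gaussianReal 0 1

theorem integrable_coord_pow (k : κ) (m : ℕ) : Integrable (fun z => z k ^ m) (stdGauss κ) :=
  (measurePreserving_eval (fun _ : κ => gaussianReal 0 1) k).integrable_comp_of_integrable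
    (integrable_pow_gaussianReal m 1)

theorem integral_coord_comp (k : κ) {f : ℝ → ℝ} (hf : Continuous f) :
    ∫ z, f (z k) ∂(stdGauss κ) = ∫ x, f x ∂(gaussianReal 0 1) := by
  have hp := measurePreserving_eval (fun _ : κ => gaussianReal 0 1) k
  conv_rhs => rw [← hp.map_eq]
  rw [integral_map hp.aemeasurable (by fun_prop)]

theorem PolyGrowth.integrable {Φ : (κ → ℝ) → ℝ} (h : PolyGrowth Φ) :
    Integrable Φ (stdGauss κ) := by
  obtain ⟨hc, C, m, h0, hm⟩ := h
  have i1 : Integrable (fun z : κ → ℝ => ∑ k, |z k ^ m|) (stdGauss κ) :=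
    integrable_finsetSum _ fun k _ => (integrable_coord_pow k m).abs
  have i2 : Integrable (fun z : κ → ℝ => C * (2 ^ m * (1 + ∑ k, |z k ^ m|))) (stdGauss κ) :=
    (((integrable_const 1).add i1).const_mul _).const_mul C
  refine i2.mono' hc.aestronglyMeasurable (ae_of_all _ fun z => ?_)
  rw [Real.norm_eq_abs]
  refine (hm z).trans (mul_le_mul_of_nonneg_left ?_ h0)
  have hs : 0 ≤ ∑ k, |z k ^ m| := Finset.sum_nonneg fun k _ => abs_nonneg _
  rcases le_total ‖z‖ 1 with hz | hz
  · calc (1 + ‖z‖) ^ m ≤ 2 ^ m := pow_le_pow_left₀ (by positivity) (by linarith) m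
      _ ≤ 2 ^ m * (1 + ∑ k, |z k ^ m|) := le_mul_of_one_le_right (by positivity) (by linarith)
  · have hne : Nonempty κ := by
      by_contra hne
      rw [not_nonempty_iff] at hne
      have : ‖z‖ = 0 := by rw [Subsingleton.elim z 0, norm_zero]
      linarith
    -- The supremum norm is attained at a coordinate, so its powers are dominated by a sum of
    -- one-dimensional powers.
    obtain ⟨k, hk⟩ := Finite.exists_max fun k => ‖z k‖
    have hzk : ‖z‖ ≤ |z k| := (pi_norm_le_iff_of_nonneg (abs_nonneg _)).2 hk
    have h1 : |z k ^ m| ≤ ∑ k, |z k ^ m| :=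
      Finset.single_le_sum (f := fun k => |z k ^ m|) (fun k _ => abs_nonneg _) (Finset.mem_univ k)
    calc (1 + ‖z‖) ^ m ≤ (2 * |z k|) ^ m :=
          pow_le_pow_left₀ (by positivity) (by linarith) m
      _ = 2 ^ m * |z k ^ m| := by rw [mul_pow, abs_pow]
      _ ≤ _ := mul_le_mul_of_nonneg_left (by linarith) (by positivity)

theorem PolyGrowth.memLp_two {Φ : (κ → ℝ) → ℝ} (h : PolyGrowth Φ) : MemLp Φ 2 (stdGauss κ) :=
  (memLp_two_iff_integrable_sq h.1.aestronglyMeasurable).2 (h.pow 2).integrable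

variable [DecidableEq κ]

theorem measurable_update_pair (k : κ) :
    Measurable fun p : (κ → ℝ) × ℝ => Function.update p.1 k p.2 := by
  refine measurable_pi_lambda _ fun j => ?_
  by_cases h : j = k
  · subst h; simpa using measurable_snd
  · simp only [Function.update_of_ne h]
    exact (measurable_pi_apply j).comp measurable_fst

/-- Resampling one coordinate preserves the Gaussian measure. -/
theorem measurePreserving_update (k : κ) :
    MeasurePreserving (fun p : (κ → ℝ) × ℝ => Function.update p.1 k p.2)
      ((stdGauss κ).prod (gaussianReal 0 1)) (stdGauss κ) := by
  refine ⟨measurable_update_pair k, (Measure.pi_eq fun s hs => ?_).symm⟩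
  rw [Measure.map_apply (measurable_update_pair k) (MeasurableSet.univ_pi hs)]
  have h : (fun p : (κ → ℝ) × ℝ => Function.update p.1 k p.2) ⁻¹' Set.univ.pi s
      = (Set.univ.pi (Function.update s k Set.univ)) ×ˢ s k := by
    ext ⟨x, t⟩
    simp only [Set.mem_preimage, Set.mem_pi, Set.mem_univ, true_implies, Set.mem_prod]
    constructor
    · intro h
      refine ⟨fun j => ?_, by simpa using h k⟩
      by_cases hj : j = k
      · subst hj; simp
      · simpa [Function.update_of_ne hj] using h j
    · rintro ⟨h1, h2⟩ j
      by_cases hj : j = k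
      · subst hj; simpa using h2
      · simpa [Function.update_of_ne hj] using h1 j
  rw [h, Measure.prod_prod, Measure.pi_pi, ← Finset.mul_prod_erase _ _ (Finset.mem_univ k),
    ← Finset.mul_prod_erase Finset.univ (fun i => gaussianReal 0 1 (s i)) (Finset.mem_univ k)]
  rw [Function.update_self, measure_univ, one_mul, mul_comm]
  congr 1
  refine Finset.prod_congr rfl fun j hj => ?_
  rw [Function.update_of_ne (Finset.ne_of_mem_erase hj)]

/-- Gaussian integration by parts in one coordinate. -/
theorem integral_coord_mul (k : κ) {Φ Φ' : (κ → ℝ) → ℝ} (hΦ : PolyGrowth Φ) (hΦ' : PolyGrowth Φ')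
    (hd : ∀ z t, HasDerivAt (fun s => Φ (Function.update z k s)) (Φ' (Function.update z k t)) t) :
    ∫ z, z k * Φ z ∂(stdGauss κ) = ∫ z, Φ' z ∂(stdGauss κ) := by
  have hp := measurePreserving_update k
  have i1 : Integrable (fun z => z k * Φ z) (stdGauss κ) := ((PolyGrowth.coord k).mul hΦ).integrable
  have j0 := hp.integrable_comp_of_integrable hΦ.integrable
  have j1 := hp.integrable_comp_of_integrable i1
  have j2 := hp.integrable_comp_of_integrable hΦ'.integrable
  have e : ∀ {F : (κ → ℝ) → ℝ}, Integrable F (stdGauss κ) → ∫ z, F z ∂(stdGauss κ)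
      = ∫ z, ∫ t, F (Function.update z k t) ∂(gaussianReal 0 1) ∂(stdGauss κ) := by
    intro F hF
    have hF' := hp.integrable_comp_of_integrable hF
    have h1 : ∫ z, F z ∂(stdGauss κ)
        = ∫ p, F (Function.update p.1 k p.2) ∂((stdGauss κ).prod (gaussianReal 0 1)) := by
      conv_lhs => rw [← hp.map_eq]
      rw [integral_map hp.aemeasurable]
      rw [hp.map_eq]; exact hF.1
    rw [h1]
    exact integral_prod _ hF'
  -- After resampling coordinate k the one-dimensional formula applies for almost every choice of
  -- the remaining coordinates.
  rw [e i1, e hΦ'.integrable]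
  refine integral_congr_ae ?_
  filter_upwards [j0.prod_right_ae, j1.prod_right_ae, j2.prod_right_ae] with z k0 k1 k2
  simp only [Function.comp_def, Function.update_self] at k0 k1 k2 ⊢
  exact integral_mul_gaussianReal (fun t => hd z t) k0 k1 k2

end PiGaussian

/-! ### Interpolation between quadratic and linear Gaussian functionals -/

section Interpolation

variable {ι : Type*} [Fintype ι] [DecidableEq ι]

/-- Interpolation between a sum of second Hermite polynomials (`θ = 0`) and a linear form with the
same covariance (`θ = π / 2`). -/
noncomputable def interp (α : ι → ℝ) (θ : ℝ) (z : ι ⊕ ι → ℝ) : ℝ :=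
  ∑ k, α k * (Real.cos θ * (z (.inl k) ^ 2 - 1) + Real.sin θ * (√2 * z (.inr k)))

theorem integral_coord_sq {κ : Type*} [Fintype κ] (k : κ) : ∫ z, z k ^ 2 ∂(stdGauss κ) = 1 :=
  (integral_coord_comp k (f := fun x => x ^ 2) (by fun_prop)).trans gaussian_moment_two

theorem integral_coord_pow_four {κ : Type*} [Fintype κ] (k : κ) :
    ∫ z, z k ^ 4 ∂(stdGauss κ) = 3 :=
  (integral_coord_comp k (f := fun x => x ^ 4) (by fun_prop)).trans gaussian_moment_four

theorem polyGrowth_hermiteSq (k : ι) : PolyGrowth fun z : ι ⊕ ι → ℝ => z (.inl k) ^ 2 - 1 :=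
  ((PolyGrowth.coord _).pow 2).sub (PolyGrowth.const 1)

theorem polyGrowth_linear (k : ι) : PolyGrowth fun z : ι ⊕ ι → ℝ => √2 * z (.inr k) :=
  (PolyGrowth.coord _).const_mul _

theorem polyGrowth_interp (α : ι → ℝ) (θ : ℝ) : PolyGrowth (interp α θ) :=
  PolyGrowth.sum fun k _ => (((polyGrowth_hermiteSq k).const_mul _).add
    ((polyGrowth_linear k).const_mul _)).const_mul _

theorem hasDerivAt_interp_inl (α : ι → ℝ) (θ : ℝ) (k : ι) (z : ι ⊕ ι → ℝ) (t : ℝ) :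
    HasDerivAt (fun s => interp α θ (Function.update z (.inl k) s))
      (2 * Real.cos θ * t * α k) t := by
  have h : ∀ j ∈ (Finset.univ : Finset ι), HasDerivAt (fun s => α j * (Real.cos θ
      * (Function.update z (.inl k) s (.inl j) ^ 2 - 1)
      + Real.sin θ * (√2 * Function.update z (.inl k) s (.inr j))))
      (if k = j then 2 * Real.cos θ * t * α j else 0) t := by
    intro j _
    by_cases hj : k = j
    · subst hj
      simp only [Function.update_self, ne_eq, reduceCtorEq, not_false_eq_true,
        Function.update_of_ne, if_true]
      have := ((((hasDerivAt_pow 2 t).sub_const 1).const_mul (Real.cos θ)).add_const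
        (Real.sin θ * (√2 * z (.inr k)))).const_mul (α k)
      convert! this using 1
      norm_num; ring
    · have hne : (Sum.inl j : ι ⊕ ι) ≠ Sum.inl k := fun h => hj (Sum.inl.inj h).symm
      simp only [Function.update_of_ne hne, ne_eq, reduceCtorEq, not_false_eq_true,
        Function.update_of_ne, if_neg hj]
      exact hasDerivAt_const _ _
  have := HasDerivAt.fun_sum h
  rwa [Finset.sum_ite_eq, if_pos (Finset.mem_univ k)] at this

theorem hasDerivAt_interp_inr (α : ι → ℝ) (θ : ℝ) (k : ι) (z : ι ⊕ ι → ℝ) (t : ℝ) :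
    HasDerivAt (fun s => interp α θ (Function.update z (.inr k) s))
      (√2 * Real.sin θ * α k) t := by
  have h : ∀ j ∈ (Finset.univ : Finset ι), HasDerivAt (fun s => α j * (Real.cos θ
      * (Function.update z (.inr k) s (.inl j) ^ 2 - 1)
      + Real.sin θ * (√2 * Function.update z (.inr k) s (.inr j))))
      (if k = j then √2 * Real.sin θ * α j else 0) t := by
    intro j _
    by_cases hj : k = j
    · subst hj
      simp only [Function.update_self, ne_eq, reduceCtorEq, not_false_eq_true,
        Function.update_of_ne, if_true]
      have := (((((hasDerivAt_id t).const_mul (√2)).const_mul (Real.sin θ)).const_add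
        (Real.cos θ * (z (.inl k) ^ 2 - 1)))).const_mul (α k)
      convert! this using 1
      ring
    · have hne : (Sum.inr j : ι ⊕ ι) ≠ Sum.inr k := fun h => hj (Sum.inr.inj h).symm
      simp only [Function.update_of_ne hne, ne_eq, reduceCtorEq, not_false_eq_true,
        Function.update_of_ne, if_neg hj]
      exact hasDerivAt_const _ _
  have := HasDerivAt.fun_sum h
  rwa [Finset.sum_ite_eq, if_pos (Finset.mem_univ k)] at this

/-- `Φ` depends on the `k`-th pair of coordinates as a function of interpolations with derivative
`H` in the direction `k`. -/
structure HasInterpDeriv (θ : ℝ) (k : ι) (Φ H : (ι ⊕ ι → ℝ) → ℝ) : Prop where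
  growth : PolyGrowth Φ
  growth_deriv : PolyGrowth H
  inl : ∀ z t, HasDerivAt (fun s => Φ (Function.update z (.inl k) s))
    (2 * Real.cos θ * t * H (Function.update z (.inl k) t)) t
  inr : ∀ z t, HasDerivAt (fun s => Φ (Function.update z (.inr k) s))
    (√2 * Real.sin θ * H (Function.update z (.inr k) t)) t

theorem hasInterpDeriv_interp (α : ι → ℝ) (θ : ℝ) (k : ι) :
    HasInterpDeriv θ k (interp α θ) fun _ => α k :=
  ⟨polyGrowth_interp α θ, PolyGrowth.const _, hasDerivAt_interp_inl α θ k,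
    hasDerivAt_interp_inr α θ k⟩

/-- Integration by parts is applied to z Φ; the term Φ that comes from differentiating z cancels the
-1 of the Hermite polynomial. -/
theorem HasInterpDeriv.integral_inl {θ : ℝ} {k : ι} {Φ H : (ι ⊕ ι → ℝ) → ℝ}
    (h : HasInterpDeriv θ k Φ H) :
    ∫ z, (z (.inl k) ^ 2 - 1) * Φ z ∂(stdGauss (ι ⊕ ι))
      = ∫ z, 2 * Real.cos θ * (z (.inl k) ^ 2 * H z) ∂(stdGauss (ι ⊕ ι)) := by
  have hc : PolyGrowth fun z : ι ⊕ ι → ℝ => z (.inl k) := PolyGrowth.coord _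
  have hG : PolyGrowth fun z : ι ⊕ ι → ℝ => 2 * Real.cos θ * (z (.inl k) ^ 2 * H z) :=
    ((hc.pow 2).mul h.growth_deriv).const_mul _
  have := integral_coord_mul (.inl k) (Φ := fun z => z (.inl k) * Φ z)
    (Φ' := fun z => Φ z + 2 * Real.cos θ * (z (.inl k) ^ 2 * H z))
    (hc.mul h.growth) (h.growth.add hG) (fun z t => by
      simp only [Function.update_self]
      have := (hasDerivAt_id t).mul (h.inl z t)
      convert! this using 1
      simp only [id]; ring)
  rw [integral_add h.growth.integrable hG.integrable] at this
  have e : ∀ z : ι ⊕ ι → ℝ, (z (.inl k) ^ 2 - 1) * Φ z = z (.inl k) * (z (.inl k) * Φ z) - Φ z :=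
    fun z => by ring
  simp_rw [e]
  rw [integral_sub (hc.mul (hc.mul h.growth)).integrable h.growth.integrable, this]
  ring

theorem HasInterpDeriv.integral_inr {θ : ℝ} {k : ι} {Φ H : (ι ⊕ ι → ℝ) → ℝ}
    (h : HasInterpDeriv θ k Φ H) :
    ∫ z, (√2 * z (.inr k)) * Φ z ∂(stdGauss (ι ⊕ ι))
      = ∫ z, 2 * Real.sin θ * H z ∂(stdGauss (ι ⊕ ι)) := by
  have := integral_coord_mul (.inr k) (Φ := Φ) (Φ' := fun z => √2 * Real.sin θ * H z)
    h.growth (h.growth_deriv.const_mul _) h.inr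
  have h2 : √(2 : ℝ) * √2 = 2 := Real.mul_self_sqrt (by norm_num)
  simp_rw [mul_assoc (√(2 : ℝ))] at this ⊢
  rw [integral_const_mul, this, ← integral_const_mul]
  refine integral_congr_ae (ae_of_all _ fun z => ?_)
  simp only
  linear_combination Real.sin θ * H z * h2

/-- Integration by parts against the interpolated variable. -/
theorem HasInterpDeriv.integral_interp {θ : ℝ} {k : ι} {Φ H : (ι ⊕ ι → ℝ) → ℝ}
    (h : HasInterpDeriv θ k Φ H) :
    ∫ z, (Real.cos θ * (z (.inl k) ^ 2 - 1) + Real.sin θ * (√2 * z (.inr k))) * Φ z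
        ∂(stdGauss (ι ⊕ ι))
      = ∫ z, 2 * (Real.cos θ ^ 2 * z (.inl k) ^ 2 + Real.sin θ ^ 2) * H z
        ∂(stdGauss (ι ⊕ ι)) := by
  have p1 := ((polyGrowth_hermiteSq k).mul h.growth).const_mul (Real.cos θ)
  have p2 := ((polyGrowth_linear k).mul h.growth).const_mul (Real.sin θ)
  have p3 := (((PolyGrowth.coord (Sum.inl k)).pow 2).mul h.growth_deriv).const_mul (2 * Real.cos θ)
  have p4 := h.growth_deriv.const_mul (2 * Real.sin θ)
  simp_rw [add_mul, mul_assoc (Real.cos θ), mul_assoc (Real.sin θ)]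
  rw [integral_add p1.integrable p2.integrable, integral_const_mul, integral_const_mul,
    h.integral_inl, h.integral_inr, ← integral_const_mul, ← integral_const_mul,
    ← integral_add (p3.const_mul _).integrable (p4.const_mul _).integrable]
  refine integral_congr_ae (ae_of_all _ fun z => ?_)
  simp only
  ring

/-- Integration by parts against the derivative of the interpolated variable. -/
theorem HasInterpDeriv.integral_interp_deriv {θ : ℝ} {k : ι} {Φ H : (ι ⊕ ι → ℝ) → ℝ}
    (h : HasInterpDeriv θ k Φ H) :
    ∫ z, (-Real.sin θ * (z (.inl k) ^ 2 - 1) + Real.cos θ * (√2 * z (.inr k))) * Φ z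
        ∂(stdGauss (ι ⊕ ι))
      = ∫ z, -2 * Real.sin θ * Real.cos θ * ((z (.inl k) ^ 2 - 1) * H z)
        ∂(stdGauss (ι ⊕ ι)) := by
  have p1 := ((polyGrowth_hermiteSq k).mul h.growth).const_mul (-Real.sin θ)
  have p2 := ((polyGrowth_linear k).mul h.growth).const_mul (Real.cos θ)
  have p3 := (((PolyGrowth.coord (Sum.inl k)).pow 2).mul h.growth_deriv).const_mul (2 * Real.cos θ)
  have p4 := h.growth_deriv.const_mul (2 * Real.sin θ)
  simp_rw [add_mul, mul_assoc (-Real.sin θ), mul_assoc (Real.cos θ)]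
  rw [integral_add p1.integrable p2.integrable, integral_const_mul, integral_const_mul,
    h.integral_inl, h.integral_inr, ← integral_const_mul, ← integral_const_mul,
    ← integral_add (p3.const_mul _).integrable (p4.const_mul _).integrable]
  refine integral_congr_ae (ae_of_all _ fun z => ?_)
  simp only
  ring

theorem integral_interp_mul (α : ι → ℝ) (θ : ℝ) {Φ : (ι ⊕ ι → ℝ) → ℝ}
    {H : ι → (ι ⊕ ι → ℝ) → ℝ} (h : ∀ k, HasInterpDeriv θ k Φ (H k)) (hΦ : PolyGrowth Φ) :
    ∫ z, interp α θ z * Φ z ∂(stdGauss (ι ⊕ ι))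
      = ∑ k, α k * ∫ z, 2 * (Real.cos θ ^ 2 * z (.inl k) ^ 2 + Real.sin θ ^ 2) * H k z
        ∂(stdGauss (ι ⊕ ι)) := by
  simp_rw [interp, Finset.sum_mul, mul_assoc (α _)]
  rw [integral_finsetSum _ fun k _ => (((((polyGrowth_hermiteSq k).const_mul _).add
    ((polyGrowth_linear k).const_mul _)).mul hΦ).const_mul _).integrable]
  refine Finset.sum_congr rfl fun k _ => ?_
  rw [integral_const_mul, (h k).integral_interp]

/-- Both z² - 1 and √2 z have variance 2 and are independent across the two blocks, so cos² + sin² =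
1 keeps the variance constant along the path. -/
theorem integral_interp_sq (α : ι → ℝ) (θ : ℝ) :
    ∫ z, interp α θ z ^ 2 ∂(stdGauss (ι ⊕ ι)) = 2 * ∑ k, α k ^ 2 := by
  have h := integral_interp_mul α θ (hasInterpDeriv_interp α θ) (polyGrowth_interp α θ)
  simp_rw [pow_two (interp α θ _)]
  rw [h, Finset.mul_sum]
  refine Finset.sum_congr rfl fun k _ => ?_
  have h2 := integral_coord_sq (Sum.inl k : ι ⊕ ι)
  have e : ∀ z : ι ⊕ ι → ℝ, 2 * (Real.cos θ ^ 2 * z (.inl k) ^ 2 + Real.sin θ ^ 2) * α k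
      = 2 * Real.cos θ ^ 2 * α k * z (.inl k) ^ 2 + 2 * Real.sin θ ^ 2 * α k := fun z => by ring
  simp_rw [e]
  rw [integral_add ((integrable_coord_pow _ 2).const_mul _) (integrable_const _),
    integral_const_mul, h2, integral_const, probReal_univ, one_smul]
  linear_combination 2 * α k ^ 2 * Real.cos_sq_add_sin_sq θ

theorem hasInterpDeriv_pow_three (α : ι → ℝ) (θ : ℝ) (k : ι) :
    HasInterpDeriv θ k (fun z => interp α θ z ^ 3) fun z => 3 * interp α θ z ^ 2 * α k := by
  refine ⟨(polyGrowth_interp α θ).pow 3, (((polyGrowth_interp α θ).pow 2).const_mul 3).mul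
    (PolyGrowth.const _), fun z t => ?_, fun z t => ?_⟩
  · have := (hasDerivAt_interp_inl α θ k z t).pow 3
    convert! this using 1
    push_cast; ring
  · have := (hasDerivAt_interp_inr α θ k z t).pow 3
    convert! this using 1
    push_cast; ring

/-- Fourth moments of the interpolation are bounded. -/
theorem integral_interp_pow_four_le {α : ι → ℝ} (θ : ℝ)
    (hα : ∀ k, α k ^ 2 ≤ (Fintype.card ι : ℝ)⁻¹) (hN : 0 < Fintype.card ι) :
    ∫ z, interp α θ z ^ 4 ∂(stdGauss (ι ⊕ ι)) ≤ 216 := by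
  have hw := polyGrowth_interp α θ
  have hN' : (0 : ℝ) < Fintype.card ι := by exact_mod_cast hN
  let R : ι → (ι ⊕ ι → ℝ) → ℝ := fun k z => Real.cos θ ^ 2 * z (.inl k) ^ 2 + Real.sin θ ^ 2
  have hR : ∀ k, PolyGrowth (R k) := fun k =>
    (((PolyGrowth.coord (Sum.inl k)).pow 2).const_mul _).add (PolyGrowth.const _)
  have h := integral_interp_mul α θ (hasInterpDeriv_pow_three α θ) (hw.pow 3)
  have e1 : ∫ z, interp α θ z ^ 4 ∂(stdGauss (ι ⊕ ι))
      = ∑ k, α k ^ 2 * ∫ z, 6 * (R k z * interp α θ z ^ 2) ∂(stdGauss (ι ⊕ ι)) := by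
    rw [← show (fun z => interp α θ z * interp α θ z ^ 3) = fun z => interp α θ z ^ 4 by
      funext z; ring, h]
    refine Finset.sum_congr rfl fun k _ => ?_
    rw [← integral_const_mul, ← integral_const_mul]
    refine integral_congr_ae (ae_of_all _ fun z => ?_)
    simp only [R]; ring
  -- Young's inequality 6Rw² ≤ w⁴/2 + 18R² lets half of the fourth moment be absorbed. Since R ≤ z²
  -- + 1 and E(z² + 1)² = 6, the remainder is 18 · 6 = 108, and X ≤ X/2 + 108 gives 216.
  have b1 : ∀ k, ∫ z, 6 * (R k z * interp α θ z ^ 2) ∂(stdGauss (ι ⊕ ι))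
      ≤ 1 / 2 * ∫ z, interp α θ z ^ 4 ∂(stdGauss (ι ⊕ ι)) + 108 := by
    intro k
    have hle : ∀ z : ι ⊕ ι → ℝ, 6 * (R k z * interp α θ z ^ 2)
        ≤ 1 / 2 * interp α θ z ^ 4 + 18 * (z (.inl k) ^ 4 + 2 * z (.inl k) ^ 2 + 1) := by
      intro z
      have h1 : 0 ≤ R k z := by positivity
      have h2 : R k z ≤ z (.inl k) ^ 2 + 1 := by
        have c1 := Real.cos_sq_le_one θ
        have c2 := Real.sin_sq_le_one θ
        simp only [R]
        nlinarith [sq_nonneg (z (.inl k))]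
      have h3 : R k z ^ 2 ≤ (z (.inl k) ^ 2 + 1) ^ 2 := pow_le_pow_left₀ h1 h2 2
      nlinarith [sq_nonneg (interp α θ z ^ 2 - 6 * R k z)]
    have c1 := (hw.pow 4).const_mul (1 / 2)
    have d4 := (PolyGrowth.coord (Sum.inl k : ι ⊕ ι)).pow 4
    have d2 := ((PolyGrowth.coord (Sum.inl k : ι ⊕ ι)).pow 2).const_mul 2
    have c2 := ((d4.add d2).add (PolyGrowth.const 1)).const_mul 18
    refine (integral_mono (((hR k).mul (hw.pow 2)).const_mul 6).integrable
      (c1.add c2).integrable hle).trans_eq ?_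
    rw [integral_add c1.integrable c2.integrable, integral_const_mul, integral_const_mul,
      integral_add (d4.add d2).integrable (integrable_const _), integral_add d4.integrable
      d2.integrable, integral_const_mul,
      integral_coord_sq (Sum.inl k : ι ⊕ ι), integral_coord_pow_four (Sum.inl k : ι ⊕ ι),
      integral_const, probReal_univ]
    norm_num
  have h4 : 0 ≤ ∫ z, interp α θ z ^ 4 ∂(stdGauss (ι ⊕ ι)) :=
    integral_nonneg fun z => by positivity
  have b2 : ∑ k, α k ^ 2 * ∫ z, 6 * (R k z * interp α θ z ^ 2) ∂(stdGauss (ι ⊕ ι))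
      ≤ ∑ _k : ι, (Fintype.card ι : ℝ)⁻¹
        * (1 / 2 * ∫ z, interp α θ z ^ 4 ∂(stdGauss (ι ⊕ ι)) + 108) :=
    Finset.sum_le_sum fun k _ => (mul_le_mul_of_nonneg_left (b1 k) (sq_nonneg _)).trans
      (mul_le_mul_of_nonneg_right (hα k) (by positivity))
  rw [← e1, Finset.sum_const, nsmul_eq_mul, ← mul_assoc, Finset.card_univ,
    mul_inv_cancel₀ hN'.ne', one_mul] at b2
  linarith

end Interpolation

/-! ### A quantitative central limit theorem for planar quadratic functionals -/

section CentralLimit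

variable {ι : Type*} [Fintype ι] [DecidableEq ι]

/-- The derivative of the interpolation in its parameter. -/
noncomputable def interpDot (α : ι → ℝ) (θ : ℝ) (z : ι ⊕ ι → ℝ) : ℝ :=
  ∑ k, α k * (-Real.sin θ * (z (.inl k) ^ 2 - 1) + Real.cos θ * (√2 * z (.inr k)))

/-- A bound for the interpolation and its derivative, uniform in the parameter. -/
noncomputable def interpBound (α : ι → ℝ) (z : ι ⊕ ι → ℝ) : ℝ :=
  ∑ k, |α k| * (|z (.inl k) ^ 2 - 1| + |√2 * z (.inr k)|)

theorem hasDerivAt_interp (α : ι → ℝ) (θ : ℝ) (z : ι ⊕ ι → ℝ) :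
    HasDerivAt (fun θ => interp α θ z) (interpDot α θ z) θ :=
  HasDerivAt.fun_sum fun _ _ => (((Real.hasDerivAt_cos θ).mul_const _).add
    ((Real.hasDerivAt_sin θ).mul_const _)).const_mul _

theorem abs_interp_le (α : ι → ℝ) (θ : ℝ) (z : ι ⊕ ι → ℝ) :
    |interp α θ z| ≤ interpBound α z := by
  refine (Finset.abs_sum_le_sum_abs _ _).trans (Finset.sum_le_sum fun k _ => ?_)
  rw [abs_mul]
  refine mul_le_mul_of_nonneg_left ((abs_add_le _ _).trans (add_le_add ?_ ?_)) (abs_nonneg _)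
  · rw [abs_mul]
    exact mul_le_of_le_one_left (abs_nonneg _) (Real.abs_cos_le_one θ)
  · rw [abs_mul]
    exact mul_le_of_le_one_left (abs_nonneg _) (Real.abs_sin_le_one θ)

theorem abs_interpDot_le (α : ι → ℝ) (θ : ℝ) (z : ι ⊕ ι → ℝ) :
    |interpDot α θ z| ≤ interpBound α z := by
  refine (Finset.abs_sum_le_sum_abs _ _).trans (Finset.sum_le_sum fun k _ => ?_)
  rw [abs_mul]
  refine mul_le_mul_of_nonneg_left ((abs_add_le _ _).trans (add_le_add ?_ ?_)) (abs_nonneg _)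
  · rw [abs_mul, abs_neg]
    exact mul_le_of_le_one_left (abs_nonneg _) (Real.abs_sin_le_one θ)
  · rw [abs_mul]
    exact mul_le_of_le_one_left (abs_nonneg _) (Real.abs_cos_le_one θ)

theorem polyGrowth_interpBound (α : ι → ℝ) : PolyGrowth (interpBound α) :=
  PolyGrowth.sum fun k _ =>
    ((polyGrowth_hermiteSq k).abs.add (polyGrowth_linear k).abs).const_mul _

theorem polyGrowth_interpDot (α : ι → ℝ) (θ : ℝ) : PolyGrowth (interpDot α θ) :=
  PolyGrowth.sum fun k _ => (((polyGrowth_hermiteSq k).const_mul _).add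
    ((polyGrowth_linear k).const_mul _)).const_mul _

/-- The squared norm of a planar interpolation. -/
noncomputable def interpRadius (α β : ι → ℝ) (θ : ℝ) (z : ι ⊕ ι → ℝ) : ℝ :=
  interp α θ z ^ 2 + interp β θ z ^ 2

theorem polyGrowth_interpRadius (α β : ι → ℝ) (θ : ℝ) : PolyGrowth (interpRadius α β θ) :=
  ((polyGrowth_interp α θ).pow 2).add ((polyGrowth_interp β θ).pow 2)

variable {F F' F'' : ℝ → ℝ} {A B : ℝ}

theorem hasDerivAt_comp_interpRadius (hF : ∀ r, HasDerivAt F (F' r) r) (α β : ι → ℝ) (θ : ℝ)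
    (z : ι ⊕ ι → ℝ) :
    HasDerivAt (fun θ => F (interpRadius α β θ z))
      (F' (interpRadius α β θ z)
        * (2 * interp α θ z * interpDot α θ z + 2 * interp β θ z * interpDot β θ z)) θ := by
  have h := (hF (interpRadius α β θ z)).comp θ (((hasDerivAt_interp α θ z).pow 2).add
    ((hasDerivAt_interp β θ z).pow 2))
  convert! h using 1
  norm_num

/-- The first function is the derivative of F(R) in the direction (α k, β k), and the second is its
derivative in the same direction. It prepares the integration by parts of the derivative in θ. -/
theorem hasInterpDeriv_gradient (hF' : ∀ r, HasDerivAt F' (F'' r) r) (hc : Continuous F'')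
    (hA : ∀ r, |F' r| ≤ A) (hB : ∀ r, |F'' r| ≤ B) (α β : ι → ℝ) (θ : ℝ) (k : ι) :
    HasInterpDeriv θ k
      (fun z => 2 * F' (interpRadius α β θ z) * (interp α θ z * α k + interp β θ z * β k))
      (fun z => 2 * F' (interpRadius α β θ z) * (α k ^ 2 + β k ^ 2)
        + 4 * F'' (interpRadius α β θ z) * (interp α θ z * α k + interp β θ z * β k) ^ 2) := by
  have hc' : Continuous F' := continuous_iff_continuousAt.2 fun r => (hF' r).continuousAt
  have hr := (polyGrowth_interpRadius α β θ).1
  have g1 : PolyGrowth fun z => F' (interpRadius α β θ z) :=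
    PolyGrowth.of_bounded (hc'.comp hr) fun z => hA _
  have g2 : PolyGrowth fun z => F'' (interpRadius α β θ z) :=
    PolyGrowth.of_bounded (hc.comp hr) fun z => hB _
  have g3 : PolyGrowth fun z => interp α θ z * α k + interp β θ z * β k :=
    ((polyGrowth_interp α θ).mul (PolyGrowth.const _)).add
      ((polyGrowth_interp β θ).mul (PolyGrowth.const _))
  refine ⟨(g1.const_mul 2).mul g3, ((g1.const_mul 2).mul (PolyGrowth.const _)).add
    ((g2.const_mul 4).mul (g3.pow 2)), fun z t => ?_, fun z t => ?_⟩
  · have d1 := hasDerivAt_interp_inl α θ k z t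
    have d2 := hasDerivAt_interp_inl β θ k z t
    have d3 := (hF' (interpRadius α β θ (Function.update z (.inl k) t))).comp t
      ((d1.pow 2).add (d2.pow 2))
    have d4 := (d3.const_mul 2).mul ((d1.mul_const (α k)).add (d2.mul_const (β k)))
    convert! d4 using 1
    simp only [Function.comp_apply, interpRadius, Pi.add_apply, Pi.pow_apply]
    push_cast
    ring
  · have d1 := hasDerivAt_interp_inr α θ k z t
    have d2 := hasDerivAt_interp_inr β θ k z t
    have d3 := (hF' (interpRadius α β θ (Function.update z (.inr k) t))).comp t
      ((d1.pow 2).add (d2.pow 2))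
    have d4 := (d3.const_mul 2).mul ((d1.mul_const (α k)).add (d2.mul_const (β k)))
    convert! d4 using 1
    simp only [Function.comp_apply, interpRadius, Pi.add_apply, Pi.pow_apply]
    push_cast
    ring

theorem polyGrowth_comp_interpRadius (hF : ∀ r, HasDerivAt F (F' r) r) (hA : ∀ r, |F' r| ≤ A)
    (α β : ι → ℝ) (θ : ℝ) : PolyGrowth fun z => F (interpRadius α β θ z) := by
  have hc : Continuous F := continuous_iff_continuousAt.2 fun r => (hF r).continuousAt
  have h : ∀ r, |F r| ≤ |F 0| + A * |r| := by
    intro r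
    have := Convex.norm_image_sub_le_of_norm_hasDerivWithin_le (s := Set.univ) (x := 0) (y := r)
      (fun x _ => (hF x).hasDerivWithinAt) (fun x _ => hA x) convex_univ trivial trivial
    rw [sub_zero, Real.norm_eq_abs, Real.norm_eq_abs] at this
    have h2 := abs_add_le (F 0) (F r - F 0)
    rw [add_sub_cancel] at h2
    linarith
  have hr := polyGrowth_interpRadius α β θ
  refine ((PolyGrowth.const (|F 0|)).add (hr.abs.const_mul A)).mono (hc.comp hr.1) fun z => ?_
  exact (h _).trans (le_abs_self _)

theorem hasDerivAt_integral_interp (hF : ∀ r, HasDerivAt F (F' r) r)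
    (hF' : ∀ r, HasDerivAt F' (F'' r) r) (hA : ∀ r, |F' r| ≤ A) (α β : ι → ℝ) (θ : ℝ) :
    HasDerivAt (fun θ => ∫ z, F (interpRadius α β θ z) ∂(stdGauss (ι ⊕ ι)))
      (∫ z, F' (interpRadius α β θ z)
        * (2 * interp α θ z * interpDot α θ z + 2 * interp β θ z * interpDot β θ z)
        ∂(stdGauss (ι ⊕ ι))) θ := by
  have hc' : Continuous F' := continuous_iff_continuousAt.2 fun r => (hF' r).continuousAt
  have hbd : PolyGrowth fun z => A * (2 * interpBound α z ^ 2 + 2 * interpBound β z ^ 2) :=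
    ((((polyGrowth_interpBound α).pow 2).const_mul 2).add
      (((polyGrowth_interpBound β).pow 2).const_mul 2)).const_mul A
  refine (hasDerivAt_integral_of_dominated_loc_of_deriv_le (s := Set.univ) univ_mem
    (Eventually.of_forall fun t => (polyGrowth_comp_interpRadius hF hA α β t).1.aestronglyMeasurable)
    (polyGrowth_comp_interpRadius hF hA α β θ).integrable ?_
    (ae_of_all _ fun z t _ => ?_) hbd.integrable
    (ae_of_all _ fun z t _ => hasDerivAt_comp_interpRadius hF α β t z)).2
  · refine Continuous.aestronglyMeasurable ?_
    exact (hc'.comp (polyGrowth_interpRadius α β θ).1).mul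
      (((continuous_const.mul (polyGrowth_interp α θ).1).mul (polyGrowth_interpDot α θ).1).add
        ((continuous_const.mul (polyGrowth_interp β θ).1).mul (polyGrowth_interpDot β θ).1))
  · rw [Real.norm_eq_abs, abs_mul]
    have e : ∀ α : ι → ℝ, |2 * interp α t z * interpDot α t z| ≤ 2 * interpBound α z ^ 2 := by
      intro α
      rw [abs_mul, abs_mul, abs_two, mul_assoc, pow_two]
      exact mul_le_mul_of_nonneg_left (mul_le_mul (abs_interp_le α t z) (abs_interpDot_le α t z)
        (abs_nonneg _) ((abs_nonneg _).trans (abs_interp_le α t z))) zero_le_two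
    exact mul_le_mul (hA _) ((abs_add_le _ _).trans (add_le_add (e α) (e β))) (abs_nonneg _)
      ((abs_nonneg _).trans (hA 0))

/-- Integration by parts produces z² from the Hermite block and 1 from the Gaussian block, with
opposite signs. Their difference z² - 1 is centred, and this gains the factor √N: a sum of N
independent centred terms is of order √N only. -/
theorem integral_interp_derivative (hF' : ∀ r, HasDerivAt F' (F'' r) r) (hc : Continuous F'')
    (hA : ∀ r, |F' r| ≤ A) (hB : ∀ r, |F'' r| ≤ B) (α β : ι → ℝ) (θ : ℝ) :
    ∫ z, F' (interpRadius α β θ z)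
        * (2 * interp α θ z * interpDot α θ z + 2 * interp β θ z * interpDot β θ z)
        ∂(stdGauss (ι ⊕ ι))
      = -2 * Real.sin θ * Real.cos θ * ∫ z, ∑ k, (z (.inl k) ^ 2 - 1)
        * (2 * F' (interpRadius α β θ z) * (α k ^ 2 + β k ^ 2)
        + 4 * F'' (interpRadius α β θ z) * (interp α θ z * α k + interp β θ z * β k) ^ 2)
        ∂(stdGauss (ι ⊕ ι)) := by
  have hd := hasInterpDeriv_gradient (ι := ι) hF' hc hA hB α β θ
  have e : ∀ z : ι ⊕ ι → ℝ, F' (interpRadius α β θ z)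
      * (2 * interp α θ z * interpDot α θ z + 2 * interp β θ z * interpDot β θ z)
      = ∑ k, (-Real.sin θ * (z (.inl k) ^ 2 - 1) + Real.cos θ * (√2 * z (.inr k)))
        * (2 * F' (interpRadius α β θ z) * (interp α θ z * α k + interp β θ z * β k)) := by
    intro z
    rw [interpDot, interpDot, Finset.mul_sum, Finset.mul_sum, ← Finset.sum_add_distrib,
      Finset.mul_sum]
    exact Finset.sum_congr rfl fun k _ => by ring
  simp_rw [e]
  rw [integral_finsetSum _ fun k _ => ((((polyGrowth_hermiteSq k).const_mul _).add
    ((polyGrowth_linear k).const_mul _)).mul (hd k).growth).integrable,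
    integral_finsetSum _ fun k _ => ((polyGrowth_hermiteSq k).mul (hd k).growth_deriv).integrable,
    Finset.mul_sum]
  refine Finset.sum_congr rfl fun k _ => ?_
  rw [(hd k).integral_interp_deriv, integral_const_mul]

theorem interp_zero (α : ι → ℝ) (z : ι ⊕ ι → ℝ) :
    interp α 0 z = ∑ k, α k * (z (.inl k) ^ 2 - 1) := by
  simp [interp]

/-- The pointwise estimate behind the central limit theorem. -/
theorem abs_sum_le_of_unit {p q : ι → ℝ} (hpq : ∀ k, p k ^ 2 + q k ^ 2 = 1) {κ : ℝ} (hκ : 0 < κ)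
    (u v f g A B : ℝ) (hA : |f| ≤ A) (hB : |g| ≤ B) (z : ι ⊕ ι → ℝ) :
    |∑ k, (z (.inl k) ^ 2 - 1) * (2 * f * ((κ⁻¹ * p k) ^ 2 + (κ⁻¹ * q k) ^ 2)
        + 4 * g * (u * (κ⁻¹ * p k) + v * (κ⁻¹ * q k)) ^ 2)|
      ≤ (κ ^ 2)⁻¹ * (A * (κ + κ⁻¹ * interp (fun _ => 1) 0 z ^ 2)
        + B * (6 * κ * (u ^ 4 + v ^ 4) + κ⁻¹ * (interp (fun _ => 1) 0 z ^ 2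
          + interp (fun k => p k ^ 2 - q k ^ 2) 0 z ^ 2 + interp (fun k => 2 * p k * q k) 0 z ^ 2))) := by
  rw [interp_zero, interp_zero, interp_zero]
  set S₁ := ∑ k, (1 : ℝ) * (z (.inl k) ^ 2 - 1)
  set S₂ := ∑ k, (p k ^ 2 - q k ^ 2) * (z (.inl k) ^ 2 - 1)
  set S₃ := ∑ k, (2 * p k * q k) * (z (.inl k) ^ 2 - 1)
  -- As (p, q) is a unit vector, double-angle formulas write (u p + v q)² through 1, p² - q² and
  -- 2pq. The random factors u, v then leave the sum over k, and only three linear sums of z² - 1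
  -- remain.
  have e : ∑ k, (z (.inl k) ^ 2 - 1) * (2 * f * ((κ⁻¹ * p k) ^ 2 + (κ⁻¹ * q k) ^ 2)
        + 4 * g * (u * (κ⁻¹ * p k) + v * (κ⁻¹ * q k)) ^ 2)
      = (κ ^ 2)⁻¹ * (2 * f * S₁ + 2 * g * ((u ^ 2 + v ^ 2) * S₁ + (u ^ 2 - v ^ 2) * S₂
        + 2 * u * v * S₃)) := by
    simp only [S₁, S₂, S₃, Finset.mul_sum, ← Finset.sum_add_distrib]
    refine Finset.sum_congr rfl fun k _ => ?_
    linear_combination (κ⁻¹) ^ 2 * (z (.inl k) ^ 2 - 1)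
      * (2 * f + 2 * g * (u ^ 2 + v ^ 2)) * hpq k
  rw [e, abs_mul, abs_of_pos (by positivity : (0 : ℝ) < (κ ^ 2)⁻¹)]
  refine mul_le_mul_of_nonneg_left ?_ (by positivity)
  have hA0 := (abs_nonneg _).trans hA
  have hB0 := (abs_nonneg _).trans hB
  -- Young's inequality with weight κ, which will be √N: the sums S have second moment O(κ²), so
  -- both sides are of order κ.
  have young : ∀ x S : ℝ, 2 * (x * |S|) ≤ κ * x ^ 2 + κ⁻¹ * S ^ 2 := by
    intro x S
    have h1 : κ * x ^ 2 + κ⁻¹ * S ^ 2 - 2 * (x * |S|) = κ⁻¹ * (κ * x - |S|) ^ 2 := by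
      rw [← sq_abs S]; field_simp; ring
    have h2 : 0 ≤ κ⁻¹ * (κ * x - |S|) ^ 2 := by positivity
    linarith
  have r2 : (u ^ 2 + v ^ 2) ^ 2 ≤ 2 * (u ^ 4 + v ^ 4) := by nlinarith [sq_nonneg (u ^ 2 - v ^ 2)]
  have b1 : |2 * f * S₁| ≤ A * (κ + κ⁻¹ * S₁ ^ 2) := by
    rw [abs_mul, abs_mul, abs_two]
    have := young 1 S₁
    nlinarith [mul_le_mul_of_nonneg_right hA (abs_nonneg S₁),
      mul_le_mul_of_nonneg_left this hA0]
  have b2 : |(u ^ 2 + v ^ 2) * S₁ + (u ^ 2 - v ^ 2) * S₂ + 2 * u * v * S₃|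
      ≤ (u ^ 2 + v ^ 2) * |S₁| + (u ^ 2 + v ^ 2) * |S₂| + (u ^ 2 + v ^ 2) * |S₃| := by
    refine (abs_add_le _ _).trans (add_le_add ((abs_add_le _ _).trans (add_le_add ?_ ?_)) ?_)
    · rw [abs_mul, abs_of_nonneg (by positivity)]
    · rw [abs_mul]
      refine mul_le_mul_of_nonneg_right (abs_le.2 ⟨?_, ?_⟩) (abs_nonneg _) <;>
        nlinarith [sq_nonneg u, sq_nonneg v]
    · rw [abs_mul]
      refine mul_le_mul_of_nonneg_right (abs_le.2 ⟨?_, ?_⟩) (abs_nonneg _) <;>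
        nlinarith [sq_nonneg (u + v), sq_nonneg (u - v)]
  have b3 : 2 * |(u ^ 2 + v ^ 2) * S₁ + (u ^ 2 - v ^ 2) * S₂ + 2 * u * v * S₃|
      ≤ 6 * κ * (u ^ 4 + v ^ 4) + κ⁻¹ * (S₁ ^ 2 + S₂ ^ 2 + S₃ ^ 2) := by
    have y1 := young (u ^ 2 + v ^ 2) S₁
    have y2 := young (u ^ 2 + v ^ 2) S₂
    have y3 := young (u ^ 2 + v ^ 2) S₃
    have := mul_le_mul_of_nonneg_left r2 hκ.le
    nlinarith
  refine (abs_add_le _ _).trans (add_le_add b1 ?_)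
  rw [abs_mul, abs_mul, abs_two, mul_comm 2 |g|, mul_assoc]
  exact mul_le_mul hB b3 (by positivity) hB0

/-- Along the path the derivative of E F(R) is at most κ⁻² times O((A + B) κ), with κ = √N, thanks
to the bounded fourth moments and the variances of the three linear sums. The constant 2600 covers
the factor 3 of A and 6 · 2 · 216 + 6 = 2598 of B. The mean value inequality on [0, π/2], of length
at most 2, doubles it. -/
theorem integral_interp_pair_le {p q : ι → ℝ} (hpq : ∀ k, p k ^ 2 + q k ^ 2 = 1)
    (hF : ∀ r, HasDerivAt F (F' r) r)
    (hF' : ∀ r, HasDerivAt F' (F'' r) r) (hc : Continuous F'')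
    (hA : ∀ r, |F' r| ≤ A) (hB : ∀ r, |F'' r| ≤ B) (hN : 0 < Fintype.card ι) :
    |(∫ z, F (interpRadius (fun k => (√(Fintype.card ι : ℝ))⁻¹ * p k)
          (fun k => (√(Fintype.card ι : ℝ))⁻¹ * q k) (Real.pi / 2) z) ∂(stdGauss (ι ⊕ ι)))
        - ∫ z, F (interpRadius (fun k => (√(Fintype.card ι : ℝ))⁻¹ * p k)
          (fun k => (√(Fintype.card ι : ℝ))⁻¹ * q k) 0 z) ∂(stdGauss (ι ⊕ ι))|
      ≤ 5200 * (A + B) / √(Fintype.card ι : ℝ) := by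
  have hN' : (0 : ℝ) < Fintype.card ι := by exact_mod_cast hN
  set κ := √(Fintype.card ι : ℝ) with hκd
  have hκ : 0 < κ := Real.sqrt_pos.2 hN'
  have hκ2 : κ ^ 2 = Fintype.card ι := Real.sq_sqrt hN'.le
  have hA0 := (abs_nonneg _).trans (hA 0)
  have hB0 := (abs_nonneg _).trans (hB 0)
  set α : ι → ℝ := fun k => κ⁻¹ * p k
  set β : ι → ℝ := fun k => κ⁻¹ * q k
  have hp1 : ∀ k, p k ^ 2 ≤ 1 := fun k => by nlinarith [hpq k, sq_nonneg (q k)]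
  have hq1 : ∀ k, q k ^ 2 ≤ 1 := fun k => by nlinarith [hpq k, sq_nonneg (p k)]
  have hα : ∀ k, α k ^ 2 ≤ (Fintype.card ι : ℝ)⁻¹ := fun k => by
    rw [← hκ2, mul_pow, inv_pow]
    exact mul_le_of_le_one_right (by positivity) (hp1 k)
  have hβ : ∀ k, β k ^ 2 ≤ (Fintype.card ι : ℝ)⁻¹ := fun k => by
    rw [← hκ2, mul_pow, inv_pow]
    exact mul_le_of_le_one_right (by positivity) (hq1 k)
  have hS : ∀ b : ι → ℝ, (∀ k, b k ^ 2 ≤ 1) →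
      ∫ z, interp b 0 z ^ 2 ∂(stdGauss (ι ⊕ ι)) ≤ 2 * κ ^ 2 := by
    intro b hb
    rw [integral_interp_sq, hκ2]
    have : ∑ k, b k ^ 2 ≤ ∑ _k : ι, (1 : ℝ) := Finset.sum_le_sum fun k _ => hb k
    simp only [Finset.sum_const, Finset.card_univ, nsmul_eq_mul, mul_one] at this
    linarith
  have h1 := hS (fun _ => 1) fun _ => by norm_num
  have h2 := hS (fun k => p k ^ 2 - q k ^ 2) fun k => by
    nlinarith [hpq k, mul_nonneg (sq_nonneg (p k)) (sq_nonneg (q k)), hp1 k, hq1 k]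
  have h3 := hS (fun k => 2 * p k * q k) fun k => by
    nlinarith [hpq k, sq_nonneg (p k ^ 2 - q k ^ 2)]
  have bound : ∀ θ : ℝ, |∫ z, F' (interpRadius α β θ z)
        * (2 * interp α θ z * interpDot α θ z + 2 * interp β θ z * interpDot β θ z)
        ∂(stdGauss (ι ⊕ ι))| ≤ 2600 * (A + B) / κ := by
    intro θ
    rw [integral_interp_derivative hF' hc hA hB α β θ, abs_mul]
    have hsc : |-2 * Real.sin θ * Real.cos θ| ≤ 1 := by
      rw [show -2 * Real.sin θ * Real.cos θ = -Real.sin (2 * θ) by rw [Real.sin_two_mul]; ring,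
        abs_neg]
      exact Real.abs_sin_le_one _
    refine (mul_le_of_le_one_left (abs_nonneg _) hsc).trans
      ((abs_integral_le_integral_abs).trans ?_)
    have gα := (polyGrowth_interp α θ).pow 4
    have gβ := (polyGrowth_interp β θ).pow 4
    have g1 := (polyGrowth_interp (fun _ : ι => (1 : ℝ)) 0).pow 2
    have g2 := (polyGrowth_interp (fun k => p k ^ 2 - q k ^ 2) 0).pow 2
    have g3 := (polyGrowth_interp (fun k => 2 * p k * q k) 0).pow 2
    have k1 := ((PolyGrowth.const κ).add (g1.const_mul κ⁻¹)).const_mul A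
    have k2 := (gα.add gβ).const_mul (6 * κ)
    have k3 := ((g1.add g2).add g3).const_mul κ⁻¹
    have hd := hasInterpDeriv_gradient (ι := ι) hF' hc hA hB α β θ
    have gl : PolyGrowth fun z : ι ⊕ ι → ℝ => ∑ k, (z (.inl k) ^ 2 - 1)
        * (2 * F' (interpRadius α β θ z) * (α k ^ 2 + β k ^ 2)
        + 4 * F'' (interpRadius α β θ z) * (interp α θ z * α k + interp β θ z * β k) ^ 2) :=
      PolyGrowth.sum fun k _ => (polyGrowth_hermiteSq k).mul (hd k).growth_deriv
    refine (integral_mono gl.abs.integrable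
      ((k1.add ((k2.add k3).const_mul B)).const_mul (κ ^ 2)⁻¹).integrable
      fun z => abs_sum_le_of_unit hpq hκ _ _ _ _ A B (hA _) (hB _) z).trans ?_
    rw [integral_const_mul, integral_add k1.integrable ((k2.add k3).const_mul B).integrable,
      integral_const_mul, integral_const_mul,
      integral_add (integrable_const _) (g1.const_mul κ⁻¹).integrable,
      integral_add k2.integrable k3.integrable, integral_const_mul, integral_const_mul,
      integral_const_mul, integral_add gα.integrable gβ.integrable,
      integral_add (g1.add g2).integrable g3.integrable, integral_add g1.integrable g2.integrable,
      integral_const, probReal_univ, one_smul]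
    have m1 := integral_interp_pow_four_le θ hα hN
    have m2 := integral_interp_pow_four_le θ hβ hN
    set I₁ := ∫ z, interp (fun _ : ι => (1 : ℝ)) 0 z ^ 2 ∂(stdGauss (ι ⊕ ι))
    set I₂ := ∫ z, interp (fun k => p k ^ 2 - q k ^ 2) 0 z ^ 2 ∂(stdGauss (ι ⊕ ι))
    set I₃ := ∫ z, interp (fun k => 2 * p k * q k) 0 z ^ 2 ∂(stdGauss (ι ⊕ ι))
    set J₁ := ∫ z, interp α θ z ^ 4 ∂(stdGauss (ι ⊕ ι))
    set J₂ := ∫ z, interp β θ z ^ 4 ∂(stdGauss (ι ⊕ ι))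
    have c1 : κ⁻¹ * I₁ ≤ 2 * κ := by
      rw [inv_mul_le_iff₀ hκ]; linarith
    have c2 : κ⁻¹ * (I₁ + I₂ + I₃) ≤ 6 * κ := by
      rw [inv_mul_le_iff₀ hκ]; linarith
    have c3 : 6 * κ * (J₁ + J₂) ≤ 2592 * κ := by nlinarith
    have c4 : A * (κ + κ⁻¹ * I₁) + B * (6 * κ * (J₁ + J₂) + κ⁻¹ * (I₁ + I₂ + I₃))
        ≤ 2600 * (A + B) * κ := by
      nlinarith [mul_le_mul_of_nonneg_left c1 hA0,
        mul_le_mul_of_nonneg_left (add_le_add c3 c2) hB0, mul_nonneg hA0 hκ.le,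
        mul_nonneg hB0 hκ.le]
    calc (κ ^ 2)⁻¹ * _ ≤ (κ ^ 2)⁻¹ * (2600 * (A + B) * κ) :=
          mul_le_mul_of_nonneg_left c4 (by positivity)
      _ = 2600 * (A + B) / κ := by field_simp
  have := Convex.norm_image_sub_le_of_norm_hasDerivWithin_le (s := Set.univ) (x := 0)
    (y := Real.pi / 2)
    (fun θ _ => (hasDerivAt_integral_interp hF hF' hA α β θ).hasDerivWithinAt)
    (fun θ _ => bound θ) convex_univ trivial trivial
  refine this.trans ?_
  have hpi : ‖Real.pi / 2 - 0‖ ≤ 2 := by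
    rw [sub_zero, Real.norm_eq_abs, abs_of_pos (by positivity)]
    linarith [Real.pi_le_four]
  calc 2600 * (A + B) / κ * ‖Real.pi / 2 - 0‖ ≤ 2600 * (A + B) / κ * 2 :=
        mul_le_mul_of_nonneg_left hpi (by positivity)
    _ = _ := by ring

end CentralLimit

/-! ### Smoothing of Lipschitz functions -/

/-- The average of a function over `[x, x + ε]`. -/
noncomputable def rightAverage (ε : ℝ) (h : ℝ → ℝ) (x : ℝ) : ℝ := ε⁻¹ * ∫ t in x..(x + ε), h t

theorem hasDerivAt_rightAverage {h : ℝ → ℝ} (hc : Continuous h) (ε x : ℝ) :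
    HasDerivAt (rightAverage ε h) (ε⁻¹ * (h (x + ε) - h x)) x := by
  have h1 : ∀ y, HasDerivAt (fun y => ∫ t in (0 : ℝ)..y, h t) (h y) y := fun y =>
    intervalIntegral.integral_hasDerivAt_right (hc.intervalIntegrable _ _)
      (hc.stronglyMeasurableAtFilter _ _) hc.continuousAt
  have h2 : rightAverage ε h
      = fun x => ε⁻¹ * ((∫ t in (0 : ℝ)..(x + ε), h t) - ∫ t in (0 : ℝ)..x, h t) := by
    funext y
    rw [rightAverage, intervalIntegral.integral_interval_sub_left (hc.intervalIntegrable _ _)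
      (hc.intervalIntegrable _ _)]
  rw [h2]
  exact (((h1 (x + ε)).comp_add_const x ε).sub (h1 x)).const_mul _

theorem abs_sub_le_of_lipschitz {h : ℝ → ℝ} (hh : LipschitzWith 1 h) (x y : ℝ) :
    |h x - h y| ≤ |x - y| := by
  have := hh.dist_le_mul x y
  simpa [Real.dist_eq] using this

theorem abs_deriv_rightAverage_le {h : ℝ → ℝ} (hh : LipschitzWith 1 h) {ε : ℝ} (hε : 0 < ε)
    (x : ℝ) : |ε⁻¹ * (h (x + ε) - h x)| ≤ 1 := by
  have := abs_sub_le_of_lipschitz hh (x + ε) x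
  rw [add_sub_cancel_left, abs_of_pos hε] at this
  rw [abs_mul, abs_of_pos (inv_pos.2 hε), inv_mul_le_iff₀ hε, mul_one]
  exact this

theorem lipschitzWith_rightAverage {h : ℝ → ℝ} (hh : LipschitzWith 1 h) {ε : ℝ} (hε : 0 < ε) :
    LipschitzWith 1 (rightAverage ε h) :=
  lipschitzWith_of_nnnorm_deriv_le
    (fun x => (hasDerivAt_rightAverage hh.continuous ε x).differentiableAt) fun x => by
      rw [(hasDerivAt_rightAverage hh.continuous ε x).deriv]
      exact abs_deriv_rightAverage_le hh hε x

theorem abs_rightAverage_sub_le {h : ℝ → ℝ} (hh : LipschitzWith 1 h) {ε : ℝ} (hε : 0 < ε) (x : ℝ) :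
    |rightAverage ε h x - h x| ≤ ε := by
  have h1 : rightAverage ε h x - h x = ε⁻¹ * ∫ t in x..(x + ε), (h t - h x) := by
    rw [intervalIntegral.integral_sub (hh.continuous.intervalIntegrable _ _)
      (continuous_const.intervalIntegrable _ _), intervalIntegral.integral_const, rightAverage]
    simp only [add_sub_cancel_left, smul_eq_mul]
    field_simp
  have h2 : ‖∫ t in x..(x + ε), (h t - h x)‖ ≤ ε * |x + ε - x| := by
    refine intervalIntegral.norm_integral_le_of_norm_le_const fun t ht => ?_
    rw [Set.uIoc_of_le (by linarith)] at ht
    refine (abs_sub_le_of_lipschitz hh t x).trans ?_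
    rw [abs_of_pos (by linarith [ht.1])]
    linarith [ht.2]
  rw [add_sub_cancel_left, abs_of_pos hε, Real.norm_eq_abs] at h2
  rw [h1, abs_mul, abs_of_pos (inv_pos.2 hε), inv_mul_le_iff₀ hε]
  exact h2

/-- Approximation of a Lipschitz function by functions with two bounded derivatives. -/
theorem exists_smoothing {h : ℝ → ℝ} (hh : LipschitzWith 1 h) {ε : ℝ} (hε : 0 < ε) :
    ∃ g g' g'' : ℝ → ℝ, (∀ x, HasDerivAt g (g' x) x) ∧ (∀ x, HasDerivAt g' (g'' x) x)
      ∧ Continuous g'' ∧ (∀ x, |g' x| ≤ 1) ∧ (∀ x, |g'' x| ≤ 2 / ε)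
      ∧ ∀ x, |g x - h x| ≤ 2 * ε := by
  have h1 := lipschitzWith_rightAverage hh hε
  have hd := hasDerivAt_rightAverage hh.continuous ε
  have hc := hh.continuous
  -- Each averaging moves a 1-Lipschitz function by at most ε and gains one derivative; two
  -- averagings give a second derivative bounded by 2/ε.
  refine ⟨rightAverage ε (rightAverage ε h), fun x => ε⁻¹ * (rightAverage ε h (x + ε)
    - rightAverage ε h x), fun x => ε⁻¹ * (ε⁻¹ * (h (x + ε + ε) - h (x + ε))
    - ε⁻¹ * (h (x + ε) - h x)), fun x => hasDerivAt_rightAverage h1.continuous ε x, fun x => ?_,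
    by fun_prop, abs_deriv_rightAverage_le h1 hε, fun x => ?_, fun x => ?_⟩
  · exact (((hd (x + ε)).comp_add_const x ε).sub (hd x)).const_mul _
  · rw [abs_mul, abs_of_pos (inv_pos.2 hε), inv_mul_le_iff₀ hε, mul_div_cancel₀ _ hε.ne']
    refine (abs_sub _ _).trans ?_
    linarith [abs_deriv_rightAverage_le hh hε (x + ε), abs_deriv_rightAverage_le hh hε x]
  · have e1 := abs_rightAverage_sub_le h1 hε x
    have e2 := abs_rightAverage_sub_le hh hε x
    have := abs_sub_le (rightAverage ε (rightAverage ε h) x) (rightAverage ε h x) (h x)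
    linarith

theorem integrable_lipschitz_comp {α : Type*} [MeasurableSpace α] {μ : Measure α}
    [IsProbabilityMeasure μ] {h : ℝ → ℝ} (hh : LipschitzWith 1 h) {X : α → ℝ}
    (hX : Integrable X μ) : Integrable (fun x => h (X x)) μ := by
  refine ((integrable_const |h 0|).add hX.abs).mono'
    (hh.continuous.comp_aestronglyMeasurable hX.1) (ae_of_all _ fun x => ?_)
  have h1 := abs_sub_le_of_lipschitz hh (X x) 0
  have h2 := abs_add_le (h 0) (h (X x) - h 0)
  rw [add_sub_cancel] at h2
  rw [sub_zero] at h1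
  simp only [Real.norm_eq_abs, Pi.add_apply]
  linarith

theorem abs_integral_lipschitz_sub_le {α : Type*} [MeasurableSpace α] {μ : Measure α}
    [IsProbabilityMeasure μ] {h : ℝ → ℝ} (hh : LipschitzWith 1 h) {X Y : α → ℝ}
    (hX : Integrable X μ) (hY : Integrable Y μ) :
    |(∫ x, h (X x) ∂μ) - ∫ x, h (Y x) ∂μ| ≤ ∫ x, |X x - Y x| ∂μ := by
  rw [← integral_sub (integrable_lipschitz_comp hh hX) (integrable_lipschitz_comp hh hY)]
  exact abs_integral_le_integral_abs.trans (integral_mono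
    ((integrable_lipschitz_comp hh hX).sub (integrable_lipschitz_comp hh hY)).abs
    (hX.sub hY).abs fun x => abs_sub_le_of_lipschitz hh _ _)

/-! ### The limiting laws -/

/-- The quadratic functional of two Gaussian variables that has law `limitLaw η`. -/
noncomputable def limitForm (η : ℝ) (x : ℝ × ℝ) : ℝ :=
  1 / (2 * √(1 + η ^ 2)) * (2 - (1 + η) * x.1 ^ 2 - (1 - η) * x.2 ^ 2)

theorem continuous_limitForm (η : ℝ) : Continuous (limitForm η) := by
  unfold limitForm; fun_prop

theorem integral_limitLaw {h : ℝ → ℝ} (hh : Continuous h) (η : ℝ) :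
    ∫ y, h y ∂(limitLaw η)
      = ∫ x, h (limitForm η x) ∂((gaussianReal 0 1).prod (gaussianReal 0 1)) := by
  rw [limitLaw]
  exact integral_map (continuous_limitForm η).aemeasurable hh.aestronglyMeasurable

/-- Exchanging the two Gaussian variables changes the sign of η, so the signed coefficient ρ may be
replaced by its modulus. -/
theorem integral_limitLaw_neg {h : ℝ → ℝ} (hh : Continuous h) (η : ℝ) :
    ∫ y, h y ∂(limitLaw (-η)) = ∫ y, h y ∂(limitLaw η) := by
  rw [integral_limitLaw hh, integral_limitLaw hh, ← integral_prod_swap]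
  refine integral_congr_ae (ae_of_all _ fun x => ?_)
  simp only [limitForm, Prod.fst_swap, Prod.snd_swap, neg_sq]
  congr 1
  ring

theorem integral_limitLaw_abs {h : ℝ → ℝ} (hh : Continuous h) (η : ℝ) :
    ∫ y, h y ∂(limitLaw |η|) = ∫ y, h y ∂(limitLaw η) := by
  rcases abs_choice η with h1 | h1 <;> rw [h1]
  exact integral_limitLaw_neg hh η

theorem integrable_sq_fst_snd :
    Integrable (fun x : ℝ × ℝ => x.1 ^ 2) ((gaussianReal 0 1).prod (gaussianReal 0 1)) ∧
    Integrable (fun x : ℝ × ℝ => x.2 ^ 2) ((gaussianReal 0 1).prod (gaussianReal 0 1)) :=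
  ⟨(integrable_pow_gaussianReal 2 1).comp_fst _, (integrable_pow_gaussianReal 2 1).comp_snd _⟩

theorem integral_sq_fst_snd :
    ∫ x : ℝ × ℝ, x.1 ^ 2 ∂((gaussianReal 0 1).prod (gaussianReal 0 1)) = 1 ∧
    ∫ x : ℝ × ℝ, x.2 ^ 2 ∂((gaussianReal 0 1).prod (gaussianReal 0 1)) = 1 := by
  constructor
  · rw [integral_fun_fst (fun x : ℝ => x ^ 2), gaussian_moment_two]; simp
  · rw [integral_fun_snd (fun x : ℝ => x ^ 2), gaussian_moment_two]; simp

theorem integrable_limitForm (η : ℝ) :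
    Integrable (limitForm η) ((gaussianReal 0 1).prod (gaussianReal 0 1)) :=
  ((integrable_fun_sub (integrable_fun_sub (integrable_const 2)
    (integrable_sq_fst_snd.1.const_mul _)) (integrable_sq_fst_snd.2.const_mul _)).const_mul _)

theorem abs_limitForm_sub_le {r η : ℝ} (hr : r ∈ Set.Icc (0 : ℝ) 1) (hη : η ∈ Set.Icc (0 : ℝ) 1)
    (x : ℝ × ℝ) :
    |limitForm r x - limitForm η x| ≤ |r - η| * (2 + 3 * x.1 ^ 2 + 3 * x.2 ^ 2) := by
  set s := √(1 + r ^ 2) with hs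
  set t := √(1 + η ^ 2) with ht
  have hs2 : s ^ 2 = 1 + r ^ 2 := Real.sq_sqrt (by positivity)
  have ht2 : t ^ 2 = 1 + η ^ 2 := Real.sq_sqrt (by positivity)
  have hs1 : 1 ≤ s := Real.one_le_sqrt.2 (by nlinarith [sq_nonneg r])
  have ht1 : 1 ≤ t := Real.one_le_sqrt.2 (by nlinarith [sq_nonneg η])
  have hd : |t - s| ≤ |r - η| := by
    have h1 : (t - s) * (s + t) = -((r - η) * (r + η)) := by linear_combination ht2 - hs2
    have h2 : |t - s| * (s + t) = |r - η| * (r + η) := by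
      rw [← abs_of_nonneg (by positivity : 0 ≤ s + t), ← abs_mul, h1, abs_neg, abs_mul,
        abs_of_nonneg (add_nonneg hr.1 hη.1)]
    have h3 : r + η ≤ s + t := by linarith [hr.2, hη.2]
    refine le_of_mul_le_mul_right (h2.trans_le ?_) (by positivity : 0 < s + t)
    exact mul_le_mul_of_nonneg_left h3 (abs_nonneg _)
  have hc : |1 / (2 * s) - 1 / (2 * t)| ≤ |r - η| := by
    have : 1 / (2 * s) - 1 / (2 * t) = (t - s) * (2 * s * t)⁻¹ := by field_simp
    rw [this, abs_mul, abs_of_pos (by positivity : 0 < (2 * s * t)⁻¹)]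
    refine (mul_le_of_le_one_right (abs_nonneg _) (inv_le_one_of_one_le₀ ?_)).trans hd
    nlinarith
  have ht0 : |1 / (2 * t)| ≤ 1 := by
    rw [abs_of_pos (by positivity), div_le_one (by positivity)]; linarith
  have e : limitForm r x - limitForm η x
      = (1 / (2 * s) - 1 / (2 * t)) * (2 - (1 + r) * x.1 ^ 2 - (1 - r) * x.2 ^ 2)
        + (r - η) * (1 / (2 * t) * (x.2 ^ 2 - x.1 ^ 2)) := by
    simp only [limitForm, ← hs, ← ht]; ring
  have b1 : |2 - (1 + r) * x.1 ^ 2 - (1 - r) * x.2 ^ 2| ≤ 2 + 2 * x.1 ^ 2 + 2 * x.2 ^ 2 := by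
    have := hr.1
    have := hr.2
    rw [abs_le]
    constructor <;> nlinarith [sq_nonneg x.1, sq_nonneg x.2, mul_nonneg hr.1 (sq_nonneg x.1),
      mul_nonneg hr.1 (sq_nonneg x.2), mul_nonneg (sub_nonneg.2 hr.2) (sq_nonneg x.1),
      mul_nonneg (sub_nonneg.2 hr.2) (sq_nonneg x.2)]
  have b2 : |x.2 ^ 2 - x.1 ^ 2| ≤ x.1 ^ 2 + x.2 ^ 2 := by
    rw [abs_le]
    constructor <;> nlinarith [sq_nonneg x.1, sq_nonneg x.2]
  rw [e]
  refine (abs_add_le _ _).trans ?_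
  rw [abs_mul, abs_mul, abs_mul]
  calc _ ≤ |r - η| * (2 + 2 * x.1 ^ 2 + 2 * x.2 ^ 2) + |r - η| * (1 * (x.1 ^ 2 + x.2 ^ 2)) :=
        add_le_add (mul_le_mul hc b1 (abs_nonneg _) (abs_nonneg _))
          (mul_le_mul_of_nonneg_left (mul_le_mul ht0 b2 (abs_nonneg _) zero_le_one) (abs_nonneg _))
    _ = _ := by ring

/-- Both laws are realised on the same pair of Gaussians; the constant is the expectation of 2 +
3X₁² + 3X₂². -/
theorem abs_integral_limitLaw_sub_le {h : ℝ → ℝ} (hh : LipschitzWith 1 h) {r η : ℝ}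
    (hr : r ∈ Set.Icc (0 : ℝ) 1) (hη : η ∈ Set.Icc (0 : ℝ) 1) :
    |(∫ y, h y ∂(limitLaw r)) - ∫ y, h y ∂(limitLaw η)| ≤ 8 * |r - η| := by
  rw [integral_limitLaw hh.continuous, integral_limitLaw hh.continuous]
  refine (abs_integral_lipschitz_sub_le hh (integrable_limitForm r) (integrable_limitForm η)).trans ?_
  obtain ⟨i1, i2⟩ := integrable_sq_fst_snd
  have i3 := ((integrable_const (μ := (gaussianReal 0 1).prod (gaussianReal 0 1)) (2 : ℝ)).fun_add
    (i1.const_mul 3))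
  refine (integral_mono ((integrable_limitForm r).sub (integrable_limitForm η)).abs
    ((i3.fun_add (i2.const_mul 3)).const_mul |r - η|)
    fun x => abs_limitForm_sub_le hr hη x).trans_eq ?_
  rw [integral_const_mul, integral_add i3 (i2.const_mul 3),
    integral_add (integrable_const _) (i1.const_mul 3), integral_const_mul, integral_const_mul,
    integral_sq_fst_snd.1, integral_sq_fst_snd.2, integral_const, probReal_univ]
  simp only [smul_eq_mul]
  ring

/-! ### The Gaussian end of the interpolation -/

section Endpoint

variable {ι : Type*} [Fintype ι] [DecidableEq ι]

theorem measurePreserving_inl :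
    MeasurePreserving (fun (z : ι ⊕ ι → ℝ) (k : ι) => z (.inl k)) (stdGauss (ι ⊕ ι))
      (stdGauss ι) := by
  have hm : Measurable fun (z : ι ⊕ ι → ℝ) (k : ι) => z (.inl k) := by fun_prop
  refine ⟨hm, (Measure.pi_eq fun s hs => ?_).symm⟩
  rw [Measure.map_apply hm (MeasurableSet.univ_pi hs)]
  have h : (fun (z : ι ⊕ ι → ℝ) (k : ι) => z (.inl k)) ⁻¹' Set.univ.pi s
      = Set.univ.pi (Sum.elim s fun _ => Set.univ) := by
    ext z
    simp [Set.mem_pi]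
  rw [h, Measure.pi_pi, Fintype.prod_sum_type]
  simp

theorem hasGaussianLaw_id_stdGauss (κ : Type*) [Fintype κ] :
    HasGaussianLaw (fun z : κ → ℝ => z) (stdGauss κ) := by
  have h : ∀ k : κ, HasLaw (fun z : κ → ℝ => z k) (gaussianReal 0 1) (stdGauss κ) := fun k =>
    (measurePreserving_eval (fun _ : κ => gaussianReal 0 1) k).hasLaw
  exact iIndepFun.hasGaussianLaw (fun k => (h k).hasGaussianLaw)
    ((iIndepFun_iff_hasLaw_pi_pi h).2 HasLaw.id)

theorem interp_pi_div_two (α : ι → ℝ) (z : ι ⊕ ι → ℝ) :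
    interp α (Real.pi / 2) z = ∑ k, α k * (√2 * z (.inr k)) := by
  simp [interp]

theorem integral_interp_mul_interp (α β : ι → ℝ) (θ : ℝ) :
    ∫ z, interp α θ z * interp β θ z ∂(stdGauss (ι ⊕ ι)) = 2 * ∑ k, α k * β k := by
  rw [integral_interp_mul α θ (hasInterpDeriv_interp β θ) (polyGrowth_interp β θ), Finset.mul_sum]
  refine Finset.sum_congr rfl fun k _ => ?_
  have h2 := integral_coord_sq (Sum.inl k : ι ⊕ ι)
  have e : ∀ z : ι ⊕ ι → ℝ, 2 * (Real.cos θ ^ 2 * z (.inl k) ^ 2 + Real.sin θ ^ 2) * β k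
      = 2 * Real.cos θ ^ 2 * β k * z (.inl k) ^ 2 + 2 * Real.sin θ ^ 2 * β k := fun z => by ring
  simp_rw [e]
  rw [integral_add ((integrable_coord_pow _ 2).const_mul _) (integrable_const _),
    integral_const_mul, h2, integral_const, probReal_univ, one_smul]
  linear_combination 2 * α k * β k * Real.cos_sq_add_sin_sq θ

theorem integral_interp_eq_zero (α : ι → ℝ) (θ : ℝ) :
    ∫ z, interp α θ z ∂(stdGauss (ι ⊕ ι)) = 0 := by
  have h := integral_interp_mul α θ (Φ := fun _ => 1) (H := fun _ _ => 0)
    (fun k => ⟨PolyGrowth.const _, PolyGrowth.const _,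
      fun z t => by simpa using hasDerivAt_const t (1 : ℝ),
      fun z t => by simpa using hasDerivAt_const t (1 : ℝ)⟩) (PolyGrowth.const _)
  simpa using h

/-- At the end of the interpolation two orthogonal directions give independent Gaussian
variables. -/
theorem hasLaw_interp_pair {α β : ι → ℝ} {v w : ℝ≥0} (hα : 2 * ∑ k, α k ^ 2 = v)
    (hβ : 2 * ∑ k, β k ^ 2 = w) (hαβ : ∑ k, α k * β k = 0) :
    HasLaw (fun z => (interp α (Real.pi / 2) z, interp β (Real.pi / 2) z))
      ((gaussianReal 0 v).prod (gaussianReal 0 w)) (stdGauss (ι ⊕ ι)) := by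
  have hz := hasGaussianLaw_id_stdGauss (ι ⊕ ι)
  let L : (ι → ℝ) → ((ι ⊕ ι → ℝ) →L[ℝ] ℝ) := fun α =>
    ∑ k, (α k * √2) • ContinuousLinearMap.proj (R := ℝ) (φ := fun _ : ι ⊕ ι => ℝ) (.inr k)
  have hL : ∀ α z, L α z = interp α (Real.pi / 2) z := fun α z => by
    rw [interp_pi_div_two]
    simp [L, mul_assoc]
  have h1 := hz.map_fun ((L α).prod (L β))
  simp only [ContinuousLinearMap.prod_apply, hL] at h1
  have hl : ∀ {α : ι → ℝ} {v : ℝ≥0}, 2 * ∑ k, α k ^ 2 = v →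
      HasLaw (interp α (Real.pi / 2)) (gaussianReal 0 v) (stdGauss (ι ⊕ ι)) := by
    intro α v hα
    have h2 := hz.map_fun (L α)
    simp only [hL] at h2
    have hm := (polyGrowth_interp α (Real.pi / 2)).memLp_two
    have h3 : Var[interp α (Real.pi / 2); stdGauss (ι ⊕ ι)] = v := by
      rw [variance_eq_sub hm, integral_interp_eq_zero]
      simp only [Pi.pow_apply]
      rw [integral_interp_sq, hα]; simp
    have h4 := h2.map_eq_gaussianReal
    refine ⟨h2.aemeasurable, ?_⟩
    rw [h4, integral_interp_eq_zero, h3]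
    simp
  have hind : IndepFun (interp α (Real.pi / 2)) (interp β (Real.pi / 2)) (stdGauss (ι ⊕ ι)) := by
    refine h1.indepFun_of_covariance_eq_zero ?_
    rw [covariance_eq_sub (polyGrowth_interp α _).memLp_two (polyGrowth_interp β _).memLp_two]
    simp only [Pi.mul_apply]
    rw [integral_interp_mul_interp, hαβ, integral_interp_eq_zero]
    simp
  exact hind.hasLaw_prod (hl hα) (hl hβ)

theorem integral_comp_interpRadius_end {α β : ι → ℝ} {v w : ℝ} (hv : 0 ≤ v) (hw : 0 ≤ w)
    (hα : 2 * ∑ k, α k ^ 2 = v) (hβ : 2 * ∑ k, β k ^ 2 = w) (hαβ : ∑ k, α k * β k = 0)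
    {F : ℝ → ℝ} (hF : Continuous F) :
    ∫ z, F (interpRadius α β (Real.pi / 2) z) ∂(stdGauss (ι ⊕ ι))
      = ∫ x, F (v * x.1 ^ 2 + w * x.2 ^ 2) ∂((gaussianReal 0 1).prod (gaussianReal 0 1)) := by
  lift v to ℝ≥0 using hv
  lift w to ℝ≥0 using hw
  have h := (hasLaw_interp_pair hα hβ hαβ).integral_comp
    (f := fun x : ℝ × ℝ => F (x.1 ^ 2 + x.2 ^ 2)) (by fun_prop)
  have e : (gaussianReal 0 v).prod (gaussianReal 0 w)
      = ((gaussianReal 0 1).prod (gaussianReal 0 1)).map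
        (Prod.map (fun x => √(v : ℝ) * x) fun x => √(w : ℝ) * x) := by
    rw [gaussianReal_eq_map_sqrt v, gaussianReal_eq_map_sqrt w]
    exact Measure.map_prod_map _ _ (by fun_prop) (by fun_prop)
  simp only [Function.comp_def] at h
  refine h.trans ?_
  rw [e, integral_map (by fun_prop) (by fun_prop)]
  refine integral_congr_ae (ae_of_all _ fun x => ?_)
  simp only [Prod.map_fst, Prod.map_snd, mul_pow, Real.sq_sqrt v.coe_nonneg,
    Real.sq_sqrt w.coe_nonneg]

end Endpoint

/-! ### The rate of convergence of the normalised fourth chaos -/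

section Rate

variable {Ω : Type*} [MeasurableSpace Ω] {P : Measure Ω} [IsProbabilityMeasure P]
  {a : ℤ × ℤ → Ω → ℂ}

theorem hasLaw_stdField (ha : IsWaveCoefficients a P) {n : ℕ} (hn : 0 < n) :
    HasLaw (fun ω (k : freq n) => stdField ha k ω) (stdGauss (freq n)) P :=
  hasLaw_pi_of_orthonormal ha (fun k => stdField_mem ha k) (orthonormal_stdField ha hn)

theorem integrable_comp_stdField (ha : IsWaveCoefficients a P) {n : ℕ} (hn : 0 < n)
    {G : (freq n → ℝ) → ℝ} (hG : PolyGrowth G) :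
    Integrable (fun ω => G fun k => stdField ha k ω) P := by
  have hl := hasLaw_stdField ha hn
  have := hG.integrable
  rw [← hl.map_eq] at this
  exact this.comp_aemeasurable hl.aemeasurable

theorem integral_comp_stdField (ha : IsWaveCoefficients a P) {n : ℕ} (hn : 0 < n)
    {G : (freq n → ℝ) → ℝ} (hG : Continuous G) :
    ∫ ω, G (fun k => stdField ha k ω) ∂P
      = ∫ z, G (fun k => z (.inl k)) ∂(stdGauss (freq n ⊕ freq n)) := by
  have hp := measurePreserving_inl (ι := freq n)
  refine ((hasLaw_stdField ha hn).integral_comp (f := G) hG.aestronglyMeasurable).trans ?_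
  conv_lhs => rw [← hp.map_eq]
  exact integral_map hp.aemeasurable hG.aestronglyMeasurable

/-- The centred sum of squared moduli with a weight. -/
noncomputable def fieldSum (ha : IsWaveCoefficients a P) (n : ℕ) (b : ℤ × ℤ → ℝ) (ω : Ω) : ℝ :=
  ∑ l ∈ freq n, b l * (stdField ha l ω ^ 2 - 1)

theorem interp_zero_field (ha : IsWaveCoefficients a P) (n : ℕ) (b : ℤ × ℤ → ℝ) (ω : Ω) :
    ∑ k : freq n, b k * (stdField ha k ω ^ 2 - 1) = fieldSum ha n b ω :=
  Finset.sum_coe_sort (freq n) fun l => b l * (stdField ha l ω ^ 2 - 1)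

theorem polyGrowth_weightedSum {κ : Type*} [Fintype κ] (b : κ → ℝ) :
    PolyGrowth fun x : κ → ℝ => ∑ k, b k * (x k ^ 2 - 1) :=
  PolyGrowth.sum fun k _ => (((PolyGrowth.coord k).pow 2).sub (PolyGrowth.const 1)).const_mul _

theorem integrable_fieldSum_sq (ha : IsWaveCoefficients a P) {n : ℕ} (hn : 0 < n)
    (b : ℤ × ℤ → ℝ) : Integrable (fun ω => fieldSum ha n b ω ^ 2) P := by
  have := integrable_comp_stdField ha hn ((polyGrowth_weightedSum fun k : freq n => b k).pow 2)
  simpa only [interp_zero_field] using this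

theorem integral_fieldSum_sq (ha : IsWaveCoefficients a P) {n : ℕ} (hn : 0 < n)
    (b : ℤ × ℤ → ℝ) : ∫ ω, fieldSum ha n b ω ^ 2 ∂P = 2 * ∑ l ∈ freq n, b l ^ 2 := by
  have h := integral_comp_stdField ha hn ((polyGrowth_weightedSum fun k : freq n => b k).pow 2).1
  simp only [interp_zero_field] at h
  rw [h, ← Finset.sum_coe_sort (freq n) fun l => b l ^ 2, ← integral_interp_sq _ 0]
  simp only [interp_zero]

/-- The squared norm of the normalised planar vector. -/
noncomputable def fieldRadius (ha : IsWaveCoefficients a P) (n : ℕ) (ω : Ω) : ℝ :=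
  (freqCard n : ℝ)⁻¹ * (fieldSum ha n (cosTwo n) ω ^ 2 + fieldSum ha n (sinTwo n) ω ^ 2)

/-- The deviation of the sum of fourth powers of moduli from its mean. -/
noncomputable def quarticDefect (ha : IsWaveCoefficients a P) (n : ℕ) (ω : Ω) : ℝ :=
  ∑ l ∈ freq n, (((stdField ha l ω ^ 2 + stdField ha (-l) ω ^ 2) / 2) ^ 2 - 2)

/-- By the addition formula the kernel cos 2(φ - ψ) is a sum of two products, so the double sum is
the squared length of a planar vector. -/
theorem chaosVar_eq_radius (ha : IsWaveCoefficients a P) {n : ℕ} (hn : n ∈ sumTwoSquares) (ω : Ω) :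
    chaosVar ha n ω = quarticDefect ha n ω + freqCard n * (2 - fieldRadius ha n ω) := by
  have hN : (freqCard n : ℝ) ≠ 0 := by exact_mod_cast (freqCard_pos hn).ne'
  have e : ∑ l ∈ freq n, ∑ m ∈ freq n, cosDouble n l m
      * ((stdField ha l ω ^ 2 - 1) * (stdField ha m ω ^ 2 - 1))
      = fieldSum ha n (cosTwo n) ω ^ 2 + fieldSum ha n (sinTwo n) ω ^ 2 := by
    rw [pow_two, pow_two, fieldSum, fieldSum, Finset.sum_mul_sum, Finset.sum_mul_sum,
      ← Finset.sum_add_distrib]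
    refine Finset.sum_congr rfl fun l hl => ?_
    rw [← Finset.sum_add_distrib]
    refine Finset.sum_congr rfl fun m hm => ?_
    rw [cosDouble_eq hn.1 hl hm]; ring
  rw [chaosVar, chaosPoly, e, quarticDefect, Finset.sum_sub_distrib, Finset.sum_const,
    nsmul_eq_mul, fieldRadius, mul_sub, ← mul_assoc, mul_inv_cancel₀ hN, freqCard]
  ring

/-- Weights of the fourth chaos component of `quarticDefect`. -/
noncomputable def defectWeight (l m : ℤ × ℤ) : ℝ :=
  (if l = m then 1 / 2 else 0) + if m = -l then 1 / 2 else 0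

theorem defectWeight_comm (l m : ℤ × ℤ) : defectWeight l m = defectWeight m l := by
  have h : (m = -l) = (l = -m) := propext ⟨fun h => by rw [h, neg_neg], fun h => by rw [h, neg_neg]⟩
  simp only [defectWeight, h, eq_comm (a := l) (b := m)]

/-- Chaos decomposition of the centred sum of fourth powers of moduli: a fourth-chaos part supported
on m = ±l, and four times a second-chaos sum. Both have variance of order N only. -/
theorem quarticDefect_eq (ha : IsWaveCoefficients a P) {n : ℕ} (hn : 0 < n) (ω : Ω) :
    quarticDefect ha n ω = wickSum ha n defectWeight ω + 4 * fieldSum ha n (fun _ => 1) ω := by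
  have h : ∀ l ∈ freq n, ∑ m ∈ freq n, defectWeight l m * wickPair ha l m ω
      = 1 / 2 * stdField ha l ω ^ 4 + 1 / 2 * (stdField ha l ω ^ 2 * stdField ha (-l) ω ^ 2)
        - 7 / 2 * stdField ha l ω ^ 2 - 1 / 2 * stdField ha (-l) ω ^ 2 + 2 := by
    intro l hl
    have hl0 := freq_ne_zero hn l hl
    have e : ∀ m ∈ freq n, defectWeight l m * wickPair ha l m ω
        = (if l = m then 1 / 2 * wick4 (stdField ha m ω) 1 else 0)
          + (if m = -l then 1 / 2 else 0)
            * ((stdField ha l ω ^ 2 - 1) * (stdField ha m ω ^ 2 - 1)) := by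
      intro m _
      by_cases h1 : l = m
      · subst h1
        simp only [defectWeight, wickPair, if_true, if_neg (ne_neg_self hl0)]
        ring
      · simp only [defectWeight, wickPair, if_neg h1]
        ring
    rw [Finset.sum_congr rfl e, Finset.sum_add_distrib, Finset.sum_ite_eq, if_pos hl,
      sum_freq_ite_neg hl fun m => (stdField ha l ω ^ 2 - 1) * (stdField ha m ω ^ 2 - 1)]
    simp only [wick4]
    ring
  have h4 := sum_freq_neg n fun l => stdField ha l ω ^ 4
  have h2 := sum_freq_neg n fun l => stdField ha l ω ^ 2
  have e1 : quarticDefect ha n ω = ∑ l ∈ freq n, (1 / 4 * stdField ha l ω ^ 4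
      + 1 / 4 * stdField ha (-l) ω ^ 4
      + 1 / 2 * (stdField ha l ω ^ 2 * stdField ha (-l) ω ^ 2) - 2) :=
    Finset.sum_congr rfl fun l _ => by ring
  rw [e1, wickSum, Finset.sum_congr rfl h, fieldSum]
  simp only [Finset.sum_add_distrib, Finset.sum_sub_distrib, ← Finset.mul_sum, h2, h4,
    Finset.sum_const, one_mul, nsmul_eq_mul]
  ring

theorem integral_wickSum_defectWeight_sq (ha : IsWaveCoefficients a P) {n : ℕ} (hn : 0 < n) :
    ∫ ω, wickSum ha n defectWeight ω ^ 2 ∂P = 8 * freqCard n := by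
  rw [integral_wickSum_sq ha hn defectWeight_comm]
  have h : ∀ l ∈ freq n, ∑ m ∈ freq n, (if l = m then 24 else 8) * defectWeight l m ^ 2
      = (8 : ℝ) := by
    intro l hl
    have hl0 := freq_ne_zero hn l hl
    have e : ∀ m ∈ freq n, (if l = m then 24 else 8) * defectWeight l m ^ 2
        = (if l = m then (6 : ℝ) else 0) + (if m = -l then 1 / 2 else 0) * 4 := by
      intro m _
      by_cases h1 : l = m
      · subst h1
        simp only [defectWeight, if_true, if_neg (ne_neg_self hl0)]
        norm_num
      · simp only [defectWeight, if_neg h1]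
        split_ifs <;> norm_num
    rw [Finset.sum_congr rfl e, Finset.sum_add_distrib, Finset.sum_ite_eq, if_pos hl,
      sum_freq_ite_neg hl fun _ => (4 : ℝ)]
    norm_num
  rw [Finset.sum_congr rfl h, Finset.sum_const, nsmul_eq_mul, freqCard]
  ring

theorem abs_le_young {x κ : ℝ} (hκ : 0 < κ) : |x| ≤ 1 / 2 * (κ + κ⁻¹ * x ^ 2) := by
  have h1 : 1 / 2 * (κ + κ⁻¹ * x ^ 2) - |x| = 1 / 2 * (κ⁻¹ * (κ - |x|) ^ 2) := by
    rw [← sq_abs x]; field_simp; ring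
  have h2 : 0 ≤ κ⁻¹ * (κ - |x|) ^ 2 := by positivity
  linarith

theorem integrable_fieldSum (ha : IsWaveCoefficients a P) {n : ℕ} (hn : 0 < n)
    (b : ℤ × ℤ → ℝ) : Integrable (fieldSum ha n b) P := by
  have := integrable_comp_stdField ha hn (polyGrowth_weightedSum fun k : freq n => b k)
  simpa only [interp_zero_field] using this

theorem integrable_quarticDefect (ha : IsWaveCoefficients a P) {n : ℕ} (hn : 0 < n) :
    Integrable (quarticDefect ha n) P := by
  have := ((memLp_wickSum ha n defectWeight).integrable one_le_two).fun_add
    ((integrable_fieldSum ha hn fun _ => 1).const_mul 4)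
  exact this.congr (ae_of_all _ fun ω => (quarticDefect_eq ha hn ω).symm)

/-- The two chaos parts have second moments 8N and 16 · 2N. Young's inequality with weight √N, in
place of Cauchy-Schwarz, gives (1 + 80)/2 ≤ 41. -/
theorem integral_abs_quarticDefect_le (ha : IsWaveCoefficients a P) {n : ℕ}
    (hn : n ∈ sumTwoSquares) :
    ∫ ω, |quarticDefect ha n ω| ∂P ≤ 41 * √(freqCard n : ℝ) := by
  have hN : (0 : ℝ) < freqCard n := by exact_mod_cast freqCard_pos hn
  set κ := √(freqCard n : ℝ)
  have hκ : 0 < κ := Real.sqrt_pos.2 hN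
  have hκ2 : κ ^ 2 = freqCard n := Real.sq_sqrt hN.le
  have i1 := ((memLp_wickSum ha n defectWeight).integrable_sq).const_mul 2
  have i2 := (integrable_fieldSum_sq ha hn.1 fun _ => 1).const_mul 32
  have hle : ∀ ω, |quarticDefect ha n ω| ≤ 1 / 2 * (κ + κ⁻¹ * (2 * wickSum ha n defectWeight ω ^ 2
      + 32 * fieldSum ha n (fun _ => 1) ω ^ 2)) := by
    intro ω
    refine (abs_le_young hκ).trans (mul_le_mul_of_nonneg_left (add_le_add le_rfl
      (mul_le_mul_of_nonneg_left ?_ (inv_nonneg.2 hκ.le))) (by norm_num))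
    rw [quarticDefect_eq ha hn.1]
    nlinarith [sq_nonneg (wickSum ha n defectWeight ω - 4 * fieldSum ha n (fun _ => 1) ω)]
  refine (integral_mono (integrable_quarticDefect ha hn.1).abs
    (((integrable_const κ).fun_add ((i1.fun_add i2).const_mul κ⁻¹)).const_mul (1 / 2)) hle).trans ?_
  rw [integral_const_mul, integral_add (integrable_const κ) ((i1.fun_add i2).const_mul κ⁻¹),
    integral_const_mul, integral_add i1 i2, integral_const_mul, integral_const_mul,
    integral_wickSum_defectWeight_sq ha hn.1, integral_fieldSum_sq ha hn.1, integral_const,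
    probReal_univ, one_smul]
  have e : ∑ l ∈ freq n, (1 : ℝ) ^ 2 = κ ^ 2 := by rw [hκ2]; simp [freqCard]
  rw [e, ← hκ2]
  have : κ⁻¹ * (2 * (8 * κ ^ 2) + 32 * (2 * κ ^ 2)) = 80 * κ := by field_simp; ring
  rw [this]
  linarith

/-- The normalising constant of the limiting law. -/
noncomputable def limitScale (ρ : ℝ) : ℝ := 1 / (2 * √(1 + ρ ^ 2))

theorem limitScale_pos (ρ : ℝ) : 0 < limitScale ρ := by unfold limitScale; positivity

theorem limitScale_le (ρ : ℝ) : limitScale ρ ≤ 1 / 2 := by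
  have : 1 ≤ √(1 + ρ ^ 2) := Real.one_le_sqrt.2 (by nlinarith [sq_nonneg ρ])
  rw [limitScale, div_le_div_iff₀ (by positivity) (by norm_num)]
  linarith

/-- The exact and the limiting normalisations have ratio t with t² = 1 - 2/(N(1+ρ²)), and 1 - t ≤ 1
- t² for t in [0, 1]. -/
theorem abs_one_sub_limitScale_le {n : ℕ} (hn : n ∈ sumTwoSquares) :
    |1 - limitScale (anisotropy n) * √(chaosVariance n) / freqCard n| ≤ 2 / freqCard n := by
  have hN : (0 : ℝ) < freqCard n := by exact_mod_cast freqCard_pos hn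
  have hV := chaosVariance_pos hn
  set N : ℝ := (freqCard n : ℝ)
  set ρ := anisotropy n
  set t := limitScale ρ * √(chaosVariance n) / N with ht
  have ht0 : 0 ≤ t := by have := limitScale_pos ρ; positivity
  have hρ : 0 < 1 + ρ ^ 2 := by positivity
  have ht2 : t ^ 2 = 1 - 2 / (N * (1 + ρ ^ 2)) := by
    rw [ht, div_pow, mul_pow, Real.sq_sqrt hV.le, limitScale, div_pow, mul_pow,
      Real.sq_sqrt hρ.le]
    rw [show chaosVariance n = 4 * N ^ 2 * (1 + ρ ^ 2) - 8 * N from rfl]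
    field_simp
    ring
  have hδ : 2 / (N * (1 + ρ ^ 2)) ≤ 2 / N := by
    refine div_le_div_of_nonneg_left (by norm_num) hN ?_
    nlinarith [sq_nonneg ρ]
  have hδ0 : 0 ≤ 2 / (N * (1 + ρ ^ 2)) := by positivity
  have ht1 : t ≤ 1 := by nlinarith
  rw [abs_of_nonneg (by linarith)]
  nlinarith

theorem integrable_fieldRadius (ha : IsWaveCoefficients a P) {n : ℕ} (hn : 0 < n) :
    Integrable (fieldRadius ha n) P :=
  ((integrable_fieldSum_sq ha hn _).add (integrable_fieldSum_sq ha hn _)).const_mul _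

/-- The error splits into the mismatch of normalisations times the chaos variable, whose L¹ norm is
at most its standard deviation, and the quartic defect divided by N; here 41/2 ≤ 21. -/
theorem integral_abs_sub_radius_le (ha : IsWaveCoefficients a P) {n : ℕ}
    (hn : n ∈ sumTwoSquares) :
    ∫ ω, |chaosVar ha n ω / √(chaosVariance n)
        - limitScale (anisotropy n) * (2 - fieldRadius ha n ω)| ∂P
      ≤ 2 / freqCard n + 21 / √(freqCard n : ℝ) := by
  have hN : (0 : ℝ) < freqCard n := by exact_mod_cast freqCard_pos hn
  have hV := chaosVariance_pos hn
  have hc0 := limitScale_pos (anisotropy n)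
  have hc1 := limitScale_le (anisotropy n)
  have hδ := abs_one_sub_limitScale_le hn
  set c := limitScale (anisotropy n)
  set σ := √(chaosVariance n) with hσd
  have hσ : 0 < σ := Real.sqrt_pos.2 hV
  have hσ2 : σ ^ 2 = chaosVariance n := Real.sq_sqrt hV.le
  set N : ℝ := (freqCard n : ℝ)
  set κ := √N
  have hκ : 0 < κ := Real.sqrt_pos.2 hN
  have hκ2 : κ ^ 2 = N := Real.sq_sqrt hN.le
  have hm := memLp_chaosVar ha hn.1
  have iq := hm.integrable one_le_two
  have id := integrable_quarticDefect ha hn.1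
  have e : ∀ ω, chaosVar ha n ω / σ - c * (2 - fieldRadius ha n ω)
      = σ⁻¹ * (1 - c * σ / N) * chaosVar ha n ω + c / N * quarticDefect ha n ω := by
    intro ω
    have h := chaosVar_eq_radius ha hn ω
    have h2 : 2 - fieldRadius ha n ω = (chaosVar ha n ω - quarticDefect ha n ω) / N := by
      rw [h]; field_simp; ring
    rw [h2]; field_simp; ring
  have hle : ∀ ω, |chaosVar ha n ω / σ - c * (2 - fieldRadius ha n ω)|
      ≤ σ⁻¹ * (2 / N) * |chaosVar ha n ω| + c / N * |quarticDefect ha n ω| := by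
    intro ω
    rw [e]
    refine (abs_add_le _ _).trans (add_le_add ?_ ?_)
    · rw [abs_mul, abs_mul, abs_of_pos (inv_pos.2 hσ)]
      gcongr
    · rw [abs_mul, abs_of_pos (by positivity : 0 < c / N)]
  have hq : ∫ ω, |chaosVar ha n ω| ∂P ≤ σ := by
    refine (integral_mono iq.abs (((integrable_const σ).fun_add
      (hm.integrable_sq.const_mul σ⁻¹)).const_mul (1 / 2)) fun ω => abs_le_young hσ).trans ?_
    rw [integral_const_mul, integral_add (integrable_const σ) (hm.integrable_sq.const_mul σ⁻¹),
      integral_const_mul, integral_chaosVar_sq ha hn, integral_const, probReal_univ, one_smul]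
    change 1 / 2 * (σ + σ⁻¹ * chaosVariance n) ≤ σ
    rw [← hσ2]
    field_simp
    linarith
  have hi : Integrable (fun ω => |chaosVar ha n ω / σ - c * (2 - fieldRadius ha n ω)|) P :=
    ((iq.div_const σ).sub (((integrable_const 2).sub
      (integrable_fieldRadius ha hn.1)).const_mul c)).abs
  refine (integral_mono hi ((iq.abs.const_mul _).fun_add (id.abs.const_mul _)) hle).trans ?_
  rw [integral_add (iq.abs.const_mul _) (id.abs.const_mul _), integral_const_mul,
    integral_const_mul]
  refine add_le_add ?_ ?_
  · calc σ⁻¹ * (2 / N) * ∫ ω, |chaosVar ha n ω| ∂P ≤ σ⁻¹ * (2 / N) * σ :=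
          mul_le_mul_of_nonneg_left hq (by positivity)
      _ = 2 / N := by field_simp
  · calc c / N * ∫ ω, |quarticDefect ha n ω| ∂P ≤ c / N * (41 * κ) :=
          mul_le_mul_of_nonneg_left (integral_abs_quarticDefect_le ha hn) (by positivity)
      _ = 41 * c / κ := by rw [← hκ2]; field_simp
      _ ≤ 21 / κ := by gcongr; linarith

theorem interpRadius_zero_eq (ha : IsWaveCoefficients a P) (n : ℕ) (ω : Ω) :
    (∑ k : freq n, (√(Fintype.card (freq n) : ℝ))⁻¹ * cosTwo n k * (stdField ha k ω ^ 2 - 1)) ^ 2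
      + (∑ k : freq n, (√(Fintype.card (freq n) : ℝ))⁻¹ * sinTwo n k
        * (stdField ha k ω ^ 2 - 1)) ^ 2 = fieldRadius ha n ω := by
  simp_rw [mul_assoc, ← Finset.mul_sum]
  rw [interp_zero_field ha n (cosTwo n), interp_zero_field ha n (sinTwo n), fieldRadius, mul_pow,
    mul_pow, inv_pow, Real.sq_sqrt (by positivity), Fintype.card_coe, freqCard]
  ring

/-- The smooth central limit theorem for the planar vector of the wave. -/
theorem abs_integral_fieldRadius_sub_le (ha : IsWaveCoefficients a P) {n : ℕ}
    (hn : n ∈ sumTwoSquares) {F F' F'' : ℝ → ℝ} {A B : ℝ} (hF : ∀ r, HasDerivAt F (F' r) r)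
    (hF' : ∀ r, HasDerivAt F' (F'' r) r) (hc : Continuous F'')
    (hA : ∀ r, |F' r| ≤ A) (hB : ∀ r, |F'' r| ≤ B) :
    |(∫ ω, F (fieldRadius ha n ω) ∂P)
      - ∫ x, F ((1 + anisotropy n) * x.1 ^ 2 + (1 - anisotropy n) * x.2 ^ 2)
        ∂((gaussianReal 0 1).prod (gaussianReal 0 1))| ≤ 5200 * (A + B) / √(freqCard n : ℝ) := by
  have hcF : Continuous F := continuous_iff_continuousAt.2 fun r => (hF r).continuousAt
  have hcard : Fintype.card (freq n) = freqCard n := by simp [freqCard]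
  have hN : (0 : ℝ) < freqCard n := by exact_mod_cast freqCard_pos hn
  have hρ := abs_le.1 (abs_anisotropy_le hn)
  have h := integral_interp_pair_le (ι := freq n) (p := fun k => cosTwo n k)
    (q := fun k => sinTwo n k) (fun k => cosTwo_sq_add_sinTwo_sq hn.1 k.2) hF hF' hc hA hB
    (by rw [hcard]; exact freqCard_pos hn)
  set κ := √(Fintype.card (freq n) : ℝ) with hκd
  have hκ2 : κ ^ 2 = freqCard n := by rw [hκd, Real.sq_sqrt (by positivity), hcard]
  have hinv : (κ⁻¹) ^ 2 = (freqCard n : ℝ)⁻¹ := by rw [inv_pow, hκ2]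
  have h0 : ∫ ω, F (fieldRadius ha n ω) ∂P
      = ∫ z, F (interpRadius (fun k : freq n => κ⁻¹ * cosTwo n k) (fun k => κ⁻¹ * sinTwo n k) 0 z)
        ∂(stdGauss (freq n ⊕ freq n)) := by
    have := integral_comp_stdField ha hn.1 (G := fun x => F (
      (∑ k : freq n, κ⁻¹ * cosTwo n k * (x k ^ 2 - 1)) ^ 2
        + (∑ k : freq n, κ⁻¹ * sinTwo n k * (x k ^ 2 - 1)) ^ 2)) (by fun_prop)
    simp only [hκd, interpRadius_zero_eq] at this
    rw [this]
    simp only [interpRadius, interp_zero]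
    rfl
  have h1 : ∫ z, F (interpRadius (fun k : freq n => κ⁻¹ * cosTwo n k) (fun k => κ⁻¹ * sinTwo n k)
        (Real.pi / 2) z) ∂(stdGauss (freq n ⊕ freq n))
      = ∫ x, F ((1 + anisotropy n) * x.1 ^ 2 + (1 - anisotropy n) * x.2 ^ 2)
        ∂((gaussianReal 0 1).prod (gaussianReal 0 1)) := by
    refine integral_comp_interpRadius_end (by linarith) (by linarith) ?_ ?_ ?_ hcF
    · simp_rw [mul_pow, ← Finset.mul_sum]
      rw [Finset.sum_coe_sort (freq n) fun l => cosTwo n l ^ 2, sum_cosTwo_sq hn, hinv]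
      field_simp
    · simp_rw [mul_pow, ← Finset.mul_sum]
      rw [Finset.sum_coe_sort (freq n) fun l => sinTwo n l ^ 2, sum_sinTwo_sq hn, hinv]
      field_simp
    · have e : ∀ k : freq n, κ⁻¹ * cosTwo n k * (κ⁻¹ * sinTwo n k)
          = (κ⁻¹) ^ 2 * (cosTwo n k * sinTwo n k) := fun k => by ring
      simp_rw [e, ← Finset.mul_sum]
      rw [Finset.sum_coe_sort (freq n) fun l => cosTwo n l * sinTwo n l, sum_cosTwo_mul_sinTwo,
        mul_zero]
  rw [h0, ← h1, abs_sub_comm, ← hcard]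
  exact h

theorem abs_integral_sub_le_of_close {α : Type*} [MeasurableSpace α] {μ : Measure α}
    [IsProbabilityMeasure μ] {g h : ℝ → ℝ} (hh : LipschitzWith 1 h) (hg : Continuous g) {δ : ℝ}
    (hgh : ∀ x, |g x - h x| ≤ δ) {X : α → ℝ} (hX : Integrable X μ) :
    |(∫ x, g (X x) ∂μ) - ∫ x, h (X x) ∂μ| ≤ δ := by
  have ih := integrable_lipschitz_comp hh hX
  have ig : Integrable (fun x => g (X x)) μ := by
    refine (ih.abs.add (integrable_const δ)).mono'
      (hg.comp_aestronglyMeasurable hX.1) (ae_of_all _ fun x => ?_)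
    have h1 := abs_add_le (h (X x)) (g (X x) - h (X x))
    rw [add_sub_cancel] at h1
    simp only [Real.norm_eq_abs, Pi.add_apply]
    linarith [hgh (X x)]
  rw [← integral_sub ig ih]
  refine abs_integral_le_integral_abs.trans ((integral_mono (ig.sub ih).abs
    (integrable_const δ) fun x => hgh (X x)).trans_eq ?_)
  simp

/-- Smoothing at scale t = N^(-1/4) costs 2t at each of the two laws, while the smooth central limit
theorem costs a multiple of (1 + 2/t) t². This scale balances them, and replacing the chaos by a
function of the radius costs less. The constants add up to 23 + 4 + 15600. -/
theorem abs_integral_normalizedFourth_sub_le (ha : IsWaveCoefficients a P) {n : ℕ}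
    (hn : n ∈ sumTwoSquares) {h : ℝ → ℝ} (hh : LipschitzWith 1 h) :
    |(∫ ω, h (normalizedFourth a P n ω) ∂P) - ∫ y, h y ∂(limitLaw (anisotropy n))|
      ≤ 15700 * (freqCard n : ℝ) ^ (-(1 / 4) : ℝ) := by
  have hN : (0 : ℝ) < freqCard n := by exact_mod_cast freqCard_pos hn
  have hN1 : (1 : ℝ) ≤ freqCard n := by exact_mod_cast freqCard_pos hn
  set t : ℝ := (freqCard n : ℝ) ^ (-(1 / 4) : ℝ) with ht
  have ht0 : 0 < t := Real.rpow_pos_of_pos hN _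
  have ht1 : t ≤ 1 := Real.rpow_le_one_of_one_le_of_nonpos hN1 (by norm_num)
  have ht4 : 1 / (freqCard n : ℝ) = t ^ 4 := by
    rw [ht, ← Real.rpow_natCast, ← Real.rpow_mul hN.le, one_div, ← Real.rpow_neg_one]
    norm_num
  have ht2 : 1 / √(freqCard n : ℝ) = t ^ 2 := by
    rw [ht, ← Real.rpow_natCast, ← Real.rpow_mul hN.le, one_div, Real.sqrt_eq_rpow,
      ← Real.rpow_neg hN.le]
    norm_num
  obtain ⟨g, g', g'', hg, hg', hgc, hA, hB, hgh⟩ := exists_smoothing hh ht0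
  set c := limitScale (anisotropy n) with hcd
  have hc0 : 0 < c := limitScale_pos _
  have hc1 : c ≤ 1 / 2 := limitScale_le _
  have hgcont : Continuous g := continuous_iff_continuousAt.2 fun r => (hg r).continuousAt
  have inner : ∀ r, HasDerivAt (fun r => c * (2 - r)) (-c) r := fun r => by
    simpa using ((hasDerivAt_id r).const_sub 2).const_mul c
  have clt := abs_integral_fieldRadius_sub_le ha hn (F := fun r => g (c * (2 - r)))
    (F' := fun r => -c * g' (c * (2 - r))) (F'' := fun r => c ^ 2 * g'' (c * (2 - r)))
    (A := 1) (B := 2 / t)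
    (fun r => by
      have := (hg (c * (2 - r))).comp r (inner r)
      convert! this using 1; ring)
    (fun r => by
      have := ((hg' (c * (2 - r))).comp r (inner r)).const_mul (-c)
      convert! this using 1; ring)
    (by fun_prop)
    (fun r => by
      rw [abs_mul, abs_neg, abs_of_pos hc0]
      nlinarith [hA (c * (2 - r)), abs_nonneg (g' (c * (2 - r)))])
    (fun r => by
      rw [abs_mul, abs_of_pos (by positivity)]
      exact (mul_le_of_le_one_left (abs_nonneg _) (by nlinarith)).trans (hB _))
  have iY : Integrable (fun ω => c * (2 - fieldRadius ha n ω)) P :=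
    ((integrable_const 2).sub (integrable_fieldRadius ha hn.1)).const_mul c
  have iX : Integrable (fun ω => chaosVar ha n ω / √(chaosVariance n)) P :=
    ((memLp_chaosVar ha hn.1).integrable one_le_two).div_const _
  have iL := integrable_limitForm (anisotropy n)
  have e1 : ∫ ω, h (normalizedFourth a P n ω) ∂P
      = ∫ ω, h (chaosVar ha n ω / √(chaosVariance n)) ∂P := by
    refine integral_congr_ae ?_
    filter_upwards [normalizedFourth_ae ha hn] with ω hω
    rw [hω]
  have s1 := (abs_integral_lipschitz_sub_le hh iX iY).trans (integral_abs_sub_radius_le ha hn)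
  have s2 := abs_integral_sub_le_of_close hh hgcont hgh iY
  have s3 := abs_integral_sub_le_of_close hh hgcont hgh iL
  have e2 : ∫ x, g (limitForm (anisotropy n) x) ∂((gaussianReal 0 1).prod (gaussianReal 0 1))
      = ∫ x, g (c * (2 - ((1 + anisotropy n) * x.1 ^ 2 + (1 - anisotropy n) * x.2 ^ 2)))
        ∂((gaussianReal 0 1).prod (gaussianReal 0 1)) := by
    refine integral_congr_ae (ae_of_all _ fun x => ?_)
    simp only [limitForm, hcd, limitScale]
    congr 1; ring
  rw [← e2] at clt
  rw [e1, integral_limitLaw hh.continuous]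
  have b1 : 2 / (freqCard n : ℝ) + 21 / √(freqCard n : ℝ) ≤ 23 * t := by
    rw [div_eq_mul_one_div, ht4, div_eq_mul_one_div 21, ht2]
    nlinarith [pow_le_of_le_one ht0.le ht1 (n := 4) (by norm_num),
      pow_le_of_le_one ht0.le ht1 (n := 2) (by norm_num)]
  have b2 : 5200 * (1 + 2 / t) / √(freqCard n : ℝ) ≤ 15600 * t := by
    rw [div_eq_mul_one_div, ht2]
    have : 5200 * (1 + 2 / t) * t ^ 2 = 5200 * t ^ 2 + 10400 * t := by
      field_simp; ring
    rw [this]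
    nlinarith
  rw [abs_le] at s1 s2 s3 clt ⊢
  constructor <;> linarith [s1.1, s1.2, s2.1, s2.2, s3.1, s3.2, clt.1, clt.2]

end Rate

end ArithmeticWave

/-! ### Conclusion. -/

theorem proposition4 :
    ∃ C : ℝ, 0 < C ∧
      ∀ (Ω : Type*) [MeasurableSpace Ω] (P : Measure Ω) [IsProbabilityMeasure P]
        (a : ℤ × ℤ → Ω → ℂ), ArithmeticWave.IsWaveCoefficients a P →
      ∀ (h : ℝ → ℝ), LipschitzWith 1 h →
      ∀ (η : ℝ), η ∈ Set.Icc (0 : ℝ) 1 →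
      ∀ (n : ℕ → ℕ), (∀ j, n j ∈ ArithmeticWave.sumTwoSquares) →
        Tendsto (fun j => ArithmeticWave.freqCard (n j)) atTop atTop →
        Tendsto (fun j => ‖ArithmeticWave.fourthFourier (ArithmeticWave.angularMeasure (n j))‖)
          atTop (𝓝 η) →
      ∀ j : ℕ,
        MemLp (ArithmeticWave.nodalLength a (n j)) 2 P ∧
        0 < variance (fun ω => ArithmeticWave.fourthComponent a P (n j) ω) P ∧
        |(∫ ω, h (ArithmeticWave.normalizedFourth a P (n j) ω) ∂P)
            - ∫ y, h y ∂(ArithmeticWave.limitLaw η)|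
          ≤ C * max ((ArithmeticWave.freqCard (n j) : ℝ) ^ (-(1 / 4) : ℝ))
              (|‖ArithmeticWave.fourthFourier (ArithmeticWave.angularMeasure (n j))‖ - η|
                ^ (1 / 2 : ℝ)) := by
  -- 15700 from the comparison with the law at parameter |ρ|, and 8 from moving the parameter from
  -- |ρ| to η.
  refine ⟨15708, by norm_num, fun Ω _ P _ a ha h hh η hη n hn _ _ j => ?_⟩
  have hnj := hn j
  refine ⟨ArithmeticWave.memLp_nodalLength ha hnj, ?_, ?_⟩
  · rw [ArithmeticWave.variance_fourthComponent ha hnj]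
    have h1 := ArithmeticWave.chaosScale_pos hnj
    have h2 := ArithmeticWave.chaosVariance_pos hnj
    positivity
  · have h1 := ArithmeticWave.abs_integral_normalizedFourth_sub_le ha hnj hh
    rw [← ArithmeticWave.integral_limitLaw_abs hh.continuous,
      ← ArithmeticWave.norm_fourthFourier hnj] at h1
    have hr0 := norm_nonneg (ArithmeticWave.fourthFourier (ArithmeticWave.angularMeasure (n j)))
    have hr1 : ‖ArithmeticWave.fourthFourier (ArithmeticWave.angularMeasure (n j))‖ ≤ 1 := by
      rw [ArithmeticWave.norm_fourthFourier hnj]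
      exact ArithmeticWave.abs_anisotropy_le hnj
    have h2 := ArithmeticWave.abs_integral_limitLaw_sub_le hh ⟨hr0, hr1⟩ hη
    set r := ‖ArithmeticWave.fourthFourier (ArithmeticWave.angularMeasure (n j))‖
    -- Both parameters lie in [0, 1], so their distance is at most 1 and is dominated by its square
    -- root.
    have h3 : |r - η| ≤ |r - η| ^ (1 / 2 : ℝ) := by
      refine Real.self_le_rpow_of_le_one (abs_nonneg _) ?_ (by norm_num)
      rw [abs_le]
      constructor <;> linarith [hη.1, hη.2]
    have m1 := le_max_left ((ArithmeticWave.freqCard (n j) : ℝ) ^ (-(1 / 4) : ℝ))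
      (|r - η| ^ (1 / 2 : ℝ))
    have m2 := le_max_right ((ArithmeticWave.freqCard (n j) : ℝ) ^ (-(1 / 4) : ℝ))
      (|r - η| ^ (1 / 2 : ℝ))
    have := abs_sub_le (∫ ω, h (ArithmeticWave.normalizedFourth a P (n j) ω) ∂P)
      (∫ y, h y ∂(ArithmeticWave.limitLaw r)) (∫ y, h y ∂(ArithmeticWave.limitLaw η))
    linarith
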